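/- Let $\mathfrak g$ be a finite-dimensional simple Lie algebra over $\mathbb C$ with an $\mathfrak{sl}_2$-triple $(e,h,f)$, let $(\cdot,\cdot)$ be the invariant symmetric bilinear form with $(e,f)=1$, $(h,h)=2$, and let $k\in\mathbb C$. Put $\mathfrak g(i)=\{a:[\tfrac h2,a]=ia\}$, $\mathfrak n=\bigoplus_{i\ge 1/2}\mathfrak g(i)$, $\mathfrak m=\bigoplus_{i\ge 1}\mathfrak g(i)$, and let $\{u_\alpha\}$, $\{v^\alpha\}$ be dual bases of $\mathfrak n$, $\mathfrak n^*$. *First definition.* Let $S(R)$ be the Poisson vertex algebra (PVA) freely generated, as a supercommutative differential algebra with derivation $\partial$, by the even elements $a\in\mathfrak g$, $\Phi_b$ ($b\in\mathfrak g(\tfrac12)\cong\mathfrak n/\mathfrak m$) and the odd elements $\phi_n$ ($n\in\mathfrak n$), $\phi^\theta$ ($\theta\in\mathfrak n^*$), all depending linearly on their labels, with $\lambda$-bracket determined by $$\{a_\lambda b\}=[a,b]+\lambda k(a,b),\quad \{\Phi_a{}_\lambda\Phi_b\}=(f,[a,b]),\quad \{\phi_n{}_\lambda\phi^\theta\}=\{\phi^\theta{}_\lambda\phi_n\}=\theta(n),$$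 all other brackets of generators being zero. Let $$d=\sum_\alpha\phi^{v^\alpha}\bigl(u_\alpha+(f,u_\alpha)+\Phi_{[u_\alpha]}\bigr)+\tfrac12\sum_{\alpha,\beta}\phi^{v^\alpha}\phi^{v^\beta}\phi_{[u_\beta,u_\alpha]},\qquad d_{(0)}(A)=\{d_\lambda A\}|_{\lambda=0},$$ where $\Phi_{[u]}$ is $\Phi$ of the $\mathfrak g(\tfrac12)$-component of $u$. Then $d_{(0)}^2=0$; let $\mathcal W_1(\mathfrak g,f,k)=H(S(R),d_{(0)})$. For $a\in\mathfrak g$ put $J_a=a+\sum_\alpha\phi^{v^\alpha}\phi_{[u_\alpha,a]}$, where $\phi_x$ means $\phi$ of the $\mathfrak n$-component of $x$. Let $S(R_-)\subset S(R)$ be the subalgebra generated by all $\partial^nJ_a$ ($a\in\bigoplus_{i\le0}\mathfrak g(i)$), $\partial^n\Phi_b$, $\partial^n\phi^\theta$, $n\ge 0$. It is stable under $d_{(0)}$; let $d_-$ be the restriction. *Second definition.* Let $S(\mathbb C[\partial]\otimes\mathfrak g)$ be the PVA with $\{a_\lambda b\}=[a,b]+\lambda k(a,b)$ for $a,b\in\mathfrak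 g$. Let $\mathcal J$ be its differential ideal generated by $m+(f,m)$, $m\in\mathfrak m$. For $n\in\mathfrak n$ the action $(\mathrm{ad}_\lambda n)(A+\mathcal J)=\{n_\lambda A\}+\mathcal J[\lambda]$ is well defined; let $\mathcal W_2(\mathfrak g,f,k)=\bigl(S(\mathbb C[\partial]\otimes\mathfrak g)/\mathcal J\bigr)^{\mathrm{ad}_\lambda\mathfrak n}$ be the subalgebra of the elements annihilated by all $\mathrm{ad}_\lambda n$, $n\in\mathfrak n$. *Theorem.* The parity, $\partial$ and $\lambda$-brackets of $S(R)$ and of $S(\mathbb C[\partial]\otimes\mathfrak g)$ induce, on representatives, PVA structures on $\mathcal W_1(\mathfrak g,f,k)$, on $H(S(R_-),d_-)$ and on $\mathcal W_2(\mathfrak g,f,k)$. Let $i:S(R_-)\to S(\mathbb C[\partial]\otimes\mathfrak g)/\mathcal J$ be the algebra homomorphism with $$\partial^nJ_a\mapsto\partial^na,\qquad \partial^n\Phi_b\mapsto-\partial^nb,\qquad \partial^n\phi^\theta\mapsto0$$ for $n\ge0$, $a\in\bigoplus_{i\le0}\mathfrak g(i)$, $b\in\mathfrak g(\tfrac12)$,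 $\theta\in\mathfrak n^*$ (it exists). Then: 1. $i$ induces an isomorphism of associative algebras $j:H(S(R_-),d_-)\to\mathcal W_2(\mathfrak g,f,k)$, $j([z])=i(z)$; 2. $j$ is an isomorphism of Poisson vertex algebras. Consequently $\mathcal W_1(\mathfrak g,f,k)$ and $\mathcal W_2(\mathfrak g,f,k)$ are isomorphic as Poisson vertex algebras. -/

import Mathlib

open Polynomial TensorProduct

namespace ClassicalW

noncomputable section

/-! ### Superpolynomials in the derivatives of even and odd variables -/

section Free

variable {W₀ W₁ : Type*} [AddCommGroup W₀] [Module ℂ W₀] [AddCommGroup W₁] [Module ℂ W₁]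

/-- Supercommutativity of the generators `R = ℂ[∂] ⊗ (W₀ ⊕ W₁)`, where `W₀` is even, `W₁` is odd. -/
inductive SRel (W₀ W₁ : Type*) [AddCommGroup W₀] [Module ℂ W₀] [AddCommGroup W₁] [Module ℂ W₁] :
    TensorAlgebra ℂ (ℂ[X] ⊗[ℂ] (W₀ × W₁)) → TensorAlgebra ℂ (ℂ[X] ⊗[ℂ] (W₀ × W₁)) → Prop
  | even (p q : ℂ[X]) (a : W₀) (w : W₀ × W₁) :
      SRel W₀ W₁
        (TensorAlgebra.ι ℂ (p ⊗ₜ[ℂ] (a, 0)) * TensorAlgebra.ι ℂ (q ⊗ₜ[ℂ] w))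
        (TensorAlgebra.ι ℂ (q ⊗ₜ[ℂ] w) * TensorAlgebra.ι ℂ (p ⊗ₜ[ℂ] (a, 0)))
  | odd (p q : ℂ[X]) (a b : W₁) :
      SRel W₀ W₁
        (TensorAlgebra.ι ℂ (p ⊗ₜ[ℂ] ((0 : W₀), a)) * TensorAlgebra.ι ℂ (q ⊗ₜ[ℂ] ((0 : W₀), b)))
        (-(TensorAlgebra.ι ℂ (q ⊗ₜ[ℂ] ((0 : W₀), b)) * TensorAlgebra.ι ℂ (p ⊗ₜ[ℂ] ((0 : W₀), a))))

/-- The supersymmetric algebra `S(R)` of the superspace `R = ℂ[∂] ⊗ (W₀ ⊕ W₁)`: the tensor algebra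
modulo supercommutativity of the generators. The variable `X` of `ℂ[X]` stands for `∂`. -/
def S (W₀ W₁ : Type*) [AddCommGroup W₀] [Module ℂ W₀] [AddCommGroup W₁] [Module ℂ W₁] : Type _ :=
  RingQuot (SRel W₀ W₁)

instance : Ring (S W₀ W₁) := inferInstanceAs (Ring (RingQuot (SRel W₀ W₁)))
instance : Algebra ℂ (S W₀ W₁) := inferInstanceAs (Algebra ℂ (RingQuot (SRel W₀ W₁)))

/-- The inclusion `R → S(R)`. -/
def ι : ℂ[X] ⊗[ℂ] (W₀ × W₁) →ₗ[ℂ] S W₀ W₁ :=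
  (RingQuot.mkAlgHom ℂ (SRel W₀ W₁)).toLinearMap ∘ₗ TensorAlgebra.ι ℂ

/-- The generator `∂ⁿ w` of `S(R)`, for `w` in `W₀ ⊕ W₁`. -/
def gen (n : ℕ) : W₀ × W₁ →ₗ[ℂ] S W₀ W₁ := ι ∘ₗ TensorProduct.mk ℂ ℂ[X] (W₀ × W₁) (X ^ n)

theorem S.induction {P : S W₀ W₁ → Prop}
    (hc : ∀ r : ℂ, P (algebraMap ℂ _ r)) (hι : ∀ v, P (ι v))
    (hmul : ∀ a b, P a → P b → P (a * b)) (hadd : ∀ a b, P a → P b → P (a + b)) (a : S W₀ W₁) :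
    P a := by
  obtain ⟨t, rfl⟩ := RingQuot.mkAlgHom_surjective ℂ (SRel W₀ W₁) a
  induction t using TensorAlgebra.induction with
  | algebraMap r => simpa using! hc r
  | ι x => exact hι x
  | mul a b ha hb => rw [map_mul]; exact hmul _ _ ha hb
  | add a b ha hb => rw [map_add]; exact hadd _ _ ha hb

/-- Universal property of `S(R)`. -/
def S.lift {B : Type*} [Ring B] [Algebra ℂ B] (φ : ℂ[X] ⊗[ℂ] (W₀ × W₁) →ₗ[ℂ] B)
    (h₀ : ∀ (p q : ℂ[X]) (a : W₀) (w : W₀ × W₁),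
      φ (p ⊗ₜ (a, 0)) * φ (q ⊗ₜ w) = φ (q ⊗ₜ w) * φ (p ⊗ₜ (a, 0)))
    (h₁ : ∀ (p q : ℂ[X]) (a b : W₁),
      φ (p ⊗ₜ (0, a)) * φ (q ⊗ₜ (0, b)) = -(φ (q ⊗ₜ (0, b)) * φ (p ⊗ₜ (0, a)))) :
    S W₀ W₁ →ₐ[ℂ] B :=
  RingQuot.liftAlgHom ℂ ⟨TensorAlgebra.lift ℂ φ, by
    intro x y hxy
    cases hxy with
    | even p q a w => simpa using h₀ p q a w
    | odd p q a b => simpa using h₁ p q a b⟩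

theorem S.lift_ι {B : Type*} [Ring B] [Algebra ℂ B] (φ : ℂ[X] ⊗[ℂ] (W₀ × W₁) →ₗ[ℂ] B) (h₀) (h₁)
    (v : ℂ[X] ⊗[ℂ] (W₀ × W₁)) : S.lift φ h₀ h₁ (ι v) = φ v := by
  have := RingQuot.liftAlgHom_mkAlgHom_apply ℂ (TensorAlgebra.lift ℂ φ)
    (s := SRel W₀ W₁) (by
      intro x y hxy
      cases hxy with
      | even p q a w => simpa using h₀ p q a w
      | odd p q a b => simpa using h₁ p q a b) (TensorAlgebra.ι ℂ v)
  exact this.trans (TensorAlgebra.lift_ι_apply φ v)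

theorem ι_even_comm (p q : ℂ[X]) (a : W₀) (w : W₀ × W₁) :
    (ι (p ⊗ₜ (a, 0)) * ι (q ⊗ₜ w) : S W₀ W₁) = ι (q ⊗ₜ w) * ι (p ⊗ₜ (a, 0)) := by
  have := RingQuot.mkAlgHom_rel ℂ (SRel.even p q a w)
  rw [map_mul, map_mul] at this
  exact this

theorem ι_odd_comm (p q : ℂ[X]) (a b : W₁) :
    (ι (p ⊗ₜ (0, a)) * ι (q ⊗ₜ (0, b)) : S W₀ W₁) = -(ι (q ⊗ₜ (0, b)) * ι (p ⊗ₜ (0, a))) := by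
  have := RingQuot.mkAlgHom_rel ℂ (SRel.odd (W₀ := W₀) p q a b)
  rw [map_neg, map_mul, map_mul] at this
  exact this

/-- The involution of `R` that is `1` on the even and `-1` on the odd part. -/
def sgn : ℂ[X] ⊗[ℂ] (W₀ × W₁) →ₗ[ℂ] ℂ[X] ⊗[ℂ] (W₀ × W₁) :=
  LinearMap.lTensor ℂ[X] (LinearMap.prodMap LinearMap.id (-LinearMap.id))

theorem sgn_even (p : ℂ[X]) (a : W₀) :
    (sgn (p ⊗ₜ (a, 0)) : ℂ[X] ⊗[ℂ] (W₀ × W₁)) = p ⊗ₜ (a, 0) := by simp [sgn]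

theorem sgn_odd (p : ℂ[X]) (b : W₁) :
    (sgn (p ⊗ₜ (0, b)) : ℂ[X] ⊗[ℂ] (W₀ × W₁)) = -(p ⊗ₜ (0, b)) := by
  rw [← TensorProduct.tmul_neg]; simp [sgn]

theorem sgn_sgn (v : ℂ[X] ⊗[ℂ] (W₀ × W₁)) : sgn (sgn v) = v := by
  induction v using TensorProduct.induction_on with
  | zero => simp
  | tmul p w => simp [sgn]
  | add a b ha hb => rw [map_add, map_add, ha, hb]

/-- The parity automorphism of `S(R)`: the even (odd) elements are those with `σ a = a`
(`σ a = -a`). -/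
def σ : S W₀ W₁ →ₐ[ℂ] S W₀ W₁ :=
  S.lift (ι ∘ₗ sgn)
    (by
      intro p q a w
      simp only [LinearMap.comp_apply, sgn_even]
      simpa [sgn] using ι_even_comm p q a (w.1, -w.2))
    (by
      intro p q a b
      simp only [LinearMap.comp_apply, sgn_odd, map_neg, neg_mul_neg]
      exact ι_odd_comm p q a b)

theorem σ_ι (v : ℂ[X] ⊗[ℂ] (W₀ × W₁)) : σ (ι v : S W₀ W₁) = ι (sgn v) := S.lift_ι _ _ _ v

theorem σ_σ (a : S W₀ W₁) : σ (σ a) = a := by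
  induction a using S.induction with
  | hc r => simp
  | hι v => simp [σ_ι, sgn_sgn]
  | hmul a b ha hb => simp [ha, hb]
  | hadd a b ha hb => simp [ha, hb]

theorem even_mul (p : ℂ[X]) (a : W₀) (x : S W₀ W₁) :
    ι (p ⊗ₜ (a, 0)) * x = x * ι (p ⊗ₜ (a, 0)) := by
  induction x using S.induction with
  | hc r => exact (Algebra.commutes r _).symm
  | hι v =>
    induction v using TensorProduct.induction_on with
    | zero => simp
    | tmul q w => exact ι_even_comm p q a w
    | add x y hx hy => rw [map_add, mul_add, add_mul, hx, hy]
  | hmul x y hx hy => rw [← mul_assoc, hx, mul_assoc, hy, mul_assoc]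
  | hadd x y hx hy => rw [mul_add, add_mul, hx, hy]

theorem odd_mul (p : ℂ[X]) (b : W₁) (x : S W₀ W₁) :
    ι (p ⊗ₜ (0, b)) * x = σ x * ι (p ⊗ₜ (0, b)) := by
  induction x using S.induction with
  | hc r => rw [AlgHom.commutes]; exact (Algebra.commutes r _).symm
  | hι v =>
    rw [σ_ι]
    induction v using TensorProduct.induction_on with
    | zero => simp
    | tmul q w =>
      obtain ⟨w₀, w₁⟩ := w
      have hw : (w₀, w₁) = ((w₀, 0) : W₀ × W₁) + (0, w₁) := by simp
      rw [hw, TensorProduct.tmul_add, map_add, map_add, map_add, sgn_even, sgn_odd, mul_add, add_mul,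
        even_mul q w₀, ι_odd_comm p q, map_neg, neg_mul]
    | add x y hx hy => rw [map_add, map_add, map_add, mul_add, add_mul, hx, hy]
  | hmul x y hx hy => rw [← mul_assoc, hx, mul_assoc, hy, map_mul, mul_assoc]
  | hadd x y hx hy => rw [mul_add, map_add, add_mul, hx, hy]

end Free

/-! ### Operators on `A[λ]`; the variable `X` of `A[X]` stands for `λ` -/

section Operators

variable {A : Type*} [Ring A] [Algebra ℂ A]

/-- The coefficientwise action of an operator `T` of `A` on `A[λ]`. -/
def coeffwise (T : A →ₗ[ℂ] A) : A[X] →ₗ[ℂ] A[X] :=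
  Polynomial.lsum fun n => (Polynomial.monomial n).restrictScalars ℂ ∘ₗ T

/-- The operator `λ + ∂` on `A[λ]`. -/
def lamAdd (T : A →ₗ[ℂ] A) : A[X] →ₗ[ℂ] A[X] := LinearMap.mulLeft ℂ (X : A[X]) + coeffwise T

/-- The substitution `∑ λⁿ cₙ ↦ ∑ (-λ-∂)ⁿ cₙ`, where `∂` acts on the coefficients `cₙ`. -/
def skewSubst (T : A →ₗ[ℂ] A) : A[X] →ₗ[ℂ] A[X] :=
  Polynomial.lsum fun n =>
    ((-lamAdd T) ^ n) ∘ₗ (Polynomial.monomial 0 : A →ₗ[A] A[X]).restrictScalars ℂ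

theorem coeff_coeffwise (T : A →ₗ[ℂ] A) (p : A[X]) (n : ℕ) :
    (coeffwise T p).coeff n = T (p.coeff n) := by
  induction p using Polynomial.induction_on' with
  | add p q hp hq => simp [hp, hq]
  | monomial m a =>
    simp only [coeffwise, Polynomial.lsum_apply]
    rw [Polynomial.sum_monomial_index _ _ (by simp)]
    simp [Polynomial.coeff_monomial, apply_ite T]

theorem skewSubst_monomial (T : A →ₗ[ℂ] A) (n : ℕ) (a : A) :
    skewSubst T (monomial n a) = ((-lamAdd T) ^ n) (C a) := by
  simp only [skewSubst, Polynomial.lsum_apply]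
  rw [Polynomial.sum_monomial_index _ _ (by simp)]
  simp

end Operators

/-! ### Superderivations `S(R) → S(R)[λ]` with given values on the generators -/

section Derivations

variable {W₀ W₁ : Type*} [AddCommGroup W₀] [Module ℂ W₀] [AddCommGroup W₁] [Module ℂ W₁]

/-- The parity automorphism of `S(R)[λ]`. -/
def σX : (S W₀ W₁)[X] →ₐ[ℂ] (S W₀ W₁)[X] := Polynomial.mapAlgHom σ

theorem coeff_σX (x : (S W₀ W₁)[X]) (n : ℕ) : (σX x).coeff n = σ (x.coeff n) := by
  simp [σX]

theorem σX_C (x : S W₀ W₁) : σX (C x) = C (σ x) := by simp [σX]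

theorem σX_σX (x : (S W₀ W₁)[X]) : σX (σX x) = x := by
  ext n; simp [coeff_σX, σ_σ]

theorem C_even_mul (p : ℂ[X]) (a : W₀) (x : (S W₀ W₁)[X]) :
    C (ι (p ⊗ₜ (a, 0))) * x = x * C (ι (p ⊗ₜ (a, 0))) := by
  ext n; simp [even_mul]

theorem C_odd_mul (p : ℂ[X]) (b : W₁) (x : (S W₀ W₁)[X]) :
    C (ι (p ⊗ₜ (0, b))) * x = σX x * C (ι (p ⊗ₜ (0, b))) := by
  ext n; simp [odd_mul, coeff_σX]

/-- `σ` for odd derivations (`o = true`), the identity for even ones (`o = false`). -/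
def twist (o : Bool) : S W₀ W₁ →ₐ[ℂ] S W₀ W₁ := bif o then σ else AlgHom.id ℂ _

/-- The sign `-1` for `o = true` and `1` for `o = false`. -/
def sign (o : Bool) : ℂ := bif o then -1 else 1

theorem sign_mul_sign (o : Bool) : sign o * sign o = 1 := by cases o <;> simp [sign]

theorem twist_even (o : Bool) (p : ℂ[X]) (a : W₀) :
    twist o (ι (p ⊗ₜ (a, 0)) : S W₀ W₁) = ι (p ⊗ₜ (a, 0)) := by
  cases o <;> simp [twist, σ_ι, sgn_even]

theorem twist_odd (o : Bool) (p : ℂ[X]) (b : W₁) :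
    twist o (ι (p ⊗ₜ (0, b)) : S W₀ W₁) = sign o • ι (p ⊗ₜ (0, b)) := by
  cases o <;> simp [twist, sign, σ_ι, sgn_odd]

/-- The component of parity `o` of a linear map `T : R → S(R)[λ]`. -/
def parityPart (o : Bool) (T : ℂ[X] ⊗[ℂ] (W₀ × W₁) →ₗ[ℂ] (S W₀ W₁)[X]) :
    ℂ[X] ⊗[ℂ] (W₀ × W₁) →ₗ[ℂ] (S W₀ W₁)[X] :=
  (1 / 2 : ℂ) • (T + sign o • σX.toLinearMap ∘ₗ T ∘ₗ sgn)

theorem parityPart_apply (o : Bool) (T : ℂ[X] ⊗[ℂ] (W₀ × W₁) →ₗ[ℂ] (S W₀ W₁)[X]) (v) :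
    parityPart o T v = (1 / 2 : ℂ) • (T v + sign o • σX (T (sgn v))) := rfl

theorem σX_parityPart (o : Bool) (T : ℂ[X] ⊗[ℂ] (W₀ × W₁) →ₗ[ℂ] (S W₀ W₁)[X]) (v) :
    σX (parityPart o T v) = sign o • parityPart o T (sgn v) := by
  simp only [parityPart_apply, map_smul, map_add, σX_σX, sgn_sgn, smul_add, smul_smul]
  rw [add_comm]
  congr 1
  · rw [mul_comm]
  · rw [mul_left_comm, sign_mul_sign, mul_one]

/-- The map `v ↦ (twist v, T v; 0, v)` into upper triangular matrices. An algebra homomorphism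
of this shape is the same as a superderivation in its upper right corner. -/
def triangular (o : Bool) (T : ℂ[X] ⊗[ℂ] (W₀ × W₁) →ₗ[ℂ] (S W₀ W₁)[X]) :
    ℂ[X] ⊗[ℂ] (W₀ × W₁) →ₗ[ℂ] Matrix (Fin 2) (Fin 2) (S W₀ W₁)[X] where
  toFun v := !![C (twist o (ι v)), T v; 0, C (ι v)]
  map_add' v w := by ext i j; fin_cases i <;> fin_cases j <;> simp
  map_smul' c v := by
    ext i j; fin_cases i <;> fin_cases j <;> simp [← Polynomial.smul_C]

/-- The algebra homomorphism extending `triangular`. -/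
def triangularHom (o : Bool) (T : ℂ[X] ⊗[ℂ] (W₀ × W₁) →ₗ[ℂ] (S W₀ W₁)[X]) :
    S W₀ W₁ →ₐ[ℂ] Matrix (Fin 2) (Fin 2) (S W₀ W₁)[X] :=
  S.lift (triangular o (parityPart o T))
    (by
      intro p q a w
      have h : C (ι (p ⊗ₜ (a, 0))) * parityPart o T (q ⊗ₜ w)
            + parityPart o T (p ⊗ₜ (a, 0)) * C (ι (q ⊗ₜ w))
          = C (twist o (ι (q ⊗ₜ w))) * parityPart o T (p ⊗ₜ (a, 0))
            + parityPart o T (q ⊗ₜ w) * C (ι (p ⊗ₜ (a, 0))) := by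
        rw [C_even_mul, add_comm]
        congr 1
        have hσ := σX_parityPart o T (p ⊗ₜ (a, 0))
        rw [sgn_even] at hσ
        obtain ⟨w₀, w₁⟩ := w
        have hw : (w₀, w₁) = ((w₀, 0) : W₀ × W₁) + (0, w₁) := by simp
        rw [hw, TensorProduct.tmul_add, map_add, map_add, map_add, map_add, twist_even, twist_odd,
          mul_add, add_mul, C_even_mul, ← Polynomial.smul_C, smul_mul_assoc, C_odd_mul, hσ,
          smul_mul_assoc, smul_smul, sign_mul_sign, one_smul]
      have h₂ := congrArg (twist o) (ι_even_comm p q a w)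
      rw [map_mul, map_mul, twist_even] at h₂
      ext i j : 1
      fin_cases i <;> fin_cases j <;>
        simp [triangular, Matrix.mul_apply, Fin.sum_univ_two, -map_mul, ← C_mul, twist_even, h, h₂,
          ι_even_comm])
    (by
      intro p q a b
      have h : ∀ (p q : ℂ[X]) (a b : W₁),
          C (twist o (ι (p ⊗ₜ (0, a)))) * parityPart o T (q ⊗ₜ (0, b))
            = - (parityPart o T (q ⊗ₜ (0, b)) * C (ι (p ⊗ₜ (0, a)))) := by
        intro p q a b
        rw [twist_odd, ← Polynomial.smul_C, smul_mul_assoc, C_odd_mul, σX_parityPart, sgn_odd,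
          map_neg, smul_neg, neg_mul, smul_neg, smul_mul_assoc, smul_smul, sign_mul_sign, one_smul]
      have h₂ := congrArg (twist o) (ι_odd_comm (W₀ := W₀) p q a b)
      rw [map_neg, map_mul, map_mul] at h₂
      ext i j : 1
      fin_cases i <;> fin_cases j <;>
        simp [triangular, Matrix.mul_apply, Fin.sum_univ_two, -map_mul, ← C_mul]
      · rw [h₂, map_neg]
      · rw [h p q a b, h q p b a]; abel
      · rw [ι_odd_comm, map_neg])

theorem triangularHom_ι (o : Bool) (T : ℂ[X] ⊗[ℂ] (W₀ × W₁) →ₗ[ℂ] (S W₀ W₁)[X]) (v) :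
    triangularHom o T (ι v) = !![C (twist o (ι v)), parityPart o T v; 0, C (ι v)] :=
  S.lift_ι _ _ _ v

/-- The derivation of parity `o` of `S(R)` into `S(R)[λ]` whose values on `R` are the parity `o`
component of `T`. -/
def derivPart (o : Bool) (T : ℂ[X] ⊗[ℂ] (W₀ × W₁) →ₗ[ℂ] (S W₀ W₁)[X]) :
    S W₀ W₁ →ₗ[ℂ] (S W₀ W₁)[X] :=
  Matrix.entryLinearMap ℂ (S W₀ W₁)[X] 0 1 ∘ₗ (triangularHom o T).toLinearMap

theorem derivPart_apply (o : Bool) (T : ℂ[X] ⊗[ℂ] (W₀ × W₁) →ₗ[ℂ] (S W₀ W₁)[X]) (a) :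
    derivPart o T a = triangularHom o T a 0 1 := rfl

theorem triangularHom_apply (o : Bool) (T : ℂ[X] ⊗[ℂ] (W₀ × W₁) →ₗ[ℂ] (S W₀ W₁)[X])
    (a : S W₀ W₁) :
    triangularHom o T a = !![C (twist o a), derivPart o T a; 0, C a] := by
  suffices h : triangularHom o T a 0 0 = C (twist o a) ∧ triangularHom o T a 1 0 = 0 ∧
      triangularHom o T a 1 1 = C a by
    ext i j : 1
    fin_cases i <;> fin_cases j <;> simp [h.1, h.2.1, h.2.2, derivPart_apply]
  induction a using S.induction with
  | hc r => simp [Matrix.algebraMap_matrix_apply, Polynomial.algebraMap_apply]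
  | hι v => simp [triangularHom_ι]
  | hmul a b ha hb =>
    simp [Matrix.mul_apply, Fin.sum_univ_two, ha.1, ha.2.1, ha.2.2, hb.1, hb.2.1, hb.2.2]
  | hadd a b ha hb => simp [ha.1, ha.2.1, ha.2.2, hb.1, hb.2.1, hb.2.2]

theorem derivPart_mul (o : Bool) (T : ℂ[X] ⊗[ℂ] (W₀ × W₁) →ₗ[ℂ] (S W₀ W₁)[X])
    (a b : S W₀ W₁) :
    derivPart o T (a * b) = C (twist o a) * derivPart o T b + derivPart o T a * C b := by
  rw [derivPart_apply, map_mul, triangularHom_apply, triangularHom_apply]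
  simp [Matrix.mul_apply, Fin.sum_univ_two]

theorem derivPart_ι (o : Bool) (T : ℂ[X] ⊗[ℂ] (W₀ × W₁) →ₗ[ℂ] (S W₀ W₁)[X]) (v) :
    derivPart o T (ι v) = parityPart o T v := by
  simp [derivPart_apply, triangularHom_ι]

theorem derivPart_algebraMap (o : Bool) (T : ℂ[X] ⊗[ℂ] (W₀ × W₁) →ₗ[ℂ] (S W₀ W₁)[X]) (r : ℂ) :
    derivPart o T (algebraMap ℂ _ r) = 0 := by
  rw [derivPart_apply, AlgHom.commutes]; simp [Matrix.algebraMap_matrix_apply]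

/-- The superderivation `S(R) → S(R)[λ]` extending a linear map `T : R → S(R)[λ]`: the sum of
an even and an odd derivation. It depends linearly on `T`. -/
def superDeriv : (ℂ[X] ⊗[ℂ] (W₀ × W₁) →ₗ[ℂ] (S W₀ W₁)[X]) →ₗ[ℂ] S W₀ W₁ →ₗ[ℂ] (S W₀ W₁)[X] where
  toFun T := derivPart false T + derivPart true T
  map_add' T T' := by
    have h : ∀ o, derivPart o (T + T') = derivPart o T + derivPart o T' := by
      intro o
      ext1 a
      induction a using S.induction with
      | hc r => simp [derivPart_algebraMap]
      | hι v =>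
        simp only [derivPart_ι, LinearMap.add_apply, parityPart_apply, map_add, smul_add]
        abel
      | hmul a b ha hb =>
        simp only [LinearMap.add_apply] at ha hb ⊢
        rw [derivPart_mul, derivPart_mul, derivPart_mul, ha, hb, mul_add, add_mul]
        abel
      | hadd a b ha hb => rw [map_add, map_add, ha, hb]
    rw [h, h]; abel
  map_smul' c T := by
    have h : ∀ o, derivPart o (c • T) = c • derivPart o T := by
      intro o
      ext1 a
      induction a using S.induction with
      | hc r => simp [derivPart_algebraMap]
      | hι v =>
        simp only [derivPart_ι, LinearMap.smul_apply, parityPart_apply, map_smul, smul_add,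
          smul_comm c]
      | hmul a b ha hb =>
        simp only [LinearMap.smul_apply] at ha hb ⊢
        rw [derivPart_mul, derivPart_mul, ha, hb, mul_smul_comm, smul_mul_assoc, smul_add]
      | hadd a b ha hb => rw [map_add, map_add, ha, hb]
    rw [h, h, RingHom.id_apply, smul_add]

theorem superDeriv_apply (T : ℂ[X] ⊗[ℂ] (W₀ × W₁) →ₗ[ℂ] (S W₀ W₁)[X]) (a) :
    superDeriv T a = derivPart false T a + derivPart true T a := rfl

theorem superDeriv_ι (T : ℂ[X] ⊗[ℂ] (W₀ × W₁) →ₗ[ℂ] (S W₀ W₁)[X]) (v) :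
    superDeriv T (ι v) = T v := by
  rw [superDeriv_apply, derivPart_ι, derivPart_ι, parityPart_apply, parityPart_apply, ← smul_add]
  have : T v + sign false • σX (T (sgn v)) + (T v + sign true • σX (T (sgn v)))
      = (2 : ℂ) • T v := by
    simp only [sign, cond_true, cond_false, one_smul, neg_smul, two_smul]; abel
  rw [this, smul_smul]; norm_num

end Derivations

/-! ### Poisson vertex algebras -/

section PVA

/-- The data of a Poisson vertex (super)algebra on a unital algebra `A` over `ℂ`: a parity
involution `par`, the operator `del = ∂` and a bilinear λ-bracket `br a b = {a_λ b}` in `A[λ]`. -/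
structure LambdaData (A : Type*) [Ring A] [Algebra ℂ A] where
  par : A →ₐ[ℂ] A
  del : A →ₗ[ℂ] A
  br : A →ₗ[ℂ] A →ₗ[ℂ] A[X]

variable {A : Type*} [Ring A] [Algebra ℂ A]

/-- `a` is homogeneous of parity `p` (only `p` modulo `2` matters). -/
def LambdaData.HasParity (P : LambdaData A) (p : ℕ) (a : A) : Prop := P.par a = (-1 : ℂ) ^ p • a

/-- The axioms of a Poisson vertex algebra. The Jacobi identity
`{a_λ {b_μ c}} = ± {b_μ {a_λ c}} + {{a_λ b}_{λ+μ} c}` is written as the equality of the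
coefficients of `λᵐ μⁿ`. -/
structure LambdaData.IsPVA (P : LambdaData A) : Prop where
  par_par : ∀ a, P.par (P.par a) = a
  supercomm : ∀ p q a b, P.HasParity p a → P.HasParity q b →
    a * b = (-1 : ℂ) ^ (p * q) • (b * a)
  par_del : ∀ a, P.par (P.del a) = P.del (P.par a)
  par_br : ∀ a b n, P.par ((P.br a b).coeff n) = (P.br (P.par a) (P.par b)).coeff n
  del_mul : ∀ a b, P.del (a * b) = P.del a * b + a * P.del b
  br_del_left : ∀ a b, P.br (P.del a) b = -(X * P.br a b)
  br_del_right : ∀ a b, P.br a (P.del b) = lamAdd P.del (P.br a b)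
  skew : ∀ p q a b, P.HasParity p a → P.HasParity q b →
    P.br b a = -((-1 : ℂ) ^ (p * q) • skewSubst P.del (P.br a b))
  jacobi : ∀ p q a b c m n, P.HasParity p a → P.HasParity q b →
    (P.br a ((P.br b c).coeff n)).coeff m
      = (-1 : ℂ) ^ (p * q) • (P.br b ((P.br a c).coeff m)).coeff n
        + ∑ i ∈ Finset.range (m + 1),
            (m - i + n).choose n • (P.br ((P.br a b).coeff i) c).coeff (m - i + n)
  leibniz : ∀ p q a b c, P.HasParity p a → P.HasParity q b →
    P.br a (b * c) = (-1 : ℂ) ^ (p * q) • (C b * P.br a c) + P.br a b * C c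

/-- An algebra isomorphism is an isomorphism of Poisson vertex algebras if it preserves the parity,
`∂` and the λ-bracket. -/
structure IsPVAEquiv {B : Type*} [Ring B] [Algebra ℂ B] (P : LambdaData A) (Q : LambdaData B)
    (j : A ≃ₐ[ℂ] B) : Prop where
  par : ∀ a, j (P.par a) = Q.par (j a)
  del : ∀ a, j (P.del a) = Q.del (j a)
  br : ∀ a b n, j ((P.br a b).coeff n) = (Q.br (j a) (j b)).coeff n

/-- The structure `Q` on `H` is induced from the structure `P` on `A` along `π : Z → H`, where `Z` is
a subalgebra of `A`: the parity, `∂` and the coefficients of the λ-bracket of `P` preserve `Z`,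
and those of `Q` are computed on representatives in `Z`. -/
structure IsInduced {H : Type*} [Ring H] [Algebra ℂ H] (P : LambdaData A) (Z : Subalgebra ℂ A)
    (π : Z → H) (Q : LambdaData H) : Prop where
  par : ∀ z : Z, ∃ y : Z, (y : A) = P.par z ∧ Q.par (π z) = π y
  del : ∀ z : Z, ∃ y : Z, (y : A) = P.del z ∧ Q.del (π z) = π y
  br : ∀ (z w : Z) (n : ℕ), ∃ y : Z, (y : A) = (P.br z w).coeff n ∧
    (Q.br (π z) (π w)).coeff n = π y

end PVA

/-! ### The λ-bracket on `S(R)` determined by its values on generators -/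

section Bracket

variable {W₀ W₁ : Type*} [AddCommGroup W₀] [Module ℂ W₀] [AddCommGroup W₁] [Module ℂ W₁]

/-- The derivation `∂` of `S(R)` that extends the action of `∂` on `R`. -/
def del : S W₀ W₁ →ₗ[ℂ] S W₀ W₁ :=
  (Polynomial.lcoeff (S W₀ W₁) 0).restrictScalars ℂ ∘ₗ
    superDeriv (Polynomial.CAlgHom.toLinearMap ∘ₗ ι ∘ₗ
      LinearMap.rTensor (W₀ × W₁) (LinearMap.mulLeft ℂ (X : ℂ[X])))

/-- The extension of `φ : W → M` to `ℂ[∂] ⊗ W → M`, where `∂` acts on `M` by `T`. -/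
def polyExt {W M : Type*} [AddCommGroup W] [Module ℂ W] [AddCommGroup M] [Module ℂ M]
    (T : M →ₗ[ℂ] M) : (W →ₗ[ℂ] M) →ₗ[ℂ] ℂ[X] ⊗[ℂ] W →ₗ[ℂ] M where
  toFun φ := TensorProduct.lift (LinearMap.lcomp ℂ M φ ∘ₗ (Polynomial.aeval T).toLinearMap)
  map_add' φ ψ := by ext; simp
  map_smul' c φ := by ext; simp

theorem polyExt_tmul {W M : Type*} [AddCommGroup W] [Module ℂ W] [AddCommGroup M] [Module ℂ M]
    (T : M →ₗ[ℂ] M) (φ : W →ₗ[ℂ] M) (p : ℂ[X]) (w : W) :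
    polyExt T φ (p ⊗ₜ w) = Polynomial.aeval T p (φ w) := by simp [polyExt]

/-- The sesquilinear extension of `β : W ⊗ W → S(R)[λ]` to `R ⊗ R`, i.e.
`[∂ᵐ a_λ ∂ⁿ b] = (-λ)ᵐ (λ + ∂)ⁿ β(a, b)`. -/
def sesq (β : W₀ × W₁ →ₗ[ℂ] W₀ × W₁ →ₗ[ℂ] (S W₀ W₁)[X]) :
    ℂ[X] ⊗[ℂ] (W₀ × W₁) →ₗ[ℂ] ℂ[X] ⊗[ℂ] (W₀ × W₁) →ₗ[ℂ] (S W₀ W₁)[X] :=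
  polyExt (-(LinearMap.mulLeft ℂ (X : (S W₀ W₁)[X])).compRight ℂ)
    (polyExt (lamAdd del) ∘ₗ β)

/-- `{v_λ f}` for `v` in `R` and `f` in `S(R)`: the left Leibniz rule. -/
def brLeft (β : W₀ × W₁ →ₗ[ℂ] W₀ × W₁ →ₗ[ℂ] (S W₀ W₁)[X]) :
    ℂ[X] ⊗[ℂ] (W₀ × W₁) →ₗ[ℂ] S W₀ W₁ →ₗ[ℂ] (S W₀ W₁)[X] := superDeriv ∘ₗ sesq β

/-- `{f_λ v}` for `f` in `S(R)` and `v` in `R`, by skewsymmetry: it is `-{v_{-λ-∂} f}` for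
even `v` and `-{v_{-λ-∂} σ f}` for odd `v`. -/
def brRight (β : W₀ × W₁ →ₗ[ℂ] W₀ × W₁ →ₗ[ℂ] (S W₀ W₁)[X]) :
    S W₀ W₁ →ₗ[ℂ] ℂ[X] ⊗[ℂ] (W₀ × W₁) →ₗ[ℂ] (S W₀ W₁)[X] where
  toFun f := -(skewSubst del ∘ₗ
    ((brLeft β).flip f ∘ₗ ((1 / 2 : ℂ) • (LinearMap.id + sgn)) +
      (brLeft β).flip (σ f) ∘ₗ ((1 / 2 : ℂ) • (LinearMap.id - sgn))))
  map_add' f g := by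
    refine LinearMap.ext fun v => ?_
    simp only [map_add, LinearMap.add_apply, LinearMap.neg_apply, LinearMap.comp_apply]
    abel
  map_smul' c f := by
    refine LinearMap.ext fun v => ?_
    simp only [map_smul, LinearMap.add_apply, LinearMap.neg_apply, LinearMap.comp_apply,
      LinearMap.smul_apply, map_add, RingHom.id_apply, smul_neg, smul_add,
      smul_comm c]

/-- The λ-bracket on `S(R)` that extends `β` by sesquilinearity, skewsymmetry and the Leibniz
rules, with `∂` and the parity of `S(R)`. -/
def freeData (β : W₀ × W₁ →ₗ[ℂ] W₀ × W₁ →ₗ[ℂ] (S W₀ W₁)[X]) : LambdaData (S W₀ W₁) where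
  par := σ
  del := del
  br := superDeriv ∘ₗ brRight β

/-! Facts on parities, needed for the complexes below. -/

/-- The conjugate of a map `T : R → S(R)[λ]` by the parity involutions. -/
def conj (T : ℂ[X] ⊗[ℂ] (W₀ × W₁) →ₗ[ℂ] (S W₀ W₁)[X]) :
    ℂ[X] ⊗[ℂ] (W₀ × W₁) →ₗ[ℂ] (S W₀ W₁)[X] := σX.toLinearMap ∘ₗ T ∘ₗ sgn

theorem conj_apply (T : ℂ[X] ⊗[ℂ] (W₀ × W₁) →ₗ[ℂ] (S W₀ W₁)[X]) (v) :
    conj T v = σX (T (sgn v)) := rfl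

theorem σ_twist (o : Bool) (a : S W₀ W₁) : σ (twist o a) = twist o (σ a) := by
  cases o <;> rfl

theorem σX_derivPart (o : Bool) (T : ℂ[X] ⊗[ℂ] (W₀ × W₁) →ₗ[ℂ] (S W₀ W₁)[X]) (a : S W₀ W₁) :
    σX (derivPart o T a) = derivPart o (conj T) (σ a) := by
  induction a using S.induction with
  | hc r => rw [AlgHom.commutes, derivPart_algebraMap, derivPart_algebraMap, map_zero]
  | hι v =>
    rw [σ_ι, derivPart_ι, derivPart_ι, parityPart_apply, parityPart_apply]
    simp only [map_smul, map_add, conj_apply, sgn_sgn, σX_σX]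
  | hmul a b ha hb =>
    simp only [derivPart_mul, map_add, map_mul, ha, hb, σX_C, σ_twist]
  | hadd a b ha hb => simp only [map_add, ha, hb]

theorem σX_superDeriv (T : ℂ[X] ⊗[ℂ] (W₀ × W₁) →ₗ[ℂ] (S W₀ W₁)[X]) (a : S W₀ W₁) :
    σX (superDeriv T a) = superDeriv (conj T) (σ a) := by
  simp only [superDeriv_apply, map_add, σX_derivPart]

theorem σ_del (a : S W₀ W₁) : σ (del a) = del (σ a) := by
  have h : conj (Polynomial.CAlgHom.toLinearMap ∘ₗ (ι : _ →ₗ[ℂ] S W₀ W₁) ∘ₗ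
      LinearMap.rTensor (W₀ × W₁) (LinearMap.mulLeft ℂ (X : ℂ[X])))
      = Polynomial.CAlgHom.toLinearMap ∘ₗ ι ∘ₗ
      LinearMap.rTensor (W₀ × W₁) (LinearMap.mulLeft ℂ (X : ℂ[X])) := by
    refine TensorProduct.ext' fun p w => ?_
    simp [conj, σ_ι, σX_C, sgn]
  have := σX_superDeriv (Polynomial.CAlgHom.toLinearMap ∘ₗ (ι : _ →ₗ[ℂ] S W₀ W₁) ∘ₗ
      LinearMap.rTensor (W₀ × W₁) (LinearMap.mulLeft ℂ (X : ℂ[X]))) a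
  rw [h] at this
  have h2 := congrArg (fun q => Polynomial.coeff q 0) this
  simp only [coeff_σX] at h2
  exact h2

theorem derivPart_eq_zero (o : Bool) (T : ℂ[X] ⊗[ℂ] (W₀ × W₁) →ₗ[ℂ] (S W₀ W₁)[X])
    (h : parityPart o T = 0) (a : S W₀ W₁) : derivPart o T a = 0 := by
  induction a using S.induction with
  | hc r => exact derivPart_algebraMap o T r
  | hι v => rw [derivPart_ι, h, LinearMap.zero_apply]
  | hmul a b ha hb => rw [derivPart_mul, ha, hb, mul_zero, zero_mul, add_zero]
  | hadd a b ha hb => rw [map_add, ha, hb, add_zero]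

theorem del_mul (a b : S W₀ W₁) : del (a * b) = del a * b + a * del b := by
  have h : parityPart true (Polynomial.CAlgHom.toLinearMap ∘ₗ (ι : _ →ₗ[ℂ] S W₀ W₁) ∘ₗ
      LinearMap.rTensor (W₀ × W₁) (LinearMap.mulLeft ℂ (X : ℂ[X]))) = 0 := by
    refine TensorProduct.ext' fun p w => ?_
    simp [parityPart, σ_ι, σX_C, sgn, sign]
  simp only [del, LinearMap.comp_apply, superDeriv_apply, derivPart_eq_zero _ _ h, add_zero,
    derivPart_mul]
  simp [twist, add_comm]

theorem aeval_intertwine {M N : Type*} [AddCommGroup M] [Module ℂ M] [AddCommGroup N] [Module ℂ N]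
    (F : M →ₗ[ℂ] N) (T : M →ₗ[ℂ] M) (T' : N →ₗ[ℂ] N) (h : ∀ x, F (T x) = T' (F x)) (p : ℂ[X])
    (x : M) : F (Polynomial.aeval T p x) = Polynomial.aeval T' p (F x) := by
  have hn : ∀ n : ℕ, F ((T ^ n) x) = (T' ^ n) (F x) := by
    intro n
    induction n with
    | zero => simp
    | succ n ih => rw [pow_succ', pow_succ', Module.End.mul_apply, Module.End.mul_apply, h, ih]
  induction p using Polynomial.induction_on' with
  | add p q hp hq => simp [hp, hq]
  | monomial n a => simp [Polynomial.aeval_monomial, hn]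

theorem σX_lamAdd (x : (S W₀ W₁)[X]) : σX (lamAdd del x) = lamAdd del (σX x) := by
  have h : σX (coeffwise del x) = coeffwise del (σX x) := by
    ext n; simp [coeff_σX, coeff_coeffwise, σ_del]
  have hX : σX (X : (S W₀ W₁)[X]) = X := by simp [σX]
  simp only [lamAdd, LinearMap.add_apply, LinearMap.mulLeft_apply, map_add, map_mul, h, hX]

theorem σX_skewSubst (x : (S W₀ W₁)[X]) : σX (skewSubst del x) = skewSubst del (σX x) := by
  induction x using Polynomial.induction_on' with
  | add p q hp hq => simp only [map_add, hp, hq]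
  | monomial n a =>
    have hn : ∀ n : ℕ, ∀ x : (S W₀ W₁)[X],
        σX (((-lamAdd del) ^ n) x) = ((-lamAdd del) ^ n) (σX x) := by
      intro n x
      induction n with
      | zero => simp
      | succ n ih =>
        rw [pow_succ', Module.End.mul_apply, Module.End.mul_apply, LinearMap.neg_apply,
          LinearMap.neg_apply, map_neg, σX_lamAdd, ih]
    have h2 : σX (monomial n a) = monomial n (σ a) := by simp [σX]
    rw [h2, skewSubst_monomial, skewSubst_monomial, hn, σX_C]

/-- `β` preserves parities. -/
def IsEven (β : W₀ × W₁ →ₗ[ℂ] W₀ × W₁ →ₗ[ℂ] (S W₀ W₁)[X]) : Prop :=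
  ∀ v w : W₀ × W₁, σX (β v w) = β (v.1, -v.2) (w.1, -w.2)

theorem conj_sesq {β : W₀ × W₁ →ₗ[ℂ] W₀ × W₁ →ₗ[ℂ] (S W₀ W₁)[X]} (hβ : IsEven β)
    (v : ℂ[X] ⊗[ℂ] (W₀ × W₁)) : conj (sesq β v) = sesq β (sgn v) := by
  have h1 : ∀ a : W₀ × W₁, conj (polyExt (lamAdd del) (β a))
      = polyExt (lamAdd del) (β (a.1, -a.2)) := by
    intro a
    refine TensorProduct.ext' fun p b => ?_
    have := aeval_intertwine (σX (W₀ := W₀) (W₁ := W₁)).toLinearMap (lamAdd del) (lamAdd del)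
      σX_lamAdd p (β a (b.1, -b.2))
    simp only [AlgHom.toLinearMap_apply] at this
    have hb := hβ a (b.1, -b.2)
    simp only [neg_neg] at hb
    simp [conj, sgn, polyExt_tmul, this, hb]
  let F : (ℂ[X] ⊗[ℂ] (W₀ × W₁) →ₗ[ℂ] (S W₀ W₁)[X]) →ₗ[ℂ]
      (ℂ[X] ⊗[ℂ] (W₀ × W₁) →ₗ[ℂ] (S W₀ W₁)[X]) :=
    { toFun := conj
      map_add' := fun T T' => LinearMap.ext fun v => by simp [conj]
      map_smul' := fun c T => LinearMap.ext fun v => by simp [conj] }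
  have hF : ∀ T, F ((-(LinearMap.mulLeft ℂ (X : (S W₀ W₁)[X])).compRight ℂ) T)
      = (-(LinearMap.mulLeft ℂ (X : (S W₀ W₁)[X])).compRight ℂ) (F T) := by
    intro T
    refine LinearMap.ext fun v => ?_
    simp [F, conj, σX]
  induction v using TensorProduct.induction_on with
  | zero => exact LinearMap.ext fun v => by simp [conj]
  | tmul p a =>
    have h2 : sgn (p ⊗ₜ[ℂ] a) = p ⊗ₜ[ℂ] ((a.1, -a.2) : W₀ × W₁) := by simp [sgn]
    rw [h2]
    simp only [sesq, polyExt_tmul, LinearMap.comp_apply]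
    rw [← h1]
    exact aeval_intertwine F _ _ hF p _
  | add x y hx hy =>
    rw [map_add, map_add, map_add, ← hx, ← hy]
    refine LinearMap.ext fun v => ?_
    simp [conj]

theorem conj_brRight {β : W₀ × W₁ →ₗ[ℂ] W₀ × W₁ →ₗ[ℂ] (S W₀ W₁)[X]} (hβ : IsEven β)
    (f : S W₀ W₁) : conj (brRight β f) = brRight β (σ f) := by
  have h : ∀ v g, σX (brLeft β v g) = brLeft β (sgn v) (σ g) := by
    intro v g
    simp only [brLeft, LinearMap.comp_apply, σX_superDeriv, conj_sesq hβ]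
  refine LinearMap.ext fun v => ?_
  simp [conj, brRight, σX_skewSubst, h, sgn_sgn]

theorem par_freeData {β : W₀ × W₁ →ₗ[ℂ] W₀ × W₁ →ₗ[ℂ] (S W₀ W₁)[X]} (hβ : IsEven β)
    (f g : S W₀ W₁) (n : ℕ) :
    σ (((freeData β).br f g).coeff n) = ((freeData β).br (σ f) (σ g)).coeff n := by
  simp only [freeData, LinearMap.comp_apply, ← coeff_σX, σX_superDeriv, conj_brRight hβ]

/-- The left Leibniz rule for an odd first argument. -/
theorem odd_leibniz {β : W₀ × W₁ →ₗ[ℂ] W₀ × W₁ →ₗ[ℂ] (S W₀ W₁)[X]} (hβ : IsEven β)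
    {d : S W₀ W₁} (hd : σ d = -d) (a b : S W₀ W₁) :
    (freeData β).br d (a * b) = C (σ a) * (freeData β).br d b + (freeData β).br d a * C b := by
  have h : parityPart false (brRight β d) = 0 := by
    have h1 := conj_brRight hβ d
    rw [hd, map_neg] at h1
    refine TensorProduct.ext' fun p w => ?_
    have h2 := LinearMap.congr_fun h1 (p ⊗ₜ w)
    rw [conj_apply] at h2
    simp [parityPart_apply, h2, sign]
  simp only [freeData, LinearMap.comp_apply, superDeriv_apply, derivPart_eq_zero _ _ h, zero_add,
    derivPart_mul, twist, cond_true]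

/-- The left Leibniz rule for an even first argument. -/
theorem even_leibniz {β : W₀ × W₁ →ₗ[ℂ] W₀ × W₁ →ₗ[ℂ] (S W₀ W₁)[X]} (hβ : IsEven β)
    {d : S W₀ W₁} (hd : σ d = d) (a b : S W₀ W₁) :
    (freeData β).br d (a * b) = C a * (freeData β).br d b + (freeData β).br d a * C b := by
  have h : parityPart true (brRight β d) = 0 := by
    have h1 := conj_brRight hβ d
    rw [hd] at h1
    refine TensorProduct.ext' fun p w => ?_
    have h2 := LinearMap.congr_fun h1 (p ⊗ₜ w)
    rw [conj_apply] at h2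
    simp [parityPart_apply, h2, sign]
  simp only [freeData, LinearMap.comp_apply, superDeriv_apply, derivPart_eq_zero _ _ h, add_zero,
    derivPart_mul, twist, cond_false, AlgHom.id_apply]

theorem br_algebraMap (β : W₀ × W₁ →ₗ[ℂ] W₀ × W₁ →ₗ[ℂ] (S W₀ W₁)[X]) (d : S W₀ W₁) (r : ℂ) :
    (freeData β).br d (algebraMap ℂ _ r) = 0 := by
  simp only [freeData, LinearMap.comp_apply, superDeriv_apply, derivPart_algebraMap, add_zero]

end Bracket

/-! ### Cohomology of an odd derivation on a stable subalgebra -/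

section Cohomology

/-- An odd derivation `d` of a superalgebra `A` with parity involution `par`. -/
structure OddDeriv (A : Type*) [Ring A] [Algebra ℂ A] where
  par : A →ₐ[ℂ] A
  d : A →ₗ[ℂ] A
  par_par : ∀ a, par (par a) = a
  d_mul : ∀ a b, d (a * b) = par a * d b + d a * b
  d_par : ∀ a, d (par a) = -par (d a)

variable {A : Type*} [Ring A] [Algebra ℂ A]

/-- The algebra of cocycles `ker (d|_B)`. -/
def OddDeriv.cocycles (D : OddDeriv A) (B : Subalgebra ℂ A) : Subalgebra ℂ A where
  carrier := {z | z ∈ B ∧ D.d z = 0}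
  mul_mem' := by
    rintro a b ⟨ha, ha'⟩ ⟨hb, hb'⟩
    exact ⟨B.mul_mem ha hb, by rw [D.d_mul, ha', hb', mul_zero, zero_mul, add_zero]⟩
  add_mem' := by
    rintro a b ⟨ha, ha'⟩ ⟨hb, hb'⟩
    exact ⟨B.add_mem ha hb, by rw [map_add, ha', hb', add_zero]⟩
  algebraMap_mem' r := by
    refine ⟨B.algebraMap_mem r, ?_⟩
    have h := D.d_mul 1 1
    simp only [map_one, one_mul, mul_one, left_eq_add] at h
    rw [Algebra.algebraMap_eq_smul_one, map_smul, h, smul_zero]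

/-- The ideal of coboundaries `im (d|_B)` in the algebra of cocycles `ker (d|_B)`. -/
def OddDeriv.coboundaries (D : OddDeriv A) (B : Subalgebra ℂ A) (hB : ∀ b ∈ B, D.par b ∈ B) :
    TwoSidedIdeal (D.cocycles B) :=
  TwoSidedIdeal.mk' {z | ∃ b ∈ B, D.d b = z}
    ⟨0, B.zero_mem, by simp⟩
    (by
      rintro x y ⟨a, ha, ha'⟩ ⟨b, hb, hb'⟩
      exact ⟨a + b, B.add_mem ha hb, by simp [ha', hb']⟩)
    (by
      rintro x ⟨a, ha, ha'⟩
      exact ⟨-a, B.neg_mem ha, by simp [ha']⟩)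
    (by
      rintro x y ⟨b, hb, hb'⟩
      refine ⟨D.par x * b, B.mul_mem (hB _ x.2.1) hb, ?_⟩
      rw [D.d_mul, D.par_par, D.d_par, x.2.2, map_zero, neg_zero, zero_mul, add_zero, hb']
      rfl)
    (by
      rintro x y ⟨b, hb, hb'⟩
      refine ⟨b * y, B.mul_mem hb y.2.1, ?_⟩
      rw [D.d_mul, y.2.2, mul_zero, zero_add, hb']
      rfl)

/-- The cohomology algebra `H(B, d|_B) = ker (d|_B) / im (d|_B)`. -/
abbrev OddDeriv.Cohomology (D : OddDeriv A) (B : Subalgebra ℂ A) (hB : ∀ b ∈ B, D.par b ∈ B) :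
    Type _ := (D.coboundaries B hB).ringCon.Quotient

/-- The projection `z ↦ [z]` from cocycles to cohomology classes. -/
def OddDeriv.cls (D : OddDeriv A) (B : Subalgebra ℂ A) (hB : ∀ b ∈ B, D.par b ∈ B) :
    D.cocycles B →ₐ[ℂ] D.Cohomology B hB := (D.coboundaries B hB).ringCon.mkₐ ℂ

end Cohomology

/-! ### The grading of `𝔤` -/

section Grading

variable {𝔤 : Type*} [LieRing 𝔤] [LieAlgebra ℂ 𝔤]

/-- The sum of the eigenspaces `𝔤(i)` of `ad (h/2)` over the `i` in `s`. -/
def gradePart (h : 𝔤) (s : Set ℚ) : Submodule ℂ 𝔤 :=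
  ⨆ i ∈ s, Module.End.eigenspace (LieAlgebra.ad ℂ 𝔤 ((1 / 2 : ℂ) • h)) (i : ℂ)

/-- `𝔫 = ⨁_{i ≥ 1/2} 𝔤(i)`. -/
abbrev nPart (h : 𝔤) : Submodule ℂ 𝔤 := gradePart h (Set.Ici (1 / 2))

/-- `𝔪 = ⨁_{i ≥ 1} 𝔤(i)`. -/
abbrev mPart (h : 𝔤) : Submodule ℂ 𝔤 := gradePart h (Set.Ici 1)

/-- `𝔤(1/2)`, a complement of `𝔪` in `𝔫`. -/
abbrev halfPart (h : 𝔤) : Submodule ℂ 𝔤 := gradePart h {1 / 2}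

/-- `⨁_{i ≤ 0} 𝔤(i)`. -/
abbrev nonposPart (h : 𝔤) : Submodule ℂ 𝔤 := gradePart h (Set.Iic 0)

open Classical in
/-- The projection of `𝔤 = ⨁ 𝔤(i)` onto the sum of the `𝔤(i)` with `i ∈ s`, along the sum of the
others. (The value `0` is never taken when `h` belongs to an `sl₂`-triple of a finite-dimensional
Lie algebra, since `ad (h/2)` is then diagonalizable with half-integral eigenvalues.) -/
def gradeProj (h : 𝔤) (s : Set ℚ) : 𝔤 →ₗ[ℂ] gradePart h s :=
  if hc : IsCompl (gradePart h s) (gradePart h sᶜ) then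
    Submodule.projectionOnto _ _ hc
  else 0

end Grading

/-! ### The classical BRST complex -/

section BRST

variable {𝔤 : Type*} [LieRing 𝔤] [LieAlgebra ℂ 𝔤]

/-- The superalgebra `S(R_k(𝔤, f))` on the even generators `𝔤 ⊕ Φ_{𝔫/𝔪}`, where
`Φ_{𝔫/𝔪} ≅ 𝔤(1/2)`, and the odd generators `φ_𝔫 ⊕ φ^{𝔫*}`. -/
abbrev C₁ (h : 𝔤) : Type _ := S (𝔤 × halfPart h) (nPart h × Module.Dual ℂ (nPart h))

/-- The generator `a` of `S(R)`, for `a` in `𝔤`. -/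
def cur (h : 𝔤) : 𝔤 →ₗ[ℂ] C₁ h :=
  gen 0 ∘ₗ LinearMap.inl ℂ _ _ ∘ₗ LinearMap.inl ℂ _ _

/-- The generator `Φ_b`, for `b` in `𝔤(1/2)`. -/
def Phi (h : 𝔤) : halfPart h →ₗ[ℂ] C₁ h :=
  gen 0 ∘ₗ LinearMap.inl ℂ _ _ ∘ₗ LinearMap.inr ℂ _ _

/-- The generator `φ_n`, for `n` in `𝔫`. -/
def phi (h : 𝔤) : nPart h →ₗ[ℂ] C₁ h :=
  gen 0 ∘ₗ LinearMap.inr ℂ _ _ ∘ₗ LinearMap.inl ℂ _ _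

/-- The generator `φ^θ`, for `θ` in `𝔫*`. -/
def phiDual (h : 𝔤) : Module.Dual ℂ (nPart h) →ₗ[ℂ] C₁ h :=
  gen 0 ∘ₗ LinearMap.inr ℂ _ _ ∘ₗ LinearMap.inr ℂ _ _

/-- The λ-brackets between the generators of `S(R_k(𝔤, f))`:
`[a_λ b] = [a, b] + λ k (a, b)`, `[Φ_a _λ Φ_b] = (f, [a, b])`, `[φ_n _λ φ^θ] = [φ^θ _λ φ_n] = θ(n)`,
the others are zero. -/
def brstBracket (B : LinearMap.BilinForm ℂ 𝔤) (h f : 𝔤) (k : ℂ) :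
    (𝔤 × halfPart h) × (nPart h × Module.Dual ℂ (nPart h)) →ₗ[ℂ]
      (𝔤 × halfPart h) × (nPart h × Module.Dual ℂ (nPart h)) →ₗ[ℂ] (C₁ h)[X] :=
  LinearMap.mk₂ ℂ
    (fun v w =>
      C (cur h ⁅v.1.1, w.1.1⁆) + X * algebraMap ℂ _ (k * B v.1.1 w.1.1)
        + algebraMap ℂ _ (B f ⁅(v.1.2 : 𝔤), (w.1.2 : 𝔤)⁆)
        + algebraMap ℂ _ (w.2.2 v.2.1 + v.2.2 w.2.1))
    (by
      intro v v' w
      simp only [Prod.fst_add, Prod.snd_add, add_lie, map_add, LinearMap.add_apply, mul_add,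
        Submodule.coe_add]
      abel)
    (by
      intro c v w
      simp only [Prod.smul_fst, Prod.smul_snd, smul_lie, map_smul, LinearMap.smul_apply,
        Submodule.coe_smul, smul_add, ← Polynomial.smul_C, Algebra.algebraMap_eq_smul_one,
        smul_eq_mul, smul_smul, mul_smul_comm, mul_add, mul_left_comm])
    (by
      intro v w w'
      simp only [Prod.fst_add, Prod.snd_add, lie_add, map_add, LinearMap.add_apply, mul_add,
        Submodule.coe_add]
      abel)
    (by
      intro c v w
      simp only [Prod.smul_fst, Prod.smul_snd, lie_smul, map_smul, LinearMap.smul_apply,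
        Submodule.coe_smul, smul_add, ← Polynomial.smul_C, Algebra.algebraMap_eq_smul_one,
        smul_eq_mul, smul_smul, mul_smul_comm, mul_add, mul_left_comm])

/-- The Poisson vertex algebra `S(R_k(𝔤, f))`. -/
def brstData (B : LinearMap.BilinForm ℂ 𝔤) (h f : 𝔤) (k : ℂ) : LambdaData (C₁ h) :=
  freeData (brstBracket B h f k)

variable {I : Type*} [Fintype I]

/-- The odd element
`d = ∑ φ^{v^α} (u_α + (f, u_α) + Φ_{[u_α]}) + 1/2 ∑ φ^{v^α} φ^{v^β} φ_{[u_β, u_α]}`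
for dual bases `u_α`, `v^α` of `𝔫`, `𝔫*`. -/
def brstElement (B : LinearMap.BilinForm ℂ 𝔤) (h f : 𝔤) (u : Module.Basis I ℂ (nPart h)) : C₁ h :=
  ∑ α, phiDual h (u.coord α) *
      (cur h (u α) + algebraMap ℂ _ (B f (u α)) + Phi h (gradeProj h {1 / 2} (u α)))
    + (1 / 2 : ℂ) • ∑ α, ∑ β, phiDual h (u.coord α) * phiDual h (u.coord β) *
        phi h (gradeProj h (Set.Ici (1 / 2)) ⁅(u β : 𝔤), (u α : 𝔤)⁆)

/-- `J_a = a + ∑ φ^{v^α} φ_{[u_α, a]}`, where `φ_x` for `x` in `𝔤` means `φ` of the component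
of `x` in `𝔫`. -/
def J (h : 𝔤) (u : Module.Basis I ℂ (nPart h)) (a : 𝔤) : C₁ h :=
  cur h a + ∑ α, phiDual h (u.coord α) * phi h (gradeProj h (Set.Ici (1 / 2)) ⁅(u α : 𝔤), a⁆)

theorem σ_cur (h a : 𝔤) : σ (cur h a) = cur h a := by simp [cur, gen, σ_ι, sgn]

theorem σ_Phi (h : 𝔤) (b : halfPart h) : σ (Phi h b) = Phi h b := by simp [Phi, gen, σ_ι, sgn]

theorem σ_phi (h : 𝔤) (n : nPart h) : σ (phi h n) = -phi h n := by
  simp only [phi, gen, LinearMap.comp_apply, TensorProduct.mk_apply, σ_ι]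
  rw [← map_neg, LinearMap.inr_apply, sgn_odd]

theorem σ_phiDual (h : 𝔤) (θ : Module.Dual ℂ (nPart h)) : σ (phiDual h θ) = -phiDual h θ := by
  simp only [phiDual, gen, LinearMap.comp_apply, TensorProduct.mk_apply, σ_ι]
  rw [← map_neg, LinearMap.inr_apply, sgn_odd]

theorem σ_J (h : 𝔤) (u : Module.Basis I ℂ (nPart h)) (a : 𝔤) : σ (J h u a) = J h u a := by
  simp [J, σ_cur, σ_phi, σ_phiDual]

theorem σ_brstElement (B : LinearMap.BilinForm ℂ 𝔤) (h f : 𝔤) (u : Module.Basis I ℂ (nPart h)) :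
    σ (brstElement B h f u) = -brstElement B h f u := by
  simp only [brstElement, map_add, map_smul, map_sum, map_mul, σ_cur, σ_phi, σ_phiDual, σ_Phi,
    AlgHom.commutes, neg_mul, mul_neg, neg_neg, Finset.sum_neg_distrib, smul_neg, neg_add]

theorem isEven_brstBracket (B : LinearMap.BilinForm ℂ 𝔤) (h f : 𝔤) (k : ℂ) :
    IsEven (brstBracket B h f k) := by
  intro v w
  have hX : σX (X : (C₁ h)[X]) = X := by simp [σX]
  have hs : (-w.2).2 (-v.2).1 + (-v.2).2 (-w.2).1 = w.2.2 v.2.1 + v.2.2 w.2.1 := by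
    rw [Prod.fst_neg, Prod.snd_neg, Prod.fst_neg, Prod.snd_neg, map_neg, map_neg,
      LinearMap.neg_apply, LinearMap.neg_apply, neg_neg, neg_neg]
  have e : ∀ v w, brstBracket B h f k v w = C (cur h ⁅v.1.1, w.1.1⁆)
      + X * algebraMap ℂ _ (k * B v.1.1 w.1.1) + algebraMap ℂ _ (B f ⁅(v.1.2 : 𝔤), (w.1.2 : 𝔤)⁆)
      + algebraMap ℂ _ (w.2.2 v.2.1 + v.2.2 w.2.1) := fun _ _ => rfl
  rw [e, e, hs, map_add, map_add, map_add, map_mul, hX, σX_C, σ_cur, AlgHom.commutes,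
    AlgHom.commutes, AlgHom.commutes]

/-- The odd derivation `d_(0) = {d_λ · }|_{λ = 0}` of `S(R_k(𝔤, f))`. -/
def brst (B : LinearMap.BilinForm ℂ 𝔤) (h f : 𝔤) (k : ℂ) (u : Module.Basis I ℂ (nPart h)) :
    OddDeriv (C₁ h) where
  par := σ
  d := (Polynomial.lcoeff (C₁ h) 0).restrictScalars ℂ ∘ₗ
    (brstData B h f k).br (brstElement B h f u)
  par_par := σ_σ
  d_mul a b := by
    have := odd_leibniz (isEven_brstBracket B h f k) (σ_brstElement B h f u) a b
    simp [brstData, this]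
  d_par a := by
    have := par_freeData (isEven_brstBracket B h f k) (brstElement B h f u) a 0
    rw [σ_brstElement, map_neg, LinearMap.neg_apply, coeff_neg] at this
    simp [brstData, this]

/-- The classical affine `W`-algebra `W₁(𝔤, f, k) = H(S(R_k(𝔤, f)), d_(0))`. -/
abbrev W₁ (B : LinearMap.BilinForm ℂ 𝔤) (h f : 𝔤) (k : ℂ) (u : Module.Basis I ℂ (nPart h)) :
    Type _ := (brst B h f k u).Cohomology ⊤ (fun _ _ => Algebra.mem_top)

/-- The subalgebra `S(R_-)` of `S(R_k(𝔤, f))`, `R_- = ℂ[∂] ⊗ (J_≤ ⊕ φ^{𝔫*} ⊕ Φ_{𝔫/𝔪})`. -/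
def Sminus (h : 𝔤) (u : Module.Basis I ℂ (nPart h)) : Subalgebra ℂ (C₁ h) :=
  Algebra.adjoin ℂ
    ({x | ∃ (n : ℕ) (a : 𝔤), a ∈ nonposPart h ∧ x = (del ^ n) (J h u a)} ∪
      {x | ∃ (n : ℕ) (b : halfPart h), x = (del ^ n) (Phi h b)} ∪
      {x | ∃ (n : ℕ) (θ : Module.Dual ℂ (nPart h)), x = (del ^ n) (phiDual h θ)})

theorem σ_del_pow {W₀ W₁ : Type*} [AddCommGroup W₀] [Module ℂ W₀] [AddCommGroup W₁] [Module ℂ W₁]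
    (n : ℕ) (x : S W₀ W₁) : σ ((del ^ n) x) = (del ^ n) (σ x) := by
  induction n with
  | zero => simp
  | succ n ih => rw [pow_succ', Module.End.mul_apply, Module.End.mul_apply, σ_del, ih]

theorem σ_mem_Sminus (h : 𝔤) (u : Module.Basis I ℂ (nPart h)) (x : C₁ h) (hx : x ∈ Sminus h u) :
    σ x ∈ Sminus h u := by
  suffices hle : Sminus h u ≤ (Sminus h u).comap σ from hle hx
  refine Algebra.adjoin_le ?_
  rintro y ((⟨n, a, ha, rfl⟩ | ⟨n, b, rfl⟩) | ⟨n, θ, rfl⟩)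
  · change σ _ ∈ Sminus h u
    rw [σ_del_pow, σ_J]
    exact Algebra.subset_adjoin (Or.inl (Or.inl ⟨n, a, ha, rfl⟩))
  · change σ _ ∈ Sminus h u
    rw [σ_del_pow, σ_Phi]
    exact Algebra.subset_adjoin (Or.inl (Or.inr ⟨n, b, rfl⟩))
  · change σ _ ∈ Sminus h u
    rw [σ_del_pow, σ_phiDual, map_neg]
    exact neg_mem (Algebra.subset_adjoin (Or.inr ⟨n, θ, rfl⟩))

theorem J_mem (h : 𝔤) (u : Module.Basis I ℂ (nPart h)) (n : ℕ) (a : 𝔤) (ha : a ∈ nonposPart h) :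
    (del ^ n) (J h u a) ∈ Sminus h u :=
  Algebra.subset_adjoin (Or.inl (Or.inl ⟨n, a, ha, rfl⟩))

theorem Phi_mem (h : 𝔤) (u : Module.Basis I ℂ (nPart h)) (n : ℕ) (b : halfPart h) :
    (del ^ n) (Phi h b) ∈ Sminus h u :=
  Algebra.subset_adjoin (Or.inl (Or.inr ⟨n, b, rfl⟩))

theorem phiDual_mem (h : 𝔤) (u : Module.Basis I ℂ (nPart h)) (n : ℕ)
    (θ : Module.Dual ℂ (nPart h)) : (del ^ n) (phiDual h θ) ∈ Sminus h u :=
  Algebra.subset_adjoin (Or.inr ⟨n, θ, rfl⟩)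

/-- The cohomology `H(S(R_-), d_-)`, where `d_-` is the restriction of `d_(0)`. -/
abbrev Hminus (B : LinearMap.BilinForm ℂ 𝔤) (h f : 𝔤) (k : ℂ) (u : Module.Basis I ℂ (nPart h)) :
    Type _ := (brst B h f k u).Cohomology (Sminus h u) (σ_mem_Sminus h u)

end BRST

/-! ### The Hamiltonian reduction -/

section Reduction

variable {𝔤 : Type*} [LieRing 𝔤] [LieAlgebra ℂ 𝔤]

/-- The symmetric algebra `S(ℂ[∂] ⊗ 𝔤)`: there are no odd generators, so it is commutative. -/
abbrev Scur (𝔤 : Type*) [LieRing 𝔤] [LieAlgebra ℂ 𝔤] : Type _ := S 𝔤 PUnit.{1}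

/-- The generator `a` of `S(ℂ[∂] ⊗ 𝔤)`, for `a` in `𝔤`. -/
def scur : 𝔤 →ₗ[ℂ] Scur 𝔤 := gen 0 ∘ₗ LinearMap.inl ℂ _ _

/-- The λ-bracket `[a_λ b] = [a, b] + λ k (a, b)` of `Cur_k(𝔤)`. -/
def curBracket (B : LinearMap.BilinForm ℂ 𝔤) (k : ℂ) :
    𝔤 × PUnit.{1} →ₗ[ℂ] 𝔤 × PUnit.{1} →ₗ[ℂ] (Scur 𝔤)[X] :=
  LinearMap.mk₂ ℂ
    (fun v w => C (scur ⁅v.1, w.1⁆) + X * algebraMap ℂ _ (k * B v.1 w.1))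
    (by
      intro v v' w
      simp only [Prod.fst_add, add_lie, map_add, LinearMap.add_apply, mul_add]
      abel)
    (by
      intro c v w
      simp only [Prod.smul_fst, smul_lie, map_smul, LinearMap.smul_apply, smul_add,
        ← Polynomial.smul_C, Algebra.algebraMap_eq_smul_one, smul_eq_mul, smul_smul,
        mul_smul_comm, mul_left_comm])
    (by
      intro v w w'
      simp only [Prod.fst_add, lie_add, map_add, mul_add]
      abel)
    (by
      intro c v w
      simp only [Prod.smul_fst, lie_smul, map_smul, smul_add,
        ← Polynomial.smul_C, Algebra.algebraMap_eq_smul_one, smul_eq_mul, smul_smul,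
        mul_smul_comm, mul_left_comm])

/-- The Poisson vertex algebra `S(ℂ[∂] ⊗ 𝔤)`. -/
def curData (B : LinearMap.BilinForm ℂ 𝔤) (k : ℂ) : LambdaData (Scur 𝔤) :=
  freeData (curBracket B k)

theorem σ_scur (a : 𝔤) : σ (scur a) = scur a := by simp [scur, gen, σ_ι, sgn]

theorem isEven_curBracket (B : LinearMap.BilinForm ℂ 𝔤) (k : ℂ) : IsEven (curBracket B k) := by
  intro v w
  have hX : σX (X : (Scur 𝔤)[X]) = X := by simp [σX]
  simp only [curBracket, LinearMap.mk₂_apply, map_add, map_mul, hX, σX_C, σ_scur, AlgHom.commutes]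

/-- The differential ideal of `S(ℂ[∂] ⊗ 𝔤)` generated by `m + (f, m)` for `m` in `𝔪`. -/
def redIdeal (B : LinearMap.BilinForm ℂ 𝔤) (h f : 𝔤) : TwoSidedIdeal (Scur 𝔤) :=
  TwoSidedIdeal.span
    {x | ∃ (n : ℕ) (m : 𝔤), m ∈ mPart h ∧ x = (del ^ n) (scur m + algebraMap ℂ _ (B f m))}

/-- The quotient of `S(ℂ[∂] ⊗ 𝔤)` by `redIdeal`. -/
abbrev Red (B : LinearMap.BilinForm ℂ 𝔤) (h f : 𝔤) : Type _ := (redIdeal B h f).ringCon.Quotient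

/-- The projection onto the quotient. -/
def toRed (B : LinearMap.BilinForm ℂ 𝔤) (h f : 𝔤) : Scur 𝔤 →ₐ[ℂ] Red B h f :=
  (redIdeal B h f).ringCon.mkₐ ℂ

/-- The classical affine `W`-algebra `W₂(𝔤, f, k)`: the subalgebra of the classes of the elements
`a` for which `{n_λ a}` has all coefficients in `redIdeal`, for every `n` in `𝔫`, i.e. the invariants
of the action `(ad_λ n) (a + redIdeal) = {n_λ a} + redIdeal[λ]`. (The condition does not depend on
the representative, because `{n_λ ·}` maps `redIdeal` into `redIdeal[λ]`.) -/
def W₂ (B : LinearMap.BilinForm ℂ 𝔤) (h f : 𝔤) (k : ℂ) : Subalgebra ℂ (Red B h f) where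
  carrier := {x | ∃ a, toRed B h f a = x ∧
    ∀ n ∈ nPart h, ∀ i, ((curData B k).br (scur n) a).coeff i ∈ redIdeal B h f}
  mul_mem' := by
    rintro _ _ ⟨a, rfl, ha⟩ ⟨b, rfl, hb⟩
    refine ⟨a * b, map_mul _ _ _, fun n hn i => ?_⟩
    have := even_leibniz (isEven_curBracket B k) (σ_scur n) a b
    rw [curData, this, coeff_add, coeff_C_mul, coeff_mul_C]
    exact TwoSidedIdeal.add_mem _ (TwoSidedIdeal.mul_mem_left _ _ _ (hb n hn i))
      (TwoSidedIdeal.mul_mem_right _ _ _ (ha n hn i))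
  add_mem' := by
    rintro _ _ ⟨a, rfl, ha⟩ ⟨b, rfl, hb⟩
    refine ⟨a + b, map_add _ _ _, fun n hn i => ?_⟩
    rw [map_add, coeff_add]
    exact TwoSidedIdeal.add_mem _ (ha n hn i) (hb n hn i)
  algebraMap_mem' r := by
    refine ⟨algebraMap ℂ _ r, AlgHom.commutes _ r, fun n hn i => ?_⟩
    rw [curData, br_algebraMap, coeff_zero]
    exact TwoSidedIdeal.zero_mem _

/-- The subalgebra of the elements of `S(ℂ[∂] ⊗ 𝔤)` whose class is in `W₂(𝔤, f, k)`. -/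
def W₂lift (B : LinearMap.BilinForm ℂ 𝔤) (h f : 𝔤) (k : ℂ) : Subalgebra ℂ (Scur 𝔤) :=
  (W₂ B h f k).comap (toRed B h f)

/-- The projection `W₂lift → W₂(𝔤, f, k)`. -/
def toW₂ (B : LinearMap.BilinForm ℂ 𝔤) (h f : 𝔤) (k : ℂ) (z : W₂lift B h f k) : W₂ B h f k :=
  ⟨toRed B h f z, z.2⟩

end Reduction

end

end ClassicalW

namespace ClassicalW
noncomputable section

/-! ### Calculus of the substitution λ ↦ -λ-∂ and of polynomials in λ and μ -/

section PolynomialOperators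

/-! Write d for d_(0). Both cohomological statements come from one device. If η is an odd derivation
and d² = 0, then L = dη + ηd is an even derivation commuting with d, and a cocycle that is a sum of
generalized eigenvectors of L with nonzero eigenvalues is a coboundary (`IsGen.exists_eq_apply`).
Eigenvalues add under products (`IsGen.mul`), so L has to be understood on generators only.

The computations with d rest on the element T(a) = J_{a_≤0} - Φ_{a_{1/2}} - (f, a) (`Tmap`), which
is J_a - dφ_{a_𝔫}. One finds dφ_n = J_n + Φ_n + (f, n), the Chevalley–Eilenberg formula for dφ^θ,
and dJ_a = ∑ φ^{v^α} T([u_α, a]) + k ∂φ^{(a,·)} (`brst_J`); dT(a) is given by the same formula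
(`brst_Tmap`). From these follow d² = 0 (`brst_brst`) and the stability of S(R_-).

From S(R) to S(R_-): let η send a to φ_{a_𝔫} and the other generators to 0. Then L is 0 on S(R_-)
and 1 on φ_n and dφ_n. These elements generate S(R) as a differential algebra, so S(R) is the direct
sum of S(R_-) and a part with positive integral eigenvalues, and the inclusion of S(R_-) is an
isomorphism on cohomology (`exists_cocycle_Sminus`, `exists_eq_brst_of_mem_Sminus`).

From S(R_-) to W₂: ad f is injective on 𝔫 and the form is nondegenerate, so the map y ↦ -(f, [·, y])
from 𝔤 to 𝔫* has a graded right inverse s (`exists_dual_section`). Let η send φ^θ to T(sθ) and kill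
J_a, Φ_b, φ_n. Up to terms treated earlier in an induction on weights, Lφ^θ is φ^θ and L T(a) is
T(πa), where π is the projection s ∘ (-(f, [·, -])). Hence the eigenvalues on S(R_-) are natural
numbers, and on φ^θ they are positive (`IsGradedData.isGen_of_wt`). The map T extends to a
homomorphism on S(ℂ[∂] ⊗ 𝔤) that kills 𝒥 and is a section of i modulo 𝒥, and x - T(i(x)) has
positive eigenvalues for x in S(R_-). So a cocycle with i(x) = 0 is itself in the positive part and
is a coboundary: j is injective. Moreover dT(w) is a combination of the ∂ᵐφ^{v^α} with coefficients
T of the coefficients of {u_α λ w} (`brst_Tlift`), so T(w) is a cocycle when w is invariant: j is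
surjective.

The λ-bracket: by the Jacobi identity d is a derivation of the bracket (`brst_coeff_br`), so {dφ_n λ
z} = d{φ_n λ z} for a cocycle z. The left side goes to {n_λ i(z)} and the right side to 0 modulo 𝒥,
so i(z) is invariant (`toScur_mem_W₂lift`). To compare {y_λ z} with {i(y)_λ i(z)}, the cocycles are
replaced by the elements with the same images in the subalgebra generated by 𝔤; the brackets with
the errors fall into 𝒥 (`redBr_of_mem_Sminus`).

Two foundations are laid first. The bracket of generators extends to a Poisson vertex algebra:
skewsymmetry is proved by induction on both arguments (`br_skew`), and the Jacobi identity, being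
symmetric in its arguments and a derivation in the last one, reduces to generators
(`jacobiAt_freeData`). And ad h is diagonalizable with integral eigenvalues by a Casimir argument
(`iSup_eigenspace_int_eq_top`), which provides the grading. -/

theorem poly_induction {A : Type*} [Ring A] {P : A[X] → Prop} (hC : ∀ a, P (C a)) (hX : ∀ p, P p → P (X * p))
    (hadd : ∀ p q, P p → P q → P (p + q)) (p : A[X]) : P p := by
  induction p using Polynomial.induction_on' with
  | add p q hp hq => exact hadd p q hp hq
  | monomial n a =>
    induction n with
    | zero => exact hC a
    | succ n ih => rw [← X_mul_monomial]; exact hX _ ih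

theorem coeff_C_X_pow_mul {A : Type*} [Ring A] (i : ℕ) (q : A[X][X]) (n m : ℕ) :
    ((C X ^ i * q).coeff n).coeff m = if i ≤ m then (q.coeff n).coeff (m - i) else 0 := by
  rw [← C_pow, coeff_C_mul, coeff_X_pow_mul']

variable {A B : Type*} [Ring A] [Algebra ℂ A] [Ring B] [Algebra ℂ B]

/-- The coefficientwise application of a linear map. -/
def mapLin (T : A →ₗ[ℂ] B) : A[X] →ₗ[ℂ] B[X] :=
  Polynomial.lsum fun n => (Polynomial.monomial n).restrictScalars ℂ ∘ₗ T

theorem mapLin_monomial (T : A →ₗ[ℂ] B) (n : ℕ) (a : A) :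
    mapLin T (monomial n a) = monomial n (T a) := by
  simp only [mapLin, Polynomial.lsum_apply]
  rw [Polynomial.sum_monomial_index _ _ (by simp)]
  simp

theorem coeff_mapLin (T : A →ₗ[ℂ] B) (p : A[X]) (n : ℕ) :
    (mapLin T p).coeff n = T (p.coeff n) := by
  induction p using Polynomial.induction_on' with
  | add p q hp hq => simp [hp, hq]
  | monomial m a => rw [mapLin_monomial]; simp [Polynomial.coeff_monomial, apply_ite T]

theorem mapLin_C (T : A →ₗ[ℂ] B) (a : A) : mapLin T (C a) = C (T a) := mapLin_monomial T 0 a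

theorem mapLin_X_mul (T : A →ₗ[ℂ] B) (p : A[X]) : mapLin T (X * p) = X * mapLin T p := by
  ext n; cases n <;> simp [coeff_mapLin]

theorem coeffwise_eq_mapLin (T : A →ₗ[ℂ] A) : coeffwise T = mapLin T := rfl

theorem coeff_smul_complex (c : ℂ) (p : A[X]) (n : ℕ) : (c • p).coeff n = c • p.coeff n := by simp

theorem lamAdd_apply (T : A →ₗ[ℂ] A) (p : A[X]) : lamAdd T p = X * p + coeffwise T p := rfl

theorem coeff_lamAdd_zero (T : A →ₗ[ℂ] A) (p : A[X]) :
    (lamAdd T p).coeff 0 = T (p.coeff 0) := by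
  simp [lamAdd_apply, coeff_coeffwise]

theorem coeff_lamAdd_succ (T : A →ₗ[ℂ] A) (p : A[X]) (n : ℕ) :
    (lamAdd T p).coeff (n + 1) = p.coeff n + T (p.coeff (n + 1)) := by
  simp [lamAdd_apply, coeff_coeffwise]

theorem lamAdd_C (T : A →ₗ[ℂ] A) (a : A) : lamAdd T (C a) = X * C a + C (T a) := by
  rw [lamAdd_apply, coeffwise_eq_mapLin, mapLin_C]

theorem lamAdd_X_mul (T : A →ₗ[ℂ] A) (p : A[X]) : lamAdd T (X * p) = X * lamAdd T p := by
  rw [lamAdd_apply, lamAdd_apply, coeffwise_eq_mapLin, mapLin_X_mul, mul_add]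

theorem mapLin_lamAdd (F : A →ₗ[ℂ] B) (T : A →ₗ[ℂ] A) (T' : B →ₗ[ℂ] B)
    (h : ∀ a, F (T a) = T' (F a)) (p : A[X]) :
    mapLin F (lamAdd T p) = lamAdd T' (mapLin F p) := by
  ext n; cases n <;> simp [coeff_mapLin, coeff_lamAdd_zero, coeff_lamAdd_succ, h]

theorem lamAdd_C_mul (T : A →ₗ[ℂ] A) (hT : ∀ a b, T (a * b) = T a * b + a * T b) (a : A)
    (p : A[X]) : lamAdd T (C a * p) = C (T a) * p + C a * lamAdd T p := by
  ext n
  cases n <;> simp only [coeff_lamAdd_zero, coeff_lamAdd_succ, coeff_C_mul, coeff_add, hT, mul_add]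
  abel

theorem lamAdd_mul_C (T : A →ₗ[ℂ] A) (hT : ∀ a b, T (a * b) = T a * b + a * T b) (a : A)
    (p : A[X]) : lamAdd T (p * C a) = lamAdd T p * C a + p * C (T a) := by
  ext n
  cases n <;> simp only [coeff_lamAdd_zero, coeff_lamAdd_succ, coeff_mul_C, coeff_add, hT, add_mul]
  abel

theorem skewSubst_C (T : A →ₗ[ℂ] A) (a : A) : skewSubst T (C a) = C a := by
  rw [← monomial_zero_left, skewSubst_monomial]; simp

theorem skewSubst_X_mul (T : A →ₗ[ℂ] A) (p : A[X]) :
    skewSubst T (X * p) = -lamAdd T (skewSubst T p) := by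
  induction p using Polynomial.induction_on' with
  | add p q hp hq => rw [mul_add, map_add, hp, hq, map_add, map_add]; abel
  | monomial n a =>
    rw [X_mul_monomial, skewSubst_monomial, skewSubst_monomial, pow_succ', Module.End.mul_apply,
      LinearMap.neg_apply]

/-- Coefficientwise ∂ commutes with -λ-∂, hence with the substitution; on the right it is written as
(λ + ∂) - λ. -/
theorem skewSubst_C_apply (T : A →ₗ[ℂ] A) (p : A[X]) :
    skewSubst T (coeffwise T p) = lamAdd T (skewSubst T p) - X * skewSubst T p := by
  induction p using poly_induction with
  | hC a => rw [coeffwise_eq_mapLin, mapLin_C, skewSubst_C, skewSubst_C, lamAdd_C]; abel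
  | hX p hp =>
    rw [coeffwise_eq_mapLin] at hp ⊢
    rw [mapLin_X_mul, skewSubst_X_mul, hp, skewSubst_X_mul, map_sub, lamAdd_X_mul, map_neg, mul_neg]
    abel
  | hadd p q hp hq => rw [map_add, map_add, hp, hq, map_add, map_add, mul_add]; abel

/-- Under λ ↦ -λ-∂ the sum λ + ∂ becomes -λ: the two sesquilinearity rules are exchanged. -/
theorem skewSubst_lamAdd (T : A →ₗ[ℂ] A) (p : A[X]) :
    skewSubst T (lamAdd T p) = -(X * skewSubst T p) := by
  rw [lamAdd_apply, map_add, skewSubst_X_mul, skewSubst_C_apply]; abel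

/-- Because -(-λ-∂)-∂ = λ. Skewsymmetry can therefore be solved for either of the two brackets. -/
theorem skewSubst_skewSubst (T : A →ₗ[ℂ] A) (p : A[X]) : skewSubst T (skewSubst T p) = p := by
  induction p using poly_induction with
  | hC a => rw [skewSubst_C, skewSubst_C]
  | hX p hp => rw [skewSubst_X_mul, map_neg, skewSubst_lamAdd, hp, neg_neg]
  | hadd p q hp hq => rw [map_add, map_add, hp, hq]

theorem mapLin_skewSubst (F : A →ₗ[ℂ] B) (T : A →ₗ[ℂ] A) (T' : B →ₗ[ℂ] B)
    (h : ∀ a, F (T a) = T' (F a)) (p : A[X]) :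
    mapLin F (skewSubst T p) = skewSubst T' (mapLin F p) := by
  induction p using poly_induction with
  | hC a => rw [skewSubst_C, mapLin_C, skewSubst_C]
  | hX p hp =>
    rw [skewSubst_X_mul, map_neg, mapLin_lamAdd F T T' h, hp, mapLin_X_mul, skewSubst_X_mul]
  | hadd p q hp hq => simp only [map_add, hp, hq]

/-- `skewSubst` preserves the polynomials with coefficients in a `∂`-stable subspace. -/
theorem coeff_skewSubst_mem (T : A →ₗ[ℂ] A) (V : Submodule ℂ A) (hV : ∀ a ∈ V, T a ∈ V)
    (p : A[X]) (hp : ∀ n, p.coeff n ∈ V) (n : ℕ) : (skewSubst T p).coeff n ∈ V := by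
  have hl : ∀ q : A[X], (∀ n, q.coeff n ∈ V) → ∀ n, (lamAdd T q).coeff n ∈ V := by
    intro q hq n
    cases n with
    | zero => rw [coeff_lamAdd_zero]; exact hV _ (hq 0)
    | succ n => rw [coeff_lamAdd_succ]; exact add_mem (hq n) (hV _ (hq _))
  have hm : ∀ (m : ℕ) (a : A), a ∈ V → ∀ n, (skewSubst T (monomial m a)).coeff n ∈ V := by
    intro m a ha
    induction m with
    | zero =>
      intro n
      rw [monomial_zero_left, skewSubst_C, coeff_C]
      split_ifs
      exacts [ha, V.zero_mem]
    | succ m ih =>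
      intro n
      rw [← X_mul_monomial, skewSubst_X_mul, coeff_neg]
      exact neg_mem (hl _ ih n)
  rw [← Polynomial.sum_monomial_eq p, Polynomial.sum_def, map_sum, finsetSum_coeff]
  exact sum_mem fun i _ => hm _ _ (hp i) n

/-- The operator `p ↦ {p →} x` of the right Leibniz rule, for the left factor. -/
def rightL (T : A →ₗ[ℂ] A) (x : A) (p : A[X]) : A[X] := skewSubst T (C x * skewSubst T p)

/-- The operator of the right Leibniz rule, for the right factor. -/
def rightR (T : A →ₗ[ℂ] A) (x : A) (p : A[X]) : A[X] := skewSubst T (skewSubst T p * C x)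

theorem rightL_add (T : A →ₗ[ℂ] A) (x : A) (p q : A[X]) :
    rightL T x (p + q) = rightL T x p + rightL T x q := by
  simp only [rightL, map_add, mul_add]

theorem rightR_add (T : A →ₗ[ℂ] A) (x : A) (p q : A[X]) :
    rightR T x (p + q) = rightR T x p + rightR T x q := by
  simp only [rightR, map_add, add_mul]

theorem rightL_C (T : A →ₗ[ℂ] A) (x a : A) : rightL T x (C a) = C (x * a) := by
  rw [rightL, skewSubst_C, ← C_mul, skewSubst_C]

theorem rightR_C (T : A →ₗ[ℂ] A) (x a : A) : rightR T x (C a) = C (a * x) := by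
  rw [rightR, skewSubst_C, ← C_mul, skewSubst_C]

/-- Each factor λ becomes λ + ∂ with ∂ acting on x alone. Together with the value on constants this
recursion determines `rightL`; the statements below are proved by it for all x at once, since ∂x
occurs in the step. -/
theorem rightL_X_mul (T : A →ₗ[ℂ] A) (hT : ∀ a b, T (a * b) = T a * b + a * T b) (x : A)
    (p : A[X]) : rightL T x (X * p) = X * rightL T x p + rightL T (T x) p := by
  have h := lamAdd_C_mul T hT x (skewSubst T p)
  rw [rightL, skewSubst_X_mul, mul_neg, map_neg, eq_sub_of_add_eq' h.symm, map_sub,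
    skewSubst_lamAdd, rightL, rightL]
  abel

theorem rightR_X_mul (T : A →ₗ[ℂ] A) (hT : ∀ a b, T (a * b) = T a * b + a * T b) (x : A)
    (p : A[X]) : rightR T x (X * p) = X * rightR T x p + rightR T (T x) p := by
  have h := lamAdd_mul_C T hT x (skewSubst T p)
  rw [rightR, skewSubst_X_mul, neg_mul, map_neg, eq_sub_of_add_eq h.symm, map_sub,
    skewSubst_lamAdd, rightR, rightR]
  abel

theorem rightL_mul_C (T : A →ₗ[ℂ] A) (hT : ∀ a b, T (a * b) = T a * b + a * T b) (c : A)
    (p : A[X]) : ∀ x, rightL T x (p * C c) = rightL T x p * C c := by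
  induction p using poly_induction with
  | hC a => intro x; rw [← C_mul, rightL_C, rightL_C, ← C_mul, mul_assoc]
  | hX p hp =>
    intro x
    rw [mul_assoc, rightL_X_mul T hT, rightL_X_mul T hT, hp, hp, add_mul, mul_assoc]
  | hadd p q hp hq => intro x; rw [add_mul, rightL_add, hp, hq, rightL_add, add_mul]

theorem rightR_C_mul (T : A →ₗ[ℂ] A) (hT : ∀ a b, T (a * b) = T a * b + a * T b) (c : A)
    (p : A[X]) : ∀ x, rightR T x (C c * p) = C c * rightR T x p := by
  induction p using poly_induction with
  | hC a => intro x; rw [← C_mul, rightR_C, rightR_C, ← C_mul, mul_assoc]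
  | hX p hp =>
    intro x
    rw [← mul_assoc, ← X_mul_C, mul_assoc, rightR_X_mul T hT, rightR_X_mul T hT, hp, hp, mul_add,
      ← mul_assoc, ← mul_assoc, X_mul_C]
  | hadd p q hp hq => intro x; rw [mul_add, rightR_add, hp, hq, rightR_add, mul_add]

/-- If `x y = τ(y) x` for `x` in a `∂`-stable set, then `rightL x` commutes with left
multiplications up to `τ`. -/
theorem rightL_C_mul (T : A →ₗ[ℂ] A) (hT : ∀ a b, T (a * b) = T a * b + a * T b) (c c' : A)
    (Q : A → Prop) (hQ : ∀ x, Q x → Q (T x)) (hc : ∀ x, Q x → x * c = c' * x)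
    (p : A[X]) : ∀ x, Q x → rightL T x (C c * p) = C c' * rightL T x p := by
  induction p using poly_induction with
  | hC a => intro x hx; rw [← C_mul, rightL_C, rightL_C, ← C_mul, ← mul_assoc, hc x hx, mul_assoc]
  | hX p hp =>
    intro x hx
    rw [← mul_assoc, ← X_mul_C, mul_assoc, rightL_X_mul T hT, rightL_X_mul T hT, hp x hx,
      hp _ (hQ x hx), mul_add, ← mul_assoc, ← mul_assoc, X_mul_C]
  | hadd p q hp hq => intro x hx; rw [mul_add, rightL_add, hp x hx, hq x hx, rightL_add, mul_add]

theorem rightR_mul_C (T : A →ₗ[ℂ] A) (hT : ∀ a b, T (a * b) = T a * b + a * T b) (c c' : A)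
    (Q : A → Prop) (hQ : ∀ x, Q x → Q (T x)) (hc : ∀ x, Q x → c * x = x * c')
    (p : A[X]) : ∀ x, Q x → rightR T x (p * C c) = rightR T x p * C c' := by
  induction p using poly_induction with
  | hC a => intro x hx; rw [← C_mul, rightR_C, rightR_C, ← C_mul, mul_assoc, hc x hx, mul_assoc]
  | hX p hp =>
    intro x hx
    rw [mul_assoc, rightR_X_mul T hT, rightR_X_mul T hT, hp x hx, hp _ (hQ x hx), add_mul,
      mul_assoc]
  | hadd p q hp hq => intro x hx; rw [add_mul, rightR_add, hp x hx, hq x hx, rightR_add, add_mul]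

/-! ### Polynomials in two variables: the inner variable is `λ`, the outer one is `μ` -/

/-- `p(μ)` as a polynomial in `λ` and `μ`. -/
def liftPoly : A[X] →ₗ[ℂ] A[X][X] := mapLin (Polynomial.CAlgHom (R := ℂ) (A := A)).toLinearMap

theorem liftPoly_C (a : A) : liftPoly (C a) = C (C a) := mapLin_C _ a

theorem coeff_liftPoly (p : A[X]) (n : ℕ) : (liftPoly p).coeff n = C (p.coeff n) :=
  coeff_mapLin _ p n

/-- The substitution `p(ν) ↦ p(λ + μ)`. -/
def shiftPoly : A[X] →ₗ[ℂ] A[X][X] :=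
  Polynomial.lsum fun n => LinearMap.mulLeft ℂ ((X + C X : A[X][X]) ^ n) ∘ₗ
    (Polynomial.CAlgHom (R := ℂ) (A := A[X])).toLinearMap ∘ₗ
      (Polynomial.CAlgHom (R := ℂ) (A := A)).toLinearMap

theorem shiftPoly_monomial (n : ℕ) (a : A) :
    shiftPoly (monomial n a) = (X + C X) ^ n * C (C a) := by
  simp only [shiftPoly, Polynomial.lsum_apply]
  rw [Polynomial.sum_monomial_index _ _ (by simp)]
  simp

theorem shiftPoly_C (a : A) : shiftPoly (C a) = C (C a) := by
  rw [← monomial_zero_left, shiftPoly_monomial]; simp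

theorem shiftPoly_X_mul (p : A[X]) : shiftPoly (X * p) = X * shiftPoly p + C X * shiftPoly p := by
  induction p using Polynomial.induction_on' with
  | add p q hp hq => simp only [mul_add, map_add, hp, hq]; abel
  | monomial n a =>
    rw [X_mul_monomial, shiftPoly_monomial, shiftPoly_monomial, pow_succ', mul_assoc, add_mul]

/-- The sum `∑ λⁱ F(pᵢ)` for a polynomial `∑ λⁱ pᵢ`. -/
def innerSum (F : A →ₗ[ℂ] B[X][X]) : A[X] →ₗ[ℂ] B[X][X] :=
  Polynomial.lsum fun n => LinearMap.mulLeft ℂ ((C X : B[X][X]) ^ n) ∘ₗ F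

theorem innerSum_apply (F : A →ₗ[ℂ] B[X][X]) (p : A[X]) :
    innerSum F p = ∑ n ∈ p.support, C X ^ n * F (p.coeff n) := by
  simp [innerSum, Polynomial.lsum_apply, Polynomial.sum_def]

theorem innerSum_monomial (F : A →ₗ[ℂ] B[X][X]) (n : ℕ) (a : A) :
    innerSum F (monomial n a) = C X ^ n * F a := by
  simp only [innerSum, Polynomial.lsum_apply]
  rw [Polynomial.sum_monomial_index _ _ (by simp)]
  simp

theorem innerSum_C (F : A →ₗ[ℂ] B[X][X]) (a : A) : innerSum F (C a) = F a := by
  rw [← monomial_zero_left, innerSum_monomial]; simp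

theorem innerSum_X_mul (F : A →ₗ[ℂ] B[X][X]) (p : A[X]) :
    innerSum F (X * p) = C X * innerSum F p := by
  induction p using Polynomial.induction_on' with
  | add p q hp hq => simp only [mul_add, map_add, hp, hq]
  | monomial n a =>
    rw [X_mul_monomial, innerSum_monomial, innerSum_monomial, pow_succ', mul_assoc]

/-- The exchange of the two variables. -/
def swapPoly : A[X][X] →ₗ[ℂ] A[X][X] :=
  Polynomial.lsum fun n => mapLin ((Polynomial.monomial n).restrictScalars ℂ)

theorem coeff_swapPoly (p : A[X][X]) (m n : ℕ) :
    ((swapPoly p).coeff m).coeff n = (p.coeff n).coeff m := by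
  induction p using Polynomial.induction_on' with
  | add p q hp hq => simp [hp, hq]
  | monomial k a =>
    simp only [swapPoly, Polynomial.lsum_apply]
    rw [Polynomial.sum_monomial_index _ _ (by simp), coeff_mapLin]
    simp only [LinearMap.restrictScalars_apply, coeff_monomial]
    split_ifs <;> simp

theorem swapPoly_swapPoly (p : A[X][X]) : swapPoly (swapPoly p) = p := by
  ext m n; rw [coeff_swapPoly, coeff_swapPoly]

theorem swapPoly_X_mul (p : A[X][X]) : swapPoly (X * p) = C X * swapPoly p := by
  ext m n
  rw [coeff_swapPoly, coeff_C_mul]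
  cases n <;> simp [coeff_swapPoly]

theorem swapPoly_C_X_mul (p : A[X][X]) : swapPoly (C X * p) = X * swapPoly p := by
  rw [← swapPoly_swapPoly (X * swapPoly p), swapPoly_X_mul, swapPoly_swapPoly]

theorem swapPoly_C_C (a : A) : swapPoly (C (C a)) = C (C a) := by
  ext m n
  rw [coeff_swapPoly, coeff_C, coeff_C]
  split_ifs with h1 h2 h2 <;> simp [coeff_C, h1, h2]

theorem swapPoly_shiftPoly (p : A[X]) : swapPoly (shiftPoly p) = shiftPoly p := by
  induction p using poly_induction with
  | hC a => rw [shiftPoly_C, swapPoly_C_C]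
  | hX p hp => rw [shiftPoly_X_mul, map_add, swapPoly_X_mul, swapPoly_C_X_mul, hp, add_comm]
  | hadd p q hp hq => simp only [map_add, hp, hq]

/-- Needed for {b_μ {a_λ c}}: it brings this term to the form of a sum ∑ λⁱ(…)(μ), to which the
substitution for μ can be applied term by term. -/
theorem swapPoly_mapLin (F : A →ₗ[ℂ] B[X]) (p : A[X]) :
    swapPoly (mapLin F p) = innerSum (liftPoly ∘ₗ F) p := by
  induction p using poly_induction with
  | hC a =>
    rw [mapLin_C, innerSum_C]
    ext m n
    rw [coeff_swapPoly, LinearMap.comp_apply, coeff_liftPoly, coeff_C, coeff_C]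
    split_ifs <;> simp
  | hX p hp => rw [mapLin_X_mul, swapPoly_X_mul, hp, innerSum_X_mul]
  | hadd p q hp hq => simp only [map_add, hp, hq]

theorem lamAdd_inner_X_mul (T : A →ₗ[ℂ] A) (p : A[X][X]) :
    lamAdd (lamAdd T) (C X * p) = C X * lamAdd (lamAdd T) p := by
  ext1 n
  cases n <;> simp only [coeff_lamAdd_zero, coeff_lamAdd_succ, coeff_C_mul, lamAdd_X_mul, mul_add]

theorem skewSubst_inner_X_mul (T : A →ₗ[ℂ] A) (p : A[X][X]) :
    skewSubst (lamAdd T) (C X * p) = C X * skewSubst (lamAdd T) p := by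
  induction p using poly_induction with
  | hC a => rw [← C_mul, skewSubst_C, skewSubst_C, ← C_mul]
  | hX p hp =>
    rw [← mul_assoc, ← X_mul_C, mul_assoc, skewSubst_X_mul, hp, skewSubst_X_mul, lamAdd_inner_X_mul]
    exact (mul_neg _ _).symm
  | hadd p q hp hq => simp only [mul_add, map_add, hp, hq]

theorem lamAdd_liftPoly (T : A →ₗ[ℂ] A) (p : A[X]) :
    lamAdd (lamAdd T) (liftPoly p) = liftPoly (lamAdd T p) + C X * liftPoly p := by
  ext1 n
  cases n <;> simp only [coeff_lamAdd_zero, coeff_lamAdd_succ, coeff_liftPoly, coeff_add,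
    coeff_C_mul, lamAdd_C, C_add] <;> abel

/-- `p(λ + ν)` at `ν = -λ - μ - ∂'` is `p(-μ - ∂)`, where `∂' = λ + ∂` acts on `A[λ]`. -/
theorem skewSubst_shiftPoly (T : A →ₗ[ℂ] A) (p : A[X]) :
    skewSubst (lamAdd T) (shiftPoly p) = liftPoly (skewSubst T p) := by
  induction p using poly_induction with
  | hC a => rw [shiftPoly_C, skewSubst_C, skewSubst_C, liftPoly_C]
  | hX p hp =>
    rw [shiftPoly_X_mul, map_add, skewSubst_X_mul, skewSubst_inner_X_mul, hp, skewSubst_X_mul,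
      lamAdd_liftPoly, map_neg]
    abel
  | hadd p q hp hq => simp only [map_add, hp, hq]

/-- The previous identity read backwards, as `skewSubst T` and `skewSubst (lamAdd T)` are both
involutions. -/
theorem skewSubst_liftPoly (T : A →ₗ[ℂ] A) (p : A[X]) :
    skewSubst (lamAdd T) (liftPoly p) = shiftPoly (skewSubst T p) := by
  have h := skewSubst_shiftPoly T (skewSubst T p)
  have h2 := skewSubst_skewSubst (lamAdd T) (shiftPoly (skewSubst T p))
  rw [h] at h2
  have h3 : skewSubst T (skewSubst T p) = p := skewSubst_skewSubst T p
  generalize skewSubst T (skewSubst T p) = q at h2 h3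
  subst h3
  exact h2

theorem skewSubst_innerSum (T : A →ₗ[ℂ] A) (F : B →ₗ[ℂ] A[X][X]) (p : B[X]) :
    skewSubst (lamAdd T) (innerSum F p) = innerSum ((skewSubst (lamAdd T)).comp F) p := by
  induction p using poly_induction with
  | hC a => rw [innerSum_C, innerSum_C, LinearMap.comp_apply]
  | hX p hp =>
    have h1 := innerSum_X_mul F p
    have h2 := innerSum_X_mul ((skewSubst (lamAdd T)).comp F) p
    rw [h1, h2, ← hp]
    exact skewSubst_inner_X_mul T _
  | hadd p q hp hq => simp only [map_add, hp, hq]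

/-- Binomial theorem: only ν^{m+n} contributes to λᵐμⁿ. -/
theorem coeff_shiftPoly (p : A[X]) (n m : ℕ) :
    ((shiftPoly p).coeff n).coeff m = (m + n).choose n • p.coeff (m + n) := by
  induction p using Polynomial.induction_on' with
  | add p q hp hq => simp [hp, hq]
  | monomial k a =>
    have hc : ((X : A[X]) ^ (k - n) * ((k.choose n : ℕ) : A[X])).coeff m
        = if m = k - n then ((k.choose n : ℕ) : A) else 0 := by
      rw [← C_eq_natCast, coeff_mul_C, coeff_X_pow, ite_mul, one_mul, zero_mul]
    rw [shiftPoly_monomial, coeff_mul_C, coeff_mul_C, Polynomial.coeff_X_add_C_pow, hc,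
      coeff_monomial]
    by_cases hk : k = m + n
    · subst hk
      rw [if_pos (by omega), if_pos rfl, nsmul_eq_mul]
    · rw [if_neg hk, smul_zero]
      split_ifs with hm
      · rw [Nat.choose_eq_zero_of_lt (by omega : k < n), Nat.cast_zero, zero_mul]
      · rw [zero_mul]

/-- This is the last sum in the coefficientwise Jacobi identity: λⁱ times a polynomial contributes
to λᵐ only for i ≤ m. -/
theorem coeff_innerSum_shiftPoly (F : A →ₗ[ℂ] B[X]) (p : A[X]) (n m : ℕ) :
    ((innerSum (shiftPoly ∘ₗ F) p).coeff n).coeff m =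
      ∑ i ∈ Finset.range (m + 1), (m - i + n).choose n • (F (p.coeff i)).coeff (m - i + n) := by
  rw [innerSum_apply, finsetSum_coeff, finsetSum_coeff]
  simp only [coeff_C_X_pow_mul, LinearMap.comp_apply, coeff_shiftPoly]
  rw [← Finset.sum_filter]
  -- The indices i ≤ m outside the support have coefficient 0.
  refine Finset.sum_subset_zero_on_sdiff (fun i hi => ?_) (fun i hi => ?_) (fun i _ => rfl)
  · simp only [Finset.mem_filter] at hi
    simpa using Nat.lt_succ_of_le hi.2
  · simp only [Finset.mem_sdiff, Finset.mem_filter, Finset.mem_range, mem_support_iff] at hi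
    have : p.coeff i = 0 := by
      by_contra h
      exact hi.2 ⟨h, by omega⟩
    simp [this]

end PolynomialOperators


/-! ### Parity and supercommutativity of S(R) -/

section Parity

variable {W₀ W₁ : Type*} [AddCommGroup W₀] [Module ℂ W₀] [AddCommGroup W₁] [Module ℂ W₁]

theorem gen_zero_apply (w : W₀ × W₁) : gen 0 w = (ι ((1 : ℂ[X]) ⊗ₜ w) : S W₀ W₁) := by
  simp [gen]

theorem del_ι (p : ℂ[X]) (w : W₀ × W₁) :
    del (ι (p ⊗ₜ w) : S W₀ W₁) = ι ((X * p) ⊗ₜ w) := by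
  simp [del, superDeriv_ι]

theorem del_algebraMap (r : ℂ) : del (algebraMap ℂ (S W₀ W₁) r) = 0 := by
  simp [del, superDeriv_apply, derivPart_algebraMap]

/-- Induction on elements of `S(R)`, from the generators that involve no derivative. -/
theorem S.induction_del {P : S W₀ W₁ → Prop} (hc : ∀ r : ℂ, P (algebraMap ℂ _ r))
    (h₀ : ∀ a, P (gen 0 (a, 0))) (h₁ : ∀ b, P (gen 0 (0, b))) (hdel : ∀ a, P a → P (del a))
    (hmul : ∀ a b, P a → P b → P (a * b)) (hadd : ∀ a b, P a → P b → P (a + b)) (a : S W₀ W₁) :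
    P a := by
  induction a using S.induction with
  | hc r => exact hc r
  | hmul a b ha hb => exact hmul a b ha hb
  | hadd a b ha hb => exact hadd a b ha hb
  | hι v =>
    induction v using TensorProduct.induction_on with
    | zero => simpa using hc 0
    | add a b ha hb => rw [map_add]; exact hadd _ _ ha hb
    | tmul p w =>
      induction p using Polynomial.induction_on' with
      | add p q hp hq => rw [TensorProduct.add_tmul, map_add]; exact hadd _ _ hp hq
      | monomial n r =>
        have h : ∀ n : ℕ, P (ι ((X ^ n : ℂ[X]) ⊗ₜ w)) := by
          intro n
          induction n with
          | zero =>
            rw [pow_zero, ← gen_zero_apply]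
            have hw : w = (w.1, 0) + (0, w.2) := by simp
            rw [hw, map_add]
            exact hadd _ _ (h₀ _) (h₁ _)
          | succ n ih => rw [pow_succ', ← del_ι]; exact hdel _ ih
        rw [← Polynomial.C_mul_X_pow_eq_monomial, ← Polynomial.smul_eq_C_mul,
          ← TensorProduct.smul_tmul', map_smul, Algebra.smul_def]
        exact hmul _ _ (hc r) (h n)

/-- `a` has parity `o`, where `true` means odd. -/
def HasPar (o : Bool) (a : S W₀ W₁) : Prop := σ a = sign o • a

/-- The component of parity `o`. -/
def part (o : Bool) : S W₀ W₁ →ₗ[ℂ] S W₀ W₁ :=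
  (1 / 2 : ℂ) • (LinearMap.id + sign o • σ.toLinearMap)

theorem part_apply (o : Bool) (a : S W₀ W₁) : part o a = (1 / 2 : ℂ) • (a + sign o • σ a) := rfl

theorem part_add_part (a : S W₀ W₁) : part false a + part true a = a := by
  rw [part_apply, part_apply, ← smul_add]
  have : a + sign false • σ a + (a + sign true • σ a) = (2 : ℂ) • a := by
    simp only [sign, cond_true, cond_false, one_smul, neg_smul, two_smul]; abel
  rw [this, smul_smul]; norm_num

theorem part_sub_part (a : S W₀ W₁) : part false a - part true a = σ a := by
  rw [part_apply, part_apply, ← smul_sub]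
  have : a + sign false • σ a - (a + sign true • σ a) = (2 : ℂ) • σ a := by
    simp only [sign, cond_true, cond_false, one_smul, neg_smul, two_smul]; abel
  rw [this, smul_smul]; norm_num

theorem hasPar_part (o : Bool) (a : S W₀ W₁) : HasPar o (part o a) := by
  rw [HasPar, part_apply, map_smul, map_add, map_smul, σ_σ,
    smul_comm (sign o) (1 / 2 : ℂ) (a + sign o • σ a), smul_add (sign o), smul_smul (sign o), sign_mul_sign, one_smul, add_comm]

theorem part_of_hasPar {o : Bool} {a : S W₀ W₁} (h : HasPar o a) : part o a = a := by
  rw [part_apply, h, smul_smul, sign_mul_sign, one_smul, ← two_smul ℂ a, smul_smul]; norm_num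

theorem hasPar_false {a : S W₀ W₁} : HasPar false a ↔ σ a = a := by simp [HasPar, sign]

theorem hasPar_true {a : S W₀ W₁} : HasPar true a ↔ σ a = -a := by simp [HasPar, sign]

theorem HasPar.mul {o o' : Bool} {a b : S W₀ W₁} (ha : HasPar o a) (hb : HasPar o' b) :
    HasPar (xor o o') (a * b) := by
  rw [HasPar] at *
  rw [map_mul, ha, hb]
  cases o <;> cases o' <;> simp [sign]

theorem HasPar.add {o : Bool} {a b : S W₀ W₁} (ha : HasPar o a) (hb : HasPar o b) :
    HasPar o (a + b) := by
  rw [HasPar] at *; rw [map_add, ha, hb, smul_add]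

theorem HasPar.del {o : Bool} {a : S W₀ W₁} (ha : HasPar o a) : HasPar o (del a) := by
  rw [HasPar] at *; rw [σ_del, ha, map_smul]

theorem hasPar_algebraMap (r : ℂ) : HasPar false (algebraMap ℂ (S W₀ W₁) r) := by
  rw [hasPar_false, AlgHom.commutes]

theorem hasPar_gen_even (a : W₀) : HasPar false (gen 0 (a, 0) : S W₀ W₁) := by
  rw [hasPar_false, gen_zero_apply, σ_ι, sgn_even]

theorem hasPar_gen_odd (b : W₁) : HasPar true (gen 0 (0, b) : S W₀ W₁) := by
  rw [hasPar_true, gen_zero_apply, σ_ι, sgn_odd, map_neg]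

/-- With a = a₀ + a₁ and σ a = a₀ - a₁, the combination ab ± σ(a)σ(b) keeps exactly the products of
the right total parity. -/
theorem part_mul (o : Bool) (a b : S W₀ W₁) :
    part o (a * b) = part false a * part o b + part true a * part (!o) b := by
  have h := (congrArg₂ (· * ·) (part_add_part a) (part_add_part b)).symm
  have h2 := (congrArg₂ (· * ·) (part_sub_part a) (part_sub_part b)).symm
  rw [part_apply, map_mul, h, h2]
  have e : ∀ x y z t : S W₀ W₁, ((x + y) * (z + t) + (x - y) * (z - t))
      = (2 : ℂ) • (x * z + y * t) := by
    intro x y z t; rw [two_smul]; noncomm_ring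
  have e' : ∀ x y z t : S W₀ W₁, ((x + y) * (z + t) - (x - y) * (z - t))
      = (2 : ℂ) • (x * t + y * z) := by
    intro x y z t; rw [two_smul]; noncomm_ring
  cases o
  · simp only [sign, cond_false, one_smul, Bool.not_false, e, smul_smul]; norm_num
  · simp only [sign, cond_true, neg_smul, one_smul, Bool.not_true, ← sub_eq_add_neg, e', smul_smul]
    norm_num

/-- Induction on homogeneous elements. -/
theorem HasPar.induction {P : Bool → S W₀ W₁ → Prop} (hc : ∀ r : ℂ, P false (algebraMap ℂ _ r))
    (h₀ : ∀ a, P false (gen 0 (a, 0))) (h₁ : ∀ b, P true (gen 0 (0, b)))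
    (hdel : ∀ o a, HasPar o a → P o a → P o (ClassicalW.del a))
    (hmul : ∀ o o' a b, HasPar o a → HasPar o' b → P o a → P o' b → P (xor o o') (a * b))
    (hadd : ∀ o a b, HasPar o a → HasPar o b → P o a → P o b → P o (a + b)) {o : Bool}
    {a : S W₀ W₁} (ha : HasPar o a) : P o a := by
  -- The induction runs over arbitrary elements, with the claim for both parity components at once;
  -- a homogeneous element is its own component.
  suffices h : ∀ o, P o (part o a) by
    have := h o
    rwa [part_of_hasPar ha] at this
  -- Zero is of both parities, so both cases are needed; the odd one comes from the odd generator
  -- with label 0.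
  have hz : ∀ o, P o (0 : S W₀ W₁) := by
    intro o
    cases o
    · simpa using hc 0
    · have h := h₁ 0
      rwa [show ((0 : W₀), (0 : W₁)) = 0 from rfl, map_zero] at h
  have hn : ∀ (o o' : Bool) (x : S W₀ W₁), HasPar o' x → o ≠ o' → part o x = 0 := by
    intro o o' x hx ho
    have : sign o * sign o' = -1 := by cases o <;> cases o' <;> simp_all [sign]
    rw [part_apply, hx, smul_smul, this, neg_one_smul, add_neg_cancel, smul_zero]
  have hh : ∀ (o' : Bool) (x : S W₀ W₁), HasPar o' x → P o' x → ∀ o, P o (part o x) := by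
    intro o' x hx hp o
    by_cases ho : o = o'
    · subst ho; rwa [part_of_hasPar hx]
    · rw [hn o o' x hx ho]; exact hz o
  clear ha
  induction a using S.induction_del with
  | hc r => exact hh _ _ (hasPar_algebraMap r) (hc r)
  | h₀ a => exact hh _ _ (hasPar_gen_even a) (h₀ a)
  | h₁ b => exact hh _ _ (hasPar_gen_odd b) (h₁ b)
  | hdel a ih =>
    intro o
    have : part o (ClassicalW.del a) = ClassicalW.del (part o a) := by
      rw [part_apply, part_apply, σ_del, map_smul, map_add, map_smul]
    rw [this]
    exact hdel _ _ (hasPar_part o a) (ih o)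
  | hadd a b ha hb =>
    intro o; rw [map_add]; exact hadd _ _ _ (hasPar_part _ _) (hasPar_part _ _) (ha o) (hb o)
  | hmul a b ha hb =>
    intro o
    rw [part_mul]
    have e1 : xor false o = o := by simp
    have e2 : xor true (!o) = o := by cases o <;> rfl
    have h1 := hmul _ _ _ _ (hasPar_part false a) (hasPar_part o b) (ha false) (hb o)
    have h2 := hmul _ _ _ _ (hasPar_part true a) (hasPar_part (!o) b) (ha true) (hb (!o))
    have p1 := (hasPar_part false a).mul (hasPar_part o b)
    have p2 := (hasPar_part true a).mul (hasPar_part (!o) b)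
    rw [e1] at h1 p1
    rw [e2] at h2 p2
    exact hadd _ _ _ p1 p2 h1 h2

theorem twist_twist (o o' : Bool) (a : S W₀ W₁) : twist o (twist o' a) = twist (xor o o') a := by
  cases o <;> cases o' <;> simp [twist, σ_σ]

theorem twist_self (o : Bool) (a : S W₀ W₁) : twist o (twist o a) = a := by
  rw [twist_twist]; simp [twist]

theorem twist_of_hasPar {o : Bool} {a : S W₀ W₁} (h : HasPar o a) (o' : Bool) :
    twist o' a = sign (o' && o) • a := by
  cases o'
  · simp [twist, sign]
  · have h' : σ a = sign o • a := h
    simpa [twist] using h'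

theorem twist_del (o : Bool) (a : S W₀ W₁) : twist o (del a) = del (twist o a) := by
  cases o <;> simp [twist, σ_del]

/-- Supercommutativity of `S(R)`. -/
theorem HasPar.mul_comm {o : Bool} {x : S W₀ W₁} (hx : HasPar o x) (y : S W₀ W₁) :
    x * y = twist o y * x := by
  -- The claim for all parity components is stable under products, so that only elements of R
  -- remain.
  suffices H : ∀ (v : ℂ[X] ⊗[ℂ] (W₀ × W₁)) o, ∀ y : S W₀ W₁,
      part o (ι v) * y = twist o y * part o (ι v) by
    suffices H2 : ∀ x : S W₀ W₁, ∀ o, ∀ y, part o x * y = twist o y * part o x by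
      have := H2 x o y
      rwa [part_of_hasPar hx] at this
    clear hx
    intro x
    induction x using S.induction with
    | hc r =>
      intro o y
      have := hasPar_algebraMap (W₀ := W₀) (W₁ := W₁) r
      cases o
      · rw [part_of_hasPar this]; exact Algebra.commutes r y
      · rw [part_apply, AlgHom.commutes]; simp [sign]
    | hι v => exact H v
    | hmul a b ha hb =>
      intro o y
      rw [part_mul, add_mul, mul_add, mul_assoc, mul_assoc, hb, hb, ← mul_assoc, ← mul_assoc, ha,
        ha, mul_assoc, mul_assoc, twist_twist, twist_twist]
      cases o <;> simp
    | hadd a b ha hb => intro o y; rw [map_add, add_mul, mul_add, ha, hb]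
  intro v o y
  induction v using TensorProduct.induction_on with
  | zero => simp
  | add a b ha hb => rw [map_add, map_add, add_mul, mul_add, ha, hb]
  | tmul p w =>
    obtain ⟨w₀, w₁⟩ := w
    have hw : (w₀, w₁) = ((w₀, 0) : W₀ × W₁) + (0, w₁) := by simp
    rw [hw, TensorProduct.tmul_add, map_add, map_add, add_mul, mul_add]
    rw [part_apply, part_apply, σ_ι, σ_ι, sgn_even, sgn_odd, map_neg]
    cases o
    · simp only [sign, cond_false, one_smul, add_neg_cancel, smul_zero, zero_mul, mul_zero,
        add_zero, smul_mul_assoc, mul_smul_comm, add_mul, mul_add, even_mul, twist, AlgHom.id_apply]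
    · simp only [sign, cond_true, neg_smul, one_smul, add_neg_cancel, smul_zero, zero_mul, mul_zero,
        zero_add, neg_neg, smul_mul_assoc, mul_smul_comm, add_mul, mul_add, odd_mul, twist]

end Parity

/-! ### Sesquilinearity, Leibniz rules and skewsymmetry of the bracket on S(R) -/

section FreeBracket

variable {W₀ W₁ : Type*} [AddCommGroup W₀] [Module ℂ W₀] [AddCommGroup W₁] [Module ℂ W₁]
variable {β : W₀ × W₁ →ₗ[ℂ] W₀ × W₁ →ₗ[ℂ] (S W₀ W₁)[X]}

/-- The Leibniz rule for a homogeneous first argument. -/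
theorem br_mul (hβ : IsEven β) {o : Bool} {a : S W₀ W₁} (ha : HasPar o a) (b c : S W₀ W₁) :
    (freeData β).br a (b * c)
      = C (twist o b) * (freeData β).br a c + (freeData β).br a b * C c := by
  cases o
  · exact even_leibniz hβ (hasPar_false.1 ha) b c
  · exact odd_leibniz hβ (hasPar_true.1 ha) b c

/-- The Leibniz rule for a homogeneous left factor. -/
theorem br_mul_left (hβ : IsEven β) {o : Bool} {b : S W₀ W₁} (hb : HasPar o b) (a c : S W₀ W₁) :
    (freeData β).br a (b * c)
      = C b * (freeData β).br (twist o a) c + (freeData β).br a b * C c := by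
  have h0 := br_mul hβ (hasPar_part false a) b c
  have h1 := br_mul hβ (hasPar_part true a) b c
  have ht : twist o a = part false a + sign o • part true a := by
    cases o
    · simp [twist, sign, part_add_part]
    · simp [twist, sign, ← part_sub_part, sub_eq_add_neg]
  rw [twist_of_hasPar hb] at h0 h1
  have e := congrArg (fun x => (freeData β).br x (b * c)) (part_add_part a)
  have e2 := congrArg (fun x => (freeData β).br x b) (part_add_part a)
  simp only [map_add, LinearMap.add_apply] at e e2
  have s1 : sign (false && o) = 1 := by simp [sign]
  have s2 : sign (true && o) = sign o := by simp
  rw [← e, h0, h1, ht, ← e2, s1, s2, one_smul, ← Polynomial.smul_C, LinearMap.map_add,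
    LinearMap.map_smul, LinearMap.add_apply, LinearMap.smul_apply, smul_mul_assoc, mul_add,
    mul_smul_comm, add_mul]
  abel

/-- λ + ∂ is a derivation over ∂, so both sides obey the same Leibniz rule and need to be compared
on R only. -/
theorem superDeriv_del (T : ℂ[X] ⊗[ℂ] (W₀ × W₁) →ₗ[ℂ] (S W₀ W₁)[X])
    (hT : ∀ p w, T ((X * p) ⊗ₜ w) = lamAdd del (T (p ⊗ₜ w))) (a : S W₀ W₁) :
    superDeriv T (del a) = lamAdd del (superDeriv T a) := by
  have h : ∀ o, derivPart o T (del a) = lamAdd del (derivPart o T a) := by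
    intro o
    induction a using S.induction with
    | hc r => rw [del_algebraMap, map_zero, derivPart_algebraMap, map_zero]
    | hι v =>
      induction v using TensorProduct.induction_on with
      | zero => simp
      | add a b ha hb => simp only [map_add, ha, hb]
      | tmul p w =>
        have e : ∀ q : ℂ[X], sgn (q ⊗ₜ[ℂ] w) = q ⊗ₜ[ℂ] ((w.1, -w.2) : W₀ × W₁) := by simp [sgn]
        rw [del_ι, derivPart_ι, derivPart_ι, parityPart_apply, parityPart_apply, e, e, hT, hT,
          σX_lamAdd, map_smul, map_add, map_smul]
    | hmul a b ha hb =>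
      rw [del_mul, map_add, derivPart_mul, derivPart_mul, derivPart_mul, ha, hb, map_add,
        lamAdd_C_mul _ del_mul, lamAdd_mul_C _ del_mul, twist_del]
      abel
    | hadd a b ha hb => simp only [map_add, ha, hb]
  rw [superDeriv_apply, superDeriv_apply, h, h, map_add]

theorem superDeriv_X_mul (T : ℂ[X] ⊗[ℂ] (W₀ × W₁) →ₗ[ℂ] (S W₀ W₁)[X]) (a : S W₀ W₁) :
    superDeriv (LinearMap.mulLeft ℂ (X : (S W₀ W₁)[X]) ∘ₗ T) a = X * superDeriv T a := by
  have h : ∀ o, derivPart o (LinearMap.mulLeft ℂ (X : (S W₀ W₁)[X]) ∘ₗ T) a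
      = X * derivPart o T a := by
    intro o
    induction a using S.induction with
    | hc r => rw [derivPart_algebraMap, derivPart_algebraMap, mul_zero]
    | hι v =>
      have hX : σX (X : (S W₀ W₁)[X]) = X := by simp [σX]
      rw [derivPart_ι, derivPart_ι, parityPart_apply, parityPart_apply]
      simp only [LinearMap.comp_apply, LinearMap.mulLeft_apply, map_mul, hX, mul_smul_comm, mul_add]
    | hmul a b ha hb =>
      rw [derivPart_mul, derivPart_mul, ha, hb, mul_add, ← mul_assoc, ← mul_assoc, ← mul_assoc,
        X_mul_C]
    | hadd a b ha hb => simp only [map_add, ha, hb, mul_add]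
  rw [superDeriv_apply, superDeriv_apply, h, h, mul_add]

theorem sesq_X_left (p : ℂ[X]) (w : W₀ × W₁) :
    sesq β ((X * p) ⊗ₜ w) = -(LinearMap.mulLeft ℂ (X : (S W₀ W₁)[X]) ∘ₗ sesq β (p ⊗ₜ w)) := by
  refine LinearMap.ext fun v => ?_
  simp only [sesq, polyExt_tmul, map_mul, aeval_X, Module.End.mul_apply]
  rfl

theorem sesq_X_right (v : ℂ[X] ⊗[ℂ] (W₀ × W₁)) (p : ℂ[X]) (w : W₀ × W₁) :
    sesq β v ((X * p) ⊗ₜ w) = lamAdd del (sesq β v (p ⊗ₜ w)) := by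
  induction v using TensorProduct.induction_on with
  | zero => simp
  | add a b ha hb => simp only [map_add, LinearMap.add_apply, ha, hb]
  | tmul q u =>
    induction q using Polynomial.induction_on' with
    | add p q hp hq => simp only [TensorProduct.add_tmul, map_add, LinearMap.add_apply, hp, hq]
    | monomial n r =>
      have h : ∀ n : ℕ, sesq β ((X ^ n : ℂ[X]) ⊗ₜ u) ((X * p) ⊗ₜ w)
          = lamAdd del (sesq β ((X ^ n : ℂ[X]) ⊗ₜ u) (p ⊗ₜ w)) := by
        intro n
        induction n with
        | zero => simp [sesq, polyExt_tmul]
        | succ n ih =>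
          rw [pow_succ', sesq_X_left, LinearMap.neg_apply, LinearMap.comp_apply,
            LinearMap.neg_apply, LinearMap.comp_apply, ih, LinearMap.mulLeft_apply,
            LinearMap.mulLeft_apply, map_neg, lamAdd_X_mul]
      rw [← Polynomial.C_mul_X_pow_eq_monomial, ← Polynomial.smul_eq_C_mul,
        ← TensorProduct.smul_tmul', map_smul, LinearMap.smul_apply, LinearMap.smul_apply, h,
        map_smul]

theorem sesq_one (v w : W₀ × W₁) : sesq β ((1 : ℂ[X]) ⊗ₜ v) ((1 : ℂ[X]) ⊗ₜ w) = β v w := by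
  simp [sesq, polyExt_tmul]

theorem brLeft_del (v : ℂ[X] ⊗[ℂ] (W₀ × W₁)) (a : S W₀ W₁) :
    brLeft β v (del a) = lamAdd del (brLeft β v a) :=
  superDeriv_del _ (sesq_X_right v) a

theorem brLeft_X (p : ℂ[X]) (w : W₀ × W₁) (a : S W₀ W₁) :
    brLeft β ((X * p) ⊗ₜ w) a = -(X * brLeft β (p ⊗ₜ w) a) := by
  simp only [brLeft, LinearMap.comp_apply, sesq_X_left, map_neg, LinearMap.neg_apply,
    superDeriv_X_mul]

theorem brRight_apply (f : S W₀ W₁) (v : ℂ[X] ⊗[ℂ] (W₀ × W₁)) :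
    brRight β f v = -(skewSubst del (brLeft β ((1 / 2 : ℂ) • (v + sgn v)) f
      + brLeft β ((1 / 2 : ℂ) • (v - sgn v)) (σ f))) := rfl

theorem brRight_even (f : S W₀ W₁) (p : ℂ[X]) (a : W₀) :
    brRight β f (p ⊗ₜ (a, 0)) = -(skewSubst del (brLeft β (p ⊗ₜ (a, 0)) f)) := by
  rw [brRight_apply, sgn_even, sub_self, smul_zero, ← two_smul ℂ, smul_smul]; simp

theorem brRight_odd (f : S W₀ W₁) (p : ℂ[X]) (b : W₁) :
    brRight β f (p ⊗ₜ (0, b)) = -(skewSubst del (brLeft β (p ⊗ₜ (0, b)) (σ f))) := by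
  rw [brRight_apply, sgn_odd, add_neg_cancel, smul_zero, sub_neg_eq_add, ← two_smul ℂ, smul_smul]
  simp

theorem brRight_X (f : S W₀ W₁) (p : ℂ[X]) (w : W₀ × W₁) :
    brRight β f ((X * p) ⊗ₜ w) = lamAdd del (brRight β f (p ⊗ₜ w)) := by
  obtain ⟨w₀, w₁⟩ := w
  have hw : (w₀, w₁) = ((w₀, 0) : W₀ × W₁) + (0, w₁) := by simp
  rw [hw, TensorProduct.tmul_add, TensorProduct.tmul_add, map_add, map_add, map_add,
    brRight_even, brRight_even, brRight_odd, brRight_odd, brLeft_X, brLeft_X]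
  simp only [map_neg, skewSubst_X_mul, neg_neg]

theorem brRight_del (f : S W₀ W₁) (v : ℂ[X] ⊗[ℂ] (W₀ × W₁)) :
    brRight β (del f) v = -(X * brRight β f v) := by
  rw [brRight_apply, brRight_apply, σ_del, brLeft_del, brLeft_del, ← map_add, skewSubst_lamAdd,
    mul_neg]

theorem br_del_right (a b : S W₀ W₁) :
    (freeData β).br a (del b) = lamAdd del ((freeData β).br a b) :=
  superDeriv_del _ (brRight_X a) b

theorem br_del_left (a b : S W₀ W₁) :
    (freeData β).br (del a) b = -(X * (freeData β).br a b) := by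
  have h : brRight β (del a) = -(LinearMap.mulLeft ℂ (X : (S W₀ W₁)[X]) ∘ₗ brRight β a) :=
    LinearMap.ext fun v => brRight_del a v
  simp only [freeData, LinearMap.comp_apply, h, map_neg, LinearMap.neg_apply, superDeriv_X_mul]

theorem br_algebraMap_left (r : ℂ) (b : S W₀ W₁) :
    (freeData β).br (algebraMap ℂ _ r) b = 0 := by
  have h : brRight β (algebraMap ℂ _ r) = 0 := by
    refine LinearMap.ext fun v => ?_
    rw [brRight_apply, AlgHom.commutes]
    simp [brLeft, superDeriv_apply, derivPart_algebraMap]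
  simp only [freeData, LinearMap.comp_apply, h, map_zero, LinearMap.zero_apply]

/-- The bracket of the generators is skewsymmetric. -/
structure IsSkew (β : W₀ × W₁ →ₗ[ℂ] W₀ × W₁ →ₗ[ℂ] (S W₀ W₁)[X]) : Prop where
  even : ∀ a w, β (a, 0) w = -skewSubst del (β w (a, 0))
  odd : ∀ b w, β (0, b) w = -skewSubst del (β (w.1, -w.2) (0, b))

/-- ℂ[∂] ⊗ W is generated by W over ℂ[∂], and both maps intertwine ∂ with U. -/
theorem linearMap_ext_of_X {M : Type*} [AddCommGroup M] [Module ℂ M]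
    {T T' : ℂ[X] ⊗[ℂ] (W₀ × W₁) →ₗ[ℂ] M} (U : M →ₗ[ℂ] M)
    (hT : ∀ p w, T ((X * p) ⊗ₜ w) = U (T (p ⊗ₜ w)))
    (hT' : ∀ p w, T' ((X * p) ⊗ₜ w) = U (T' (p ⊗ₜ w)))
    (h : ∀ w, T ((1 : ℂ[X]) ⊗ₜ w) = T' ((1 : ℂ[X]) ⊗ₜ w)) : T = T' := by
  refine TensorProduct.ext' fun p w => ?_
  induction p using Polynomial.induction_on' with
  | add p q hp hq => simp only [TensorProduct.add_tmul, map_add, hp, hq]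
  | monomial n r =>
    have h' : ∀ n : ℕ, T ((X ^ n : ℂ[X]) ⊗ₜ w) = T' ((X ^ n : ℂ[X]) ⊗ₜ w) := by
      intro n
      induction n with
      | zero => simpa using h w
      | succ n ih => rw [pow_succ', hT, hT', ih]
    rw [← Polynomial.C_mul_X_pow_eq_monomial, ← Polynomial.smul_eq_C_mul,
      ← TensorProduct.smul_tmul', map_smul, map_smul, h']

/-- `brRight` is defined from `brLeft` by skewsymmetry. Its agreement with the sesquilinear form on
generators is precisely the skewsymmetry of β. -/
theorem brRight_gen (hs : IsSkew β) (v : W₀ × W₁) :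
    brRight β (gen 0 v) = sesq β ((1 : ℂ[X]) ⊗ₜ v) := by
  refine linearMap_ext_of_X (lamAdd del) (brRight_X _) (sesq_X_right _) fun w => ?_
  obtain ⟨w₀, w₁⟩ := w
  have hw : (w₀, w₁) = ((w₀, 0) : W₀ × W₁) + (0, w₁) := by simp
  have hσ : σ (gen 0 v : S W₀ W₁) = gen 0 (v.1, -v.2) := by
    rw [gen_zero_apply, gen_zero_apply, σ_ι]; simp [sgn]
  rw [hw, TensorProduct.tmul_add, map_add, map_add, brRight_even, brRight_odd, sesq_one, sesq_one,
    hσ, gen_zero_apply, gen_zero_apply]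
  simp only [brLeft, LinearMap.comp_apply, superDeriv_ι, sesq_one]
  rw [hs.even, hs.odd]
  simp only [map_neg, skewSubst_skewSubst, neg_neg, Prod.mk.eta]

theorem br_gen (hs : IsSkew β) (v : W₀ × W₁) (b : S W₀ W₁) :
    (freeData β).br (gen 0 v) b = brLeft β ((1 : ℂ[X]) ⊗ₜ v) b := by
  simp only [freeData, LinearMap.comp_apply, brRight_gen hs, brLeft]

theorem br_gen_gen (hs : IsSkew β) (v w : W₀ × W₁) :
    (freeData β).br (gen 0 v) (gen 0 w) = β v w := by
  rw [br_gen hs, gen_zero_apply, brLeft, LinearMap.comp_apply, superDeriv_ι, sesq_one]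

/-- The definition of `brRight` unfolded: skewsymmetry holds by construction when the right argument
is a homogeneous generator. It is the start of both inductions in `br_skew`. -/
theorem br_gen_right (hs : IsSkew β) {o : Bool} {v : W₀ × W₁}
    (hv : o = false ∧ v.2 = 0 ∨ o = true ∧ v.1 = 0) (f : S W₀ W₁) :
    (freeData β).br f (gen 0 v) = -skewSubst del ((freeData β).br (gen 0 v) (twist o f)) := by
  rw [br_gen hs, freeData, LinearMap.comp_apply, gen_zero_apply, superDeriv_ι]
  obtain ⟨v₀, v₁⟩ := v
  rcases hv with ⟨rfl, h⟩ | ⟨rfl, h⟩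
  · simp only at h; subst h; rw [brRight_even]; rfl
  · simp only at h; subst h; rw [brRight_odd]; rfl

theorem par_br (hβ : IsEven β) (f g : S W₀ W₁) :
    σX ((freeData β).br f g) = (freeData β).br (σ f) (σ g) := by
  ext n; rw [coeff_σX]; exact par_freeData hβ f g n

theorem hasPar_gen {o : Bool} {v : W₀ × W₁} (hv : o = false ∧ v.2 = 0 ∨ o = true ∧ v.1 = 0) :
    HasPar o (gen 0 v : S W₀ W₁) := by
  obtain ⟨v₀, v₁⟩ := v
  rcases hv with ⟨rfl, h⟩ | ⟨rfl, h⟩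
  · simp only at h; subst h; exact hasPar_gen_even v₀
  · simp only at h; subst h; exact hasPar_gen_odd v₁

theorem rightL_lamAdd (T : (S W₀ W₁) →ₗ[ℂ] (S W₀ W₁)) (x : S W₀ W₁) (p : (S W₀ W₁)[X]) :
    rightL T x (lamAdd T p) = lamAdd T (rightL T x p) := by
  rw [rightL, rightL, skewSubst_lamAdd, mul_neg, map_neg, ← mul_assoc, ← X_mul_C, mul_assoc,
    skewSubst_X_mul, neg_neg]

theorem rightR_lamAdd (T : (S W₀ W₁) →ₗ[ℂ] (S W₀ W₁)) (x : S W₀ W₁) (p : (S W₀ W₁)[X]) :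
    rightR T x (lamAdd T p) = lamAdd T (rightR T x p) := by
  rw [rightR, rightR, skewSubst_lamAdd, neg_mul, map_neg, mul_assoc, skewSubst_X_mul, neg_neg]

/-- Skewsymmetry of the λ-bracket of `S(R)`. -/
theorem br_skew (hβ : IsEven β) (hs : IsSkew β) {o : Bool} {a : S W₀ W₁} (ha : HasPar o a) :
    ∀ b, (freeData β).br a b = -skewSubst del ((freeData β).br (twist o b) a) := by
  refine HasPar.induction (P := fun o a => ∀ b, (freeData β).br a b
    = -skewSubst del ((freeData β).br (twist o b) a)) ?_ ?_ ?_ ?_ ?_ ?_ ha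
  · intro r b; rw [br_algebraMap_left, br_algebraMap, map_zero, neg_zero]
  · intro a b
    rw [br_gen_right hs (o := false) (by simp), map_neg, neg_neg, skewSubst_skewSubst, twist_self]
  · intro a b
    rw [br_gen_right hs (o := true) (by simp), map_neg, neg_neg, skewSubst_skewSubst, twist_self]
  · intro o a _ ih b
    rw [br_del_left, ih, br_del_right, skewSubst_lamAdd, mul_neg]
  · intro p q x y hx hy ihx ihy
    -- The left Leibniz rule for {b_λ xy}, transported by λ ↦ -λ-∂ and combined with skewsymmetry
    -- for x and for y. It makes skewsymmetry for xy equivalent to the right Leibniz rule for {xy_λ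
    -- b}, which is proved by a second induction, on b.
    have step : ∀ b, rightL del x ((freeData β).br y b)
        + rightR del y ((freeData β).br x (twist q b))
        = -skewSubst del ((freeData β).br (twist (xor p q) b) (x * y)) := by
      intro b
      have e1 : twist p (twist (xor p q) b) = twist q b := by
        rw [twist_twist]; congr 1; cases p <;> cases q <;> rfl
      rw [br_mul_left hβ hx, e1, rightL, rightR, ihy b, ihx (twist q b), twist_twist]
      simp only [map_neg, skewSubst_skewSubst, map_add, mul_neg, neg_mul]
      abel
    intro b
    rw [← step]
    induction b using S.induction_del with
    | hc r =>
      have : twist q (algebraMap ℂ (S W₀ W₁) r) = algebraMap ℂ _ r := AlgHom.commutes _ r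
      rw [this, br_algebraMap, br_algebraMap, br_algebraMap]
      simp [rightL, rightR]
    -- For a generator b skewsymmetry of {xy_λ b} is already known, and `step` turns it into the
    -- right Leibniz rule.
    | h₀ w =>
      rw [step, br_gen_right hs (o := false) (by simp), twist_of_hasPar (hasPar_gen_even w)]
      simp [twist, sign]
    | h₁ w =>
      rw [step, br_gen_right hs (o := true) (by simp), twist_of_hasPar (hx.mul hy),
        twist_of_hasPar (hasPar_gen_odd w)]
      simp only [map_smul, LinearMap.smul_apply, Bool.and_true, Bool.true_and]
    | hdel a ih =>
      rw [br_del_right, br_del_right, twist_del, br_del_right, ih, rightL_lamAdd, rightR_lamAdd,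
        map_add]
    | hadd a b ha hb =>
      simp only [map_add, ha, hb, rightL_add, rightR_add]; abel
    | hmul b c hb hc =>
      -- `rightL del x` and `rightR del y` involve only derivatives of x and y, which have the
      -- parities of x and y; moving a factor past them costs the usual sign.
      have k1 : rightL del x (C (twist q b) * (freeData β).br y c)
          = C (twist (xor p q) b) * rightL del x ((freeData β).br y c) := by
        refine rightL_C_mul del del_mul _ _ (HasPar p) (fun _ h => h.del) (fun x hx => ?_) _ x hx
        rw [hx.mul_comm, twist_twist]
      have k2 : rightR del y ((freeData β).br x (twist q b) * C (twist q c))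
          = rightR del y ((freeData β).br x (twist q b)) * C c := by
        refine rightR_mul_C del del_mul _ _ (HasPar q) (fun _ h => h.del) (fun x hx => ?_) _ y hy
        rw [hx.mul_comm]
      rw [br_mul hβ (hx.mul hy), hb, hc, br_mul hβ hy, map_mul, br_mul hβ hx, rightL_add,
        rightR_add, k1, k2, rightL_mul_C _ del_mul, rightR_C_mul _ del_mul, twist_twist]
      noncomm_ring
  · intro o a b _ _ ha hb c
    simp only [map_add, LinearMap.add_apply, ha, hb]; abel

end FreeBracket


/-! ### The Jacobi identity as an identity in λ and μ, and its symmetries -/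

section Jacobi

variable {A : Type*} [Ring A] [Algebra ℂ A]

/-- The operator is λ + μ + ∂, which is symmetric in the two variables; therefore it commutes with
their exchange. -/
theorem lamAdd_lamAdd (T : A →ₗ[ℂ] A) (p : A[X][X]) :
    lamAdd (lamAdd T) p = X * p + (C X * p + mapLin (mapLin T) p) := by
  ext1 n
  rw [lamAdd_apply, coeff_add, coeff_add, coeff_add, coeffwise_eq_mapLin, coeff_mapLin, coeff_mapLin,
    coeff_C_mul, lamAdd_apply, coeffwise_eq_mapLin]

theorem swapPoly_lamAdd (T : A →ₗ[ℂ] A) (p : A[X][X]) :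
    swapPoly (lamAdd (lamAdd T) p) = lamAdd (lamAdd T) (swapPoly p) := by
  have h : swapPoly (mapLin (mapLin T) p) = mapLin (mapLin T) (swapPoly p) := by
    ext m n; simp only [coeff_swapPoly, coeff_mapLin]
  rw [lamAdd_lamAdd, lamAdd_lamAdd, map_add, map_add, swapPoly_X_mul, swapPoly_C_X_mul, h]
  abel

theorem shiftPoly_lamAdd (T : A →ₗ[ℂ] A) (p : A[X]) :
    shiftPoly (lamAdd T p) = lamAdd (lamAdd T) (shiftPoly p) := by
  have h : shiftPoly (mapLin T p) = mapLin (mapLin T) (shiftPoly p) := by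
    ext m n; simp only [coeff_shiftPoly, coeff_mapLin, map_nsmul]
  rw [lamAdd_lamAdd, lamAdd_apply, map_add, shiftPoly_X_mul, coeffwise_eq_mapLin, h]
  abel

theorem innerSum_lamAdd {B : Type*} [Ring B] [Algebra ℂ B] (T : A →ₗ[ℂ] A) (F : B →ₗ[ℂ] A[X][X])
    (p : B[X]) :
    innerSum ((lamAdd (lamAdd T)).comp F) p = lamAdd (lamAdd T) (innerSum F p) := by
  induction p using poly_induction with
  | hC a => rw [innerSum_C, innerSum_C, LinearMap.comp_apply]
  | hX p hp =>
    have h1 := innerSum_X_mul F p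
    have h2 := innerSum_X_mul ((lamAdd (lamAdd T)).comp F) p
    rw [h1, h2, hp]
    exact (lamAdd_inner_X_mul T _).symm
  | hadd p q hp hq => simp only [map_add, hp, hq]

/-- The two sides of the Jacobi identity, as polynomials in `λ` (inner) and `μ` (outer). -/
def JacobiAt (br : A →ₗ[ℂ] A →ₗ[ℂ] A[X]) (ε : ℂ) (a b c : A) : Prop :=
  mapLin (br a) (br b c) = ε • swapPoly (mapLin (br b) (br a c))
    + innerSum (shiftPoly ∘ₗ br.flip c) (br a b)

theorem jacobiAt_iff (br : A →ₗ[ℂ] A →ₗ[ℂ] A[X]) (ε : ℂ) (a b c : A) :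
    JacobiAt br ε a b c ↔ ∀ m n, (br a ((br b c).coeff n)).coeff m
      = ε • (br b ((br a c).coeff m)).coeff n
        + ∑ i ∈ Finset.range (m + 1),
            (m - i + n).choose n • (br ((br a b).coeff i) c).coeff (m - i + n) := by
  have h : JacobiAt br ε a b c ↔ ∀ n m, ((mapLin (br a) (br b c)).coeff n).coeff m
      = ((ε • swapPoly (mapLin (br b) (br a c))
        + innerSum (shiftPoly ∘ₗ br.flip c) (br a b)).coeff n).coeff m := by
    rw [JacobiAt]
    constructor
    · intro h n m; rw [h]
    · intro h; ext n m; exact h n m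
  rw [h]
  constructor
  · intro h m n
    have := h n m
    rw [coeff_add, coeff_add, coeff_innerSum_shiftPoly, coeff_smul_complex, coeff_smul_complex,
      coeff_swapPoly, coeff_mapLin, coeff_mapLin] at this
    exact this
  · intro h n m
    rw [coeff_add, coeff_add, coeff_innerSum_shiftPoly, coeff_smul_complex, coeff_smul_complex,
      coeff_swapPoly, coeff_mapLin, coeff_mapLin]
    exact h m n

/-- Replacing c by ∂c applies λ + μ + ∂ to each of the three terms. -/
theorem JacobiAt.del {br : A →ₗ[ℂ] A →ₗ[ℂ] A[X]} {T : A →ₗ[ℂ] A}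
    (hT : ∀ a b, br a (T b) = lamAdd T (br a b)) {ε : ℂ} {a b c : A}
    (h : JacobiAt br ε a b c) : JacobiAt br ε a b (T c) := by
  rw [JacobiAt] at *
  have e : shiftPoly ∘ₗ br.flip (T c) = (lamAdd (lamAdd T)).comp (shiftPoly ∘ₗ br.flip c) := by
    refine LinearMap.ext fun x => ?_
    simp only [LinearMap.comp_apply, LinearMap.flip_apply, hT, shiftPoly_lamAdd]
  rw [hT, hT, e, mapLin_lamAdd (br a) T (lamAdd T) (hT a), mapLin_lamAdd (br b) T (lamAdd T) (hT b),
    innerSum_lamAdd, h, swapPoly_lamAdd, map_add, map_smul]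

theorem mul_neg_mul_add_mul {R : Type*} [Ring R] (r s q : R) (h : s * r = r * s) :
    r * -(s * q + r * q) = -(s * (r * q) + r * (r * q)) := by
  rw [← mul_assoc s, h]; noncomm_ring

/-- This is {∂x_ν c} = -ν{x_ν c} at ν = λ + μ. -/
theorem innerSum_shiftPoly_mapLin {br : A →ₗ[ℂ] A →ₗ[ℂ] A[X]} {T : A →ₗ[ℂ] A}
    (hT : ∀ a b, br (T a) b = -(X * br a b)) (c : A) (p : A[X]) :
    innerSum (shiftPoly ∘ₗ br.flip c) (mapLin T p)
      = -(X * innerSum (shiftPoly ∘ₗ br.flip c) p + C X * innerSum (shiftPoly ∘ₗ br.flip c) p) := by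
  induction p using poly_induction with
  | hC a =>
    rw [mapLin_C, innerSum_C, innerSum_C]
    simp only [LinearMap.comp_apply, LinearMap.flip_apply, hT, map_neg, shiftPoly_X_mul]
  | hX p hp =>
    rw [mapLin_X_mul, innerSum_X_mul, hp, innerSum_X_mul]
    exact mul_neg_mul_add_mul _ _ _ (X_mul_C X)
  | hadd p q hp hq => simp only [map_add, hp, hq, mul_add]; abel

/-- Inside {p_{λ+μ} c} the operator ∂ on p acts as -λ-μ, so λ ↦ -λ-∂ amounts to λ ↦ μ. This is how
skewsymmetry of {a_λ b} becomes the exchange of the variables. -/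
theorem swapPoly_innerSum_skewSubst {br : A →ₗ[ℂ] A →ₗ[ℂ] A[X]} {T : A →ₗ[ℂ] A}
    (hT : ∀ a b, br (T a) b = -(X * br a b)) (c : A) (p : A[X]) :
    swapPoly (innerSum (shiftPoly ∘ₗ br.flip c) (skewSubst T p))
      = innerSum (shiftPoly ∘ₗ br.flip c) p := by
  have h2 : ∀ p : A[X], innerSum (shiftPoly ∘ₗ br.flip c) (lamAdd T p)
      = -(X * innerSum (shiftPoly ∘ₗ br.flip c) p) := by
    intro p
    rw [lamAdd_apply, map_add, coeffwise_eq_mapLin,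
      innerSum_shiftPoly_mapLin hT, innerSum_X_mul]
    abel
  induction p using poly_induction with
  | hC a =>
    rw [skewSubst_C, innerSum_C, LinearMap.comp_apply, swapPoly_shiftPoly]
  | hX p hp =>
    rw [skewSubst_X_mul, map_neg, h2, neg_neg, swapPoly_X_mul, hp, innerSum_X_mul]
  | hadd p q hp hq => simp only [map_add, hp, hq]

/-- The Jacobi identity is invariant under the exchange of the first two arguments. -/
theorem JacobiAt.swap_left {br : A →ₗ[ℂ] A →ₗ[ℂ] A[X]} {T : A →ₗ[ℂ] A}
    (hT : ∀ a b, br (T a) b = -(X * br a b)) {ε : ℂ} (hε : ε * ε = 1) {a b c : A}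
    (hs : br b a = -(ε • skewSubst T (br a b))) (h : JacobiAt br ε a b c) :
    JacobiAt br ε b a c := by
  rw [JacobiAt] at *
  have h3 := swapPoly_innerSum_skewSubst hT c (skewSubst T (br a b))
  rw [skewSubst_skewSubst] at h3
  rw [hs, map_neg, map_smul, ← h3, h, map_add, map_smul, swapPoly_swapPoly, smul_add, smul_smul, hε,
    one_smul]
  abel

/-- The Jacobi identity is invariant under the exchange of the last two arguments. -/
theorem JacobiAt.swap_right {br : A →ₗ[ℂ] A →ₗ[ℂ] A[X]} {T : A →ₗ[ℂ] A}
    (hT : ∀ a b, br a (T b) = lamAdd T (br a b)) {ε ε' δ η θ : ℂ} {a b c : A}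
    (hbc : br b c = -(δ • skewSubst T (br c b)))
    (hb : ∀ m, br b ((br a c).coeff m) = -(η • skewSubst T (br ((br a c).coeff m) b)))
    (hc : ∀ m, br ((br a b).coeff m) c = -(θ • skewSubst T (br c ((br a b).coeff m))))
    (h1 : δ * ε' = θ) (h2 : δ = ε * η) (h : JacobiAt br ε' a c b) :
    JacobiAt br ε a b c := by
  rw [JacobiAt] at *
  -- `skewSubst (lamAdd T)` is μ ↦ -λ-μ-∂. It carries {a_λ{c_μ b}}, {{a_λ c}_{λ+μ} b} and {c_μ{a_λ
  -- b}}, up to sign, to {a_λ{b_μ c}}, {b_μ{a_λ c}} and {{a_λ b}_{λ+μ} c}; `h1` and `h2` say that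
  -- the signs match.
  have e1 : mapLin (br a) (br b c) = -(δ • skewSubst (lamAdd T) (mapLin (br a) (br c b))) := by
    rw [hbc, map_neg, map_smul, mapLin_skewSubst (br a) T (lamAdd T) (hT a)]
  have e2 : swapPoly (mapLin (br b) (br a c))
      = -(η • skewSubst (lamAdd T) (innerSum (shiftPoly ∘ₗ br.flip b) (br a c))) := by
    rw [swapPoly_mapLin, skewSubst_innerSum, innerSum_apply, innerSum_apply, Finset.smul_sum,
      ← Finset.sum_neg_distrib]
    refine Finset.sum_congr rfl fun m _ => ?_
    simp only [LinearMap.comp_apply, LinearMap.flip_apply]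
    rw [hb, skewSubst_shiftPoly, map_neg, map_smul, ← mul_smul_comm, ← mul_neg]
  have e3 : innerSum (shiftPoly ∘ₗ br.flip c) (br a b)
      = -(θ • skewSubst (lamAdd T) (swapPoly (mapLin (br c) (br a b)))) := by
    rw [swapPoly_mapLin, skewSubst_innerSum, innerSum_apply, innerSum_apply, Finset.smul_sum,
      ← Finset.sum_neg_distrib]
    refine Finset.sum_congr rfl fun m _ => ?_
    simp only [LinearMap.comp_apply, LinearMap.flip_apply]
    rw [hc, skewSubst_liftPoly, map_neg, map_smul, ← mul_smul_comm, ← mul_neg]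
  rw [e1, e2, e3, h, map_add, map_smul, smul_add, smul_smul, h1, h2, smul_neg, smul_smul]
  abel

end Jacobi

/-! ### The Jacobi identity for the bracket on S(R) -/

section FreePVA

variable {W₀ W₁ : Type*} [AddCommGroup W₀] [Module ℂ W₀] [AddCommGroup W₁] [Module ℂ W₁]
variable {β : W₀ × W₁ →ₗ[ℂ] W₀ × W₁ →ₗ[ℂ] (S W₀ W₁)[X]}

theorem hasPar_coeff_br (hβ : IsEven β) {o o' : Bool} {a b : S W₀ W₁} (ha : HasPar o a)
    (hb : HasPar o' b) (n : ℕ) : HasPar (xor o o') (((freeData β).br a b).coeff n) := by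
  rw [HasPar, par_freeData hβ, ha, hb, map_smul, map_smul, LinearMap.smul_apply, smul_smul,
    coeff_smul_complex]
  cases o <;> cases o' <;> simp [sign]

theorem br_skew_sign (hβ : IsEven β) (hs : IsSkew β) {o o' : Bool} {a b : S W₀ W₁}
    (ha : HasPar o a) (hb : HasPar o' b) :
    (freeData β).br a b = -(sign (o && o') • skewSubst del ((freeData β).br b a)) := by
  rw [br_skew hβ hs ha, twist_of_hasPar hb, map_smul, LinearMap.smul_apply, map_smul]

theorem twist_coeff_br (hβ : IsEven β) (o : Bool) (a b : S W₀ W₁) (n : ℕ) :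
    twist o (((freeData β).br a b).coeff n)
      = ((freeData β).br (twist o a) (twist o b)).coeff n := by
  cases o
  · rfl
  · exact par_freeData hβ a b n

/-- {a_λ ·} and {b_μ ·} are superderivations, so their supercommutator is one, and so is {{a_λ
b}_{λ+μ} ·}. The mixed terms of the two double brackets cancel. -/
theorem JacobiAt.mul (hβ : IsEven β) {o o' : Bool} {a b : S W₀ W₁}
    (ha : HasPar o a) (hb : HasPar o' b) {x y : S W₀ W₁}
    (hx : JacobiAt (freeData β).br (sign (o && o')) a b x)
    (hy : JacobiAt (freeData β).br (sign (o && o')) a b y) :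
    JacobiAt (freeData β).br (sign (o && o')) a b (x * y) := by
  rw [jacobiAt_iff] at *
  intro m n
  have e1 : ∀ i, (m - i + n).choose n •
      ((freeData β).br (((freeData β).br a b).coeff i) (x * y)).coeff (m - i + n)
      = twist (xor o o') x * ((m - i + n).choose n •
          ((freeData β).br (((freeData β).br a b).coeff i) y).coeff (m - i + n))
        + ((m - i + n).choose n •
          ((freeData β).br (((freeData β).br a b).coeff i) x).coeff (m - i + n)) * y := by
    intro i
    rw [br_mul hβ (hasPar_coeff_br hβ ha hb i), coeff_add, coeff_C_mul, coeff_mul_C, smul_add,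
      mul_smul_comm, smul_mul_assoc]
  simp only [e1, Finset.sum_add_distrib, ← Finset.mul_sum, ← Finset.sum_mul]
  have hx' := hx m n
  have hy' := hy m n
  rw [← sub_eq_iff_eq_add'] at hx' hy'
  rw [← hx', ← hy', br_mul hβ hb, br_mul hβ ha, coeff_add, coeff_add, coeff_C_mul, coeff_C_mul,
    coeff_mul_C, coeff_mul_C, map_add, map_add, br_mul hβ ha, br_mul hβ ha, br_mul hβ hb,
    br_mul hβ hb, coeff_add, coeff_add, coeff_add, coeff_add, coeff_add, coeff_add, coeff_C_mul,
    coeff_C_mul, coeff_C_mul, coeff_C_mul, coeff_mul_C, coeff_mul_C, coeff_mul_C, coeff_mul_C,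
    twist_coeff_br hβ, twist_coeff_br hβ, twist_of_hasPar hb, twist_of_hasPar ha, map_smul,
    map_smul, LinearMap.smul_apply, LinearMap.smul_apply, coeff_smul_complex, coeff_smul_complex,
    twist_twist, twist_twist, Bool.xor_comm o' o, Bool.and_comm o' o]
  simp only [smul_add, smul_mul_assoc, mul_smul_comm, mul_sub, sub_mul, smul_smul, sign_mul_sign,
    one_smul]
  abel

/-- The Jacobi identity for the generators of `S(R)`. -/
def GenJacobi (β : W₀ × W₁ →ₗ[ℂ] W₀ × W₁ →ₗ[ℂ] (S W₀ W₁)[X]) : Prop :=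
  ∀ (o o' o'' : Bool) (u v w : W₀ × W₁),
    (o = false ∧ u.2 = 0 ∨ o = true ∧ u.1 = 0) → (o' = false ∧ v.2 = 0 ∨ o' = true ∧ v.1 = 0) →
    (o'' = false ∧ w.2 = 0 ∨ o'' = true ∧ w.1 = 0) →
    JacobiAt (freeData β).br (sign (o && o')) (gen 0 u) (gen 0 v) (gen 0 w)

/-- In c both sides are derivations intertwining ∂ with λ + μ + ∂, so generators are enough. -/
theorem jacobiAt_of_gen (hβ : IsEven β) {o o' : Bool} {a b : S W₀ W₁} (ha : HasPar o a) (hb : HasPar o' b)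
    (h : ∀ (o'' : Bool) (w : W₀ × W₁), (o'' = false ∧ w.2 = 0 ∨ o'' = true ∧ w.1 = 0) →
      JacobiAt (freeData β).br (sign (o && o')) a b (gen 0 w)) (c : S W₀ W₁) :
    JacobiAt (freeData β).br (sign (o && o')) a b c := by
  induction c using S.induction_del with
  | hc r =>
    rw [jacobiAt_iff]
    intro m n
    simp [br_algebraMap]
  | h₀ w => exact h false _ (by simp)
  | h₁ w => exact h true _ (by simp)
  | hdel c ih => exact ih.del br_del_right
  | hmul x y hx hy => exact JacobiAt.mul hβ ha hb hx hy
  | hadd x y hx hy =>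
    rw [jacobiAt_iff] at *
    intro m n
    simp only [map_add, coeff_add, hx, hy, smul_add, Finset.sum_add_distrib]
    abel

theorem JacobiAt.swap_right_of_hasPar (hβ : IsEven β) (hs : IsSkew β) {o o' o'' : Bool} {a b c : S W₀ W₁} (ha : HasPar o a)
    (hb : HasPar o' b) (hc : HasPar o'' c)
    (h : JacobiAt (freeData β).br (sign (o && o'')) a c b) :
    JacobiAt (freeData β).br (sign (o && o')) a b c := by
  refine JacobiAt.swap_right (T := ClassicalW.del) br_del_right (br_skew_sign hβ hs hb hc)
    (fun m => br_skew_sign hβ hs hb (hasPar_coeff_br hβ ha hc m))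
    (fun m => br_skew_sign hβ hs (hasPar_coeff_br hβ ha hb m) hc) ?_ ?_ h <;>
  cases o <;> cases o' <;> cases o'' <;> simp [sign]

/-- The Leibniz rule frees the last argument, and the exchanges of arguments bring each of the other
two into the last place. So the triples (gen, gen, any), (any, gen, any) and (any, any, any) are
reached in turn. -/
theorem jacobiAt_freeData (hβ : IsEven β) (hs : IsSkew β) (hJ : GenJacobi β) {o o' : Bool} {a b : S W₀ W₁} (ha : HasPar o a) (hb : HasPar o' b)
    (c : S W₀ W₁) : JacobiAt (freeData β).br (sign (o && o')) a b c := by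
  have h1 : ∀ (o o' : Bool) (u v : W₀ × W₁), (o = false ∧ u.2 = 0 ∨ o = true ∧ u.1 = 0) →
      (o' = false ∧ v.2 = 0 ∨ o' = true ∧ v.1 = 0) → ∀ c,
      JacobiAt (freeData β).br (sign (o && o')) (gen 0 u) (gen 0 v) c :=
    fun o o' u v hu hv c => jacobiAt_of_gen hβ (hasPar_gen hu) (hasPar_gen hv)
      (fun o'' w hw => hJ o o' o'' u v w hu hv hw) c
  have h2 : ∀ (o o' : Bool) (a : S W₀ W₁) (v : W₀ × W₁), HasPar o a →
      (o' = false ∧ v.2 = 0 ∨ o' = true ∧ v.1 = 0) → ∀ c,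
      JacobiAt (freeData β).br (sign (o && o')) a (gen 0 v) c := by
    intro o o' a v ha hv c
    refine jacobiAt_of_gen hβ ha (hasPar_gen hv) (fun o'' w hw => ?_) c
    -- The order is changed from (v, w, a) to (v, a, w) and then to (a, v, w).
    have k1 := h1 o' o'' v w hv hw a
    have k2 := JacobiAt.swap_right_of_hasPar hβ hs (hasPar_gen hv) ha (hasPar_gen hw) k1
    have hs' : (freeData β).br a (gen 0 v)
        = -(sign (o' && o) • skewSubst ClassicalW.del ((freeData β).br (gen 0 v) a)) := by
      rw [Bool.and_comm o' o]; exact br_skew_sign hβ hs ha (hasPar_gen hv)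
    have k3 := JacobiAt.swap_left (br := (freeData β).br) (T := ClassicalW.del) br_del_left
      (sign_mul_sign (o' && o)) hs' k2
    rwa [Bool.and_comm o' o] at k3
  refine jacobiAt_of_gen hβ ha hb (fun o'' w hw => ?_) c
  exact JacobiAt.swap_right_of_hasPar hβ hs ha hb (hasPar_gen hw) (h2 o o'' a w ha hw b)

theorem neg_one_pow_eq_sign (p : ℕ) : (-1 : ℂ) ^ p = sign p.bodd := by
  induction p with
  | zero => simp [sign]
  | succ n ih => rw [pow_succ, ih, Nat.bodd_succ]; cases n.bodd <;> simp [sign]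

/-- A skewsymmetric bracket of generators that satisfies the Jacobi identity extends to a Poisson
vertex algebra. -/
theorem isPVA_freeData (hβ : IsEven β) (hs : IsSkew β) (hJ : GenJacobi β) : (freeData β).IsPVA := by
  have hpar : ∀ p (a : S W₀ W₁), (freeData β).HasParity p a → HasPar (p.bodd) a := by
    intro p a h
    have h' : σ a = (-1 : ℂ) ^ p • a := h
    rw [HasPar, h', neg_one_pow_eq_sign]
  have hsgn : ∀ p q : ℕ, (-1 : ℂ) ^ (p * q) = sign (p.bodd && q.bodd) := by
    intro p q
    rw [neg_one_pow_eq_sign, Nat.bodd_mul]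
  exact
  { par_par := σ_σ
    supercomm := by
      intro p q a b ha hb
      rw [(hpar _ _ ha).mul_comm, twist_of_hasPar (hpar _ _ hb), hsgn, smul_mul_assoc]
    par_del := σ_del
    par_br := par_freeData hβ
    del_mul := del_mul
    br_del_left := br_del_left
    br_del_right := br_del_right
    skew := by
      intro p q a b ha hb
      rw [hsgn, Bool.and_comm]
      exact br_skew_sign hβ hs (hpar _ _ hb) (hpar _ _ ha)
    jacobi := by
      intro p q a b c m n ha hb
      rw [hsgn]
      exact (jacobiAt_iff _ _ _ _ _).1 (jacobiAt_freeData hβ hs hJ (hpar _ _ ha) (hpar _ _ hb) c) m n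
    leibniz := by
      intro p q a b c ha hb
      rw [br_mul hβ (hpar _ _ ha), twist_of_hasPar (hpar _ _ hb), hsgn, ← Polynomial.smul_C,
        smul_mul_assoc] }

end FreePVA


/-! ### Brackets of generators of the form L(v, w) + λω(v, w) + ψ(v, w) -/

section LieType

variable {W₀ W₁ : Type*} [AddCommGroup W₀] [Module ℂ W₀] [AddCommGroup W₁] [Module ℂ W₁]
variable {β : W₀ × W₁ →ₗ[ℂ] W₀ × W₁ →ₗ[ℂ] (S W₀ W₁)[X]}
  {L : W₀ × W₁ → W₀ × W₁ → W₀ × W₁} {ω ψ : W₀ × W₁ → W₀ × W₁ → ℂ}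

/-- The coefficient of λ is a scalar, which ∂ kills, so λ merely changes sign. -/
theorem skewSubst_lieType (g : S W₀ W₁) (r s : ℂ) :
    skewSubst del (C g + X * algebraMap ℂ (S W₀ W₁)[X] r + algebraMap ℂ _ s)
      = C g - X * algebraMap ℂ (S W₀ W₁)[X] r + algebraMap ℂ _ s := by
  rw [Polynomial.algebraMap_apply, Polynomial.algebraMap_apply, map_add, map_add, skewSubst_X_mul,
    skewSubst_C, skewSubst_C, skewSubst_C, lamAdd_C, del_algebraMap, C_0, add_zero, sub_eq_add_neg]

theorem isSkew_of_lieType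
    (hβ : ∀ v w, β v w = C (gen 0 (L v w)) + X * algebraMap ℂ _ (ω v w) + algebraMap ℂ _ (ψ v w))
    (h₀ : ∀ a w, L (a, 0) w = -L w (a, 0) ∧ ω (a, 0) w = ω w (a, 0) ∧ ψ (a, 0) w = -ψ w (a, 0))
    (h₁ : ∀ b w, L (0, b) w = -L (w.1, -w.2) (0, b) ∧ ω (0, b) w = ω (w.1, -w.2) (0, b) ∧
      ψ (0, b) w = -ψ (w.1, -w.2) (0, b)) : IsSkew β where
  even a w := by
    obtain ⟨e1, e2, e3⟩ := h₀ a w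
    rw [hβ, hβ, skewSubst_lieType, e1, e2, e3, map_neg, map_neg, map_neg]; abel
  odd b w := by
    obtain ⟨e1, e2, e3⟩ := h₁ b w
    rw [hβ, hβ, skewSubst_lieType, e1, e2, e3, map_neg, map_neg, map_neg]; abel

/-- Double brackets of generators have degree at most one in λ, μ. The constant terms give the
Jacobi identity for L and the cocycle condition for ψ. The terms with λ and μ give the two
conditions on ω, since the third bracket contributes (λ + μ) ω(L(u, v), w). -/
theorem genJacobi_of_lieType (hs : IsSkew β)
    (hβ : ∀ v w, β v w = C (gen 0 (L v w)) + X * algebraMap ℂ _ (ω v w) + algebraMap ℂ _ (ψ v w))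
    (h : ∀ (o o' : Bool) (u v w : W₀ × W₁), (o = false ∧ u.2 = 0 ∨ o = true ∧ u.1 = 0) →
      (o' = false ∧ v.2 = 0 ∨ o' = true ∧ v.1 = 0) →
      L u (L v w) = sign (o && o') • L v (L u w) + L (L u v) w ∧
      ω u (L v w) = ω (L u v) w ∧ sign (o && o') * ω v (L u w) = -ω (L u v) w ∧
      ψ u (L v w) = sign (o && o') * ψ v (L u w) + ψ (L u v) w) : GenJacobi β := by
  intro o o' o'' u v w hu hv _
  obtain ⟨e1, e2, e3, e4⟩ := h o o' u v w hu hv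
  have hm : ∀ u v w, mapLin ((freeData β).br (gen 0 u)) ((freeData β).br (gen 0 v) (gen 0 w))
      = C (β u (L v w)) := by
    intro u v w
    rw [br_gen_gen hs, hβ v w, map_add, map_add, mapLin_C, br_gen_gen hs, mapLin_X_mul,
      Polynomial.algebraMap_apply, Polynomial.algebraMap_apply, mapLin_C, mapLin_C, br_algebraMap,
      br_algebraMap, C_0, mul_zero, add_zero, add_zero]
  have hi : innerSum (shiftPoly ∘ₗ (freeData β).br.flip (gen 0 w))
      ((freeData β).br (gen 0 u) (gen 0 v)) = shiftPoly (β (L u v) w) := by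
    rw [br_gen_gen hs, hβ u v, map_add, map_add, innerSum_C, innerSum_X_mul,
      Polynomial.algebraMap_apply, Polynomial.algebraMap_apply, innerSum_C, innerSum_C]
    simp only [LinearMap.comp_apply, LinearMap.flip_apply, br_algebraMap_left, map_zero, mul_zero,
      add_zero, br_gen_gen hs]
  rw [jacobiAt_iff]
  have key : ∀ m n, ((C (β u (L v w))).coeff n).coeff m
      = sign (o && o') • ((C (β v (L u w))).coeff m).coeff n
        + ((shiftPoly (β (L u v) w)).coeff n).coeff m := by
    have hc : ∀ (x : S W₀ W₁) (n : ℕ), (X * C x).coeff n = if n = 1 then x else 0 := by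
      intro x n
      rw [X_mul_C, coeff_C_mul, coeff_X]
      simp [eq_comm]
    have hcC : ∀ (x : (S W₀ W₁)[X]) (m n : ℕ), ((C x).coeff n).coeff m
        = if n = 0 then x.coeff m else 0 := by
      intro x m n; rw [coeff_C]; split_ifs <;> simp
    have e3' : sign (o && o') • (algebraMap ℂ (S W₀ W₁)) (ω v (L u w))
        = -(algebraMap ℂ (S W₀ W₁)) (ω (L u v) w) := by
      rw [← map_neg, ← e3, map_mul, Algebra.smul_def]
    have e4' : (algebraMap ℂ (S W₀ W₁)) (ψ u (L v w))
        = sign (o && o') • (algebraMap ℂ (S W₀ W₁)) (ψ v (L u w))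
          + (algebraMap ℂ (S W₀ W₁)) (ψ (L u v) w) := by
      rw [e4, map_add, map_mul, Algebra.smul_def]
    have e1' : (gen 0 (L u (L v w)) : S W₀ W₁)
        = sign (o && o') • gen 0 (L v (L u w)) + gen 0 (L (L u v) w) := by
      rw [e1, map_add, map_smul]
    intro m n
    rw [coeff_shiftPoly, hcC, hcC, hβ, hβ, hβ]
    simp only [Polynomial.algebraMap_apply, coeff_add, hc, coeff_C]
    rcases n with _ | _ | n <;> rcases m with _ | _ | m <;>
      simp [e1', e4', e2, e3', smul_add]
    · abel
    · intro h; omega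
  intro m n
  have k1 : ((freeData β).br (gen 0 u) (((freeData β).br (gen 0 v) (gen 0 w)).coeff n)).coeff m
      = ((C (β u (L v w))).coeff n).coeff m := by
    rw [← hm, coeff_mapLin]
  have k2 : ((freeData β).br (gen 0 v) (((freeData β).br (gen 0 u) (gen 0 w)).coeff m)).coeff n
      = ((C (β v (L u w))).coeff m).coeff n := by
    rw [← hm, coeff_mapLin]
  rw [k1, k2, key, ← hi, coeff_innerSum_shiftPoly]
  rfl

end LieType

/-! ### S(R) and S(ℂ[∂] ⊗ 𝔤) as Poisson vertex algebras -/

section Concrete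

variable {𝔤 : Type*} [LieRing 𝔤] [LieAlgebra ℂ 𝔤] {B : LinearMap.BilinForm ℂ 𝔤} {h f : 𝔤} {k : ℂ}

theorem isSkew_curBracket (hsymm : ∀ x y, B x y = B y x) : IsSkew (curBracket B k) := by
  refine isSkew_of_lieType (L := fun v w => (⁅v.1, w.1⁆, 0)) (ω := fun v w => k * B v.1 w.1)
    (ψ := fun _ _ => 0) (fun v w => ?_) (fun a w => ?_) (fun b w => ?_)
  · simp [curBracket, scur]
  · exact ⟨by simp, by simp [hsymm a], by simp⟩
  · exact ⟨by simp, by simp, by simp⟩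

theorem isPVA_curData (hsymm : ∀ x y, B x y = B y x) (hinv : ∀ x y z, B ⁅x, y⁆ z = B x ⁅y, z⁆) :
    (curData B k).IsPVA := by
  refine isPVA_freeData (isEven_curBracket B k) (isSkew_curBracket hsymm) ?_
  refine genJacobi_of_lieType (L := fun v w => (⁅v.1, w.1⁆, 0)) (ω := fun v w => k * B v.1 w.1)
    (ψ := fun _ _ => 0) (isSkew_curBracket hsymm) (fun v w => ?_) (fun o o' u v w hu hv => ?_)
  · simp [curBracket, scur]
  · have e : B v.1 ⁅u.1, w.1⁆ = -B ⁅u.1, v.1⁆ w.1 := by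
      rw [← hinv, ← lie_skew, map_neg, LinearMap.neg_apply]
    -- Nested brackets involve the labels in 𝔤 only, so with an odd first generator every term
    -- vanishes and no sign enters.
    have ho' : o = false ∨ u.1 = 0 := by rcases hu with h | h <;> simp [h]
    rcases ho' with rfl | h0
    · refine ⟨?_, ?_, ?_, by simp⟩
      · simp only [Bool.false_and, sign, cond_false, one_smul, Prod.mk_add_mk, add_zero]
        rw [leibniz_lie, add_comm]
      · simp [hinv]
      · simp [sign, e]
    · simp [h0]

/-- The bracket of the generators of `S(R_k(𝔤, f))` in terms of the bracket of `𝔤`. -/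
theorem brstBracket_apply (v w : (𝔤 × halfPart h) × (nPart h × Module.Dual ℂ (nPart h))) :
    brstBracket B h f k v w = C (gen 0 (((⁅v.1.1, w.1.1⁆, 0), 0) :
        (𝔤 × halfPart h) × (nPart h × Module.Dual ℂ (nPart h))))
      + X * algebraMap ℂ _ (k * B v.1.1 w.1.1)
      + algebraMap ℂ _ (B f ⁅(v.1.2 : 𝔤), (w.1.2 : 𝔤)⁆ + (w.2.2 v.2.1 + v.2.2 w.2.1)) := by
  rw [map_add, ← add_assoc]; rfl

theorem isSkew_brstBracket (hsymm : ∀ x y, B x y = B y x) : IsSkew (brstBracket B h f k) := by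
  refine isSkew_of_lieType (L := fun v w => ((⁅v.1.1, w.1.1⁆, 0), 0))
    (ω := fun v w => k * B v.1.1 w.1.1)
    (ψ := fun v w => B f ⁅(v.1.2 : 𝔤), (w.1.2 : 𝔤)⁆ + (w.2.2 v.2.1 + v.2.2 w.2.1))
    brstBracket_apply (fun a w => ?_) (fun b w => ?_)
  · refine ⟨by simp, by simp [hsymm a.1], ?_⟩
    simp only [Prod.fst_zero, Prod.snd_zero, map_zero, LinearMap.zero_apply, add_zero]
    rw [← lie_skew, map_neg]
  · refine ⟨by simp, by simp, ?_⟩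
    simp [add_comm]

theorem isPVA_brstData (hsymm : ∀ x y, B x y = B y x) (hinv : ∀ x y z, B ⁅x, y⁆ z = B x ⁅y, z⁆) :
    (brstData B h f k).IsPVA := by
  refine isPVA_freeData (isEven_brstBracket B h f k) (isSkew_brstBracket hsymm) ?_
  refine genJacobi_of_lieType (L := fun v w => ((⁅v.1.1, w.1.1⁆, 0), 0))
    (ω := fun v w => k * B v.1.1 w.1.1)
    (ψ := fun v w => B f ⁅(v.1.2 : 𝔤), (w.1.2 : 𝔤)⁆ + (w.2.2 v.2.1 + v.2.2 w.2.1))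
    (isSkew_brstBracket hsymm) brstBracket_apply (fun o o' u v w hu hv => ?_)
  have e : B v.1.1 ⁅u.1.1, w.1.1⁆ = -B ⁅u.1.1, v.1.1⁆ w.1.1 := by
    rw [← hinv, ← lie_skew, map_neg, LinearMap.neg_apply]
  have ho' : o = false ∨ u.1 = 0 := by rcases hu with h | h <;> simp [h]
  rcases ho' with rfl | h0
  · refine ⟨?_, ?_, ?_, by simp⟩
    · simp only [Bool.false_and, sign, cond_false, one_smul, Prod.mk_add_mk, add_zero]
      rw [leibniz_lie, add_comm]
    · simp [hinv]
    · simp [sign, e]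
  · simp [h0]

end Concrete


/-! ### Diagonalizability of h in finite-dimensional representations of 𝔰𝔩₂ -/

section Sl2

variable {V : Type*} [AddCommGroup V] [Module ℂ V]

theorem mem_maxGenEigenspace_shift {H E : Module.End ℂ V} {c : ℂ}
    (hE : ∀ v, H (E v) = E (H v) + c • E v) {ν : ℂ} {x : V} (hx : x ∈ H.maxGenEigenspace ν) :
    E x ∈ H.maxGenEigenspace (ν + c) := by
  rw [Module.End.mem_maxGenEigenspace] at *
  obtain ⟨k, hk⟩ := hx
  refine ⟨k, ?_⟩
  have h : ∀ k : ℕ, ∀ x, ((H - (ν + c) • 1) ^ k) (E x) = E (((H - ν • 1) ^ k) x) := by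
    intro k
    induction k with
    | zero => intro x; simp
    | succ k ih =>
      intro x
      have : (H - (ν + c) • 1) (E x) = E ((H - ν • 1) x) := by
        simp only [LinearMap.sub_apply, LinearMap.smul_apply, Module.End.one_apply, hE, map_sub,
          map_smul]
        module
      rw [pow_succ, pow_succ, Module.End.mul_apply, Module.End.mul_apply, this, ih]
  rw [h, hk, map_zero]

/-- E shifts generalized eigenvalues by c ≠ 0, and only finitely many of them occur. -/
theorem exists_pow_apply_eq_zero [FiniteDimensional ℂ V] {H E : Module.End ℂ V} {c : ℂ}
    (hc : c ≠ 0) (hE : ∀ v, H (E v) = E (H v) + c • E v) {ν : ℂ} {x : V}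
    (hx : x ∈ H.maxGenEigenspace ν) : ∃ n : ℕ, (E ^ n) x = 0 := by
  have hfin : {μ | H.maxGenEigenspace μ ≠ ⊥}.Finite :=
    WellFoundedGT.finite_ne_bot_of_iSupIndep H.independent_maxGenEigenspace
  have hinj : Function.Injective fun n : ℕ => ν + n * c := by
    intro m n h
    simpa [hc] using h
  obtain ⟨n, hn⟩ : ∃ n : ℕ, (ν + n * c) ∉ {μ | H.maxGenEigenspace μ ≠ ⊥} := by
    by_contra hcon
    push Not at hcon
    exact Set.infinite_of_injective_forall_mem hinj hcon hfin
  have hn' : H.maxGenEigenspace (ν + n * c) = ⊥ := by simpa using hn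
  have hm : ∀ m : ℕ, (E ^ m) x ∈ H.maxGenEigenspace (ν + m * c) := by
    intro m
    induction m with
    | zero => simpa using hx
    | succ m ih =>
      have := mem_maxGenEigenspace_shift hE ih
      rw [pow_succ', Module.End.mul_apply]
      convert this using 2
      push_cast; ring
  exact ⟨n, by simpa [hn'] using hm n⟩

/-- The product `∏_{j < n} (H - j)`. -/
def descProd (H : Module.End ℂ V) : ℕ → Module.End ℂ V
  | 0 => 1
  | n + 1 => descProd H n * (H - (n : ℂ) • 1)

/-- On ker E one has E F^{n+1} = (n + 1) Fⁿ (H - n). So if v in ker E is killed by F^{n+1}, then (H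
- n)v is again in ker E and is killed by Fⁿ; each step removes one factor of the product. -/
theorem descProd_apply_eq_zero {H E F : Module.End ℂ V} (hE : ∀ v, H (E v) = E (H v) + (2 : ℂ) • E v)
    (hF : ∀ v, H (F v) = F (H v) + (-2 : ℂ) • F v) (hEF : ∀ v, E (F v) = F (E v) + H v) (n : ℕ) :
    ∀ v, E v = 0 → (F ^ n) v = 0 → descProd H n v = 0 := by
  have key : ∀ (n : ℕ) v, E v = 0 → E ((F ^ (n + 1)) v)
      = ((n : ℂ) + 1) • (F ^ n) (H v - (n : ℂ) • v) := by
    have hH : ∀ (n : ℕ) v, H ((F ^ n) v) = (F ^ n) (H v) - (2 * n : ℂ) • (F ^ n) v := by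
      intro n
      induction n with
      | zero => intro v; simp
      | succ n ih =>
        intro v
        rw [pow_succ', Module.End.mul_apply, hF, ih, map_sub, map_smul, Module.End.mul_apply]
        push_cast
        module
    intro n
    induction n with
    | zero => intro v hv; simp [hEF, hv]
    | succ n ih =>
      intro v hv
      rw [pow_succ', Module.End.mul_apply, hEF, ih v hv, hH, map_smul]
      rw [← Module.End.mul_apply, ← pow_succ']
      simp only [map_sub, map_smul]
      push_cast
      module
  induction n with
  | zero => intro v _ h; simpa [descProd] using h
  | succ n ih =>
    intro v hv h
    have h2 := key n v hv
    rw [h, map_zero] at h2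
    have hne : (n : ℂ) + 1 ≠ 0 := by exact_mod_cast Nat.succ_ne_zero n
    have h3 : (F ^ n) (H v - (n : ℂ) • v) = 0 := (smul_eq_zero.1 h2.symm).resolve_left hne
    have h4 : E (H v - (n : ℂ) • v) = 0 := by
      have := hE v
      rw [hv, map_zero, smul_zero, add_zero] at this
      rw [map_sub, map_smul, hv, ← this, smul_zero, sub_zero]
    exact ih _ h4 h3

theorem eq_of_mem_maxGenEigenspace {H : Module.End ℂ V} {μ ν : ℂ} {x : V} (hx : x ≠ 0)
    (h1 : x ∈ H.maxGenEigenspace μ) (h2 : H x = ν • x) : μ = ν := by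
  by_contra hne
  have h2' : x ∈ H.maxGenEigenspace ν :=
    Module.End.eigenspace_le_maxGenEigenspace (Module.End.mem_eigenspace_iff.2 h2)
  have hd : Disjoint (H.maxGenEigenspace μ) (H.maxGenEigenspace ν) :=
    Module.End.disjoint_genEigenspace H hne _ _
  exact hx (Submodule.disjoint_def.1 hd x h1 h2')

/-- The roots of ∏_{j<n} (H - j) are simple and natural numbers, which forces a generalized
eigenvector killed by the product to be an eigenvector for one of them. -/
theorem exists_nat_of_descProd {H : Module.End ℂ V} {ν : ℂ} (n : ℕ) :
    ∀ u, u ≠ 0 → u ∈ H.maxGenEigenspace ν → descProd H n u = 0 →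
      ∃ j : ℕ, j < n ∧ ν = j ∧ H u = ν • u := by
  induction n with
  | zero => intro u hu _ h; simp [descProd] at h; exact absurd h hu
  | succ n ih =>
    intro u hu hν h
    have hstab : ∀ w ∈ H.maxGenEigenspace ν, H w ∈ H.maxGenEigenspace ν :=
      fun w hw => Module.End.mapsTo_maxGenEigenspace_of_comm (Commute.refl H) ν hw
    by_cases h0 : H u - (n : ℂ) • u = 0
    · have hn := sub_eq_zero.1 h0
      have := eq_of_mem_maxGenEigenspace hu hν hn
      exact ⟨n, n.lt_succ_self, this, by rw [this, hn]⟩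
    · obtain ⟨j, hjn, hj, hH⟩ := ih (H u - (n : ℂ) • u) h0
        (sub_mem (hstab u hν) (Submodule.smul_mem _ _ hν)) h
      refine ⟨j, hjn.trans n.lt_succ_self, hj, ?_⟩
      by_contra hne
      have hne' : H u - ν • u ≠ 0 := sub_ne_zero.2 hne
      have hmem : H u - ν • u ∈ H.maxGenEigenspace ν :=
        sub_mem (hstab u hν) (Submodule.smul_mem _ _ hν)
      have heig : H (H u - ν • u) = (n : ℂ) • (H u - ν • u) := by
        rw [map_sub, map_smul, smul_sub] at hH
        rw [map_sub, map_smul, smul_sub, smul_comm (n : ℂ) ν]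
        rw [sub_eq_iff_eq_add] at hH
        rw [hH]; abel
      have hνn := eq_of_mem_maxGenEigenspace hne' hmem heig
      rw [hj] at hνn
      exact hjn.ne (by exact_mod_cast hνn)

/-- The semisimple element of an `sl₂`-triple acts diagonalizably, with integral eigenvalues. -/
theorem iSup_eigenspace_int_eq_top [FiniteDimensional ℂ V] {H E F : Module.End ℂ V}
    (hE : ∀ v, H (E v) = E (H v) + (2 : ℂ) • E v)
    (hF : ∀ v, H (F v) = F (H v) + (-2 : ℂ) • F v) (hEF : ∀ v, E (F v) = F (E v) + H v) :
    ⨆ n : ℤ, H.eigenspace (n : ℂ) = ⊤ := by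
  -- the Casimir element
  let Ω : Module.End ℂ V := H * H + (2 : ℂ) • H + (4 : ℂ) • (F * E)
  have hΩ : ∀ v, Ω v = H (H v) + (2 : ℂ) • H v + (4 : ℂ) • F (E v) := fun v => rfl
  have hcomm : Commute Ω H := by
    refine LinearMap.ext fun v => ?_
    simp only [Module.End.mul_apply, hΩ, map_add, map_smul, hE, hF]
    module
  have hΩE : ∀ v, Ω (E v) = E (Ω v) + (0 : ℂ) • E v := by
    intro v
    simp only [hΩ, map_add, map_smul, hE, hEF, smul_add]
    module
  -- The vector v is raised by E as far as possible. The top vector E^k v is a true eigenvector with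
  -- a natural eigenvalue j = μ + 2k, and Ω acts on it by j² + 2j. Thus c determines j, and μ and j
  -- determine k.
  have main : ∀ (μ c : ℂ) (v : V), v ∈ H.maxGenEigenspace μ → v ∈ Ω.maxGenEigenspace c → v ≠ 0 →
      ∃ k j : ℕ, μ + k * 2 = j ∧ c = (j : ℂ) * j + 2 * j ∧ (E ^ k) v ≠ 0 ∧
        (E ^ k) (H v - μ • v) = 0 := by
    intro μ c v hμ hc hv
    classical
    have hex := exists_pow_apply_eq_zero two_ne_zero hE hμ
    obtain ⟨k, hk, hk'⟩ : ∃ k, (E ^ k) v ≠ 0 ∧ E ((E ^ k) v) = 0 := by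
      have hpos : Nat.find hex ≠ 0 := by
        intro h0
        have := Nat.find_spec hex
        rw [h0] at this
        exact hv (by simpa using this)
      obtain ⟨k, hk⟩ := Nat.exists_eq_succ_of_ne_zero hpos
      refine ⟨k, Nat.find_min hex (by omega), ?_⟩
      have := Nat.find_spec hex
      rwa [hk, Nat.succ_eq_add_one, pow_succ', Module.End.mul_apply] at this
    have hm : ∀ (m : ℕ) (w : V), w ∈ H.maxGenEigenspace μ →
        (E ^ m) w ∈ H.maxGenEigenspace (μ + m * 2) := by
      intro m w hw
      induction m with
      | zero => simpa using hw
      | succ m ih =>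
        have := mem_maxGenEigenspace_shift hE ih
        rw [pow_succ', Module.End.mul_apply]
        convert this using 2
        push_cast; ring
    have hmc : ∀ m : ℕ, (E ^ m) v ∈ Ω.maxGenEigenspace c := by
      intro m
      induction m with
      | zero => simpa using hc
      | succ m ih =>
        have := mem_maxGenEigenspace_shift hΩE ih
        rw [pow_succ', Module.End.mul_apply]
        rwa [add_zero] at this
    obtain ⟨n, hn⟩ := exists_pow_apply_eq_zero (by norm_num : (-2 : ℂ) ≠ 0) hF (hm k v hμ)
    obtain ⟨j, -, hj, hH⟩ := exists_nat_of_descProd n _ hk (hm k v hμ)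
      (descProd_apply_eq_zero hE hF hEF n _ hk' hn)
    refine ⟨k, j, hj, ?_, hk, ?_⟩
    · refine eq_of_mem_maxGenEigenspace hk (hmc k) ?_
      rw [hΩ, hk', hH, map_smul, hH, map_zero, hj]
      module
    · have hHE : ∀ (m : ℕ) (w : V), H ((E ^ m) w) = (E ^ m) (H w) + (m * 2 : ℂ) • (E ^ m) w := by
        intro m w
        induction m with
        | zero => simp
        | succ m ih =>
          rw [pow_succ', Module.End.mul_apply, hE, ih, map_add, map_smul, Module.End.mul_apply]
          push_cast
          module
      have := hHE k v
      rw [hH, add_smul] at this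
      rw [map_sub, map_smul, sub_eq_zero]
      exact (add_right_cancel this).symm
  have hstabH : ∀ μ, ∀ w ∈ H.maxGenEigenspace μ, H w ∈ H.maxGenEigenspace μ :=
    fun μ w hw => Module.End.mapsTo_maxGenEigenspace_of_comm (Commute.refl H) μ hw
  have hstabΩ : ∀ c, ∀ w ∈ Ω.maxGenEigenspace c, H w ∈ Ω.maxGenEigenspace c :=
    fun c w hw => Module.End.mapsTo_maxGenEigenspace_of_comm hcomm c hw
  have hvec : ∀ (μ c : ℂ) (v : V), v ∈ H.maxGenEigenspace μ → v ∈ Ω.maxGenEigenspace c →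
      v ∈ ⨆ n : ℤ, H.eigenspace (n : ℂ) := by
    intro μ c v hμ hc
    by_cases hv : v = 0
    · rw [hv]; exact zero_mem _
    obtain ⟨k, j, hj, hcj, hk, hk0⟩ := main μ c v hμ hc hv
    -- If w = Hv - μv were nonzero, it would have the same μ and c, hence the same k, and E^k w ≠ 0.
    -- But E^k w = 0, since E^k v is an eigenvector.
    have hw : H v - μ • v = 0 := by
      by_contra hw
      obtain ⟨k', j', hj', hcj', hk', -⟩ := main μ c (H v - μ • v)
        (sub_mem (hstabH μ v hμ) (Submodule.smul_mem _ _ hμ))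
        (sub_mem (hstabΩ c v hc) (Submodule.smul_mem _ _ hc)) hw
      have hjj : j = j' := by
        have h1 : ((j * j + 2 * j : ℕ) : ℂ) = ((j' * j' + 2 * j' : ℕ) : ℂ) := by
          push_cast; rw [← hcj, ← hcj']
        have h2 : j * j + 2 * j = j' * j' + 2 * j' := by exact_mod_cast h1
        nlinarith [sq_nonneg ((j : ℤ) - j')]
      have hkk : k = k' := by
        have h1 : (k : ℂ) * 2 = k' * 2 := by
          have := hj.trans ((congrArg _ hjj).trans hj'.symm)
          exact add_left_cancel this
        have h2 : (k : ℂ) = k' := mul_right_cancel₀ two_ne_zero h1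
        exact_mod_cast h2
      rw [hkk] at hk0
      exact hk' hk0
    refine Submodule.mem_iSup_of_mem ((j : ℤ) - 2 * k) (Module.End.mem_eigenspace_iff.2 ?_)
    rw [sub_eq_zero.1 hw]
    congr 1
    push_cast
    rw [← hj]; ring
  -- Ω commutes with H, so each generalized eigenspace of H is a sum of its intersections with those
  -- of Ω.
  rw [eq_top_iff, ← H.iSup_maxGenEigenspace_eq_top]
  refine iSup_le fun μ => ?_
  have hsub := Submodule.eq_iSup_inf_genEigenspace (p := H.maxGenEigenspace μ) (f := Ω) ⊤
    (fun x hx => Module.End.mapsTo_maxGenEigenspace_of_comm hcomm.symm μ hx)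
    Ω.iSup_maxGenEigenspace_eq_top
  rw [hsub]
  exact iSup_le fun c v hv => hvec μ c v hv.1 hv.2

end Sl2


/-! ### The grading of 𝔤 by the eigenvalues of ad (h/2) -/

section Grade

variable {𝔤 : Type*} [LieRing 𝔤] [LieAlgebra ℂ 𝔤] {e h f : 𝔤}

/-- `x` is in the eigenspace `𝔤(i)`. -/
def IsWt (h : 𝔤) (i : ℚ) (x : 𝔤) : Prop := ⁅(1 / 2 : ℂ) • h, x⁆ = (i : ℂ) • x

theorem mem_gradePart {s : Set ℚ} {i : ℚ} {x : 𝔤} (hi : i ∈ s) (hx : IsWt h i x) :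
    x ∈ gradePart h s :=
  Submodule.mem_iSup_of_mem i (Submodule.mem_iSup_of_mem hi (Module.End.mem_eigenspace_iff.2 hx))

theorem gradePart_le {s : Set ℚ} {N : Submodule ℂ 𝔤} (H : ∀ i ∈ s, ∀ x, IsWt h i x → x ∈ N) :
    gradePart h s ≤ N :=
  iSup₂_le fun i hi x hx => H i hi x (Module.End.mem_eigenspace_iff.1 hx)

theorem gradePart_mono {s t : Set ℚ} (hst : s ⊆ t) : gradePart h s ≤ gradePart h t :=
  gradePart_le fun _ hi _ hx => mem_gradePart (hst hi) hx

theorem mem_halfPart_iff {i : ℚ} {x : 𝔤} : x ∈ gradePart h {i} ↔ IsWt h i x := by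
  refine ⟨fun hx => ?_, mem_gradePart rfl⟩
  have : gradePart h {i} ≤ Module.End.eigenspace (LieAlgebra.ad ℂ 𝔤 ((1 / 2 : ℂ) • h)) (i : ℂ) := by
    refine gradePart_le fun j hj x hx => Module.End.mem_eigenspace_iff.2 ?_
    rw [Set.mem_singleton_iff] at hj
    rw [← hj]
    exact hx
  exact Module.End.mem_eigenspace_iff.1 (this hx)

theorem IsWt.lie {i j : ℚ} {x y : 𝔤} (hx : IsWt h i x) (hy : IsWt h j y) :
    IsWt h (i + j) ⁅x, y⁆ := by
  rw [IsWt] at *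
  rw [leibniz_lie, hx, hy, smul_lie, lie_smul, ← add_smul]
  push_cast; rfl

theorem IsWt.sub {i : ℚ} {x y : 𝔤} (hx : IsWt h i x) (hy : IsWt h i y) : IsWt h i (x - y) := by
  rw [IsWt] at *; rw [lie_sub, hx, hy, smul_sub]

theorem lie_mem_gradePart {s t r : Set ℚ} (H : ∀ i ∈ s, ∀ j ∈ t, i + j ∈ r) {x y : 𝔤}
    (hx : x ∈ gradePart h s) (hy : y ∈ gradePart h t) : ⁅x, y⁆ ∈ gradePart h r := by
  have h1 : ∀ i ∈ s, ∀ x, IsWt h i x → ∀ y ∈ gradePart h t, ⁅x, y⁆ ∈ gradePart h r := by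
    intro i hi x hx y hy
    have : gradePart h t ≤ (gradePart h r).comap (LieAlgebra.ad ℂ 𝔤 x) :=
      gradePart_le fun j hj y hy => mem_gradePart (H i hi j hj) (hx.lie hy)
    exact this hy
  have : gradePart h s ≤ (gradePart h r).comap (LieAlgebra.ad ℂ 𝔤 y) := by
    refine gradePart_le fun i hi x hx => ?_
    rw [Submodule.mem_comap, LieAlgebra.ad_apply, ← lie_skew]
    exact neg_mem (h1 i hi x hx y hy)
  have h2 := this hx
  rw [Submodule.mem_comap, LieAlgebra.ad_apply, ← lie_skew] at h2
  simpa using neg_mem h2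

theorem lie_mem_mPart {x y : 𝔤} (hx : x ∈ nPart h) (hy : y ∈ nPart h) : ⁅x, y⁆ ∈ mPart h :=
  lie_mem_gradePart (fun i hi j hj => by
    simp only [Set.mem_Ici] at *; linarith) hx hy

theorem mPart_le_nPart : mPart h ≤ nPart h :=
  gradePart_mono (Set.Ici_subset_Ici.2 (by norm_num))

theorem halfPart_le_nPart : halfPart h ≤ nPart h :=
  gradePart_mono (by simp)

theorem lie_mem_nPart {x y : 𝔤} (hx : x ∈ nPart h) (hy : y ∈ nPart h) : ⁅x, y⁆ ∈ nPart h :=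
  mPart_le_nPart (lie_mem_mPart hx hy)

theorem lie_mem_nonposPart {x y : 𝔤} (hx : x ∈ nonposPart h) (hy : y ∈ nonposPart h) :
    ⁅x, y⁆ ∈ nonposPart h :=
  lie_mem_gradePart (fun i hi j hj => by
    simp only [Set.mem_Iic] at *; linarith) hx hy

theorem isWt_f (hsl : IsSl2Triple h e f) : IsWt h (-1) f := by
  rw [IsWt, smul_lie, hsl.lie_h_f_nsmul, smul_neg, two_smul, ← two_smul ℂ f, smul_smul]
  norm_num

/-! ### The invariant form and the grading -/

section Invariant

variable {B : LinearMap.BilinForm ℂ 𝔤}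

/-- Invariance under h/2 gives (i + j)(x, y) = 0. -/
theorem bilin_eq_zero_of_wt (hinv : ∀ x y z, B ⁅x, y⁆ z = B x ⁅y, z⁆) {i j : ℚ} {x y : 𝔤}
    (hx : IsWt h i x) (hy : IsWt h j y) (hij : i + j ≠ 0) : B x y = 0 := by
  have h1 := hinv x ((1 / 2 : ℂ) • h) y
  rw [← lie_skew, hx, hy] at h1
  simp only [map_neg, map_smul, LinearMap.neg_apply, LinearMap.smul_apply, smul_eq_mul] at h1
  have h2 : ((i + j : ℚ) : ℂ) * B x y = 0 := by
    push_cast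
    linear_combination -h1
  rcases mul_eq_zero.1 h2 with h3 | h3
  · exact absurd (by exact_mod_cast h3) hij
  · exact h3

theorem bilin_eq_zero_of_mem (hinv : ∀ x y z, B ⁅x, y⁆ z = B x ⁅y, z⁆) {s t : Set ℚ}
    (H : ∀ i ∈ s, ∀ j ∈ t, i + j ≠ 0) {x y : 𝔤}
    (hx : x ∈ gradePart h s) (hy : y ∈ gradePart h t) : B x y = 0 := by
  have h1 : ∀ i ∈ s, ∀ x, IsWt h i x → ∀ y ∈ gradePart h t, B x y = 0 := by
    intro i hi x hx y hy
    have : gradePart h t ≤ LinearMap.ker (B x) :=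
      gradePart_le fun j hj y hy => bilin_eq_zero_of_wt hinv hx hy (H i hi j hj)
    exact this hy
  have : gradePart h s ≤ LinearMap.ker (B.flip y) :=
    gradePart_le fun i hi x hx => h1 i hi x hx y hy
  exact this hx

theorem bilin_nPart (hinv : ∀ x y z, B ⁅x, y⁆ z = B x ⁅y, z⁆) {x y : 𝔤} (hx : x ∈ nPart h)
    (hy : y ∈ nPart h) : B x y = 0 :=
  bilin_eq_zero_of_mem hinv (fun i hi j hj => by
    simp only [Set.mem_Ici] at *; linarith) hx hy

/-- f has weight -1 and pairs only with 𝔤(1), whereas [𝔫, 𝔪] has weights at least 3/2. This is what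
makes the ideal generated by m + (f, m) stable under 𝔫. -/
theorem bilin_f_lie (hsl : IsSl2Triple h e f) (hinv : ∀ x y z, B ⁅x, y⁆ z = B x ⁅y, z⁆) {x y : 𝔤}
    (hx : x ∈ nPart h) (hy : y ∈ mPart h) : B f ⁅x, y⁆ = 0 := by
  refine bilin_eq_zero_of_mem (s := {-1}) (t := Set.Ici (3 / 2)) hinv ?_
    (mem_halfPart_iff.2 (isWt_f hsl))
    (lie_mem_gradePart (s := Set.Ici (1 / 2)) (t := Set.Ici 1) ?_ hx hy)
  · intro i hi j hj
    simp only [Set.mem_Ici, Set.mem_singleton_iff] at *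
    subst hi
    linarith
  · intro i hi j hj
    simp only [Set.mem_Ici] at *
    linarith

theorem bilin_f_nonpos (hsl : IsSl2Triple h e f) (hinv : ∀ x y z, B ⁅x, y⁆ z = B x ⁅y, z⁆)
    {x : 𝔤} (hx : x ∈ nonposPart h) : B f x = 0 := by
  refine bilin_eq_zero_of_mem (s := {-1}) (t := Set.Iic 0) hinv ?_
    (mem_halfPart_iff.2 (isWt_f hsl)) hx
  intro i hi j hj
  simp only [Set.mem_Iic, Set.mem_singleton_iff] at *
  subst hi
  linarith

theorem bilin_f_half (hsl : IsSl2Triple h e f) (hinv : ∀ x y z, B ⁅x, y⁆ z = B x ⁅y, z⁆)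
    {x : 𝔤} (hx : x ∈ halfPart h) : B f x = 0 := by
  refine bilin_eq_zero_of_mem (s := {-1}) (t := {1 / 2}) hinv ?_
    (mem_halfPart_iff.2 (isWt_f hsl)) hx
  intro i hi j hj
  simp only [Set.mem_singleton_iff] at *
  subst hi hj
  norm_num

/-- By invariance the radical is an ideal of the simple algebra 𝔤, and it is not all of 𝔤 since (e,
f) = 1. -/
theorem bilin_nondegenerate [LieAlgebra.IsSimple ℂ 𝔤]
    (hinv : ∀ x y z, B ⁅x, y⁆ z = B x ⁅y, z⁆) (hef : B e f = 1) {x : 𝔤} (hx : ∀ y, B x y = 0) :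
    x = 0 := by
  let R : LieIdeal ℂ 𝔤 :=
    { LinearMap.ker B with
      lie_mem := by
        intro a m hm
        have hm' : B m = 0 := hm
        change B ⁅a, m⁆ = 0
        refine LinearMap.ext fun y => ?_
        rw [← lie_skew, map_neg, LinearMap.neg_apply, hinv, hm', LinearMap.zero_apply,
          LinearMap.zero_apply, neg_zero] }
  have hR : x ∈ R := LinearMap.ext hx
  rcases LieAlgebra.IsSimple.eq_bot_or_eq_top (R := ℂ) R with h | h
  · rw [h] at hR; exact hR
  · have : e ∈ R := by rw [h]; trivial
    have he : B e = 0 := this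
    rw [he] at hef
    simp at hef

end Invariant

/-! ### Half-integral weights, projections, graded inverses and weight bases -/

section FiniteDimensional

variable [FiniteDimensional ℂ 𝔤]

theorem gradePart_half_integers (hsl : IsSl2Triple h e f) :
    gradePart h (Set.range fun n : ℤ => (n : ℚ) / 2) = ⊤ := by
  have key := iSup_eigenspace_int_eq_top (H := LieAlgebra.ad ℂ 𝔤 h) (E := LieAlgebra.ad ℂ 𝔤 e)
    (F := LieAlgebra.ad ℂ 𝔤 f)
    (by
      intro v
      simp only [LieAlgebra.ad_apply]
      rw [leibniz_lie, hsl.lie_h_e_smul ℂ, smul_lie, add_comm])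
    (by
      intro v
      simp only [LieAlgebra.ad_apply]
      rw [leibniz_lie, hsl.lie_lie_smul_f ℂ, neg_lie, smul_lie, add_comm, neg_smul])
    (by
      intro v
      simp only [LieAlgebra.ad_apply]
      rw [leibniz_lie, hsl.lie_e_f, add_comm])
  rw [eq_top_iff, ← key]
  refine iSup_le fun n x hx => ?_
  refine mem_gradePart (i := (n : ℚ) / 2) ⟨n, rfl⟩ ?_
  have hx' : ⁅h, x⁆ = (n : ℂ) • x := Module.End.mem_eigenspace_iff.1 hx
  rw [IsWt, smul_lie, hx', smul_smul]
  congr 1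
  push_cast; ring

/-- Linear maps on `𝔤` are determined by their values on eigenvectors of half-integral weight. -/
theorem ext_wt (hsl : IsSl2Triple h e f) {M : Type*} [AddCommGroup M] [Module ℂ M]
    {T T' : 𝔤 →ₗ[ℂ] M} (H : ∀ (n : ℤ) x, IsWt h ((n : ℚ) / 2) x → T x = T' x) (x : 𝔤) :
    T x = T' x := by
  have : gradePart h (Set.range fun n : ℤ => (n : ℚ) / 2) ≤ LinearMap.eqLocus T T' := by
    refine gradePart_le ?_
    rintro _ ⟨n, rfl⟩ x hx
    exact H n x hx
  rw [gradePart_half_integers hsl] at this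
  exact this (Submodule.mem_top (x := x))

theorem isCompl_gradePart (hsl : IsSl2Triple h e f) (s : Set ℚ) :
    IsCompl (gradePart h s) (gradePart h sᶜ) := by
  constructor
  · have hi : iSupIndep fun i : ℚ =>
        Module.End.eigenspace (LieAlgebra.ad ℂ 𝔤 ((1 / 2 : ℂ) • h)) (i : ℂ) :=
      (Module.End.eigenspaces_iSupIndep (LieAlgebra.ad ℂ 𝔤 ((1 / 2 : ℂ) • h))).comp
        (f := fun i : ℚ => (i : ℂ)) Rat.cast_injective
    exact hi.disjoint_biSup_biSup disjoint_compl_right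
  · rw [codisjoint_iff, eq_top_iff, ← gradePart_half_integers hsl]
    refine gradePart_le fun i _ x hx => ?_
    by_cases his : i ∈ s
    · exact Submodule.mem_sup_left (mem_gradePart his hx)
    · exact Submodule.mem_sup_right (mem_gradePart his hx)

theorem gradeProj_of_mem (hsl : IsSl2Triple h e f) {s : Set ℚ} {x : 𝔤} (hx : x ∈ gradePart h s) :
    gradeProj h s x = ⟨x, hx⟩ := by
  rw [gradeProj, dif_pos (isCompl_gradePart hsl s)]
  exact Submodule.projectionOnto_apply_left _ ⟨x, hx⟩

theorem coe_gradeProj_of_subset (hsl : IsSl2Triple h e f) {s t : Set ℚ} (hst : t ⊆ s) {x : 𝔤}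
    (hx : x ∈ gradePart h t) : (gradeProj h s x : 𝔤) = x := by
  rw [gradeProj_of_mem hsl (gradePart_mono hst hx)]

theorem gradeProj_of_disjoint (hsl : IsSl2Triple h e f) {s t : Set ℚ} (hst : ∀ i ∈ t, i ∉ s) {x : 𝔤}
    (hx : x ∈ gradePart h t) : gradeProj h s x = 0 := by
  rw [gradeProj, dif_pos (isCompl_gradePart hsl s)]
  exact Submodule.projectionOnto_apply_right (isCompl_gradePart hsl s) ⟨x, gradePart_mono hst hx⟩

theorem coe_gradeProj_of_wt (hsl : IsSl2Triple h e f) {s : Set ℚ} {i : ℚ} {x : 𝔤} (hi : i ∈ s)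
    (hx : IsWt h i x) : (gradeProj h s x : 𝔤) = x :=
  coe_gradeProj_of_subset hsl (t := {i}) (by simpa using hi) (mem_halfPart_iff.2 hx)

theorem gradeProj_of_wt_eq_zero (hsl : IsSl2Triple h e f) {s : Set ℚ} {i : ℚ} {x : 𝔤} (hi : i ∉ s)
    (hx : IsWt h i x) : gradeProj h s x = 0 :=
  gradeProj_of_disjoint hsl (t := {i}) (by simpa using hi) (mem_halfPart_iff.2 hx)

theorem half_integer_cases (n : ℤ) : (n : ℚ) / 2 ≤ 0 ∨ (1 / 2 : ℚ) ≤ (n : ℚ) / 2 := by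
  rcases le_or_gt n 0 with h | h
  · left
    have : (n : ℚ) ≤ 0 := by exact_mod_cast h
    linarith
  · right
    have : (1 : ℚ) ≤ n := by exact_mod_cast h
    linarith

theorem gradeProj_nonpos_add (hsl : IsSl2Triple h e f) (x : 𝔤) :
    (gradeProj h (Set.Iic 0) x : 𝔤) + gradeProj h (Set.Ici (1 / 2)) x = x := by
  refine ext_wt hsl (T := (nonposPart h).subtype ∘ₗ gradeProj h (Set.Iic 0)
    + (nPart h).subtype ∘ₗ gradeProj h (Set.Ici (1 / 2))) (T' := LinearMap.id) ?_ x
  intro n x hx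
  simp only [LinearMap.add_apply, LinearMap.comp_apply, Submodule.subtype_apply, LinearMap.id_apply]
  rcases half_integer_cases n with h | h
  · rw [coe_gradeProj_of_wt hsl (Set.mem_Iic.2 h) hx, gradeProj_of_wt_eq_zero hsl _ hx]
    · simp
    · simp only [Set.mem_Ici]; linarith
  · rw [coe_gradeProj_of_wt hsl (Set.mem_Ici.2 h) hx, gradeProj_of_wt_eq_zero hsl _ hx]
    · simp
    · simp only [Set.mem_Iic]; linarith

theorem gradeProj_half_of_mPart (hsl : IsSl2Triple h e f) {x : 𝔤} (hx : x ∈ mPart h) :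
    gradeProj h {1 / 2} x = 0 := by
  refine gradeProj_of_disjoint hsl (fun i hi => ?_) hx
  simp only [Set.mem_Ici, Set.mem_singleton_iff] at *
  linarith

theorem gradeProj_half_of_nonpos (hsl : IsSl2Triple h e f) {x : 𝔤} (hx : x ∈ nonposPart h) :
    gradeProj h {1 / 2} x = 0 := by
  refine gradeProj_of_disjoint hsl (fun i hi => ?_) hx
  simp only [Set.mem_Iic, Set.mem_singleton_iff] at *
  linarith

theorem gradeProj_nPart_of_nonpos (hsl : IsSl2Triple h e f) {x : 𝔤} (hx : x ∈ nonposPart h) :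
    gradeProj h (Set.Ici (1 / 2)) x = 0 := by
  refine gradeProj_of_disjoint hsl (fun i hi => ?_) hx
  simp only [Set.mem_Iic, Set.mem_Ici] at *
  linarith

theorem gradeProj_nonpos_of_nPart (hsl : IsSl2Triple h e f) {x : 𝔤} (hx : x ∈ nPart h) :
    gradeProj h (Set.Iic 0) x = 0 := by
  refine gradeProj_of_disjoint hsl (fun i hi => ?_) hx
  simp only [Set.mem_Iic, Set.mem_Ici] at *
  linarith

/-- No weight lies strictly between 1/2 and 1. -/
theorem sub_gradeProj_half_mem (hsl : IsSl2Triple h e f) {x : 𝔤} (hx : x ∈ nPart h) :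
    x - gradeProj h {1 / 2} x ∈ mPart h := by
  have h1 : gradePart h (Set.range fun n : ℤ => (n : ℚ) / 2) ≤
      (mPart h).comap ((LinearMap.id - (halfPart h).subtype ∘ₗ gradeProj h {1 / 2}) ∘ₗ
        (nPart h).subtype ∘ₗ gradeProj h (Set.Ici (1 / 2))) := by
    refine gradePart_le ?_
    rintro _ ⟨n, rfl⟩ x hx
    simp only [Submodule.mem_comap, LinearMap.comp_apply, Submodule.subtype_apply,
      LinearMap.sub_apply, LinearMap.id_apply]
    rcases half_integer_cases n with h | h
    · rw [gradeProj_of_wt_eq_zero hsl _ hx]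
      · simp
      · simp only [Set.mem_Ici]; linarith
    · rw [coe_gradeProj_of_wt hsl (Set.mem_Ici.2 h) hx]
      rcases eq_or_lt_of_le h with h' | h'
      · rw [coe_gradeProj_of_wt hsl (s := {1 / 2}) h'.symm hx, sub_self]
        exact zero_mem _
      · rw [gradeProj_of_wt_eq_zero hsl (s := {1 / 2}) (by simpa using h'.ne') hx]
        simp only [ZeroMemClass.coe_zero, sub_zero]
        refine mem_gradePart ?_ hx
        have : (1 : ℚ) < n := by linarith
        have : (2 : ℤ) ≤ n := by exact_mod_cast this
        have : (2 : ℚ) ≤ n := by exact_mod_cast this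
        simp only [Set.mem_Ici]; linarith
  rw [gradePart_half_integers hsl] at h1
  have h2 := h1 (Submodule.mem_top (x := x))
  simpa [gradeProj_of_mem hsl hx] using h2

variable {B : LinearMap.BilinForm ℂ 𝔤}

/-- Changing an argument by an element of 𝔪 does not change (f, [x, y]), by `bilin_f_lie`. So Φ,
which sees only the components in 𝔤(1/2), reproduces the form (f, [·,·]) on all of 𝔫. -/
theorem bilin_f_lie_half (hsl : IsSl2Triple h e f) (hinv : ∀ x y z, B ⁅x, y⁆ z = B x ⁅y, z⁆)
    {x y : 𝔤} (hx : x ∈ nPart h) (hy : y ∈ nPart h) :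
    B f ⁅(gradeProj h {1 / 2} x : 𝔤), (gradeProj h {1 / 2} y : 𝔤)⁆ = B f ⁅x, y⁆ := by
  have h1 := bilin_f_lie hsl hinv hx (sub_gradeProj_half_mem hsl hy)
  have h2 := bilin_f_lie hsl hinv (halfPart_le_nPart (gradeProj h {1 / 2} y).2)
    (sub_gradeProj_half_mem hsl hx)
  rw [← lie_skew, map_neg, neg_eq_zero] at h2
  simp only [lie_sub, sub_lie, map_sub] at h1 h2
  linear_combination -h1 - h2

/-- Only finitely many weights occur. -/
theorem exists_finset_wt (h : 𝔤) :
    ∃ W : Finset ℤ, ∀ (n : ℤ) (x : 𝔤), IsWt h ((n : ℚ) / 2) x → n ∉ W → x = 0 := by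
  have hi : iSupIndep fun n : ℤ =>
      Module.End.eigenspace (LieAlgebra.ad ℂ 𝔤 ((1 / 2 : ℂ) • h)) (((n : ℚ) / 2 : ℚ) : ℂ) := by
    refine (Module.End.eigenspaces_iSupIndep (LieAlgebra.ad ℂ 𝔤 ((1 / 2 : ℂ) • h))).comp
        (f := fun n : ℤ => (((n : ℚ) / 2 : ℚ) : ℂ)) fun m n hmn => ?_
    have h1 : (m : ℚ) / 2 = (n : ℚ) / 2 := Rat.cast_injective hmn
    have h2 : (m : ℚ) = n := by linarith
    exact_mod_cast h2
  have hfin := WellFoundedGT.finite_ne_bot_of_iSupIndep hi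
  refine ⟨hfin.toFinset, fun n x hx hn => ?_⟩
  rw [Set.Finite.mem_toFinset, Set.mem_ofPred_eq, not_not] at hn
  have : x ∈ Module.End.eigenspace (LieAlgebra.ad ℂ 𝔤 ((1 / 2 : ℂ) • h)) (((n : ℚ) / 2 : ℚ) : ℂ) :=
    Module.End.mem_eigenspace_iff.2 hx
  rwa [hn, Submodule.mem_bot] at this

/-- A nonzero such x would be a primitive vector of the opposite triple with eigenvalue -2i, which
must be a natural number. -/
theorem eq_zero_of_lie_f_of_wt (hsl : IsSl2Triple h e f) {i : ℚ} (hi : 1 / 2 ≤ i) {x : 𝔤}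
    (hx : IsWt h i x) (hf : ⁅f, x⁆ = 0) : x = 0 := by
  by_contra hne
  have P : IsSl2Triple.HasPrimitiveVectorWith hsl.symm x (-2 * (i : ℂ)) := by
    refine ⟨hne, ?_, hf⟩
    have h1 : ⁅(2 : ℂ) • (1 / 2 : ℂ) • h, x⁆ = (2 : ℂ) • (i : ℂ) • x := by rw [smul_lie, hx]
    rw [smul_smul] at h1
    norm_num at h1
    rw [neg_lie, h1, smul_smul, ← neg_smul]
    congr 1; ring
  obtain ⟨n, hn⟩ := P.exists_nat
  have h1 : -2 * i = n := by exact_mod_cast hn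
  have h2 : (0 : ℚ) ≤ n := n.cast_nonneg
  linarith

/-- A graded left inverse of `ad f : 𝔫 → 𝔤`. -/
theorem exists_leftInverse_ad_f (hsl : IsSl2Triple h e f) :
    ∃ r : 𝔤 →ₗ[ℂ] nPart h, (∀ n : nPart h, r ⁅f, (n : 𝔤)⁆ = n) ∧
      ∀ (m : ℤ) x, IsWt h ((m : ℚ) / 2) x → IsWt h ((m : ℚ) / 2 + 1) (r x : 𝔤) := by
  classical
  obtain ⟨W, hW⟩ := exists_finset_wt h
  let P : ℚ → 𝔤 →ₗ[ℂ] 𝔤 := fun i => (gradePart h {i}).subtype ∘ₗ gradeProj h {i}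
  have hP : ∀ i x, IsWt h i (P i x) := fun i x => mem_halfPart_iff.1 (gradeProj h {i} x).2
  have hPid : ∀ i x, IsWt h i x → P i x = x := fun i x hx => coe_gradeProj_of_wt hsl rfl hx
  have hP0 : ∀ i j x, IsWt h i x → i ≠ j → P j x = 0 := by
    intro i j x hx hij
    simp only [P, LinearMap.comp_apply, gradeProj_of_wt_eq_zero hsl (s := {j}) hij hx, map_zero]
  have hsum : ∀ x, x = ∑ n ∈ W, P ((n : ℚ) / 2) x := by
    intro x
    refine (ext_wt hsl (T := LinearMap.id) (T' := ∑ n ∈ W, P ((n : ℚ) / 2)) ?_ x).trans (by simp)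
    intro n x hx
    rw [LinearMap.sum_apply, LinearMap.id_apply]
    by_cases hn : n ∈ W
    · rw [Finset.sum_eq_single_of_mem n hn, hPid _ _ hx]
      intro m _ hm
      refine hP0 _ _ _ hx fun h => hm ?_
      have h2 : (m : ℚ) = n := by linarith
      exact_mod_cast h2
    · rw [hW n x hx hn]; simp
  have hfP : ∀ i x, ⁅f, P i x⁆ = P (i - 1) ⁅f, x⁆ := by
    intro i x
    refine ext_wt hsl (T := LieAlgebra.ad ℂ 𝔤 f ∘ₗ P i) (T' := P (i - 1) ∘ₗ LieAlgebra.ad ℂ 𝔤 f)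
      ?_ x
    intro n x hx
    simp only [LinearMap.comp_apply, LieAlgebra.ad_apply]
    by_cases h : (n : ℚ) / 2 = i
    · rw [h] at hx
      rw [hPid _ _ hx, hPid]
      have := (isWt_f hsl).lie hx
      rwa [neg_add_eq_sub] at this
    · rw [hP0 _ _ _ hx h, lie_zero, hP0 _ _ _ ((isWt_f hsl).lie hx)]
      intro h'
      apply h
      linarith
  -- The kernel of ad f is graded, and ad f is injective in each weight at least 1/2.
  have hinj : Function.Injective (LieAlgebra.ad ℂ 𝔤 f ∘ₗ (nPart h).subtype) := by
    rw [← LinearMap.ker_eq_bot, Submodule.eq_bot_iff]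
    rintro ⟨x, hx⟩ hfx
    have hfx' : ⁅f, x⁆ = 0 := hfx
    have hx0 : x = 0 := by
      rw [hsum x]
      refine Finset.sum_eq_zero fun n _ => ?_
      rcases half_integer_cases n with hn | hn
      · have : x ∈ LinearMap.ker (P ((n : ℚ) / 2)) := by
          refine (gradePart_le (N := LinearMap.ker (P ((n : ℚ) / 2))) (fun i hi x hx => ?_)) hx
          refine hP0 _ _ _ hx fun h => ?_
          rw [Set.mem_Ici] at hi
          linarith
        exact this
      · refine eq_zero_of_lie_f_of_wt hsl hn (hP _ _) ?_
        rw [hfP, hfx', map_zero]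
    exact Subtype.ext hx0
  obtain ⟨r₀, hr₀⟩ := LinearMap.exists_leftInverse_of_injective _ (LinearMap.ker_eq_bot.2 hinj)
  have hPn : ∀ i x, x ∈ nPart h → P i x ∈ nPart h := by
    intro i x hx
    refine (gradePart_le (N := (nPart h).comap (P i)) (fun j hj x hx => ?_)) hx
    rw [Submodule.mem_comap]
    by_cases hij : j = i
    · rw [← hij, hPid _ _ hx]; exact mem_gradePart hj hx
    · rw [hP0 _ _ _ hx hij]; exact zero_mem _
  -- An arbitrary left inverse r₀ is made graded by keeping its component of degree 1. It remains a
  -- left inverse because ad f has degree -1.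
  let r : 𝔤 →ₗ[ℂ] nPart h := ∑ n ∈ W,
    (P ((n : ℚ) / 2 + 1)).restrict (fun x hx => hPn _ x hx) ∘ₗ r₀ ∘ₗ P ((n : ℚ) / 2)
  have hr : ∀ (m : ℤ) x, IsWt h ((m : ℚ) / 2) x → (r x : 𝔤) = P ((m : ℚ) / 2 + 1) (r₀ x) := by
    intro m x hx
    simp only [r, LinearMap.sum_apply, LinearMap.comp_apply, AddSubmonoidClass.coe_finsetSum,
      LinearMap.coe_restrict_apply]
    by_cases hm : m ∈ W
    · rw [Finset.sum_eq_single_of_mem m hm, hPid _ _ hx]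
      intro n _ hn
      rw [hP0 _ _ _ hx, map_zero, ZeroMemClass.coe_zero, map_zero]
      intro h
      apply hn
      have h2 : (n : ℚ) = m := by linarith
      exact_mod_cast h2
    · rw [hW m x hx hm]; simp
  refine ⟨r, ?_, fun m x hx => by rw [hr m x hx]; exact hP _ _⟩
  have hid : ∀ n : nPart h, r₀ ⁅f, (n : 𝔤)⁆ = n := fun n => LinearMap.congr_fun hr₀ n
  have := ext_wt hsl (T := (nPart h).subtype ∘ₗ r ∘ₗ LieAlgebra.ad ℂ 𝔤 f ∘ₗ (nPart h).subtype ∘ₗ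
    gradeProj h (Set.Ici (1 / 2))) (T' := (nPart h).subtype ∘ₗ gradeProj h (Set.Ici (1 / 2))) (by
    intro n x hx
    simp only [LinearMap.comp_apply, Submodule.subtype_apply, LieAlgebra.ad_apply]
    rcases half_integer_cases n with hn | hn
    · rw [gradeProj_of_wt_eq_zero hsl _ hx]
      · simp
      · simp only [Set.mem_Ici]; linarith
    · have hxn := mem_gradePart (Set.mem_Ici.2 hn) hx
      rw [gradeProj_of_mem hsl hxn]
      have hfx : IsWt h (((n - 2 : ℤ) : ℚ) / 2) ⁅f, x⁆ := by
        have := (isWt_f hsl).lie hx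
        convert this using 1
        push_cast; ring
      rw [hr (n - 2) _ hfx, hid ⟨x, hxn⟩]
      refine (hPid _ _ ?_)
      convert hx using 1
      push_cast; ring)
  intro n
  have h2 := this n
  simp only [LinearMap.comp_apply, Submodule.subtype_apply, LieAlgebra.ad_apply,
    gradeProj_of_mem hsl n.2] at h2
  exact Subtype.ext h2

/-- `θ` vanishes on the weight spaces of weight different from `i`. -/
def DualWt (h : 𝔤) (i : ℚ) (θ : Module.Dual ℂ (nPart h)) : Prop :=
  ∀ (j : ℤ) (n : nPart h), IsWt h ((j : ℚ) / 2) (n : 𝔤) → (j : ℚ) / 2 ≠ i → θ n = 0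

/-- A graded right inverse of the map `𝔤 → 𝔫*`, `y ↦ -(f, [·, y])`. -/
theorem exists_dual_section [LieAlgebra.IsSimple ℂ 𝔤] (hsl : IsSl2Triple h e f)
    (hsymm : ∀ x y, B x y = B y x) (hinv : ∀ x y z, B ⁅x, y⁆ z = B x ⁅y, z⁆) (hef : B e f = 1) :
    ∃ s : Module.Dual ℂ (nPart h) →ₗ[ℂ] 𝔤,
      (∀ θ (n : nPart h), -(B f ⁅(n : 𝔤), s θ⁆) = θ n) ∧
      ∀ (i : ℚ) θ, DualWt h i θ → IsWt h (1 - i) (s θ) := by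
  obtain ⟨r, hr, hrw⟩ := exists_leftInverse_ad_f hsl
  have hB : Function.Injective B := by
    rw [← LinearMap.ker_eq_bot, Submodule.eq_bot_iff]
    intro x hx
    exact bilin_nondegenerate hinv hef fun y => by
      rw [LinearMap.mem_ker.1 hx, LinearMap.zero_apply]
  let Beq : 𝔤 ≃ₗ[ℂ] Module.Dual ℂ 𝔤 := LinearEquiv.ofInjectiveOfFinrankEq B hB
    (Subspace.dual_finrank_eq).symm
  -- s θ is the element with (sθ, x) = -θ(r x). Then (f, [n, sθ]) = ([f, n], sθ) = -θ(r[f, n]) =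
  -- -θ(n).
  let s : Module.Dual ℂ (nPart h) →ₗ[ℂ] 𝔤 :=
    Beq.symm.toLinearMap ∘ₗ (-LinearMap.lcomp ℂ ℂ r)
  have hs : ∀ θ x, B (s θ) x = -θ (r x) := by
    intro θ x
    have : Beq (s θ) = -(θ ∘ₗ r) := by
      simp only [s, LinearMap.comp_apply, LinearEquiv.coe_coe, LinearEquiv.apply_symm_apply]
      rfl
    have h2 := LinearMap.congr_fun this x
    exact h2
  refine ⟨s, fun θ n => ?_, fun i θ hθ => ?_⟩
  · rw [← hinv, hsymm, hs, hr, neg_neg]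
  · rw [IsWt, ← sub_eq_zero]
    refine bilin_nondegenerate hinv hef fun y => ?_
    refine ext_wt hsl (T := B (⁅(1 / 2 : ℂ) • h, s θ⁆ - ((1 - i : ℚ) : ℂ) • s θ)) (T' := 0) ?_ y
    intro m x hx
    have h1 : ⁅(1 / 2 : ℂ) • h, s θ⁆ = -⁅s θ, (1 / 2 : ℂ) • h⁆ := (lie_skew _ _).symm
    rw [h1]
    simp only [map_sub, map_neg, map_smul, LinearMap.sub_apply, LinearMap.neg_apply,
      LinearMap.smul_apply, LinearMap.zero_apply, hinv]
    rw [hx, map_smul, hs]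
    by_cases hm : (m : ℚ) / 2 + 1 = i
    · rw [← hm]; push_cast; simp only [smul_eq_mul]; ring
    · have : θ (r x) = 0 := by
        -- r raises weights by 1, so r x has weight (m + 2)/2, which is different from i.
        refine hθ (m + 2) _ ?_ ?_
        · convert hrw m x hx using 1
          push_cast; ring
        · intro h; apply hm; rw [← h]; push_cast; ring
      rw [this]; simp

/-- `𝔫` has a basis of weight vectors. -/
theorem exists_wt_basis (hsl : IsSl2Triple h e f) :
    ∃ (I : Type) (_ : Fintype I) (u : Module.Basis I ℂ (nPart h)) (w : I → ℤ),
      (∀ α, 1 ≤ w α) ∧ (∀ α, IsWt h ((w α : ℚ) / 2) (u α : 𝔤)) ∧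
      ∀ α, DualWt h ((w α : ℚ) / 2) (u.coord α) := by
  classical
  let s : Set (nPart h) := {n | ∃ m : ℤ, 1 ≤ m ∧ IsWt h ((m : ℚ) / 2) (n : 𝔤)}
  have hs : ⊤ ≤ Submodule.span ℂ s := by
    intro n _
    have h1 : gradePart h (Set.range fun n : ℤ => (n : ℚ) / 2) ≤
        (Submodule.span ℂ s).comap (gradeProj h (Set.Ici (1 / 2))) := by
      refine gradePart_le ?_
      rintro _ ⟨m, rfl⟩ x hx
      rw [Submodule.mem_comap]
      rcases half_integer_cases m with hm | hm
      · rw [gradeProj_of_wt_eq_zero hsl _ hx]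
        · exact zero_mem _
        · simp only [Set.mem_Ici]; linarith
      · refine Submodule.subset_span ⟨m, ?_, ?_⟩
        · have : (1 : ℚ) ≤ m := by linarith
          exact_mod_cast this
        · rwa [coe_gradeProj_of_wt hsl (Set.mem_Ici.2 hm) hx]
    rw [gradePart_half_integers hsl] at h1
    have h2 := h1 (Submodule.mem_top (x := (n : 𝔤)))
    rwa [Submodule.mem_comap, gradeProj_of_mem hsl n.2] at h2
  let b := Module.Basis.ofSpan hs
  have hb : ∀ i, b i ∈ s := fun i => Module.Basis.ofSpan_subset hs ⟨i, rfl⟩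
  let u : Module.Basis (Fin (Module.finrank ℂ (nPart h))) ℂ (nPart h) :=
    b.reindex (b.indexEquiv (Module.finBasis ℂ (nPart h)))
  have hu : ∀ α, u α ∈ s := fun α => by
    rw [Module.Basis.reindex_apply]; exact hb _
  choose w hw1 hw using hu
  refine ⟨Fin (Module.finrank ℂ (nPart h)), inferInstance, u, w, hw1, hw, fun α j n hn hj => ?_⟩
  have hstab : ∀ n ∈ nPart h, LieAlgebra.ad ℂ 𝔤 ((1 / 2 : ℂ) • h) n ∈ nPart h := by
    intro n hn
    refine (gradePart_le (N := (nPart h).comap (LieAlgebra.ad ℂ 𝔤 ((1 / 2 : ℂ) • h)))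
      (fun i hi x hx => ?_)) hn
    rw [Submodule.mem_comap, LieAlgebra.ad_apply, hx]
    exact Submodule.smul_mem _ _ (mem_gradePart hi hx)
  have hco : ∀ (m : ℤ) (n : nPart h), IsWt h ((m : ℚ) / 2) (n : 𝔤) →
      (LieAlgebra.ad ℂ 𝔤 ((1 / 2 : ℂ) • h)).restrict hstab n = (((m : ℚ) / 2 : ℚ) : ℂ) • n :=
    fun m n hn => Subtype.ext hn
  -- Each basis vector is an eigenvector of ad (h/2), so each coordinate functional is an
  -- eigenvector of its transpose and pairs trivially with the other weights.
  have key : u.coord α ∘ₗ (LieAlgebra.ad ℂ 𝔤 ((1 / 2 : ℂ) • h)).restrict hstab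
      = (((w α : ℚ) / 2 : ℚ) : ℂ) • u.coord α := by
    refine u.ext fun β => ?_
    rw [LinearMap.comp_apply, hco _ _ (hw β), map_smul, LinearMap.smul_apply,
      Module.Basis.coord_apply, Module.Basis.repr_self]
    by_cases hαβ : α = β
    · rw [hαβ]
    · rw [Finsupp.single_eq_of_ne hαβ]; simp
  have h1 := LinearMap.congr_fun key n
  rw [LinearMap.comp_apply, hco _ _ hn, map_smul, LinearMap.smul_apply, ← sub_eq_zero,
    ← sub_smul] at h1
  refine (smul_eq_zero.1 h1).resolve_left ?_
  exact fun h2 => hj (Rat.cast_injective (sub_eq_zero.1 h2))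

end FiniteDimensional

end Grade


/-- The hypotheses on the `sl₂`-triple and the invariant form. -/
structure IsDatum {𝔤 : Type*} [LieRing 𝔤] [LieAlgebra ℂ 𝔤] (B : LinearMap.BilinForm ℂ 𝔤)
    (e h f : 𝔤) : Prop where
  sl2 : IsSl2Triple h e f
  symm : ∀ x y, B x y = B y x
  inv : ∀ x y z, B ⁅x, y⁆ z = B x ⁅y, z⁆
  ef : B e f = 1

/-! ### λ-brackets of the generators of S(R) -/

section Table

variable {𝔤 : Type*} [LieRing 𝔤] [LieAlgebra ℂ 𝔤] {e h f : 𝔤} {B : LinearMap.BilinForm ℂ 𝔤} {k : ℂ}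

theorem hasPar_cur (a : 𝔤) : HasPar false (cur h a) := hasPar_false.2 (σ_cur h a)
theorem hasPar_Phi (b : halfPart h) : HasPar false (Phi h b) := hasPar_false.2 (σ_Phi h b)
theorem hasPar_phi (n : nPart h) : HasPar true (phi h n) := hasPar_true.2 (σ_phi h n)
theorem hasPar_phiDual (θ : Module.Dual ℂ (nPart h)) : HasPar true (phiDual h θ) :=
  hasPar_true.2 (σ_phiDual h θ)

theorem brst_br_gen (D : IsDatum B e h f) (v w : (𝔤 × halfPart h) × (nPart h × Module.Dual ℂ (nPart h))) :
    (brstData B h f k).br (gen 0 v) (gen 0 w) = C (cur h ⁅v.1.1, w.1.1⁆)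
      + X * C (algebraMap ℂ _ (k * B v.1.1 w.1.1))
      + C (algebraMap ℂ _ (B f ⁅(v.1.2 : 𝔤), (w.1.2 : 𝔤)⁆ + (w.2.2 v.2.1 + v.2.2 w.2.1))) :=
  (br_gen_gen (isSkew_brstBracket D.symm) v w).trans (brstBracket_apply v w)

theorem br_cur_cur (D : IsDatum B e h f) (a b : 𝔤) : (brstData B h f k).br (cur h a) (cur h b)
    = C (cur h ⁅a, b⁆) + X * C (algebraMap ℂ _ (k * B a b)) :=
  (brst_br_gen D _ _).trans (by simp)
theorem br_cur_Phi (D : IsDatum B e h f) (a : 𝔤) (b : halfPart h) :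
    (brstData B h f k).br (cur h a) (Phi h b) = 0 := (brst_br_gen D _ _).trans (by simp)
theorem br_cur_phi (D : IsDatum B e h f) (a : 𝔤) (n : nPart h) :
    (brstData B h f k).br (cur h a) (phi h n) = 0 := (brst_br_gen D _ _).trans (by simp)
theorem br_cur_phiDual (D : IsDatum B e h f) (a : 𝔤) (θ : Module.Dual ℂ (nPart h)) :
    (brstData B h f k).br (cur h a) (phiDual h θ) = 0 := (brst_br_gen D _ _).trans (by simp)
theorem br_Phi_cur (D : IsDatum B e h f) (b : halfPart h) (a : 𝔤) :
    (brstData B h f k).br (Phi h b) (cur h a) = 0 := (brst_br_gen D _ _).trans (by simp)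
theorem br_Phi_Phi (D : IsDatum B e h f) (b c : halfPart h) :
    (brstData B h f k).br (Phi h b) (Phi h c) = C (algebraMap ℂ _ (B f ⁅(b : 𝔤), (c : 𝔤)⁆)) :=
  (brst_br_gen D _ _).trans (by simp)
theorem br_Phi_phi (D : IsDatum B e h f) (b : halfPart h) (n : nPart h) :
    (brstData B h f k).br (Phi h b) (phi h n) = 0 := (brst_br_gen D _ _).trans (by simp)
theorem br_Phi_phiDual (D : IsDatum B e h f) (b : halfPart h) (θ : Module.Dual ℂ (nPart h)) :
    (brstData B h f k).br (Phi h b) (phiDual h θ) = 0 := (brst_br_gen D _ _).trans (by simp)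
theorem br_phi_cur (D : IsDatum B e h f) (n : nPart h) (a : 𝔤) :
    (brstData B h f k).br (phi h n) (cur h a) = 0 := (brst_br_gen D _ _).trans (by simp)
theorem br_phi_Phi (D : IsDatum B e h f) (n : nPart h) (b : halfPart h) :
    (brstData B h f k).br (phi h n) (Phi h b) = 0 := (brst_br_gen D _ _).trans (by simp)
theorem br_phi_phi (D : IsDatum B e h f) (n m : nPart h) :
    (brstData B h f k).br (phi h n) (phi h m) = 0 := (brst_br_gen D _ _).trans (by simp)
theorem br_phi_phiDual (D : IsDatum B e h f) (n : nPart h) (θ : Module.Dual ℂ (nPart h)) :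
    (brstData B h f k).br (phi h n) (phiDual h θ) = C (algebraMap ℂ _ (θ n)) :=
  (brst_br_gen D _ _).trans (by simp)
theorem br_phiDual_cur (D : IsDatum B e h f) (θ : Module.Dual ℂ (nPart h)) (a : 𝔤) :
    (brstData B h f k).br (phiDual h θ) (cur h a) = 0 := (brst_br_gen D _ _).trans (by simp)
theorem br_phiDual_Phi (D : IsDatum B e h f) (θ : Module.Dual ℂ (nPart h)) (b : halfPart h) :
    (brstData B h f k).br (phiDual h θ) (Phi h b) = 0 := (brst_br_gen D _ _).trans (by simp)
theorem br_phiDual_phi (D : IsDatum B e h f) (θ : Module.Dual ℂ (nPart h)) (n : nPart h) :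
    (brstData B h f k).br (phiDual h θ) (phi h n) = C (algebraMap ℂ _ (θ n)) :=
  (brst_br_gen D _ _).trans (by simp)
theorem br_phiDual_phiDual (D : IsDatum B e h f) (θ η : Module.Dual ℂ (nPart h)) :
    (brstData B h f k).br (phiDual h θ) (phiDual h η) = 0 := (brst_br_gen D _ _).trans (by simp)

/-- The Leibniz rule for a homogeneous first argument. -/
theorem brst_br_mul {o : Bool} {a : C₁ h} (ha : HasPar o a) (b c : C₁ h) :
    (brstData B h f k).br a (b * c) = C (twist o b) * (brstData B h f k).br a c
      + (brstData B h f k).br a b * C c := br_mul (isEven_brstBracket B h f k) ha b c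

theorem brst_br_even_mul {a : C₁ h} (ha : HasPar false a) (b c : C₁ h) :
    (brstData B h f k).br a (b * c) = C b * (brstData B h f k).br a c
      + (brstData B h f k).br a b * C c := brst_br_mul ha b c

theorem brst_br_odd_mul {a : C₁ h} (ha : HasPar true a) (b c : C₁ h) :
    (brstData B h f k).br a (b * c) = C (σ b) * (brstData B h f k).br a c
      + (brstData B h f k).br a b * C c := brst_br_mul ha b c

theorem brst_br_algebraMap (a : C₁ h) (r : ℂ) :
    (brstData B h f k).br a (algebraMap ℂ _ r) = 0 := br_algebraMap _ a r

/-- Skewsymmetry for a first argument whose bracket is of degree at most one. -/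
theorem brst_br_swap (D : IsDatum B e h f) {o : Bool} {a b : C₁ h} (ha : HasPar o a) {p q : C₁ h}
    (hb : (brstData B h f k).br (twist o b) a = C p + X * C q) :
    (brstData B h f k).br a b = C (del q - p) + X * C q := by
  have := br_skew (isEven_brstBracket B h f k) (isSkew_brstBracket D.symm) ha b
  rw [show (freeData (brstBracket B h f k)).br (twist o b) a = C p + X * C q from hb, map_add,
    skewSubst_X_mul, skewSubst_C, skewSubst_C, lamAdd_C] at this
  rw [show (brstData B h f k).br a b = _ from this, C_sub]
  abel

theorem phiDual_mul (θ : Module.Dual ℂ (nPart h)) (x : C₁ h) :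
    phiDual h θ * x = σ x * phiDual h θ := (hasPar_phiDual θ).mul_comm x
theorem phiDual_mul_phiDual (θ η : Module.Dual ℂ (nPart h)) :
    phiDual h θ * phiDual h η = -(phiDual h η * phiDual h θ) := by
  rw [phiDual_mul, σ_phiDual, neg_mul]

end Table

/-! ### The differential d_(0) on φ_n, φ^θ, Φ_b and J_a -/

section Differential

variable {𝔤 : Type*} [LieRing 𝔤] [LieAlgebra ℂ 𝔤] {e h f : 𝔤} {B : LinearMap.BilinForm ℂ 𝔤} {k : ℂ}
  {I : Type*} [Fintype I] {u : Module.Basis I ℂ (nPart h)}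

theorem brst_mul (a b : C₁ h) : (brst B h f k u).d (a * b)
    = σ a * (brst B h f k u).d b + (brst B h f k u).d a * b := (brst B h f k u).d_mul a b

theorem brst_apply (a : C₁ h) :
    (brst B h f k u).d a = ((brstData B h f k).br (brstElement B h f u) a).coeff 0 := rfl

theorem brst_algebraMap (r : ℂ) : (brst B h f k u).d (algebraMap ℂ _ r) = 0 := by
  rw [brst_apply, brst_br_algebraMap, coeff_zero]

theorem brst_del (a : C₁ h) : (brst B h f k u).d (del a) = del ((brst B h f k u).d a) := by
  rw [brst_apply, brst_apply, ← coeff_lamAdd_zero]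
  exact congrArg (fun p => coeff p 0) (br_del_right _ _)

theorem brst_σ (a : C₁ h) : (brst B h f k u).d (σ a) = -σ ((brst B h f k u).d a) :=
  (brst B h f k u).d_par a

theorem hasPar_brstElement : HasPar true (brstElement B h f u) :=
  hasPar_true.2 (σ_brstElement B h f u)

/-- By skewsymmetry {d_λ a} is -{σ(a)_{-λ-∂} d}, with constant term ∂q - p. The bracket with d on
the right is the one that the left Leibniz rule expands. -/
theorem brst_eq (D : IsDatum B e h f) {a p q : C₁ h}
    (ha : (brstData B h f k).br (σ a) (brstElement B h f u) = C p + X * C q) :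
    (brst B h f k u).d a = del q - p := by
  rw [brst_apply, brst_br_swap D hasPar_brstElement (o := true) ha]
  simp

theorem brst_eq_odd (D : IsDatum B e h f) {a p : C₁ h} (hσ : σ a = -a)
    (ha : (brstData B h f k).br a (brstElement B h f u) = C p) :
    (brst B h f k u).d a = p := by
  rw [brst_eq D (p := -p) (q := 0), map_zero, zero_sub, neg_neg]
  rw [hσ, map_neg, LinearMap.neg_apply, ha]
  simp

/-! Sums over dual bases. -/

theorem sum_smul_phiDual (θ : Module.Dual ℂ (nPart h)) :
    ∑ α, θ (u α) • phiDual h (u.coord α) = phiDual h θ := by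
  simp only [← map_smul]
  rw [← map_sum]
  congr 1
  refine u.ext fun β => ?_
  rw [LinearMap.sum_apply]
  rw [Finset.sum_eq_single β]
  · simp
  · intro α _ hαβ
    simp [Finsupp.single_eq_of_ne hαβ]
  · simp

theorem sum_coord_smul {M : Type*} [AddCommGroup M] [Module ℂ M] (F : nPart h →ₗ[ℂ] M) (n : nPart h) :
    ∑ α, u.coord α n • F (u α) = F n := by
  simp only [← map_smul]
  rw [← map_sum]
  congr 1
  exact u.sum_repr n

/-- Both sums come from the element of 𝔫* ⊗ 𝔫 that corresponds to the endomorphism P. -/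
theorem sum_phiDual_comp_mul (P : nPart h →ₗ[ℂ] nPart h) (F : nPart h →ₗ[ℂ] C₁ h) :
    ∑ α, phiDual h (u.coord α ∘ₗ P) * F (u α) = ∑ α, phiDual h (u.coord α) * F (P (u α)) := by
  have h1 : ∀ α, phiDual h (u.coord α ∘ₗ P) * F (u α)
      = ∑ β, phiDual h (u.coord β) * (u.coord α (P (u β)) • F (u α)) := by
    intro α
    rw [← sum_smul_phiDual (u := u) (u.coord α ∘ₗ P), Finset.sum_mul]
    refine Finset.sum_congr rfl fun β _ => ?_
    rw [smul_mul_assoc, mul_smul_comm]; rfl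
  simp only [h1]
  rw [Finset.sum_comm]
  refine Finset.sum_congr rfl fun β _ => ?_
  rw [← Finset.mul_sum, sum_coord_smul]

/-- The products x_α x_β see only the antisymmetric part of G; this absorbs the factor 1/2 in d. -/
theorem half_sum_antisymm {ι A : Type*} [Fintype ι] [Ring A] [Algebra ℂ A] {x : ι → A}
    (hx : ∀ α β, x α * x β = -(x β * x α)) (G : ι → ι → A) :
    (1 / 2 : ℂ) • ∑ α, ∑ β, x α * x β * (G α β - G β α) = ∑ α, ∑ β, x α * x β * G α β := by
  have : ∑ α, ∑ β, x α * x β * G β α = -∑ α, ∑ β, x α * x β * G α β := by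
    rw [Finset.sum_comm, ← Finset.sum_neg_distrib]
    refine Finset.sum_congr rfl fun β _ => ?_
    rw [← Finset.sum_neg_distrib]
    refine Finset.sum_congr rfl fun α _ => ?_
    rw [hx α β, neg_mul]
  simp only [mul_sub, Finset.sum_sub_distrib]
  rw [this, sub_neg_eq_add, ← two_smul ℂ, smul_smul]; norm_num

/-- `J` as a linear map. -/
def Jlin (h : 𝔤) (u : Module.Basis I ℂ (nPart h)) : 𝔤 →ₗ[ℂ] C₁ h :=
  cur h + ∑ α, LinearMap.mulLeft ℂ (phiDual h (u.coord α)) ∘ₗ phi h ∘ₗ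
    gradeProj h (Set.Ici (1 / 2)) ∘ₗ LieAlgebra.ad ℂ 𝔤 (u α : 𝔤)

theorem Jlin_apply (a : 𝔤) : Jlin h u a = J h u a := by
  simp [Jlin, J]

/-- The cocycle-like element `T(a) = J_{a_≤} - Φ_{a_{1/2}} - (f, a)`. -/
def Tmap (B : LinearMap.BilinForm ℂ 𝔤) (h f : 𝔤) (u : Module.Basis I ℂ (nPart h)) :
    𝔤 →ₗ[ℂ] C₁ h :=
  Jlin h u ∘ₗ (nonposPart h).subtype ∘ₗ gradeProj h (Set.Iic 0) - Phi h ∘ₗ gradeProj h {1 / 2}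
    - Algebra.linearMap ℂ (C₁ h) ∘ₗ B f

theorem Tmap_apply (a : 𝔤) : Tmap B h f u a = J h u (gradeProj h (Set.Iic 0) a)
    - Phi h (gradeProj h {1 / 2} a) - algebraMap ℂ _ (B f a) := by
  simp [Tmap, Jlin_apply]

/-- The functional `(a, ·)` on `𝔫`. -/
def pairing (B : LinearMap.BilinForm ℂ 𝔤) (h : 𝔤) : 𝔤 →ₗ[ℂ] Module.Dual ℂ (nPart h) :=
  LinearMap.lcomp ℂ ℂ (nPart h).subtype ∘ₗ B

theorem pairing_apply (a : 𝔤) (n : nPart h) : pairing B h a n = B a n := rfl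

theorem brst_cur (D : IsDatum B e h f) (a : 𝔤) : (brst B h f k u).d (cur h a)
    = ∑ α, phiDual h (u.coord α) * cur h ⁅(u α : 𝔤), a⁆ + k • del (phiDual h (pairing B h a)) := by
  rw [brst_eq D (p := ∑ α, phiDual h (u.coord α) * cur h ⁅a, (u α : 𝔤)⁆)
    (q := k • phiDual h (pairing B h a))]
  · rw [map_smul, sub_eq_add_neg, add_comm, ← Finset.sum_neg_distrib]
    congr 1
    refine Finset.sum_congr rfl fun α _ => ?_
    rw [← mul_neg, ← map_neg, lie_skew]
  · rw [σ_cur, brstElement]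
    simp only [map_add, map_sum, map_smul, brst_br_even_mul (hasPar_cur a), br_cur_cur D,
      br_cur_Phi D, br_cur_phi D, br_cur_phiDual D, brst_br_algebraMap, mul_zero, zero_mul,
      add_zero, Finset.sum_const_zero, smul_zero, mul_add, Finset.sum_add_distrib]
    simp only [← C_mul]
    congr 1
    rw [← sum_smul_phiDual (u := u) (pairing B h a), Finset.smul_sum, map_sum, Finset.mul_sum]
    refine Finset.sum_congr rfl fun α _ => ?_
    rw [← mul_assoc, ← X_mul_C, mul_assoc, ← C_mul, ← Algebra.commutes, ← Algebra.smul_def,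
      mul_smul, pairing_apply]

/-- The functional `(f, [·, a])` on `𝔫`. -/
def fpair (B : LinearMap.BilinForm ℂ 𝔤) (h f : 𝔤) : 𝔤 →ₗ[ℂ] Module.Dual ℂ (nPart h) where
  toFun a := -(B f ∘ₗ LieAlgebra.ad ℂ 𝔤 a ∘ₗ (nPart h).subtype)
  map_add' a b := by ext; simp [add_comm]
  map_smul' c a := by ext; simp

theorem fpair_apply (a : 𝔤) (n : nPart h) : fpair B h f a n = B f ⁅(n : 𝔤), a⁆ := by
  rw [← lie_skew, map_neg]; rfl

theorem sum_phiDual_mul_algebraMap (θ : Module.Dual ℂ (nPart h)) :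
    ∑ α, phiDual h (u.coord α) * algebraMap ℂ _ (θ (u α)) = phiDual h θ := by
  rw [← sum_smul_phiDual (u := u) θ]
  refine Finset.sum_congr rfl fun α _ => ?_
  rw [← Algebra.commutes, ← Algebra.smul_def]

theorem brst_Phi [FiniteDimensional ℂ 𝔤] (D : IsDatum B e h f) (b : halfPart h) :
    (brst B h f k u).d (Phi h b) = phiDual h (fpair B h f b) := by
  rw [brst_eq D (p := -phiDual h (fpair B h f b)) (q := 0), map_zero, zero_sub, neg_neg]
  rw [σ_Phi, brstElement]
  simp only [map_add, map_sum, map_smul, brst_br_even_mul (hasPar_Phi b), br_Phi_cur D,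
      br_Phi_Phi D, br_Phi_phi D, br_Phi_phiDual D, brst_br_algebraMap, mul_zero, zero_mul,
      add_zero, zero_add, Finset.sum_const_zero, smul_zero, map_zero]
  simp only [← C_mul]
  rw [← map_sum, ← (phiDual h).map_neg, ← sum_phiDual_mul_algebraMap (u := u)]
  congr 1
  refine Finset.sum_congr rfl fun α _ => ?_
  have hb := bilin_f_lie_half D.sl2 D.inv (u α).2 (halfPart_le_nPart b.2)
  rw [gradeProj_of_mem D.sl2 b.2] at hb
  rw [LinearMap.neg_apply, fpair_apply, ← hb, ← lie_skew, map_neg]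

theorem brst_phi (D : IsDatum B e h f) (n : nPart h) :
    (brst B h f k u).d (phi h n) = J h u n + algebraMap ℂ _ (B f n)
      + Phi h (gradeProj h {1 / 2} (n : 𝔤)) := by
  refine brst_eq_odd D (σ_phi h n) ?_
  rw [brstElement]
  simp only [map_add, map_sum, map_smul,
    brst_br_odd_mul (hasPar_phi n), br_phi_cur D,
    br_phi_Phi D, br_phi_phi D, br_phi_phiDual D, brst_br_algebraMap, mul_zero,
    add_zero, zero_add, σ_phiDual]
  simp only [← C_mul, ← C_add, ← map_sum, Polynomial.smul_C, ← Algebra.smul_def]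
  congr 1
  have h1 : ∑ α, u.coord α n • (cur h (u α : 𝔤) + algebraMap ℂ (C₁ h) (B f (u α))
      + Phi h (gradeProj h {1 / 2} (u α : 𝔤)))
      = cur h (n : 𝔤) + algebraMap ℂ _ (B f n) + Phi h (gradeProj h {1 / 2} (n : 𝔤)) :=
    sum_coord_smul (u := u) (cur h ∘ₗ (nPart h).subtype
      + Algebra.linearMap ℂ (C₁ h) ∘ₗ B f ∘ₗ (nPart h).subtype
      + Phi h ∘ₗ gradeProj h {1 / 2} ∘ₗ (nPart h).subtype) n
  -- φ_n can be contracted with either of the two factors φ^{v^α}, φ^{v^β} of the cubic term of d.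
  -- The contributions agree after exchanging α and β, which cancels the factor 1/2.
  have h2 : ∑ α, ∑ β, (-phiDual h (u.coord α) * algebraMap ℂ (C₁ h) (u.coord β n)
        + u.coord α n • phiDual h (u.coord β))
          * phi h (gradeProj h (Set.Ici (1 / 2)) ⁅(u β : 𝔤), (u α : 𝔤)⁆)
      = (2 : ℂ) • ∑ α, phiDual h (u.coord α) *
        phi h (gradeProj h (Set.Ici (1 / 2)) ⁅(u α : 𝔤), (n : 𝔤)⁆) := by
    simp only [add_mul, Finset.sum_add_distrib]
    rw [two_smul]
    congr 1
    · refine Finset.sum_congr rfl fun α _ => ?_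
      have := sum_coord_smul (u := u) (phi h ∘ₗ gradeProj h (Set.Ici (1 / 2)) ∘ₗ
        LieAlgebra.ad ℂ 𝔤 (u α : 𝔤) ∘ₗ (nPart h).subtype) n
      simp only [LinearMap.comp_apply, LieAlgebra.ad_apply, Submodule.subtype_apply] at this
      rw [← this, Finset.mul_sum]
      refine Finset.sum_congr rfl fun β _ => ?_
      rw [← lie_skew, map_neg, map_neg, mul_neg, neg_mul, neg_mul, neg_neg, ← Algebra.commutes,
        mul_smul_comm, mul_assoc, ← Algebra.smul_def]
    · rw [Finset.sum_comm]
      refine Finset.sum_congr rfl fun β _ => ?_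
      have := sum_coord_smul (u := u) (phi h ∘ₗ gradeProj h (Set.Ici (1 / 2)) ∘ₗ
        LieAlgebra.ad ℂ 𝔤 (u β : 𝔤) ∘ₗ (nPart h).subtype) n
      simp only [LinearMap.comp_apply, LieAlgebra.ad_apply, Submodule.subtype_apply] at this
      rw [← this, Finset.mul_sum]
      refine Finset.sum_congr rfl fun α _ => ?_
      rw [mul_smul_comm, smul_mul_assoc]
  rw [h1, h2, smul_smul, J]
  norm_num
  abel

theorem brst_phiDual (D : IsDatum B e h f) (θ : Module.Dual ℂ (nPart h)) :
    (brst B h f k u).d (phiDual h θ) = (1 / 2 : ℂ) • ∑ α, ∑ β,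
      θ (gradeProj h (Set.Ici (1 / 2)) ⁅(u β : 𝔤), (u α : 𝔤)⁆) •
        (phiDual h (u.coord α) * phiDual h (u.coord β)) := by
  refine brst_eq_odd D (σ_phiDual h θ) ?_
  rw [brstElement]
  simp only [map_add, map_sum, map_smul,
    brst_br_odd_mul (hasPar_phiDual θ), br_phiDual_cur D,
    br_phiDual_Phi D, br_phiDual_phi D, br_phiDual_phiDual D, brst_br_algebraMap, mul_zero,
    zero_mul, add_zero, zero_add, Finset.sum_const_zero, σ_phiDual, map_mul,
    neg_mul_neg]
  simp only [← C_mul, ← map_sum, Polynomial.smul_C, ← Algebra.commutes,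
    ← Algebra.smul_def]

variable [FiniteDimensional ℂ 𝔤]

/-- By the formula for dφ_n this says T(a) = J_a - dφ_{a_𝔫}: T is J corrected by a coboundary so as
to lie in S(R_-). -/
theorem Tmap_eq (D : IsDatum B e h f) (a : 𝔤) : Tmap B h f u a = J h u a
    - J h u (gradeProj h (Set.Ici (1 / 2)) a)
    - Phi h (gradeProj h {1 / 2} (gradeProj h (Set.Ici (1 / 2)) a : 𝔤))
    - algebraMap ℂ _ (B f (gradeProj h (Set.Ici (1 / 2)) a)) := by
  have e1 := gradeProj_nonpos_add D.sl2 a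
  have e2 := gradeProj_half_of_nonpos D.sl2 (gradeProj h (Set.Iic 0) a).2
  have e3 := bilin_f_nonpos D.sl2 D.inv (gradeProj h (Set.Iic 0) a).2
  have h1 : J h u a = J h u (gradeProj h (Set.Iic 0) a) + J h u (gradeProj h (Set.Ici (1 / 2)) a) := by
    rw [← Jlin_apply, ← Jlin_apply, ← Jlin_apply, ← map_add, e1]
  have h2 : gradeProj h {1 / 2} a = gradeProj h {1 / 2} (gradeProj h (Set.Ici (1 / 2)) a : 𝔤) := by
    conv_lhs => rw [← e1, map_add, e2, zero_add]
  have h3 : B f a = B f (gradeProj h (Set.Ici (1 / 2)) a) := by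
    conv_lhs => rw [← e1, map_add, e3, zero_add]
  rw [Tmap_apply, h1, ← h2, ← h3]
  abel

/-- dφ^{v^α} brings in [u_β, u_α], which acts on a as a commutator of adjoint actions;
`half_sum_antisymm` then removes the antisymmetrization. -/
theorem sum_brst_phiDual_mul (D : IsDatum B e h f) (F : 𝔤 →ₗ[ℂ] C₁ h) (a : 𝔤) :
    ∑ α, (brst B h f k u).d (phiDual h (u.coord α)) * F ⁅(u α : 𝔤), a⁆
      = ∑ α, ∑ β, phiDual h (u.coord α) * phiDual h (u.coord β)
        * F ⁅(u β : 𝔤), ⁅(u α : 𝔤), a⁆⁆ := by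
  rw [← half_sum_antisymm fun α β => phiDual_mul_phiDual _ _]
  simp only [brst_phiDual D, smul_mul_assoc, Finset.sum_mul]
  rw [← Finset.smul_sum]
  congr 1
  rw [Finset.sum_comm]
  refine Finset.sum_congr rfl fun α _ => ?_
  rw [Finset.sum_comm]
  refine Finset.sum_congr rfl fun β _ => ?_
  have := sum_coord_smul (u := u) (-(F ∘ₗ LieAlgebra.ad ℂ 𝔤 a ∘ₗ (nPart h).subtype))
      (gradeProj h (Set.Ici (1 / 2)) ⁅(u β : 𝔤), (u α : 𝔤)⁆)
  simp only [← mul_smul_comm]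
  rw [← Finset.mul_sum]
  congr 1
  simp only [LinearMap.comp_apply, LinearMap.neg_apply,
    LieAlgebra.ad_apply, Submodule.subtype_apply, ← map_neg, lie_skew] at this
  refine this.trans ?_
  rw [gradeProj_of_mem D.sl2 (lie_mem_nPart (u β).2 (u α).2), ← map_sub, lie_lie]

/-- Applying d to φ^{v^α} φ_{[u_α, a]} gives -φ^{v^α} dφ_{[u_α, a]} together with quadratic terms
that complete [u_α, a] to J_{[u_α, a]}. What remains is J - dφ, that is, T. -/
theorem brst_J (D : IsDatum B e h f) (a : 𝔤) : (brst B h f k u).d (J h u a)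
    = ∑ α, phiDual h (u.coord α) * Tmap B h f u ⁅(u α : 𝔤), a⁆
      + k • del (phiDual h (pairing B h a)) := by
  have hM := sum_brst_phiDual_mul (k := k) (u := u) D
    (phi h ∘ₗ gradeProj h (Set.Ici (1 / 2))) a
  simp only [LinearMap.comp_apply] at hM
  rw [J, map_add, map_sum, brst_cur D, add_right_comm]
  congr 1
  simp only [brst_mul, Finset.sum_add_distrib, hM]
  rw [← Finset.sum_add_distrib, ← Finset.sum_add_distrib]
  refine Finset.sum_congr rfl fun α _ => ?_
  rw [Tmap_eq D, brst_phi D, σ_phiDual]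
  simp only [mul_assoc, ← Finset.mul_sum]
  have hJ : J h u ⁅(u α : 𝔤), a⁆ = cur h ⁅(u α : 𝔤), a⁆ + ∑ β, phiDual h (u.coord β)
      * phi h (gradeProj h (Set.Ici (1 / 2)) ⁅(u β : 𝔤), ⁅(u α : 𝔤), a⁆⁆) := rfl
  rw [hJ]
  noncomm_ring

end Differential


/-! ### d_(0)² = 0 -/

section Square

variable {𝔤 : Type*} [LieRing 𝔤] [LieAlgebra ℂ 𝔤] {e h f : 𝔤} {B : LinearMap.BilinForm ℂ 𝔤} {k : ℂ}
  {I : Type*} [Fintype I] {u : Module.Basis I ℂ (nPart h)}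

theorem gen_even_eq (x : 𝔤 × halfPart h) : (gen 0 (x, 0) : C₁ h) = cur h x.1 + Phi h x.2 := by
  change gen 0 _ = gen 0 _ + gen 0 _
  rw [← map_add]
  congr 1
  simp

theorem gen_odd_eq (y : nPart h × Module.Dual ℂ (nPart h)) :
    (gen 0 (0, y) : C₁ h) = phi h y.1 + phiDual h y.2 := by
  change gen 0 _ = gen 0 _ + gen 0 _
  rw [← map_add]
  congr 1
  simp

theorem J_zero : J h u 0 = 0 := by rw [← Jlin_apply, map_zero]

theorem pairing_of_nPart (D : IsDatum B e h f) {a : 𝔤} (ha : a ∈ nPart h) :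
    pairing B h a = 0 :=
  LinearMap.ext fun n => bilin_nPart D.inv ha n.2

theorem brst_brst_mul {a b : C₁ h} (ha : (brst B h f k u).d ((brst B h f k u).d a) = 0)
    (hb : (brst B h f k u).d ((brst B h f k u).d b) = 0) :
    (brst B h f k u).d ((brst B h f k u).d (a * b)) = 0 := by
  rw [brst_mul, map_add, brst_mul, brst_mul, ha, hb, brst_σ]
  simp

theorem hasPar_brst {o : Bool} {a : C₁ h} (ha : HasPar o a) :
    HasPar (!o) ((brst B h f k u).d a) := by
  cases o
  · rw [hasPar_false] at ha
    have := brst_σ (B := B) (f := f) (k := k) (u := u) a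
    rw [ha] at this
    exact hasPar_true.2 (by rw [← neg_eq_iff_eq_neg, ← this])
  · rw [hasPar_true] at ha
    have := brst_σ (B := B) (f := f) (k := k) (u := u) a
    rw [ha, map_neg, neg_inj] at this
    exact hasPar_false.2 this.symm

variable [FiniteDimensional ℂ 𝔤]

theorem gradeProj_half_nPart (hsl : IsSl2Triple h e f) (a : 𝔤) :
    gradeProj h {1 / 2} (gradeProj h (Set.Ici (1 / 2)) a : 𝔤) = gradeProj h {1 / 2} a := by
  have e1 := gradeProj_nonpos_add hsl a
  have e2 := gradeProj_half_of_nonpos hsl (gradeProj h (Set.Iic 0) a).2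
  conv_rhs => rw [← e1, map_add, e2, zero_add]

theorem Tmap_of_nonpos (D : IsDatum B e h f) {a : 𝔤} (ha : a ∈ nonposPart h) :
    Tmap B h f u a = J h u a := by
  rw [Tmap_apply, gradeProj_of_mem D.sl2 ha, gradeProj_half_of_nonpos D.sl2 ha,
    bilin_f_nonpos D.sl2 D.inv ha]
  simp

theorem Tmap_of_half (D : IsDatum B e h f) (b : halfPart h) :
    Tmap B h f u b = -Phi h b := by
  rw [Tmap_apply, gradeProj_nonpos_of_nPart D.sl2 (halfPart_le_nPart b.2),
    gradeProj_of_mem D.sl2 b.2, bilin_f_half D.sl2 D.inv b.2, ZeroMemClass.coe_zero, J_zero]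
  simp

theorem Tmap_of_mPart (D : IsDatum B e h f) {a : 𝔤} (ha : a ∈ mPart h) :
    Tmap B h f u a = -algebraMap ℂ _ (B f a) := by
  rw [Tmap_apply, gradeProj_nonpos_of_nPart D.sl2 (mPart_le_nPart ha),
    gradeProj_half_of_mPart D.sl2 ha, ZeroMemClass.coe_zero, J_zero]
  simp

theorem sum_phiDual_mul_Tmap_of_nPart (D : IsDatum B e h f) {a : 𝔤} (ha : a ∈ nPart h) :
    ∑ α, phiDual h (u.coord α) * Tmap B h f u ⁅(u α : 𝔤), a⁆ = -phiDual h (fpair B h f a) := by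
  rw [← sum_phiDual_mul_algebraMap (u := u), ← Finset.sum_neg_distrib]
  refine Finset.sum_congr rfl fun α _ => ?_
  rw [Tmap_of_mPart D (lie_mem_mPart (u α).2 ha), fpair_apply, mul_neg]

theorem fpair_half (D : IsDatum B e h f) {a : 𝔤} (ha : a ∈ nPart h) :
    fpair B h f (gradeProj h {1 / 2} a : 𝔤) = fpair B h f a := by
  refine LinearMap.ext fun n => ?_
  rw [fpair_apply, fpair_apply, ← bilin_f_lie_half D.sl2 D.inv n.2 ha,
    ← bilin_f_lie_half D.sl2 D.inv n.2 (halfPart_le_nPart (gradeProj h {1 / 2} a).2),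
    gradeProj_of_mem D.sl2 (gradeProj h {1 / 2} a).2]

/-- For the part of a in 𝔤_{≤0} this is `brst_J`. For the part in 𝔫 the brackets [u_α, a] lie in 𝔪,
where T is the scalar -(f, ·), and the sum becomes -dΦ; the pairing of that part with 𝔫 vanishes. -/
theorem brst_Tmap (D : IsDatum B e h f) (a : 𝔤) : (brst B h f k u).d (Tmap B h f u a)
    = ∑ α, phiDual h (u.coord α) * Tmap B h f u ⁅(u α : 𝔤), a⁆
      + k • del (phiDual h (pairing B h a)) := by
  have e1 := gradeProj_nonpos_add D.sl2 a
  set p := gradeProj h (Set.Iic 0) a with hp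
  set q := gradeProj h (Set.Ici (1 / 2)) a with hq
  have h1 : pairing B h a = pairing B h (p : 𝔤) := by
    rw [← e1, map_add, pairing_of_nPart D q.2, add_zero]
  have h2 : ∀ α, Tmap B h f u ⁅(u α : 𝔤), a⁆
      = Tmap B h f u ⁅(u α : 𝔤), (p : 𝔤)⁆ + Tmap B h f u ⁅(u α : 𝔤), (q : 𝔤)⁆ := by
    intro α
    rw [← map_add, ← lie_add, e1]
  simp only [h2, mul_add, Finset.sum_add_distrib]
  rw [sum_phiDual_mul_Tmap_of_nPart D q.2, ← fpair_half D q.2, hq, gradeProj_half_nPart D.sl2, h1,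
    Tmap_apply, map_sub, map_sub, brst_algebraMap, sub_zero, brst_Phi D, brst_J D]
  abel

theorem brst_brst_phi (D : IsDatum B e h f) (n : nPart h) :
    (brst B h f k u).d ((brst B h f k u).d (phi h n)) = 0 := by
  rw [brst_phi D, map_add, map_add, brst_algebraMap, brst_Phi D, brst_J D,
    sum_phiDual_mul_Tmap_of_nPart D n.2, fpair_half D n.2, pairing_of_nPart D n.2]
  simp

/-- The coefficients are (f, [[u_β, u_α], b]), which vanish since [𝔫, 𝔫] ⊆ 𝔪. -/
theorem brst_brst_Phi (D : IsDatum B e h f) (b : halfPart h) :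
    (brst B h f k u).d ((brst B h f k u).d (Phi h b)) = 0 := by
  rw [brst_Phi D, brst_phiDual D]
  refine smul_eq_zero_of_right _ (Finset.sum_eq_zero fun α _ => Finset.sum_eq_zero fun β _ => ?_)
  rw [fpair_apply, gradeProj_of_mem D.sl2 (lie_mem_nPart (u β).2 (u α).2), ← lie_skew, map_neg,
    bilin_f_lie D.sl2 D.inv (halfPart_le_nPart b.2) (lie_mem_mPart (u β).2 (u α).2)]
  simp

/-- This is the Chevalley–Eilenberg differential of 𝔫. Its square is a cubic sum S with coefficients
given by double brackets; the Jacobi identity and the antisymmetry of the products of the φ^{v^α}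
give S = -2S. -/
theorem brst_brst_phiDual (D : IsDatum B e h f) (θ : Module.Dual ℂ (nPart h)) :
    (brst B h f k u).d ((brst B h f k u).d (phiDual h θ)) = 0 := by
  set c : I → I → ℂ := fun α β => θ (gradeProj h (Set.Ici (1 / 2)) ⁅(u β : 𝔤), (u α : 𝔤)⁆) with hc
  set x : I → C₁ h := fun α => phiDual h (u.coord α) with hx
  have hcs : ∀ α β, c α β = -c β α := by
    intro α β
    simp only [hc]
    rw [← lie_skew, map_neg, map_neg]
  have hd : ∀ α β, (brst B h f k u).d (x α) * x β = x β * (brst B h f k u).d (x α) := by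
    intro α β
    exact HasPar.mul_comm (hasPar_brst (o := true) (hasPar_phiDual _)) _
  let ad' : I → nPart h →ₗ[ℂ] nPart h := fun α =>
    -(gradeProj h (Set.Ici (1 / 2)) ∘ₗ LieAlgebra.ad ℂ 𝔤 (u α : 𝔤) ∘ₗ (nPart h).subtype)
  have had : ∀ α n, ad' α n = gradeProj h (Set.Ici (1 / 2)) ⁅(n : 𝔤), (u α : 𝔤)⁆ := by
    intro α n
    rw [← lie_skew, map_neg]; rfl
  -- The two terms of d(φ^{v^α}φ^{v^β}) are equal up to exchanging α and β, since dφ^{v^α} is even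
  -- and the coefficients are antisymmetric.
  have h1 : (brst B h f k u).d ((brst B h f k u).d (phiDual h θ))
      = -∑ α, x α * (brst B h f k u).d (phiDual h (θ ∘ₗ ad' α)) := by
    have e1 : ∀ α, (brst B h f k u).d (phiDual h (θ ∘ₗ ad' α))
        = ∑ β, c α β • (brst B h f k u).d (x β) := by
      intro α
      rw [← sum_smul_phiDual (u := u) (θ ∘ₗ ad' α), map_sum]
      refine Finset.sum_congr rfl fun β _ => ?_
      rw [map_smul, LinearMap.comp_apply, had]
    have e2 : ∑ α, ∑ β, c α β • ((brst B h f k u).d (x α) * x β)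
        = -∑ α, ∑ β, c α β • (x α * (brst B h f k u).d (x β)) := by
      rw [Finset.sum_comm, ← Finset.sum_neg_distrib]
      refine Finset.sum_congr rfl fun β _ => ?_
      rw [← Finset.sum_neg_distrib]
      refine Finset.sum_congr rfl fun α _ => ?_
      rw [hcs, hd, neg_smul]
    rw [brst_phiDual D]
    simp only [map_smul, map_sum, brst_mul, smul_add, Finset.sum_add_distrib, e1, Finset.mul_sum,
      mul_smul_comm]
    rw [e2]
    simp only [x, σ_phiDual, neg_mul, smul_neg, Finset.sum_neg_distrib]
    module
  let t : I → I → I → ℂ := fun α β γ => θ (gradeProj h (Set.Ici (1 / 2))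
    ⁅⁅(u γ : 𝔤), (u β : 𝔤)⁆, (u α : 𝔤)⁆)
  -- The Jacobi identity in 𝔫. Each term on the right is t with its indices permuted, so the
  -- symmetry of cubic products applies: an odd permutation changes the sign and a cyclic one does
  -- not.
  have ht : ∀ α β γ, t α β γ = t β α γ - t γ α β := by
    intro α β γ
    simp only [t]
    rw [lie_lie, ← lie_skew (u γ : 𝔤), ← lie_skew (u β : 𝔤) ⁅(u γ : 𝔤), (u α : 𝔤)⁆, ← map_sub,
      ← map_sub]
    congr 2
    abel
  have h2 : (brst B h f k u).d ((brst B h f k u).d (phiDual h θ))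
      = -((1 / 2 : ℂ) • ∑ α, ∑ β, ∑ γ, t α β γ • (x α * (x β * x γ))) := by
    rw [h1, Finset.smul_sum]
    congr 1
    refine Finset.sum_congr rfl fun α _ => ?_
    rw [brst_phiDual D, mul_smul_comm, Finset.mul_sum]
    congr 1
    refine Finset.sum_congr rfl fun β _ => ?_
    rw [Finset.mul_sum]
    refine Finset.sum_congr rfl fun γ _ => ?_
    rw [mul_smul_comm, LinearMap.comp_apply, had,
      gradeProj_of_mem D.sl2 (lie_mem_nPart (u γ).2 (u β).2)]
  have hxx : ∀ α β, x α * x β = -(x β * x α) := fun α β => phiDual_mul_phiDual _ _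
  have hS : ∑ α, ∑ β, ∑ γ, t α β γ • (x α * (x β * x γ)) = 0 := by
    set S := ∑ α, ∑ β, ∑ γ, t α β γ • (x α * (x β * x γ)) with hSdef
    have e1 : ∑ α, ∑ β, ∑ γ, t β α γ • (x α * (x β * x γ)) = -S := by
      rw [Finset.sum_comm, hSdef, ← Finset.sum_neg_distrib]
      refine Finset.sum_congr rfl fun β _ => ?_
      rw [← Finset.sum_neg_distrib]
      refine Finset.sum_congr rfl fun α _ => ?_
      rw [← Finset.sum_neg_distrib]
      refine Finset.sum_congr rfl fun γ _ => ?_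
      rw [← mul_assoc, hxx α β, neg_mul, mul_assoc, smul_neg]
    have e2 : ∑ α, ∑ β, ∑ γ, t γ α β • (x α * (x β * x γ)) = S := by
      have : ∀ α, ∑ β, ∑ γ, t γ α β • (x α * (x β * x γ))
          = ∑ γ, ∑ β, t γ α β • (x α * (x β * x γ)) := fun α => Finset.sum_comm
      simp only [this]
      rw [Finset.sum_comm]
      refine Finset.sum_congr rfl fun γ _ => ?_
      refine Finset.sum_congr rfl fun α _ => ?_
      refine Finset.sum_congr rfl fun β _ => ?_
      rw [← mul_assoc, mul_assoc (x α), hxx β γ, mul_neg, ← mul_assoc, hxx α γ, neg_mul, neg_neg,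
        mul_assoc]
    have e3 : S = -S - S := by
      have : S = ∑ α, ∑ β, ∑ γ, t β α γ • (x α * (x β * x γ))
          - ∑ α, ∑ β, ∑ γ, t γ α β • (x α * (x β * x γ)) := by
        rw [hSdef]
        simp only [← Finset.sum_sub_distrib, ← sub_smul, ← ht]
      exact this.trans (by rw [e1, e2])
    have e4 : (3 : ℂ) • S = 0 := by
      have : (3 : ℂ) • S = S - (-S - S) := by module
      rw [this, ← e3, sub_self]
    exact (smul_eq_zero.1 e4).resolve_left (by norm_num)
  rw [h2, hS, smul_zero, neg_zero]

/-- T satisfies the formula of `brst_J` itself, so the terms quadratic in φ^{v^α} cancel by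
`sum_brst_phiDual_mul`. The terms with k cancel by invariance of the form, which identifies the sums
in `h1` and `h2`. -/
theorem brst_brst_J (D : IsDatum B e h f) (a : 𝔤) :
    (brst B h f k u).d ((brst B h f k u).d (J h u a)) = 0 := by
  set x : I → C₁ h := fun α => phiDual h (u.coord α) with hx
  have hpair : ∀ b : 𝔤, phiDual h (pairing B h b) = ∑ β, B b (u β) • x β :=
    fun b => (sum_smul_phiDual (u := u) (pairing B h b)).symm
  have h1 : ∑ α, x α * del (phiDual h (pairing B h ⁅(u α : 𝔤), a⁆))
      = ∑ α, ∑ β, B a ⁅(u β : 𝔤), (u α : 𝔤)⁆ • (x α * del (x β)) := by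
    refine Finset.sum_congr rfl fun α _ => ?_
    rw [hpair, map_sum, Finset.mul_sum]
    refine Finset.sum_congr rfl fun β _ => ?_
    rw [map_smul, mul_smul_comm]
    congr 1
    rw [← lie_skew, map_neg, LinearMap.neg_apply, D.inv, ← lie_skew (u β : 𝔤), map_neg]
  have h2 : del ((brst B h f k u).d (phiDual h (pairing B h a)))
      = ∑ α, ∑ β, B a ⁅(u β : 𝔤), (u α : 𝔤)⁆ • (x α * del (x β)) := by
    have e1 : ∑ α, ∑ β, B a ⁅(u β : 𝔤), (u α : 𝔤)⁆ • (del (x α) * x β)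
        = ∑ α, ∑ β, B a ⁅(u β : 𝔤), (u α : 𝔤)⁆ • (x α * del (x β)) := by
      rw [Finset.sum_comm]
      refine Finset.sum_congr rfl fun β _ => ?_
      refine Finset.sum_congr rfl fun α _ => ?_
      have : del (x α) * x β = -(x β * del (x α)) := by
        rw [(hasPar_phiDual (u.coord α)).del.mul_comm (x β)]
        change σ (x β) * _ = _
        rw [hx]
        simp only [σ_phiDual, neg_mul]
      rw [this, ← lie_skew, map_neg, neg_smul, smul_neg, neg_neg]
    rw [brst_phiDual D]
    simp only [pairing_apply, map_smul, map_sum, del_mul, smul_add, Finset.sum_add_distrib,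
      gradeProj_of_mem D.sl2 (lie_mem_nPart (u _).2 (u _).2)]
    rw [e1]
    module
  have h3 := sum_brst_phiDual_mul (k := k) (u := u) D (Tmap B h f u) a
  rw [brst_J D, map_add, map_smul, brst_del, h2, map_sum]
  simp only [brst_mul, Finset.sum_add_distrib, h3, σ_phiDual, brst_Tmap D, neg_mul, mul_add,
    Finset.sum_neg_distrib, Finset.mul_sum, mul_smul_comm, ← Finset.smul_sum, mul_assoc]
  rw [h1]
  module

theorem brst_brst (D : IsDatum B e h f) (a : C₁ h) :
    (brst B h f k u).d ((brst B h f k u).d a) = 0 := by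
  refine S.induction_del (P := fun a => (brst B h f k u).d ((brst B h f k u).d a) = 0)
    (fun r => by rw [brst_algebraMap, map_zero]) (fun x => ?_) (fun y => ?_)
    (fun a ha => by rw [brst_del, brst_del, ha, map_zero]) (fun a b => brst_brst_mul)
    (fun a b ha hb => by rw [map_add, map_add, ha, hb, add_zero]) a
  -- The generator a is replaced by J_a, for which d² is known, minus products of generators.
  · have h2 : cur h x.1 = J h u x.1 - ∑ α, phiDual h (u.coord α) *
        phi h (gradeProj h (Set.Ici (1 / 2)) ⁅(u α : 𝔤), x.1⁆) := by
      rw [J, add_sub_cancel_right]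
    rw [gen_even_eq, map_add, map_add, brst_brst_Phi D, h2, map_sub, map_sub, brst_brst_J D, map_sum,
      map_sum, Finset.sum_eq_zero, sub_zero, add_zero]
    intro α _
    exact brst_brst_mul (brst_brst_phiDual D _) (brst_brst_phi D _)
  · rw [gen_odd_eq, map_add, map_add, brst_brst_phi D, brst_brst_phiDual D, add_zero]

end Square


/-! ### S(R_-) is closed under ∂, the λ-bracket and d_(0) -/

section Stability

variable {𝔤 : Type*} [LieRing 𝔤] [LieAlgebra ℂ 𝔤] {e h f : 𝔤} {B : LinearMap.BilinForm ℂ 𝔤} {k : ℂ}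
  {I : Type*} [Fintype I] {u : Module.Basis I ℂ (nPart h)}

/-- Induction on the elements of `S(R_-)`. -/
theorem Sminus_induction {P : C₁ h → Prop} (hc : ∀ r : ℂ, P (algebraMap ℂ _ r))
    (hJ : ∀ a ∈ nonposPart h, P (J h u a)) (hPhi : ∀ b, P (Phi h b)) (hphi : ∀ θ, P (phiDual h θ))
    (hdel : ∀ x ∈ Sminus h u, P x → P (del x))
    (hmul : ∀ x ∈ Sminus h u, ∀ y ∈ Sminus h u, P x → P y → P (x * y))
    (hadd : ∀ x ∈ Sminus h u, ∀ y ∈ Sminus h u, P x → P y → P (x + y)) {x : C₁ h}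
    (hx : x ∈ Sminus h u) : P x := by
  have hpow : ∀ y : C₁ h, (∀ n, (del ^ n) y ∈ Sminus h u) → P y → ∀ n, P ((del ^ n) y) := by
    intro y hy hP n
    induction n with
    | zero => simpa using hP
    | succ n ih => rw [pow_succ', Module.End.mul_apply]; exact hdel _ (hy n) ih
  refine Algebra.adjoin_induction (p := fun x _ => P x) ?_ hc (fun x y hx hy => hadd x hx y hy)
    (fun x y hx hy => hmul x hx y hy) hx
  rintro y ((⟨n, a, ha, rfl⟩ | ⟨n, b, rfl⟩) | ⟨n, θ, rfl⟩)
  · exact hpow _ (fun n => J_mem h u n a ha) (hJ a ha) n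
  · exact hpow _ (fun n => Phi_mem h u n b) (hPhi b) n
  · exact hpow _ (fun n => phiDual_mem h u n θ) (hphi θ) n

theorem J_mem_Sminus {a : 𝔤} (ha : a ∈ nonposPart h) : J h u a ∈ Sminus h u := J_mem h u 0 a ha
theorem Phi_mem_Sminus (b : halfPart h) : Phi h b ∈ Sminus h u := Phi_mem h u 0 b
theorem phiDual_mem_Sminus (θ : Module.Dual ℂ (nPart h)) : phiDual h θ ∈ Sminus h u :=
  phiDual_mem h u 0 θ

theorem del_mem_Sminus {x : C₁ h} (hx : x ∈ Sminus h u) : del x ∈ Sminus h u := by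
  refine Algebra.adjoin_induction (p := fun x _ => del x ∈ Sminus h u) ?_ ?_ ?_ ?_ hx
  · rintro y ((⟨n, a, ha, rfl⟩ | ⟨n, b, rfl⟩) | ⟨n, θ, rfl⟩)
    · rw [← Module.End.mul_apply, ← pow_succ']; exact J_mem h u (n + 1) a ha
    · rw [← Module.End.mul_apply, ← pow_succ']; exact Phi_mem h u (n + 1) b
    · rw [← Module.End.mul_apply, ← pow_succ']; exact phiDual_mem h u (n + 1) θ
  · intro r; rw [del_algebraMap]; exact zero_mem _
  · intro x y _ _ hx hy; rw [map_add]; exact add_mem hx hy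
  · intro x y hx' hy' hx hy; rw [del_mul]; exact add_mem (mul_mem hx hy') (mul_mem hx' hy)

theorem twist_mem_Sminus (o : Bool) {x : C₁ h} (hx : x ∈ Sminus h u) : twist o x ∈ Sminus h u := by
  cases o
  · exact hx
  · exact σ_mem_Sminus h u x hx

theorem part_mem_Sminus (o : Bool) {x : C₁ h} (hx : x ∈ Sminus h u) : part o x ∈ Sminus h u := by
  rw [part_apply]
  exact Subalgebra.smul_mem _ (add_mem hx (Subalgebra.smul_mem _ (σ_mem_Sminus h u x hx) _)) _

theorem Tmap_mem_Sminus (a : 𝔤) : Tmap B h f u a ∈ Sminus h u := by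
  rw [Tmap_apply]
  exact sub_mem (sub_mem (J_mem_Sminus (Subtype.prop _)) (Phi_mem_Sminus _))
    (Subalgebra.algebraMap_mem _ _)

/-! The brackets of `J` with the generators. -/

/-- The map `n ↦ [n, a]_𝔫` of `𝔫`. -/
def adN (h a : 𝔤) : nPart h →ₗ[ℂ] nPart h :=
  -(gradeProj h (Set.Ici (1 / 2)) ∘ₗ LieAlgebra.ad ℂ 𝔤 a ∘ₗ (nPart h).subtype)

theorem adN_apply (a : 𝔤) (n : nPart h) :
    adN h a n = gradeProj h (Set.Ici (1 / 2)) ⁅(n : 𝔤), a⁆ := by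
  rw [← lie_skew, map_neg]; rfl

theorem J_eq (a : 𝔤) : J h u a
    = cur h a + ∑ α, phiDual h (u.coord α) * phi h (adN h a (u α)) := by
  simp only [adN_apply, J]

theorem hasPar_J (a : 𝔤) : HasPar false (J h u a) := hasPar_false.2 (σ_J h u a)

theorem br_phiDual_J (D : IsDatum B e h f) (θ : Module.Dual ℂ (nPart h)) (a : 𝔤) :
    (brstData B h f k).br (phiDual h θ) (J h u a) = C (-phiDual h (θ ∘ₗ adN h a)) := by
  rw [J_eq]
  simp only [map_add, map_sum, brst_br_odd_mul (hasPar_phiDual θ), br_phiDual_cur D,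
    br_phiDual_phi D, br_phiDual_phiDual D, zero_mul, add_zero, zero_add, σ_phiDual, ← C_mul]
  rw [← map_sum, ← sum_phiDual_mul_algebraMap (u := u) (θ ∘ₗ adN h a), ← Finset.sum_neg_distrib]
  congr 1
  refine Finset.sum_congr rfl fun α _ => ?_
  rw [neg_mul]; rfl

theorem br_phi_J (D : IsDatum B e h f) (n : nPart h) (a : 𝔤) :
    (brstData B h f k).br (phi h n) (J h u a) = C (phi h (adN h a n)) := by
  rw [J_eq]
  simp only [map_add, map_sum, brst_br_odd_mul (hasPar_phi n), br_phi_cur D,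
    br_phi_phi D, br_phi_phiDual D, mul_zero, zero_add, ← C_mul, ← Algebra.smul_def]
  rw [← map_sum]
  congr 1
  exact sum_coord_smul (u := u) (phi h ∘ₗ adN h a) n

theorem br_cur_J (D : IsDatum B e h f) (b a : 𝔤) :
    (brstData B h f k).br (cur h b) (J h u a)
      = C (cur h ⁅b, a⁆) + X * C (algebraMap ℂ _ (k * B b a)) := by
  rw [J_eq]
  simp only [map_add, map_sum, brst_br_even_mul (hasPar_cur b), br_cur_cur D, br_cur_phi D,
    br_cur_phiDual D, mul_zero, zero_mul, add_zero, Finset.sum_const_zero]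

theorem br_Phi_J (D : IsDatum B e h f) (b : halfPart h) (a : 𝔤) :
    (brstData B h f k).br (Phi h b) (J h u a) = 0 := by
  rw [J_eq]
  simp only [map_add, map_sum, brst_br_even_mul (hasPar_Phi b), br_Phi_cur D, br_Phi_phi D,
    br_Phi_phiDual D, mul_zero, zero_mul, add_zero, Finset.sum_const_zero]

theorem br_J_phiDual (D : IsDatum B e h f) (θ : Module.Dual ℂ (nPart h)) (a : 𝔤) :
    (brstData B h f k).br (J h u a) (phiDual h θ) = C (phiDual h (θ ∘ₗ adN h a)) := by
  rw [brst_br_swap D (hasPar_J a) (p := -phiDual h (θ ∘ₗ adN h a)) (q := 0)]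
  · simp
  · simpa using! br_phiDual_J D θ a

theorem br_J_phi (D : IsDatum B e h f) (n : nPart h) (a : 𝔤) :
    (brstData B h f k).br (J h u a) (phi h n) = C (-phi h (adN h a n)) := by
  rw [brst_br_swap D (hasPar_J a) (p := phi h (adN h a n)) (q := 0)]
  · simp
  · simpa using! br_phi_J D n a

theorem br_J_cur (D : IsDatum B e h f) (a b : 𝔤) :
    (brstData B h f k).br (J h u a) (cur h b)
      = C (cur h ⁅a, b⁆) + X * C (algebraMap ℂ _ (k * B a b)) := by
  rw [brst_br_swap D (hasPar_J a) (b := cur h b) (br_cur_J D b a), del_algebraMap, zero_sub, ← map_neg, lie_skew,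
    D.symm]

theorem br_J_Phi (D : IsDatum B e h f) (a : 𝔤) (b : halfPart h) :
    (brstData B h f k).br (J h u a) (Phi h b) = 0 := by
  rw [brst_br_swap D (hasPar_J a) (p := 0) (q := 0)]
  · simp
  · simpa using! br_Phi_J D b a

/-- All coefficients of a polynomial in `λ` are in `S(R_-)`. -/
def CoeffMem (u : Module.Basis I ℂ (nPart h)) (p : (C₁ h)[X]) : Prop := ∀ n, p.coeff n ∈ Sminus h u

theorem coeffMem_C {x : C₁ h} (hx : x ∈ Sminus h u) : CoeffMem u (C x) := by
  intro n
  rw [coeff_C]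
  split_ifs
  · exact hx
  · exact zero_mem _

theorem coeffMem_X_mul_C {x : C₁ h} (hx : x ∈ Sminus h u) : CoeffMem u (X * C x) := by
  intro n
  cases n with
  | zero => simp
  | succ n => rw [coeff_X_mul]; exact coeffMem_C hx n

theorem coeffMem_zero : CoeffMem u (0 : (C₁ h)[X]) := fun n => by simp

theorem CoeffMem.add {p q : (C₁ h)[X]} (hp : CoeffMem u p) (hq : CoeffMem u q) :
    CoeffMem u (p + q) := fun n => by rw [coeff_add]; exact add_mem (hp n) (hq n)

variable [FiniteDimensional ℂ 𝔤]

/-- For a of nonpositive weight, n ↦ [n, a]_𝔫 is the action on 𝔤/𝔤_{≤0} ≅ 𝔫, which respects brackets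
because 𝔤_{≤0} is a subalgebra. -/
theorem adN_comm (D : IsDatum B e h f) {a b : 𝔤} (ha : a ∈ nonposPart h) (hb : b ∈ nonposPart h)
    (n : nPart h) : adN h b (adN h a n) - adN h a (adN h b n) = adN h ⁅a, b⁆ n := by
  have key : ∀ x, ∀ b ∈ nonposPart h, gradeProj h (Set.Ici (1 / 2))
      ⁅(gradeProj h (Set.Ici (1 / 2)) x : 𝔤), b⁆ = gradeProj h (Set.Ici (1 / 2)) ⁅x, b⁆ := by
    intro x b hb
    conv_rhs => rw [← gradeProj_nonpos_add D.sl2 x, add_lie, map_add,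
      gradeProj_nPart_of_nonpos D.sl2 (lie_mem_nonposPart (Subtype.prop _) hb), zero_add]
  simp only [adN_apply]
  rw [key _ b hb, key _ a ha, ← map_sub]
  congr 1
  rw [leibniz_lie (n : 𝔤) a b, ← lie_skew a ⁅(n : 𝔤), b⁆]
  abel

/-- The quadratic part of J realizes the action of 𝔤_{≤0} on 𝔤/𝔤_{≤0}, so it closes by `adN_comm`;
this is where nonpositive weights are used. -/
theorem br_J_J (D : IsDatum B e h f) {a b : 𝔤} (ha : a ∈ nonposPart h) (hb : b ∈ nonposPart h) :
    (brstData B h f k).br (J h u a) (J h u b)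
      = C (J h u ⁅a, b⁆) + X * C (algebraMap ℂ _ (k * B a b)) := by
  rw [J_eq (u := u) b, J_eq (u := u) ⁅a, b⁆]
  have h1 : ∀ α, (brstData B h f k).br (J h u a) (phiDual h (u.coord α) * phi h (adN h b (u α)))
      = C (phiDual h (u.coord α) * -phi h (adN h a (adN h b (u α)))
        + phiDual h (u.coord α ∘ₗ adN h a) * phi h (adN h b (u α))) := by
    intro α
    rw [brst_br_even_mul (hasPar_J a), br_J_phi D, br_J_phiDual D, ← C_mul, ← C_mul, ← C_add]
  rw [map_add, map_sum, br_J_cur D, Finset.sum_congr rfl fun α _ => h1 α, ← map_sum,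
    add_right_comm, ← C_add]
  congr 3
  rw [Finset.sum_add_distrib]
  have := sum_phiDual_comp_mul (u := u) (adN h a) (phi h ∘ₗ adN h b)
  simp only [LinearMap.comp_apply] at this
  rw [this, ← Finset.sum_add_distrib]
  refine Finset.sum_congr rfl fun α _ => ?_
  rw [← adN_comm D ha hb, map_sub]
  noncomm_ring

theorem coeffMem_of_gens {o : Bool} {a : C₁ h} (ha : HasPar o a)
    (hJ : ∀ b ∈ nonposPart h, CoeffMem u ((brstData B h f k).br a (J h u b)))
    (hPhi : ∀ b, CoeffMem u ((brstData B h f k).br a (Phi h b)))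
    (hphi : ∀ θ, CoeffMem u ((brstData B h f k).br a (phiDual h θ))) {y : C₁ h}
    (hy : y ∈ Sminus h u) : CoeffMem u ((brstData B h f k).br a y) := by
  refine Sminus_induction (u := u) (P := fun y => CoeffMem u ((brstData B h f k).br a y))
    ?_ hJ hPhi hphi ?_ ?_ ?_ hy
  · intro r; rw [brst_br_algebraMap]; exact coeffMem_zero
  · intro x _ hx n
    rw [show (brstData B h f k).br a (del x) = lamAdd del ((brstData B h f k).br a x) from
      br_del_right a x]
    cases n with
    | zero => rw [coeff_lamAdd_zero]; exact del_mem_Sminus (hx 0)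
    | succ n => rw [coeff_lamAdd_succ]; exact add_mem (hx n) (del_mem_Sminus (hx _))
  · intro x hx y hy hPx hPy n
    rw [brst_br_mul ha, coeff_add, coeff_C_mul, coeff_mul_C]
    exact add_mem (mul_mem (twist_mem_Sminus o hx) (hPy n)) (mul_mem (hPx n) hy)
  · intro x _ y _ hx hy
    rw [map_add]; exact hx.add hy

theorem br_mem_Sminus (D : IsDatum B e h f) {x y : C₁ h} (hx : x ∈ Sminus h u)
    (hy : y ∈ Sminus h u) (n : ℕ) : ((brstData B h f k).br x y).coeff n ∈ Sminus h u := by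
  have hgJ : ∀ a ∈ nonposPart h, ∀ y ∈ Sminus h u, CoeffMem u ((brstData B h f k).br (J h u a) y) := by
    intro a ha y hy
    refine coeffMem_of_gens (hasPar_J a) (fun b hb => ?_) (fun b => ?_) (fun θ => ?_) hy
    · rw [br_J_J D ha hb]
      exact (coeffMem_C (J_mem_Sminus (lie_mem_nonposPart ha hb))).add
        (coeffMem_X_mul_C (Subalgebra.algebraMap_mem _ _))
    · rw [br_J_Phi D]; exact coeffMem_zero
    · rw [br_J_phiDual D]; exact coeffMem_C (phiDual_mem_Sminus _)
  have hgPhi : ∀ b, ∀ y ∈ Sminus h u, CoeffMem u ((brstData B h f k).br (Phi h b) y) := by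
    intro b y hy
    refine coeffMem_of_gens (hasPar_Phi b) (fun a _ => ?_) (fun c => ?_) (fun θ => ?_) hy
    · rw [br_Phi_J D]; exact coeffMem_zero
    · rw [br_Phi_Phi D]; exact coeffMem_C (Subalgebra.algebraMap_mem _ _)
    · rw [br_Phi_phiDual D]; exact coeffMem_zero
  have hgphi : ∀ θ, ∀ y ∈ Sminus h u, CoeffMem u ((brstData B h f k).br (phiDual h θ) y) := by
    intro θ y hy
    refine coeffMem_of_gens (hasPar_phiDual θ) (fun a _ => ?_) (fun c => ?_) (fun η => ?_) hy
    · rw [br_phiDual_J D]; exact coeffMem_C (neg_mem (phiDual_mem_Sminus _))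
    · rw [br_phiDual_Phi D]; exact coeffMem_zero
    · rw [br_phiDual_phiDual D]; exact coeffMem_zero
  -- Once {g_λ y} is known for all generators g and all y in S(R_-), skewsymmetry gives {a_λ g} for
  -- all a, and the Leibniz rule then gives {a_λ y}.
  have hswap : ∀ {o o' : Bool} {a g : C₁ h}, HasPar o a → HasPar o' g → a ∈ Sminus h u →
      (∀ y ∈ Sminus h u, CoeffMem u ((brstData B h f k).br g y)) →
      CoeffMem u ((brstData B h f k).br a g) := by
    intro o o' a g ha hg hmem H n
    rw [show (brstData B h f k).br a g = _ from
      br_skew (isEven_brstBracket B h f k) (isSkew_brstBracket D.symm) ha g, coeff_neg]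
    refine neg_mem (coeff_skewSubst_mem del (Sminus h u).toSubmodule
      (fun x hx => del_mem_Sminus hx) _ (fun m => ?_) n)
    rw [twist_of_hasPar hg, map_smul, LinearMap.smul_apply, coeff_smul]
    exact Subalgebra.smul_mem _ (H a hmem m) _
  have hpart : ∀ o, CoeffMem u ((brstData B h f k).br (part o x) y) := by
    intro o
    have hp := hasPar_part o x
    have hm := part_mem_Sminus o hx
    exact coeffMem_of_gens hp (fun a ha => hswap hp (hasPar_J a) hm (hgJ a ha))
      (fun b => hswap hp (hasPar_Phi b) hm (hgPhi b))
      (fun θ => hswap hp (hasPar_phiDual θ) hm (hgphi θ)) hy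
  rw [← part_add_part x, map_add, LinearMap.add_apply]
  exact ((hpart false).add (hpart true)) n

theorem brst_mem_Sminus (D : IsDatum B e h f) {x : C₁ h} (hx : x ∈ Sminus h u) :
    (brst B h f k u).d x ∈ Sminus h u := by
  refine Sminus_induction (u := u) (P := fun x => (brst B h f k u).d x ∈ Sminus h u)
    ?_ ?_ ?_ ?_ ?_ ?_ ?_ hx
  · intro r; rw [brst_algebraMap]; exact zero_mem _
  · intro a _
    rw [brst_J D]
    exact add_mem (sum_mem fun α _ => mul_mem (phiDual_mem_Sminus _) (Tmap_mem_Sminus _))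
      (Subalgebra.smul_mem _ (del_mem_Sminus (phiDual_mem_Sminus _)) _)
  · intro b; rw [brst_Phi D]; exact phiDual_mem_Sminus _
  · intro θ
    rw [brst_phiDual D]
    exact Subalgebra.smul_mem _ (sum_mem fun α _ => sum_mem fun β _ => Subalgebra.smul_mem _
      (mul_mem (phiDual_mem_Sminus _) (phiDual_mem_Sminus _)) _) _
  · intro x _ hx; rw [brst_del]; exact del_mem_Sminus hx
  · intro x hx y hy hPx hPy
    rw [brst_mul]
    exact add_mem (mul_mem (σ_mem_Sminus h u x hx) hPy) (mul_mem hPx hy)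
  · intro x _ y _ hx hy; rw [map_add]; exact add_mem hx hy

end Stability

/-! ### The Hamiltonian reduction -/

section RedIdeal

variable {𝔤 : Type*} [LieRing 𝔤] [LieAlgebra ℂ 𝔤] {e h f : 𝔤} {B : LinearMap.BilinForm ℂ 𝔤} {k : ℂ}

theorem redGen_mem {m : 𝔤} (hm : m ∈ mPart h) (n : ℕ) :
    (del ^ n) (scur m + algebraMap ℂ _ (B f m)) ∈ redIdeal B h f :=
  TwoSidedIdeal.subset_span ⟨n, m, hm, rfl⟩

/-- Induction on the elements of the ideal. -/
theorem redIdeal_induction {P : Scur 𝔤 → Prop} (h0 : P 0)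
    (hgen : ∀ (n : ℕ), ∀ m ∈ mPart h, P ((del ^ n) (scur m + algebraMap ℂ _ (B f m))))
    (hneg : ∀ x ∈ redIdeal B h f, P x → P (-x))
    (hadd : ∀ x ∈ redIdeal B h f, ∀ y ∈ redIdeal B h f, P x → P y → P (x + y))
    (hleft : ∀ x, ∀ y ∈ redIdeal B h f, P y → P (x * y))
    (hright : ∀ x ∈ redIdeal B h f, ∀ y, P x → P (x * y)) {x : Scur 𝔤}
    (hx : x ∈ redIdeal B h f) : P x := by
  refine TwoSidedIdeal.span_induction (p := fun x _ => P x) ?_ h0 (fun x y hx hy => hadd x hx y hy)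
    (fun x hx => hneg x hx) (fun a x hx => hleft a x hx) (fun a x hx hp => hright x hx a hp) hx
  rintro y ⟨n, m, hm, rfl⟩
  exact hgen n m hm

/-- The generating set contains all derivatives, so the two-sided ideal is differential. -/
theorem del_mem_redIdeal {x : Scur 𝔤} (hx : x ∈ redIdeal B h f) : del x ∈ redIdeal B h f := by
  refine redIdeal_induction (P := fun x => del x ∈ redIdeal B h f) ?_ ?_ ?_ ?_ ?_ ?_ hx
  · rw [map_zero]; exact zero_mem _
  · intro n m hm
    rw [← Module.End.mul_apply, ← pow_succ']
    exact redGen_mem hm _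
  · intro x _ hx; rw [map_neg]; exact neg_mem hx
  · intro x _ y _ hx hy; rw [map_add]; exact add_mem hx hy
  · intro x y hy hdy
    rw [del_mul]
    exact add_mem (TwoSidedIdeal.mul_mem_left _ _ _ hy) (TwoSidedIdeal.mul_mem_left _ _ _ hdy)
  · intro x hx y hdx
    rw [del_mul]
    exact add_mem (TwoSidedIdeal.mul_mem_right _ _ _ hdx) (TwoSidedIdeal.mul_mem_right _ _ _ hx)

end RedIdeal


/-! ### Polynomials in λ with coefficients in a ∂-stable ideal -/

section CoeffIdeal

variable {W₀ W₁ : Type*} [AddCommGroup W₀] [Module ℂ W₀] [AddCommGroup W₁] [Module ℂ W₁]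

theorem smul_mem_ideal {A : Type*} [Ring A] [Algebra ℂ A] (K : TwoSidedIdeal A) (c : ℂ) {x : A}
    (hx : x ∈ K) : c • x ∈ K := by
  rw [Algebra.smul_def]; exact TwoSidedIdeal.mul_mem_left _ _ _ hx

theorem coeff_skewSubst_mem_ideal (K : TwoSidedIdeal (S W₀ W₁)) (hK : ∀ x ∈ K, del x ∈ K)
    (p : (S W₀ W₁)[X]) (hp : ∀ n, p.coeff n ∈ K) (n : ℕ) : (skewSubst del p).coeff n ∈ K := by
  let V : Submodule ℂ (S W₀ W₁) :=
    { carrier := {x | x ∈ K}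
      add_mem' := fun ha hb => TwoSidedIdeal.add_mem K ha hb
      zero_mem' := TwoSidedIdeal.zero_mem K
      smul_mem' := fun c x hx => smul_mem_ideal K c hx }
  exact coeff_skewSubst_mem del V hK p hp n

theorem coeff_lamAdd_mem_ideal (K : TwoSidedIdeal (S W₀ W₁)) (hK : ∀ x ∈ K, del x ∈ K)
    (p : (S W₀ W₁)[X]) (hp : ∀ n, p.coeff n ∈ K) (n : ℕ) : (lamAdd del p).coeff n ∈ K := by
  cases n with
  | zero => rw [coeff_lamAdd_zero]; exact hK _ (hp 0)
  | succ n => rw [coeff_lamAdd_succ]; exact add_mem (hp n) (hK _ (hp _))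

end CoeffIdeal

/-! ### Invariants of 𝔫 and their λ-brackets -/

section Reduction

variable {𝔤 : Type*} [LieRing 𝔤] [LieAlgebra ℂ 𝔤] {e h f : 𝔤} {B : LinearMap.BilinForm ℂ 𝔤} {k : ℂ}

/-- Induction on the elements of `S(ℂ[∂] ⊗ 𝔤)`. -/
theorem Scur_induction {P : Scur 𝔤 → Prop} (hc : ∀ r : ℂ, P (algebraMap ℂ _ r))
    (hgen : ∀ a, P (scur a)) (hdel : ∀ a, P a → P (del a))
    (hmul : ∀ a b, P a → P b → P (a * b)) (hadd : ∀ a b, P a → P b → P (a + b)) (a : Scur 𝔤) :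
    P a := by
  refine S.induction_del hc (fun a => hgen a) (fun b => ?_) hdel hmul hadd a
  have : (gen 0 ((0 : 𝔤), b) : Scur 𝔤) = algebraMap ℂ _ 0 := by
    rw [map_zero, show ((0 : 𝔤), b) = 0 from rfl, map_zero]
  rw [this]; exact hc 0

theorem σ_Scur (a : Scur 𝔤) : σ a = a := by
  induction a using Scur_induction with
  | hc r => rw [AlgHom.commutes]
  | hgen a => exact σ_scur a
  | hdel a ha => rw [σ_del, ha]
  | hmul a b ha hb => rw [map_mul, ha, hb]
  | hadd a b ha hb => rw [map_add, ha, hb]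

theorem hasPar_Scur (a : Scur 𝔤) : HasPar false a := hasPar_false.2 (σ_Scur a)

theorem cur_br_mul (a b c : Scur 𝔤) : (curData B k).br a (b * c)
    = C b * (curData B k).br a c + (curData B k).br a b * C c :=
  br_mul (isEven_curBracket B k) (hasPar_Scur a) b c

theorem cur_br_del_right (a b : Scur 𝔤) :
    (curData B k).br a (del b) = lamAdd del ((curData B k).br a b) := br_del_right a b

theorem cur_br_algebraMap (a : Scur 𝔤) (r : ℂ) : (curData B k).br a (algebraMap ℂ _ r) = 0 :=
  br_algebraMap _ a r

theorem cur_br_skew (D : IsDatum B e h f) (a b : Scur 𝔤) :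
    (curData B k).br a b = -skewSubst del ((curData B k).br b a) :=
  br_skew (isEven_curBracket B k) (isSkew_curBracket D.symm) (hasPar_Scur a) b

theorem br_scur_scur (D : IsDatum B e h f) (a b : 𝔤) : (curData B k).br (scur a) (scur b)
    = C (scur ⁅a, b⁆) + X * C (algebraMap ℂ _ (k * B a b)) :=
  br_gen_gen (isSkew_curBracket D.symm) _ _

theorem toRed_eq_zero {x : Scur 𝔤} : toRed B h f x = 0 ↔ x ∈ redIdeal B h f := by
  rw [TwoSidedIdeal.mem_iff, ← RingCon.eq]; rfl

/-- The elements `a` whose brackets with the generators of an ideal have coefficients in it. -/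
theorem br_mem_redIdeal_of_gens {a : Scur 𝔤}
    (hgen : ∀ m ∈ mPart h, ∀ i, ((curData B k).br a (scur m)).coeff i ∈ redIdeal B h f)
    {x : Scur 𝔤} (hx : x ∈ redIdeal B h f) (i : ℕ) :
    ((curData B k).br a x).coeff i ∈ redIdeal B h f := by
  refine redIdeal_induction (P := fun x => ∀ i, ((curData B k).br a x).coeff i ∈ redIdeal B h f)
    ?_ ?_ ?_ ?_ ?_ ?_ hx i
  · intro i; rw [map_zero, coeff_zero]; exact zero_mem _
  · intro n m hm
    induction n with
    | zero =>
      intro i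
      rw [pow_zero, Module.End.one_apply, map_add, cur_br_algebraMap, add_zero]
      exact hgen m hm i
    | succ n ih =>
      rw [pow_succ', Module.End.mul_apply, cur_br_del_right]
      exact coeff_lamAdd_mem_ideal _ (fun x hx => del_mem_redIdeal hx) _ ih
  · intro x _ hx i; rw [map_neg, coeff_neg]; exact neg_mem (hx i)
  · intro x _ y _ hx hy i; rw [map_add, coeff_add]; exact add_mem (hx i) (hy i)
  · intro x y hy hP i
    rw [cur_br_mul, coeff_add, coeff_C_mul, coeff_mul_C]
    exact add_mem (TwoSidedIdeal.mul_mem_left _ _ _ (hP i)) (TwoSidedIdeal.mul_mem_left _ _ _ hy)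
  · intro x hx y hP i
    rw [cur_br_mul, coeff_add, coeff_C_mul, coeff_mul_C]
    exact add_mem (TwoSidedIdeal.mul_mem_right _ _ _ hx) (TwoSidedIdeal.mul_mem_right _ _ _ (hP i))

/-- {n_λ m + (f, m)} = [n, m] has no λ-term, since (n, m) = 0. It lies in 𝔪 and is orthogonal to f,
so it is itself a generator of the ideal. -/
theorem br_nPart_mem_redIdeal (D : IsDatum B e h f) {n : 𝔤} (hn : n ∈ nPart h) {x : Scur 𝔤}
    (hx : x ∈ redIdeal B h f) (i : ℕ) :
    ((curData B k).br (scur n) x).coeff i ∈ redIdeal B h f := by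
  refine br_mem_redIdeal_of_gens (fun m hm i => ?_) hx i
  rw [br_scur_scur D, bilin_nPart D.inv hn (mPart_le_nPart hm), mul_zero, map_zero, C_0, mul_zero,
    add_zero, coeff_C]
  split_ifs
  · have := redGen_mem (B := B) (f := f) (lie_mem_mPart hn (mPart_le_nPart hm)) 0
    rwa [bilin_f_lie D.sl2 D.inv hn hm, map_zero, add_zero, pow_zero] at this
  · exact zero_mem _

/-- Invariance of the class does not depend on its representative, by `br_nPart_mem_redIdeal`. -/
theorem mem_W₂lift (D : IsDatum B e h f) {w : Scur 𝔤} : w ∈ W₂lift B h f k ↔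
    ∀ n ∈ nPart h, ∀ i, ((curData B k).br (scur n) w).coeff i ∈ redIdeal B h f := by
  constructor
  · rintro ⟨a, ha, hn⟩ n hnn i
    have h1 : w - a ∈ redIdeal B h f := by
      rw [← toRed_eq_zero, map_sub, ha]
      exact sub_self _
    have h2 := br_nPart_mem_redIdeal (k := k) D hnn h1 i
    rw [map_sub, coeff_sub] at h2
    have h3 := add_mem h2 (hn n hnn i)
    rwa [sub_add_cancel] at h3
  · intro H
    exact ⟨w, rfl, H⟩

/-- By skewsymmetry {w_λ m} is controlled by {m_λ w}, which lies in the ideal because 𝔪 ⊆ 𝔫 and w is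
invariant. -/
theorem br_W₂lift_mem_redIdeal (D : IsDatum B e h f) {w x : Scur 𝔤} (hw : w ∈ W₂lift B h f k)
    (hx : x ∈ redIdeal B h f) (i : ℕ) : ((curData B k).br w x).coeff i ∈ redIdeal B h f := by
  refine br_mem_redIdeal_of_gens (fun m hm => ?_) hx i
  intro i
  rw [cur_br_skew D, coeff_neg]
  exact neg_mem (coeff_skewSubst_mem_ideal _ (fun x hx => del_mem_redIdeal hx) _
    ((mem_W₂lift D).1 hw m (mPart_le_nPart hm)) i)

theorem br_redIdeal_W₂lift_mem (D : IsDatum B e h f) {w x : Scur 𝔤} (hw : w ∈ W₂lift B h f k)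
    (hx : x ∈ redIdeal B h f) (i : ℕ) : ((curData B k).br x w).coeff i ∈ redIdeal B h f := by
  rw [cur_br_skew D, coeff_neg]
  exact neg_mem (coeff_skewSubst_mem_ideal _ (fun x hx => del_mem_redIdeal hx) _
    (br_W₂lift_mem_redIdeal D hw hx) i)

theorem del_mem_W₂lift (D : IsDatum B e h f) {w : Scur 𝔤} (hw : w ∈ W₂lift B h f k) :
    del w ∈ W₂lift B h f k := by
  rw [mem_W₂lift D] at *
  intro n hn i
  rw [cur_br_del_right]
  exact coeff_lamAdd_mem_ideal _ (fun x hx => del_mem_redIdeal hx) _ (hw n hn) i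

/-- In the Jacobi identity for n, v, w both terms on the right are brackets of an invariant with an
element of the ideal. -/
theorem br_mem_W₂lift (D : IsDatum B e h f) {v w : Scur 𝔤} (hv : v ∈ W₂lift B h f k)
    (hw : w ∈ W₂lift B h f k) (i : ℕ) : ((curData B k).br v w).coeff i ∈ W₂lift B h f k := by
  rw [mem_W₂lift D]
  intro n hn m
  have hp : ∀ a : Scur 𝔤, (curData B k).HasParity 0 a := fun a => by
    rw [LambdaData.HasParity, pow_zero, one_smul]; exact σ_Scur a
  rw [(isPVA_curData D.symm D.inv).jacobi 0 0 (scur n) v w m i (hp _) (hp _)]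
  refine add_mem (smul_mem_ideal _ _ ?_) (sum_mem fun j _ => ?_)
  · exact br_W₂lift_mem_redIdeal D hv ((mem_W₂lift D).1 hw n hn m) i
  · exact nsmul_mem (br_redIdeal_W₂lift_mem D hw ((mem_W₂lift D).1 hv n hn j) _) _

end Reduction


/-! ### Generalized eigenvectors of derivations -/

section Gen

variable {V : Type*} [AddCommGroup V] [Module ℂ V]

/-- `x` is a sum of generalized eigenvectors of `L` with eigenvalues in `s`. -/
inductive IsGen (L : V →ₗ[ℂ] V) (s : Set ℂ) : V → Prop
  | zero : IsGen L s 0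
  | step (m : ℂ) (x : V) (hm : m ∈ s) (hx : IsGen L s (L x - m • x)) : IsGen L s x

variable {L : V →ₗ[ℂ] V} {s : Set ℂ}

theorem IsGen.map {T : V →ₗ[ℂ] V} (hT : ∀ x, T (L x) = L (T x)) {x : V} (hx : IsGen L s x) :
    IsGen L s (T x) := by
  induction hx with
  | zero => rw [map_zero]; exact .zero
  | step m x hm _ ih =>
    refine .step m _ hm ?_
    rwa [map_sub, map_smul, hT] at ih

theorem IsGen.smul (c : ℂ) {x : V} (hx : IsGen L s x) : IsGen L s (c • x) :=
  hx.map (T := c • LinearMap.id) fun y => by simp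

theorem IsGen.apply {x : V} (hx : IsGen L s x) : IsGen L s (L x) := hx.map fun _ => rfl

/-- The factor L - m is applied to x + y; it shortens the chain of x, and (L - m)y is of the same
kind as y. -/
theorem IsGen.add {x y : V} (hx : IsGen L s x) (hy : IsGen L s y) : IsGen L s (x + y) := by
  induction hx generalizing y with
  | zero => rwa [zero_add]
  | step m x hm _ ih =>
    refine .step m _ hm ?_
    have hy' : IsGen L s (L y - m • y) := hy.map (T := L - m • LinearMap.id) fun z => by simp
    have := ih hy'
    rw [map_add, smul_add]
    convert this using 1
    abel

theorem IsGen.mono {t : Set ℂ} (hst : s ⊆ t) {x : V} (hx : IsGen L s x) : IsGen L t x := by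
  induction hx with
  | zero => exact .zero
  | step m x hm _ ih => exact .step m x (hst hm) ih

/-- The submodule of the sums of generalized eigenvectors with eigenvalues in `s`. -/
def genSub (L : V →ₗ[ℂ] V) (s : Set ℂ) : Submodule ℂ V where
  carrier := {x | IsGen L s x}
  add_mem' := IsGen.add
  zero_mem' := .zero
  smul_mem' c _ := IsGen.smul c

theorem mem_genSub {x : V} : x ∈ genSub L s ↔ IsGen L s x := Iff.rfl

theorem IsGen.eq_zero (hs : (0 : ℂ) ∉ s) {x : V} (hx : IsGen L s x) (h0 : L x = 0) : x = 0 := by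
  induction hx with
  | zero => rfl
  | step m x hm _ ih =>
    have := ih (by rw [map_sub, map_smul, h0]; simp)
    rw [h0, zero_sub, neg_eq_zero] at this
    refine (smul_eq_zero.1 this).resolve_left ?_
    rintro rfl
    exact hs hm

/-- Cocycles without component of eigenvalue `0` with respect to `L = d h + h d` are
coboundaries. -/
theorem IsGen.exists_eq_apply {d η : V →ₗ[ℂ] V} (hd : ∀ x, d (d x) = 0)
    (hL : ∀ x, L x = d (η x) + η (d x)) (hs : (0 : ℂ) ∉ s) (N : Submodule ℂ V)
    (hNη : ∀ x ∈ N, η x ∈ N) (hNd : ∀ x ∈ N, d x ∈ N) {x : V} (hx : IsGen L s x) (hxN : x ∈ N)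
    (h0 : d x = 0) : ∃ y ∈ N, d y = x := by
  induction hx with
  | zero => exact ⟨0, N.zero_mem, map_zero _⟩
  | step m x hm _ ih =>
    have hLx : L x = d (η x) := by rw [hL, h0, map_zero, add_zero]
    have hm0 : m ≠ 0 := by rintro rfl; exact hs hm
    obtain ⟨y, hy, hdy⟩ := ih
      (N.sub_mem (by rw [hLx]; exact hNd _ (hNη _ hxN)) (N.smul_mem _ hxN))
      (by rw [map_sub, map_smul, h0, hLx, hd]; simp)
    -- On a cocycle Lx = d(ηx), so mx = d(ηx) - (Lx - mx), and Lx - mx = dy by induction.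
    refine ⟨m⁻¹ • (η x - y), N.smul_mem _ (N.sub_mem (hNη _ hxN) hy), ?_⟩
    rw [map_smul, map_sub, hdy, hLx, sub_sub_cancel, smul_smul, inv_mul_cancel₀ hm0, one_smul]

/-- For a derivation, (L - m - n)(xy) = ((L - m)x) y + x ((L - n)y); induction on both factors. -/
theorem IsGen.mul {A : Type*} [Ring A] [Algebra ℂ A] {L : A →ₗ[ℂ] A}
    (hL : ∀ x y, L (x * y) = x * L y + L x * y) {s t r : Set ℂ}
    (hst : ∀ m ∈ s, ∀ n ∈ t, m + n ∈ r) {x y : A} (hx : IsGen L s x) (hy : IsGen L t y) :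
    IsGen L r (x * y) := by
  induction hx generalizing y with
  | zero => rw [zero_mul]; exact .zero
  | step m x hm _ ih =>
    induction hy with
    | zero => rw [mul_zero]; exact .zero
    | step n y hn hy' ihy =>
      refine .step (m + n) _ (hst m hm n hn) ?_
      have h1 := (ih (.step n y hn hy')).add ihy
      convert h1 using 1
      rw [hL, sub_mul, mul_sub, smul_mul_assoc, mul_smul_comm, add_smul]
      abel

end Gen

/-! ### Homomorphisms and odd derivations commuting with `∂` -/

section Lift

variable {W₀ W₁ : Type*} [AddCommGroup W₀] [Module ℂ W₀] [AddCommGroup W₁] [Module ℂ W₁]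
variable {V₀ V₁ : Type*} [AddCommGroup V₀] [Module ℂ V₀] [AddCommGroup V₁] [Module ℂ V₁]

theorem polyExt_X {W M : Type*} [AddCommGroup W] [Module ℂ W] [AddCommGroup M] [Module ℂ M]
    (T : M →ₗ[ℂ] M) (φ : W →ₗ[ℂ] M) (p : ℂ[X]) (w : W) :
    polyExt T φ ((X * p) ⊗ₜ w) = T (polyExt T φ (p ⊗ₜ w)) := by
  simp [polyExt_tmul]

theorem σ_polyExt {W : Type*} [AddCommGroup W] [Module ℂ W] (φ : W →ₗ[ℂ] S V₀ V₁) (c : ℂ)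
    {w : W} (hw : σ (φ w) = c • φ w) (p : ℂ[X]) :
    σ (polyExt del φ (p ⊗ₜ w)) = c • polyExt del φ (p ⊗ₜ w) := by
  rw [polyExt_tmul]
  have := aeval_intertwine (σ (W₀ := V₀) (W₁ := V₁)).toLinearMap del del σ_del p (φ w)
  simp only [AlgHom.toLinearMap_apply] at this
  rw [this, hw, map_smul]

theorem polyExt_even_comm (φ : W₀ →ₗ[ℂ] S V₀ V₁) (hφ : ∀ a, σ (φ a) = φ a) (p q : ℂ[X]) (a : W₀)
    (w : W₀ × W₁) :
    polyExt del (φ ∘ₗ LinearMap.fst ℂ W₀ W₁) (p ⊗ₜ (a, 0)) *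
        polyExt del (φ ∘ₗ LinearMap.fst ℂ W₀ W₁) (q ⊗ₜ w) =
      polyExt del (φ ∘ₗ LinearMap.fst ℂ W₀ W₁) (q ⊗ₜ w) *
        polyExt del (φ ∘ₗ LinearMap.fst ℂ W₀ W₁) (p ⊗ₜ (a, 0)) := by
  refine HasPar.mul_comm (o := false) ?_ _
  have := σ_polyExt (φ ∘ₗ LinearMap.fst ℂ W₀ W₁) 1 (w := (a, 0)) (by simp [hφ]) p
  rw [hasPar_false, this, one_smul]

/-- The homomorphism commuting with `∂` that sends the odd generators to `0` and is given by
`φ` on the even generators. -/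
def evenLift (φ : W₀ →ₗ[ℂ] S V₀ V₁) (hφ : ∀ a, σ (φ a) = φ a) : S W₀ W₁ →ₐ[ℂ] S V₀ V₁ :=
  S.lift (polyExt del (φ ∘ₗ LinearMap.fst ℂ W₀ W₁)) (polyExt_even_comm φ hφ)
    (fun p q a b => by simp [polyExt_tmul])

theorem evenLift_gen (φ : W₀ →ₗ[ℂ] S V₀ V₁) (hφ : ∀ a, σ (φ a) = φ a) (w : W₀ × W₁) :
    evenLift φ hφ (gen 0 w) = φ w.1 := by
  rw [gen_zero_apply, evenLift, S.lift_ι, polyExt_tmul]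
  simp

theorem evenLift_del (φ : W₀ →ₗ[ℂ] S V₀ V₁) (hφ : ∀ a, σ (φ a) = φ a) (x : S W₀ W₁) :
    evenLift φ hφ (del x) = del (evenLift φ hφ x) := by
  induction x using S.induction with
  | hc r => rw [del_algebraMap, AlgHom.commutes, del_algebraMap, map_zero]
  | hι v =>
    induction v using TensorProduct.induction_on with
    | zero => simp
    | tmul p w => rw [del_ι, evenLift, S.lift_ι, S.lift_ι, polyExt_X]
    | add x y hx hy => simp only [map_add, hx, hy]
  | hmul a b ha hb => rw [del_mul, map_add, map_mul, map_mul, map_mul, ha, hb, del_mul]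
  | hadd a b ha hb => simp only [map_add, ha, hb]

theorem evenLift_σ (φ : W₀ →ₗ[ℂ] S V₀ V₁) (hφ : ∀ a, σ (φ a) = φ a) (x : S W₀ W₁) :
    evenLift φ hφ (σ x) = evenLift φ hφ x := by
  induction x using S.induction_del with
  | hc r => rw [AlgHom.commutes]
  | h₀ a => rw [hasPar_false.1 (hasPar_gen_even a)]
  | h₁ b => rw [hasPar_true.1 (hasPar_gen_odd b), map_neg, evenLift_gen]; simp
  | hdel a ha => rw [σ_del, evenLift_del, ha, evenLift_del]
  | hmul a b ha hb => simp only [map_mul, ha, hb]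
  | hadd a b ha hb => simp only [map_add, ha, hb]

theorem σ_evenLift (φ : W₀ →ₗ[ℂ] S V₀ V₁) (hφ : ∀ a, σ (φ a) = φ a) (x : S W₀ W₁) :
    σ (evenLift φ hφ x) = evenLift φ hφ x := by
  induction x using S.induction_del with
  | hc r => rw [AlgHom.commutes, AlgHom.commutes]
  | h₀ a => rw [evenLift_gen, hφ]
  | h₁ b => rw [evenLift_gen, hφ]
  | hdel a ha => rw [evenLift_del, σ_del, ha]
  | hmul a b ha hb => simp only [map_mul, ha, hb]
  | hadd a b ha hb => simp only [map_add, ha, hb]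

/-- The odd derivation commuting with `∂` with values `η` on the generators. -/
def oddDer (η : W₀ × W₁ →ₗ[ℂ] S W₀ W₁) : S W₀ W₁ →ₗ[ℂ] S W₀ W₁ :=
  (Polynomial.lcoeff (S W₀ W₁) 0).restrictScalars ℂ ∘ₗ
    derivPart true (Polynomial.CAlgHom.toLinearMap ∘ₗ polyExt del η)

variable {η : W₀ × W₁ →ₗ[ℂ] S W₀ W₁}

theorem oddDer_apply (x : S W₀ W₁) : oddDer η x =
    (derivPart true (Polynomial.CAlgHom.toLinearMap ∘ₗ polyExt del η) x).coeff 0 := rfl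

theorem oddDer_mul (a b : S W₀ W₁) : oddDer η (a * b) = σ a * oddDer η b + oddDer η a * b := by
  rw [oddDer_apply, derivPart_mul]
  simp [twist, oddDer_apply]

theorem oddDer_algebraMap (r : ℂ) : oddDer η (algebraMap ℂ _ r) = 0 := by
  rw [oddDer_apply, derivPart_algebraMap, coeff_zero]

theorem oddDer_ι_even (h₀ : ∀ a, σ (η (a, 0)) = -η (a, 0)) (p : ℂ[X]) (a : W₀) :
    oddDer η (ι (p ⊗ₜ (a, 0))) = polyExt del η (p ⊗ₜ (a, 0)) := by
  have h1 := σ_polyExt η (-1) (w := (a, 0)) (by rw [h₀, neg_one_smul]) p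
  rw [oddDer_apply, derivPart_ι, parityPart_apply, sgn_even]
  simp only [LinearMap.comp_apply, AlgHom.toLinearMap_apply, CAlgHom_apply, σX_C, h1, sign,
    cond_true, coeff_smul, coeff_add, coeff_C_zero]
  module

theorem oddDer_ι_odd (h₁ : ∀ b, σ (η (0, b)) = η (0, b)) (p : ℂ[X]) (b : W₁) :
    oddDer η (ι (p ⊗ₜ (0, b))) = polyExt del η (p ⊗ₜ (0, b)) := by
  have h1 := σ_polyExt η 1 (w := (0, b)) (by rw [h₁, one_smul]) p
  rw [oddDer_apply, derivPart_ι, parityPart_apply, sgn_odd]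
  simp only [LinearMap.comp_apply, AlgHom.toLinearMap_apply, CAlgHom_apply, map_neg, σX_C, h1, sign,
    cond_true, coeff_smul, coeff_add, coeff_C_zero, coeff_neg]
  module

theorem oddDer_ι (h₀ : ∀ a, σ (η (a, 0)) = -η (a, 0)) (h₁ : ∀ b, σ (η (0, b)) = η (0, b))
    (p : ℂ[X]) (w : W₀ × W₁) : oddDer η (ι (p ⊗ₜ w)) = polyExt del η (p ⊗ₜ w) := by
  obtain ⟨w₀, w₁⟩ := w
  have hw : (w₀, w₁) = ((w₀, 0) : W₀ × W₁) + (0, w₁) := by simp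
  rw [hw, TensorProduct.tmul_add, map_add, map_add, map_add, oddDer_ι_even h₀, oddDer_ι_odd h₁]

theorem oddDer_gen (h₀ : ∀ a, σ (η (a, 0)) = -η (a, 0)) (h₁ : ∀ b, σ (η (0, b)) = η (0, b))
    (w : W₀ × W₁) : oddDer η (gen 0 w) = η w := by
  rw [gen_zero_apply, oddDer_ι h₀ h₁, polyExt_tmul]; simp

theorem oddDer_del (h₀ : ∀ a, σ (η (a, 0)) = -η (a, 0)) (h₁ : ∀ b, σ (η (0, b)) = η (0, b))
    (x : S W₀ W₁) : oddDer η (del x) = del (oddDer η x) := by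
  induction x using S.induction with
  | hc r => rw [del_algebraMap, oddDer_algebraMap, map_zero, map_zero]
  | hι v =>
    induction v using TensorProduct.induction_on with
    | zero => simp
    | tmul p w => rw [del_ι, oddDer_ι h₀ h₁, oddDer_ι h₀ h₁, polyExt_X]
    | add x y hx hy => simp only [map_add, hx, hy]
  | hmul a b ha hb =>
    simp only [del_mul, map_add, oddDer_mul, ha, hb, σ_del]
    abel
  | hadd a b ha hb => simp only [map_add, ha, hb]

theorem oddDer_σ (h₀ : ∀ a, σ (η (a, 0)) = -η (a, 0)) (h₁ : ∀ b, σ (η (0, b)) = η (0, b))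
    (x : S W₀ W₁) : oddDer η (σ x) = -σ (oddDer η x) := by
  induction x using S.induction_del with
  | hc r => rw [AlgHom.commutes, oddDer_algebraMap, map_zero, neg_zero]
  | h₀ a => rw [hasPar_false.1 (hasPar_gen_even a), oddDer_gen h₀ h₁, h₀, neg_neg]
  | h₁ b => rw [hasPar_true.1 (hasPar_gen_odd b), map_neg, oddDer_gen h₀ h₁, h₁]
  | hdel a ha => rw [σ_del, oddDer_del h₀ h₁, oddDer_del h₀ h₁, ha, map_neg, σ_del]
  | hmul a b ha hb =>
    simp only [map_mul, oddDer_mul, map_add, ha, hb, σ_σ]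
    noncomm_ring
  | hadd a b ha hb => simp only [map_add, ha, hb, neg_add]

/-- The anticommutator of two odd derivations is a derivation. -/
theorem anticomm_mul {d η : S W₀ W₁ →ₗ[ℂ] S W₀ W₁}
    (hd : ∀ a b, d (a * b) = σ a * d b + d a * b) (hdσ : ∀ a, d (σ a) = -σ (d a))
    (hη : ∀ a b, η (a * b) = σ a * η b + η a * b) (hησ : ∀ a, η (σ a) = -σ (η a))
    (a b : S W₀ W₁) : d (η (a * b)) + η (d (a * b))
      = a * (d (η b) + η (d b)) + (d (η a) + η (d a)) * b := by
  rw [hη, hd a b, map_add, map_add, hd, hd, hη, hη, hdσ, hησ, σ_σ, mul_add, add_mul]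
  noncomm_ring

end Lift


/-! ### The homomorphisms between the two complexes -/

section Homs

variable {𝔤 : Type*} [LieRing 𝔤] [LieAlgebra ℂ 𝔤] {e h f : 𝔤} {B : LinearMap.BilinForm ℂ 𝔤} {k : ℂ}
  {I : Type*} [Fintype I] {u : Module.Basis I ℂ (nPart h)}

/-- Induction on the elements of `S(R)`. -/
theorem C₁_induction {P : C₁ h → Prop} (hc : ∀ r : ℂ, P (algebraMap ℂ _ r))
    (hcur : ∀ a, P (cur h a)) (hPhi : ∀ b, P (Phi h b)) (hphi : ∀ n, P (phi h n))
    (hphiDual : ∀ θ, P (phiDual h θ)) (hdel : ∀ a, P a → P (del a))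
    (hmul : ∀ a b, P a → P b → P (a * b)) (hadd : ∀ a b, P a → P b → P (a + b)) (a : C₁ h) :
    P a := by
  refine S.induction_del hc (fun x => ?_) (fun y => ?_) hdel hmul hadd a
  · rw [gen_even_eq]; exact hadd _ _ (hcur _) (hPhi _)
  · rw [gen_odd_eq]; exact hadd _ _ (hphi _) (hphiDual _)

/-- The homomorphism `a ↦ a`, `Φ_b ↦ -b`, `φ ↦ 0`. -/
def toScur (h : 𝔤) : C₁ h →ₐ[ℂ] Scur 𝔤 :=
  evenLift (scur ∘ₗ LinearMap.fst ℂ 𝔤 (halfPart h)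
    - scur ∘ₗ (halfPart h).subtype ∘ₗ LinearMap.snd ℂ 𝔤 (halfPart h)) fun _ => σ_Scur _

theorem toScur_cur (a : 𝔤) : toScur h (cur h a) = scur a :=
  (evenLift_gen _ _ _).trans (by simp)
theorem toScur_Phi (b : halfPart h) : toScur h (Phi h b) = -scur (b : 𝔤) :=
  (evenLift_gen _ _ _).trans (by simp)
theorem toScur_phi (n : nPart h) : toScur h (phi h n) = 0 := (evenLift_gen _ _ _).trans (by simp)
theorem toScur_phiDual (θ : Module.Dual ℂ (nPart h)) : toScur h (phiDual h θ) = 0 :=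
  (evenLift_gen _ _ _).trans (by simp)
theorem toScur_del (x : C₁ h) : toScur h (del x) = del (toScur h x) := evenLift_del _ _ x
theorem toScur_σ (x : C₁ h) : toScur h (σ x) = toScur h x := evenLift_σ _ _ x

theorem toScur_twist (o : Bool) (x : C₁ h) : toScur h (twist o x) = toScur h x := by
  cases o
  · rfl
  · exact toScur_σ x

theorem toScur_J (a : 𝔤) : toScur h (J h u a) = scur a := by
  simp [J, toScur_cur, toScur_phi]

/-- The homomorphism `a ↦ a`. -/
def fromScur (h : 𝔤) : Scur 𝔤 →ₐ[ℂ] C₁ h := evenLift (cur h) (σ_cur h)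

theorem fromScur_scur (a : 𝔤) : fromScur h (scur a) = cur h a := evenLift_gen _ _ _
theorem fromScur_del (x : Scur 𝔤) : fromScur h (del x) = del (fromScur h x) := evenLift_del _ _ x
theorem hasPar_fromScur (x : Scur 𝔤) : HasPar false (fromScur h x) :=
  hasPar_false.2 (σ_evenLift _ _ x)

theorem toScur_fromScur (w : Scur 𝔤) : toScur h (fromScur h w) = w := by
  induction w using Scur_induction with
  | hc r => rw [AlgHom.commutes, AlgHom.commutes]
  | hgen a => rw [fromScur_scur, toScur_cur]
  | hdel a ha => rw [fromScur_del, toScur_del, ha]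
  | hmul a b ha hb => rw [map_mul, map_mul, ha, hb]
  | hadd a b ha hb => rw [map_add, map_add, ha, hb]

theorem hasPar_Tmap (a : 𝔤) : HasPar false (Tmap B h f u a) := by
  rw [hasPar_false, Tmap_apply, map_sub, map_sub, σ_J, σ_Phi, AlgHom.commutes]

/-- The homomorphism `a ↦ T(a)`. -/
def Tlift (B : LinearMap.BilinForm ℂ 𝔤) (h f : 𝔤) (u : Module.Basis I ℂ (nPart h)) :
    Scur 𝔤 →ₐ[ℂ] C₁ h := evenLift (Tmap B h f u) fun a => hasPar_false.1 (hasPar_Tmap a)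

theorem Tlift_scur (a : 𝔤) : Tlift B h f u (scur a) = Tmap B h f u a := evenLift_gen _ _ _
theorem Tlift_del (x : Scur 𝔤) : Tlift B h f u (del x) = del (Tlift B h f u x) :=
  evenLift_del _ _ x
theorem hasPar_Tlift (x : Scur 𝔤) : HasPar false (Tlift B h f u x) :=
  hasPar_false.2 (σ_evenLift _ _ x)

theorem Tlift_mem_Sminus (w : Scur 𝔤) : Tlift B h f u w ∈ Sminus h u := by
  induction w using Scur_induction with
  | hc r => rw [AlgHom.commutes]; exact Subalgebra.algebraMap_mem _ _
  | hgen a => rw [Tlift_scur]; exact Tmap_mem_Sminus a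
  | hdel a ha => rw [Tlift_del]; exact del_mem_Sminus ha
  | hmul a b ha hb => rw [map_mul]; exact mul_mem ha hb
  | hadd a b ha hb => rw [map_add]; exact add_mem ha hb

variable [FiniteDimensional ℂ 𝔤]

/-- T is the scalar -(f, m) on m in 𝔪, so it kills m + (f, m) and factors through the quotient. -/
theorem Tlift_of_mem_redIdeal (D : IsDatum B e h f) {w : Scur 𝔤} (hw : w ∈ redIdeal B h f) :
    Tlift B h f u w = 0 := by
  refine redIdeal_induction (P := fun w => Tlift B h f u w = 0) (map_zero _) ?_ ?_ ?_ ?_ ?_ hw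
  · intro n m hm
    induction n with
    | zero =>
      rw [pow_zero, Module.End.one_apply, map_add, Tlift_scur, Tmap_of_mPart D hm,
        AlgHom.commutes, neg_add_cancel]
    | succ n ih => rw [pow_succ', Module.End.mul_apply, Tlift_del, ih, map_zero]
  · intro x _ hx; rw [map_neg, hx, neg_zero]
  · intro x _ y _ hx hy; rw [map_add, hx, hy, add_zero]
  · intro x y _ hy; rw [map_mul, hy, mul_zero]
  · intro x _ y hx; rw [map_mul, hx, zero_mul]

theorem scur_sub_mem_redIdeal (D : IsDatum B e h f) (n : nPart h) :
    scur (n : 𝔤) - scur (gradeProj h {1 / 2} (n : 𝔤) : 𝔤) + algebraMap ℂ _ (B f n)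
      ∈ redIdeal B h f := by
  have := redGen_mem (B := B) (f := f) (sub_gradeProj_half_mem D.sl2 n.2) 0
  rwa [pow_zero, Module.End.one_apply, map_sub, map_sub,
    bilin_f_half D.sl2 D.inv (gradeProj h {1 / 2} (n : 𝔤)).2, sub_zero] at this

theorem toScur_Tmap_sub_mem (D : IsDatum B e h f) (a : 𝔤) :
    toScur h (Tmap B h f u a) - scur a ∈ redIdeal B h f := by
  have h1 := neg_mem (scur_sub_mem_redIdeal D (gradeProj h (Set.Ici (1 / 2)) a))
  have e1 := gradeProj_nonpos_add D.sl2 a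
  have e3 := bilin_f_nonpos D.sl2 D.inv (gradeProj h (Set.Iic 0) a).2
  rw [gradeProj_half_nPart D.sl2] at h1
  rw [Tmap_apply, map_sub, map_sub, toScur_J, toScur_Phi, AlgHom.commutes]
  have h2 : scur a = scur (gradeProj h (Set.Iic 0) a : 𝔤)
      + scur (gradeProj h (Set.Ici (1 / 2)) a : 𝔤) := by rw [← map_add, e1]
  have h3 : B f a = B f (gradeProj h (Set.Ici (1 / 2)) a) := by
    conv_lhs => rw [← e1, map_add, e3, zero_add]
  rw [h2, h3]
  convert h1 using 1
  abel

/-- T is thus a section of i modulo the ideal; the surjectivity of j rests on it. -/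
theorem toRed_toScur_Tlift (D : IsDatum B e h f) (w : Scur 𝔤) :
    toRed B h f (toScur h (Tlift B h f u w)) = toRed B h f w := by
  rw [← sub_eq_zero, ← map_sub, toRed_eq_zero]
  induction w using Scur_induction with
  | hc r => rw [AlgHom.commutes, AlgHom.commutes, sub_self]; exact zero_mem _
  | hgen a => rw [Tlift_scur]; exact toScur_Tmap_sub_mem D a
  | hdel a ha => rw [Tlift_del, toScur_del, ← map_sub]; exact del_mem_redIdeal ha
  | hmul a b ha hb =>
    rw [map_mul, map_mul]
    have := add_mem (TwoSidedIdeal.mul_mem_right _ _ (toScur h (Tlift B h f u b)) ha)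
      (TwoSidedIdeal.mul_mem_left _ a _ hb)
    convert this using 1
    noncomm_ring
  | hadd a b ha hb =>
    rw [map_add, map_add]
    convert add_mem ha hb using 1
    abel

/-- dφ_n goes to n - n_{1/2} + (f, n), which is a generator of the ideal since n - n_{1/2} is in 𝔪
and f is orthogonal to 𝔤(1/2). For the other generators every term of the differential contains some
∂ᵐφ^θ and goes to 0. -/
theorem toScur_brst_mem (D : IsDatum B e h f) (x : C₁ h) :
    toScur h ((brst B h f k u).d x) ∈ redIdeal B h f := by
  have hz : (0 : Scur 𝔤) ∈ redIdeal B h f := zero_mem _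
  induction x using C₁_induction with
  | hc r => rwa [brst_algebraMap, map_zero]
  | hcur a =>
    rw [brst_cur D]
    simpa only [map_add, map_sum, map_mul, toScur_phiDual, zero_mul, Finset.sum_const_zero, map_smul,
      toScur_del, map_zero, smul_zero, add_zero] using hz
  | hPhi b => rw [brst_Phi D, toScur_phiDual]; exact hz
  | hphi n =>
    rw [brst_phi D, map_add, map_add, toScur_J, toScur_Phi, AlgHom.commutes]
    convert scur_sub_mem_redIdeal D n using 1
    abel
  | hphiDual θ =>
    rw [brst_phiDual D]
    simpa only [map_sum, map_mul, toScur_phiDual, zero_mul, Finset.sum_const_zero, map_smul,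
      smul_zero] using hz
  | hdel a ha => rw [brst_del, toScur_del]; exact del_mem_redIdeal ha
  | hmul a b ha hb =>
    rw [brst_mul, map_add, map_mul, map_mul]
    exact add_mem (TwoSidedIdeal.mul_mem_left _ _ _ hb) (TwoSidedIdeal.mul_mem_right _ _ _ ha)
  | hadd a b ha hb => rw [map_add, map_add]; exact add_mem ha hb

end Homs

/-! ### The contracting homotopy on the subalgebra generated by `φ_n` and `d φ_n` -/

section HomotopyPlus

variable {𝔤 : Type*} [LieRing 𝔤] [LieAlgebra ℂ 𝔤] {e h f : 𝔤} {B : LinearMap.BilinForm ℂ 𝔤} {k : ℂ}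
  {I : Type*} [Fintype I] {u : Module.Basis I ℂ (nPart h)}

/-- The values `a ↦ φ_a` of the homotopy on generators. -/
def homPlusGen (h : 𝔤) : (𝔤 × halfPart h) × (nPart h × Module.Dual ℂ (nPart h)) →ₗ[ℂ] C₁ h :=
  phi h ∘ₗ gradeProj h (Set.Ici (1 / 2)) ∘ₗ LinearMap.fst ℂ _ _ ∘ₗ LinearMap.fst ℂ _ _

theorem homPlusGen_even (a : 𝔤 × halfPart h) :
    σ (homPlusGen h (a, 0)) = -homPlusGen h (a, 0) := σ_phi _ _

theorem homPlusGen_odd (b : nPart h × Module.Dual ℂ (nPart h)) :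
    σ (homPlusGen h (0, b)) = homPlusGen h (0, b) := by simp [homPlusGen]

/-- The odd derivation `a ↦ φ_a`, which is zero on the other generators. -/
def homPlus (h : 𝔤) : C₁ h →ₗ[ℂ] C₁ h := oddDer (homPlusGen h)

theorem homPlus_cur (a : 𝔤) : homPlus h (cur h a) = phi h (gradeProj h (Set.Ici (1 / 2)) a) :=
  (oddDer_gen homPlusGen_even homPlusGen_odd _).trans (by simp [homPlusGen])
theorem homPlus_Phi (b : halfPart h) : homPlus h (Phi h b) = 0 :=
  (oddDer_gen homPlusGen_even homPlusGen_odd _).trans (by simp [homPlusGen])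
theorem homPlus_phi (n : nPart h) : homPlus h (phi h n) = 0 :=
  (oddDer_gen homPlusGen_even homPlusGen_odd _).trans (by simp [homPlusGen])
theorem homPlus_phiDual (θ : Module.Dual ℂ (nPart h)) : homPlus h (phiDual h θ) = 0 :=
  (oddDer_gen homPlusGen_even homPlusGen_odd _).trans (by simp [homPlusGen])
theorem homPlus_mul (a b : C₁ h) : homPlus h (a * b) = σ a * homPlus h b + homPlus h a * b :=
  oddDer_mul a b
theorem homPlus_algebraMap (r : ℂ) : homPlus h (algebraMap ℂ _ r) = 0 := oddDer_algebraMap r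
theorem homPlus_del (a : C₁ h) : homPlus h (del a) = del (homPlus h a) :=
  oddDer_del homPlusGen_even homPlusGen_odd a
theorem homPlus_σ (a : C₁ h) : homPlus h (σ a) = -σ (homPlus h a) :=
  oddDer_σ homPlusGen_even homPlusGen_odd a

theorem homPlus_J (a : 𝔤) : homPlus h (J h u a) = phi h (gradeProj h (Set.Ici (1 / 2)) a) := by
  simp [J, homPlus_cur, homPlus_mul, homPlus_phi, homPlus_phiDual]

/-- `d h₊ + h₊ d`. -/
def lapPlus (B : LinearMap.BilinForm ℂ 𝔤) (h f : 𝔤) (k : ℂ) (u : Module.Basis I ℂ (nPart h)) :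
    C₁ h →ₗ[ℂ] C₁ h := (brst B h f k u).d ∘ₗ homPlus h + homPlus h ∘ₗ (brst B h f k u).d

theorem lapPlus_apply (x : C₁ h) : lapPlus B h f k u x
    = (brst B h f k u).d (homPlus h x) + homPlus h ((brst B h f k u).d x) := rfl

theorem lapPlus_mul (x y : C₁ h) : lapPlus B h f k u (x * y)
    = x * lapPlus B h f k u y + lapPlus B h f k u x * y := by
  rw [lapPlus_apply, lapPlus_apply, lapPlus_apply]
  exact anticomm_mul (d := (brst B h f k u).d) (η := homPlus h) brst_mul brst_σ homPlus_mul
    homPlus_σ x y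

theorem lapPlus_del (x : C₁ h) : lapPlus B h f k u (del x) = del (lapPlus B h f k u x) := by
  rw [lapPlus_apply, lapPlus_apply, homPlus_del, brst_del, brst_del, homPlus_del, map_add]

variable [FiniteDimensional ℂ 𝔤]

theorem homPlus_of_mem_Sminus (D : IsDatum B e h f) {x : C₁ h} (hx : x ∈ Sminus h u) :
    homPlus h x = 0 := by
  refine Sminus_induction (u := u) (P := fun x => homPlus h x = 0) homPlus_algebraMap
    (fun a ha => ?_) homPlus_Phi homPlus_phiDual (fun x _ hx => ?_) (fun x _ y _ hx hy => ?_)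
    (fun x _ y _ hx hy => ?_) hx
  · rw [homPlus_J, gradeProj_nPart_of_nonpos D.sl2 ha, map_zero]
  · rw [homPlus_del, hx, map_zero]
  · rw [homPlus_mul, hx, hy]; simp
  · rw [map_add, hx, hy, add_zero]

theorem lapPlus_of_mem_Sminus (D : IsDatum B e h f) {x : C₁ h} (hx : x ∈ Sminus h u) :
    lapPlus B h f k u x = 0 := by
  rw [lapPlus_apply, homPlus_of_mem_Sminus D hx, homPlus_of_mem_Sminus D (brst_mem_Sminus D hx),
    map_zero, add_zero]

theorem lapPlus_phi (D : IsDatum B e h f) (n : nPart h) :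
    lapPlus B h f k u (phi h n) = phi h n := by
  rw [lapPlus_apply, homPlus_phi, brst_phi D, map_add, map_add, homPlus_J, homPlus_algebraMap,
    homPlus_Phi, gradeProj_of_mem D.sl2 n.2]
  simp

theorem lapPlus_brst (D : IsDatum B e h f) (x : C₁ h) :
    lapPlus B h f k u ((brst B h f k u).d x) = (brst B h f k u).d (lapPlus B h f k u x) := by
  rw [lapPlus_apply, lapPlus_apply, brst_brst D, map_add, brst_brst D]; simp

/-- The positive integers. -/
abbrev posNat : Set ℂ := Set.range fun n : ℕ => (n : ℂ) + 1

/-- The non-negative integers. -/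
abbrev nonnegNat : Set ℂ := Set.range fun n : ℕ => (n : ℂ)

theorem zero_notMem_posNat : (0 : ℂ) ∉ posNat := by
  rintro ⟨n, hn⟩
  exact Nat.cast_add_one_ne_zero n hn

theorem posNat_subset_nonnegNat : posNat ⊆ nonnegNat := by
  rintro _ ⟨n, rfl⟩
  exact ⟨n + 1, by push_cast; rfl⟩

theorem posNat_add_nonnegNat : ∀ m ∈ posNat, ∀ n ∈ nonnegNat, m + n ∈ posNat := by
  rintro _ ⟨m, rfl⟩ _ ⟨n, rfl⟩
  exact ⟨m + n, by push_cast; ring⟩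

theorem nonnegNat_add_posNat : ∀ m ∈ nonnegNat, ∀ n ∈ posNat, m + n ∈ posNat := by
  rintro _ ⟨m, rfl⟩ _ ⟨n, rfl⟩
  exact ⟨m + n, by push_cast; ring⟩

theorem nonnegNat_add_nonnegNat : ∀ m ∈ nonnegNat, ∀ n ∈ nonnegNat, m + n ∈ nonnegNat := by
  rintro _ ⟨m, rfl⟩ _ ⟨n, rfl⟩
  exact ⟨m + n, by push_cast; ring⟩

theorem one_mem_posNat : (1 : ℂ) ∈ posNat := ⟨0, by simp⟩

theorem zero_mem_nonnegNat : (0 : ℂ) ∈ nonnegNat := ⟨0, by simp⟩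

theorem IsGen.of_eigen {V : Type*} [AddCommGroup V] [Module ℂ V] {L : V →ₗ[ℂ] V} {s : Set ℂ}
    {m : ℂ} (hm : m ∈ s) {x : V} (hx : L x = m • x) : IsGen L s x :=
  .step m x hm (by rw [hx, sub_self]; exact .zero)

/-- `S(R)` is the sum of `S(R_-)` and of the part of positive eigenvalue. -/
theorem exists_mem_Sminus_add (D : IsDatum B e h f) (x : C₁ h) :
    ∃ y ∈ Sminus h u, IsGen (lapPlus B h f k u) posNat (x - y) := by
  set G : Submodule ℂ (C₁ h) := genSub (lapPlus B h f k u) posNat with hG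
  have hmem : ∀ {z}, z ∈ G ↔ IsGen (lapPlus B h f k u) posNat z := Iff.rfl
  have hS0 : ∀ y ∈ Sminus h u, IsGen (lapPlus B h f k u) nonnegNat y := fun y hy =>
    .of_eigen zero_mem_nonnegNat (by rw [lapPlus_of_mem_Sminus D hy, zero_smul])
  have hphi : ∀ n, phi h n ∈ G := fun n =>
    .of_eigen one_mem_posNat (by rw [lapPlus_phi D, one_smul])
  have hdphi : ∀ n, (brst B h f k u).d (phi h n) ∈ G := fun n => .of_eigen one_mem_posNat
    (by rw [lapPlus_brst D, lapPlus_phi D, one_smul])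
  change ∃ y ∈ Sminus h u, x - y ∈ G
  induction x using C₁_induction with
  | hc r => exact ⟨_, Subalgebra.algebraMap_mem _ r, by rw [sub_self]; exact zero_mem _⟩
  | hcur a =>
    -- a = J_{a_≤0} + J_{a_𝔫} - ∑ φ^{v^α}φ_{[u_α, a]} and J_{a_𝔫} = dφ_{a_𝔫} - (f, a_𝔫) - Φ.
    -- Removing dφ and the products, which have eigenvalue 1, leaves this element.
    refine ⟨J h u (gradeProj h (Set.Iic 0) a)
      + -(algebraMap ℂ _ (B f (gradeProj h (Set.Ici (1 / 2)) a : 𝔤))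
      + Phi h (gradeProj h {1 / 2} (gradeProj h (Set.Ici (1 / 2)) a : 𝔤))),
      add_mem (J_mem_Sminus (Subtype.prop _)) (neg_mem (add_mem (Subalgebra.algebraMap_mem _ _)
        (Phi_mem_Sminus _))), ?_⟩
    have h1 : cur h a = J h u (gradeProj h (Set.Iic 0) a)
        + J h u (gradeProj h (Set.Ici (1 / 2)) a)
        - ∑ α, phiDual h (u.coord α) * phi h (gradeProj h (Set.Ici (1 / 2)) ⁅(u α : 𝔤), a⁆) := by
      rw [eq_sub_iff_add_eq]
      conv_rhs => rw [← Jlin_apply, ← Jlin_apply, ← map_add, gradeProj_nonpos_add D.sl2, Jlin_apply]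
      rfl
    have h2 := brst_phi (u := u) (k := k) D (gradeProj h (Set.Ici (1 / 2)) a)
    have h3 : ∑ α, phiDual h (u.coord α) * phi h (gradeProj h (Set.Ici (1 / 2)) ⁅(u α : 𝔤), a⁆)
        ∈ G := sum_mem fun α _ =>
      IsGen.mul lapPlus_mul nonnegNat_add_posNat (hS0 _ (phiDual_mem_Sminus _)) (hphi _)
    have h4 := sub_mem (hdphi (gradeProj h (Set.Ici (1 / 2)) a)) h3
    convert h4 using 1
    rw [h1, h2]
    abel
  | hPhi b => exact ⟨_, Phi_mem_Sminus b, by rw [sub_self]; exact zero_mem _⟩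
  | hphi n => exact ⟨0, zero_mem _, by rw [sub_zero]; exact hphi n⟩
  | hphiDual θ => exact ⟨_, phiDual_mem_Sminus θ, by rw [sub_self]; exact zero_mem _⟩
  | hdel a ha =>
    obtain ⟨y, hy, hG'⟩ := ha
    refine ⟨del y, del_mem_Sminus hy, ?_⟩
    rw [← map_sub]
    exact IsGen.map (fun z => (lapPlus_del z).symm) (hmem.1 hG')
  | hmul a b ha hb =>
    obtain ⟨y, hy, hya⟩ := ha
    obtain ⟨z, hz, hzb⟩ := hb
    refine ⟨y * z, mul_mem hy hz, ?_⟩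
    -- ab - yz = (a - y)z + y(b - z) + (a - y)(b - z), each term having a factor of positive
    -- eigenvalue.
    have h1 := IsGen.mul lapPlus_mul posNat_add_nonnegNat (hmem.1 hya) (hS0 z hz)
    have h2 := IsGen.mul lapPlus_mul nonnegNat_add_posNat (hS0 y hy) (hmem.1 hzb)
    have h3 := IsGen.mul lapPlus_mul posNat_add_nonnegNat (hmem.1 hya)
      ((hmem.1 hzb).mono posNat_subset_nonnegNat)
    have h4 := (h1.add h2).add h3
    refine hmem.2 ?_
    convert h4 using 1
    noncomm_ring
  | hadd a b ha hb =>
    obtain ⟨y, hy, hya⟩ := ha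
    obtain ⟨z, hz, hzb⟩ := hb
    refine ⟨y + z, add_mem hy hz, ?_⟩
    rw [add_sub_add_comm]
    exact add_mem hya hzb

theorem Sminus_inf_gen (D : IsDatum B e h f) {x : C₁ h} (hx : x ∈ Sminus h u)
    (hg : IsGen (lapPlus B h f k u) posNat x) : x = 0 :=
  hg.eq_zero zero_notMem_posNat (lapPlus_of_mem_Sminus D hx)

/-- Every cocycle of `S(R)` is cohomologous to a cocycle of `S(R_-)`. -/
theorem exists_cocycle_Sminus (D : IsDatum B e h f) {x : C₁ h} (hx : (brst B h f k u).d x = 0) :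
    ∃ y ∈ Sminus h u, (brst B h f k u).d y = 0 ∧ ∃ z, (brst B h f k u).d z = x - y := by
  obtain ⟨y, hy, hg⟩ := exists_mem_Sminus_add (k := k) (u := u) D x
  have h1 : IsGen (lapPlus B h f k u) posNat ((brst B h f k u).d (x - y)) :=
    hg.map fun z => (lapPlus_brst D z).symm
  rw [map_sub, hx, zero_sub] at h1
  -- -dy lies both in S(R_-) and in the part of positive eigenvalue, so y is a cocycle, and then so
  -- is x - y.
  have h2 := Sminus_inf_gen D (neg_mem (brst_mem_Sminus D hy)) h1
  rw [neg_eq_zero] at h2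
  obtain ⟨z, -, hz⟩ := hg.exists_eq_apply (brst_brst D) lapPlus_apply zero_notMem_posNat ⊤
    (fun _ _ => trivial) (fun _ _ => trivial) trivial (by rw [map_sub, hx, h2, sub_zero])
  exact ⟨y, hy, h2, z, hz⟩

/-- A coboundary of `S(R)` that lies in `S(R_-)` is a coboundary of `S(R_-)`. -/
theorem exists_eq_brst_of_mem_Sminus (D : IsDatum B e h f) {x : C₁ h}
    (hx : (brst B h f k u).d x ∈ Sminus h u) :
    ∃ y ∈ Sminus h u, (brst B h f k u).d y = (brst B h f k u).d x := by
  obtain ⟨y, hy, hg⟩ := exists_mem_Sminus_add (k := k) (u := u) D x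
  refine ⟨y, hy, ?_⟩
  have h1 : IsGen (lapPlus B h f k u) posNat ((brst B h f k u).d (x - y)) :=
    hg.map fun z => (lapPlus_brst D z).symm
  rw [map_sub] at h1
  -- d(x - y) lies both in S(R_-) and in the part of positive eigenvalue.
  exact (sub_eq_zero.1 (Sminus_inf_gen D (sub_mem hx (brst_mem_Sminus D hy)) h1)).symm

end HomotopyPlus


/-! ### The contracting homotopy on `S(R_-)` -/

section HomotopyMinus

variable {𝔤 : Type*} [LieRing 𝔤] [LieAlgebra ℂ 𝔤] {e h f : 𝔤} {B : LinearMap.BilinForm ℂ 𝔤} {k : ℂ}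
  {I : Type*} [Fintype I] {u : Module.Basis I ℂ (nPart h)}
  {s : Module.Dual ℂ (nPart h) →ₗ[ℂ] 𝔤}

/-- The linear map `a ↦ ∑ T(s u^α) φ_{[u_α, a]}`, with `u^α` the dual basis. -/
def sectionSum (B : LinearMap.BilinForm ℂ 𝔤) (h f : 𝔤) (u : Module.Basis I ℂ (nPart h))
    (s : Module.Dual ℂ (nPart h) →ₗ[ℂ] 𝔤) : 𝔤 →ₗ[ℂ] C₁ h :=
  ∑ α, LinearMap.mulLeft ℂ (Tmap B h f u (s (u.coord α))) ∘ₗ phi h ∘ₗ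
    gradeProj h (Set.Ici (1 / 2)) ∘ₗ LieAlgebra.ad ℂ 𝔤 (u α : 𝔤)

theorem sectionSum_apply (a : 𝔤) : sectionSum B h f u s a = ∑ α, Tmap B h f u (s (u.coord α))
    * phi h (gradeProj h (Set.Ici (1 / 2)) ⁅(u α : 𝔤), a⁆) := by
  simp [sectionSum]

theorem σ_sectionSum (a : 𝔤) : σ (sectionSum B h f u s a) = -sectionSum B h f u s a := by
  rw [sectionSum_apply, map_sum, ← Finset.sum_neg_distrib]
  refine Finset.sum_congr rfl fun α _ => ?_
  rw [map_mul, hasPar_false.1 (hasPar_Tmap _), σ_phi, mul_neg]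

/-- The values of the homotopy on generators. -/
def homMinusGen (B : LinearMap.BilinForm ℂ 𝔤) (h f : 𝔤) (u : Module.Basis I ℂ (nPart h))
    (s : Module.Dual ℂ (nPart h) →ₗ[ℂ] 𝔤) :
    (𝔤 × halfPart h) × (nPart h × Module.Dual ℂ (nPart h)) →ₗ[ℂ] C₁ h :=
  (Tmap B h f u ∘ₗ s) ∘ₗ LinearMap.snd ℂ _ _ ∘ₗ LinearMap.snd ℂ _ _
    - sectionSum B h f u s ∘ₗ LinearMap.fst ℂ _ _ ∘ₗ LinearMap.fst ℂ _ _

theorem homMinusGen_even (a : 𝔤 × halfPart h) :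
    σ (homMinusGen B h f u s (a, 0)) = -homMinusGen B h f u s (a, 0) := by
  have : homMinusGen B h f u s (a, 0) = -sectionSum B h f u s a.1 := by simp [homMinusGen]
  rw [this, map_neg, σ_sectionSum]

theorem homMinusGen_odd (b : nPart h × Module.Dual ℂ (nPart h)) :
    σ (homMinusGen B h f u s (0, b)) = homMinusGen B h f u s (0, b) := by
  have : homMinusGen B h f u s (0, b) = Tmap B h f u (s b.2) := by simp [homMinusGen]
  rw [this, hasPar_false.1 (hasPar_Tmap _)]

/-- The odd derivation `φ^θ ↦ T(s θ)`, which is zero on `J_a`, `Φ_b` and `φ_n`. -/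
def homMinus (B : LinearMap.BilinForm ℂ 𝔤) (h f : 𝔤) (u : Module.Basis I ℂ (nPart h))
    (s : Module.Dual ℂ (nPart h) →ₗ[ℂ] 𝔤) : C₁ h →ₗ[ℂ] C₁ h := oddDer (homMinusGen B h f u s)

theorem homMinus_cur (a : 𝔤) : homMinus B h f u s (cur h a) = -sectionSum B h f u s a :=
  (oddDer_gen homMinusGen_even homMinusGen_odd _).trans (by simp [homMinusGen])
theorem homMinus_Phi (b : halfPart h) : homMinus B h f u s (Phi h b) = 0 :=
  (oddDer_gen homMinusGen_even homMinusGen_odd _).trans (by simp [homMinusGen])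
theorem homMinus_phi (n : nPart h) : homMinus B h f u s (phi h n) = 0 :=
  (oddDer_gen homMinusGen_even homMinusGen_odd _).trans (by simp [homMinusGen])
theorem homMinus_phiDual (θ : Module.Dual ℂ (nPart h)) :
    homMinus B h f u s (phiDual h θ) = Tmap B h f u (s θ) :=
  (oddDer_gen homMinusGen_even homMinusGen_odd _).trans (by simp [homMinusGen])
theorem homMinus_mul (a b : C₁ h) : homMinus B h f u s (a * b)
    = σ a * homMinus B h f u s b + homMinus B h f u s a * b := oddDer_mul a b
theorem homMinus_algebraMap (r : ℂ) : homMinus B h f u s (algebraMap ℂ _ r) = 0 :=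
  oddDer_algebraMap r
theorem homMinus_del (a : C₁ h) : homMinus B h f u s (del a) = del (homMinus B h f u s a) :=
  oddDer_del homMinusGen_even homMinusGen_odd a
theorem homMinus_σ (a : C₁ h) : homMinus B h f u s (σ a) = -σ (homMinus B h f u s a) :=
  oddDer_σ homMinusGen_even homMinusGen_odd a

/-- The value on a was chosen to cancel the terms T(s v^α) φ_{[u_α, a]} that arise from the
quadratic part of J_a. -/
theorem homMinus_J (a : 𝔤) : homMinus B h f u s (J h u a) = 0 := by
  simp [J, homMinus_cur, homMinus_mul, homMinus_phi, homMinus_phiDual, sectionSum_apply]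

theorem homMinus_Tmap (a : 𝔤) : homMinus B h f u s (Tmap B h f u a) = 0 := by
  rw [Tmap_apply, map_sub, map_sub, homMinus_J, homMinus_Phi, homMinus_algebraMap]; simp

theorem homMinus_mem_Sminus {x : C₁ h} (hx : x ∈ Sminus h u) :
    homMinus B h f u s x ∈ Sminus h u := by
  refine Sminus_induction (u := u) (P := fun x => homMinus B h f u s x ∈ Sminus h u)
    (fun r => ?_) (fun a ha => ?_) (fun b => ?_) (fun θ => ?_) (fun x _ hx => ?_)
    (fun x hx' y hy' hx hy => ?_) (fun x _ y _ hx hy => ?_) hx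
  · rw [homMinus_algebraMap]; exact zero_mem _
  · rw [homMinus_J]; exact zero_mem _
  · rw [homMinus_Phi]; exact zero_mem _
  · rw [homMinus_phiDual]; exact Tmap_mem_Sminus _
  · rw [homMinus_del]; exact del_mem_Sminus hx
  · rw [homMinus_mul]; exact add_mem (mul_mem (σ_mem_Sminus h u x hx') hy) (mul_mem hx hy')
  · rw [map_add]; exact add_mem hx hy

/-- `d h₋ + h₋ d`. -/
def lapMinus (B : LinearMap.BilinForm ℂ 𝔤) (h f : 𝔤) (k : ℂ) (u : Module.Basis I ℂ (nPart h))
    (s : Module.Dual ℂ (nPart h) →ₗ[ℂ] 𝔤) : C₁ h →ₗ[ℂ] C₁ h :=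
  (brst B h f k u).d ∘ₗ homMinus B h f u s + homMinus B h f u s ∘ₗ (brst B h f k u).d

theorem lapMinus_apply (x : C₁ h) : lapMinus B h f k u s x
    = (brst B h f k u).d (homMinus B h f u s x) + homMinus B h f u s ((brst B h f k u).d x) := rfl

theorem lapMinus_mul (x y : C₁ h) : lapMinus B h f k u s (x * y)
    = x * lapMinus B h f k u s y + lapMinus B h f k u s x * y := by
  rw [lapMinus_apply, lapMinus_apply, lapMinus_apply]
  exact anticomm_mul (d := (brst B h f k u).d) (η := homMinus B h f u s) brst_mul brst_σ
    homMinus_mul homMinus_σ x y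

theorem lapMinus_del (x : C₁ h) :
    lapMinus B h f k u s (del x) = del (lapMinus B h f k u s x) := by
  rw [lapMinus_apply, lapMinus_apply, homMinus_del, brst_del, brst_del, homMinus_del, map_add]

theorem IsGen.del_lapMinus {t : Set ℂ} {x : C₁ h} (hx : IsGen (lapMinus B h f k u s) t x) :
    IsGen (lapMinus B h f k u s) t (del x) := hx.map fun z => (lapMinus_del z).symm

/-- A basis of homogeneous elements and a graded right inverse of `y ↦ -(f, [·, y])`. -/
structure IsGradedData (B : LinearMap.BilinForm ℂ 𝔤) (h f : 𝔤) (u : Module.Basis I ℂ (nPart h))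
    (s : Module.Dual ℂ (nPart h) →ₗ[ℂ] 𝔤) (w : I → ℤ) : Prop where
  one_le : ∀ α, 1 ≤ w α
  wt : ∀ α, IsWt h ((w α : ℚ) / 2) (u α : 𝔤)
  dualWt : ∀ α, DualWt h ((w α : ℚ) / 2) (u.coord α)
  sec : ∀ θ (n : nPart h), -(B f ⁅(n : 𝔤), s θ⁆) = θ n
  sec_wt : ∀ (i : ℚ) θ, DualWt h i θ → IsWt h (1 - i) (s θ)

theorem dualWt_pairing (hinv : ∀ x y z, B ⁅x, y⁆ z = B x ⁅y, z⁆) {i : ℚ} {a : 𝔤}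
    (ha : IsWt h i a) : DualWt h (-i) (pairing B h a) := fun j n hn hj =>
  bilin_eq_zero_of_wt hinv ha hn fun h0 => hj (by linarith)

theorem dualWt_fpair (hsl : IsSl2Triple h e f) (hinv : ∀ x y z, B ⁅x, y⁆ z = B x ⁅y, z⁆) {i : ℚ}
    {a : 𝔤} (ha : IsWt h i a) : DualWt h (1 - i) (fpair B h f a) := fun j n hn hj => by
  rw [fpair_apply]
  exact bilin_eq_zero_of_wt hinv (isWt_f hsl) (hn.lie ha) fun h0 => hj (by linarith)

theorem bilin_f_eq_zero_of_wt (hsl : IsSl2Triple h e f)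
    (hinv : ∀ x y z, B ⁅x, y⁆ z = B x ⁅y, z⁆) {i : ℚ} {a : 𝔤} (ha : IsWt h i a) (hi : i ≠ 1) :
    B f a = 0 :=
  bilin_eq_zero_of_wt hinv (isWt_f hsl) ha fun h0 => hi (by linarith)

variable [FiniteDimensional ℂ 𝔤]

theorem lapMinus_phiDual (D : IsDatum B e h f) (θ : Module.Dual ℂ (nPart h)) :
    lapMinus B h f k u s (phiDual h θ)
      = ∑ α, phiDual h (u.coord α) * Tmap B h f u ⁅(u α : 𝔤), s θ⁆
        + k • del (phiDual h (pairing B h (s θ)))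
        + (1 / 2 : ℂ) • ∑ α, ∑ β, θ (gradeProj h (Set.Ici (1 / 2)) ⁅(u β : 𝔤), (u α : 𝔤)⁆) •
          (-phiDual h (u.coord α) * Tmap B h f u (s (u.coord β))
            + Tmap B h f u (s (u.coord α)) * phiDual h (u.coord β)) := by
  rw [lapMinus_apply, homMinus_phiDual, brst_Tmap D, brst_phiDual D]
  simp only [map_smul, map_sum, homMinus_mul, homMinus_phiDual, σ_phiDual]

theorem lapMinus_Tmap (D : IsDatum B e h f) (a : 𝔤) :
    lapMinus B h f k u s (Tmap B h f u a)
      = ∑ α, Tmap B h f u (s (u.coord α)) * Tmap B h f u ⁅(u α : 𝔤), a⁆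
        + k • del (Tmap B h f u (s (pairing B h a))) := by
  rw [lapMinus_apply, homMinus_Tmap, brst_Tmap D]
  simp only [map_smul, map_sum, map_add, map_zero, homMinus_mul, homMinus_phiDual, homMinus_Tmap,
    homMinus_del, mul_zero, zero_add]

theorem IsWt.mem_mPart_of_two_le {i : ℤ} {a : 𝔤} (ha : IsWt h ((i : ℚ) / 2) a) (hi : 2 ≤ i) :
    a ∈ mPart h := by
  refine mem_gradePart (Set.mem_Ici.2 ?_) ha
  have : (2 : ℚ) ≤ i := by exact_mod_cast hi
  linarith

/-- For weight above 1, T is the scalar -(f, a), and f pairs only with weight 1. -/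
theorem Tmap_of_two_lt (D : IsDatum B e h f) {i : ℤ} {a : 𝔤} (ha : IsWt h ((i : ℚ) / 2) a)
    (hi : 2 < i) : Tmap B h f u a = 0 := by
  rw [Tmap_of_mPart D (ha.mem_mPart_of_two_le hi.le), bilin_f_eq_zero_of_wt D.sl2 D.inv ha, map_zero,
    neg_zero]
  have : (2 : ℚ) < i := by exact_mod_cast hi
  intro h1
  linarith

variable {w : I → ℤ}

theorem IsGradedData.apply_eq_zero (Q : IsGradedData B h f u s w) {i : ℤ}
    {θ : Module.Dual ℂ (nPart h)} (hθ : DualWt h ((i : ℚ) / 2) θ) {α : I} (hα : w α ≠ i) :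
    θ (u α) = 0 := by
  refine hθ (w α) _ (Q.wt α) fun h0 => hα ?_
  have : (w α : ℚ) = i := by linarith
  exact_mod_cast this

theorem IsGradedData.wt_section (Q : IsGradedData B h f u s w) {i : ℤ}
    {θ : Module.Dual ℂ (nPart h)} (hθ : DualWt h ((i : ℚ) / 2) θ) :
    IsWt h (((2 - i : ℤ) : ℚ) / 2) (s θ) := by
  have := Q.sec_wt _ _ hθ
  convert this using 1
  push_cast
  ring

theorem IsGradedData.wt_lie (Q : IsGradedData B h f u s w) (α : I) {i : ℤ} {a : 𝔤}
    (ha : IsWt h ((i : ℚ) / 2) a) : IsWt h (((w α + i : ℤ) : ℚ) / 2) ⁅(u α : 𝔤), a⁆ := by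
  convert (Q.wt α).lie ha using 1
  push_cast
  ring

/-- Lφ^θ equals φ^θ up to treated terms. In ∑ φ^{v^α} T([u_α, sθ]) with `w α` at least N, the
bracket lies in 𝔪 and T is -(f, [u_α, sθ]) = θ(u_α). All remaining terms contain some φ^η of smaller
weight or its derivative, multiplied by at most one T of weight already known. -/
theorem IsGradedData.isGen_phiDual_step (Q : IsGradedData B h f u s w) (D : IsDatum B e h f) (N : ℕ)
    (hA : ∀ (i : ℤ) a, IsWt h ((i : ℚ) / 2) a → 2 - (N : ℤ) < i →
      IsGen (lapMinus B h f k u s) nonnegNat (Tmap B h f u a))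
    (hB : ∀ (i : ℤ) θ, DualWt h ((i : ℚ) / 2) θ → i < N →
      IsGen (lapMinus B h f k u s) posNat (phiDual h θ))
    {θ : Module.Dual ℂ (nPart h)} (hθ : DualWt h (((N : ℤ) : ℚ) / 2) θ) :
    IsGen (lapMinus B h f k u s) posNat (phiDual h θ) := by
  have hmul := lapMinus_mul (B := B) (h := h) (f := f) (k := k) (u := u) (s := s)
  refine .step 1 _ one_mem_posNat ?_
  have hsθ := Q.wt_section hθ
  rw [one_smul, lapMinus_phiDual D, ← sum_phiDual_mul_algebraMap (u := u) θ]
  have h1 : IsGen (lapMinus B h f k u s) posNat (∑ α, (phiDual h (u.coord α)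
      * Tmap B h f u ⁅(u α : 𝔤), s θ⁆ - phiDual h (u.coord α) * algebraMap ℂ _ (θ (u α)))) := by
    refine (genSub (lapMinus B h f k u s) posNat).sum_mem fun α _ => ?_
    rw [mem_genSub]
    have hwt := Q.wt_lie α hsθ
    rcases lt_or_ge (w α) N with hα | hα
    · rw [Q.apply_eq_zero hθ hα.ne, map_zero, mul_zero, sub_zero]
      exact IsGen.mul hmul posNat_add_nonnegNat (hB _ _ (Q.dualWt α) hα)
        (hA _ _ hwt (by have := Q.one_le α; omega))
    -- [u_α, sθ] has weight (w_α + 2 - N)/2 ≥ 1, so T is a scalar, equal to θ(u_α) by the choice of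
    -- s.
    · rw [Tmap_of_mPart D (hwt.mem_mPart_of_two_le (by omega)), ← Q.sec θ (u α), map_neg, sub_self]
      exact .zero
  -- (sθ, ·) has weight (N - 2)/2: s reflects weights by i ↦ 1 - i and the form by i ↦ -i.
  have h2 : IsGen (lapMinus B h f k u s) posNat (k • del (phiDual h (pairing B h (s θ)))) := by
    refine IsGen.smul _ (IsGen.del_lapMinus (hB (N - 2) _ ?_ (by omega)))
    convert dualWt_pairing D.inv hsθ using 1
    push_cast
    ring
  have h3 : IsGen (lapMinus B h f k u s) posNat ((1 / 2 : ℂ) • ∑ α, ∑ β,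
      θ (gradeProj h (Set.Ici (1 / 2)) ⁅(u β : 𝔤), (u α : 𝔤)⁆) •
          (-phiDual h (u.coord α) * Tmap B h f u (s (u.coord β))
            + Tmap B h f u (s (u.coord α)) * phiDual h (u.coord β))) := by
    refine IsGen.smul _ ((genSub (lapMinus B h f k u s) posNat).sum_mem fun α _ =>
      (genSub (lapMinus B h f k u s) posNat).sum_mem fun β _ => ?_)
    rw [mem_genSub]
    by_cases hαβ : w β + w α = N
    · have h1α := Q.one_le α
      have h1β := Q.one_le β
      refine IsGen.smul _ (IsGen.add ?_ ?_)
      · rw [neg_mul, ← neg_one_smul ℂ]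
        exact IsGen.smul _ (IsGen.mul hmul posNat_add_nonnegNat
          (hB _ _ (Q.dualWt α) (by omega)) (hA _ _ (Q.wt_section (Q.dualWt β)) (by omega)))
      · exact IsGen.mul hmul nonnegNat_add_posNat (hA _ _ (Q.wt_section (Q.dualWt α)) (by omega))
          (hB _ _ (Q.dualWt β) (by omega))
    · have h0 : θ (gradeProj h (Set.Ici (1 / 2)) ⁅(u β : 𝔤), (u α : 𝔤)⁆) = 0 := by
        refine hθ (w β + w α) _ ?_ fun h0 => hαβ ?_
        · rw [gradeProj_of_mem D.sl2 (lie_mem_nPart (u β).2 (u α).2)]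
          exact Q.wt_lie β (Q.wt α)
        · have : ((w β + w α : ℤ) : ℚ) = (N : ℤ) := by linarith
          exact_mod_cast this
      rw [h0, zero_smul]
      exact .zero
  have h4 := (h1.add h2).add h3
  rw [Finset.sum_sub_distrib] at h4
  convert h4 using 1
  abel

/-- Up to terms of higher weight L T(a) = T(πa), where πa = s(-(f, [·, a])). Since s is a right
inverse, π is a projection, so a = πa + (a - πa) splits T(a) into parts of eigenvalue 1 and 0 modulo
those terms. -/
theorem IsGradedData.isGen_Tmap_step (Q : IsGradedData B h f u s w) (D : IsDatum B e h f) (N : ℕ)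
    (hA : ∀ (i : ℤ) a, IsWt h ((i : ℚ) / 2) a → 2 - (N : ℤ) < i →
      IsGen (lapMinus B h f k u s) nonnegNat (Tmap B h f u a))
    {a : 𝔤} (ha : IsWt h (((2 - N : ℤ) : ℚ) / 2) a) :
    IsGen (lapMinus B h f k u s) nonnegNat (Tmap B h f u a) := by
  have hmul := lapMinus_mul (B := B) (h := h) (f := f) (k := k) (u := u) (s := s)
  have key : ∀ a, IsWt h (((2 - N : ℤ) : ℚ) / 2) a → IsGen (lapMinus B h f k u s) nonnegNat
      (lapMinus B h f k u s (Tmap B h f u a) - Tmap B h f u (s (-fpair B h f a))) := by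
    intro a ha
    have hθ : DualWt h (((N : ℤ) : ℚ) / 2) (-fpair B h f a) := by
      intro j n hn hj
      rw [LinearMap.neg_apply, dualWt_fpair D.sl2 D.inv ha j n hn, neg_zero]
      intro h0
      refine hj (h0.trans ?_)
      push_cast
      ring
    have hsum : Tmap B h f u (s (-fpair B h f a))
        = ∑ α, Tmap B h f u (s (u.coord α)) * algebraMap ℂ _ ((-fpair B h f a) (u α)) := by
      have h1 : ∑ α, (-fpair B h f a) (u α) • u.coord α = -fpair B h f a := by
        refine u.ext fun β => ?_
        rw [LinearMap.sum_apply, Finset.sum_eq_single β]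
        · simp
        · intro α _ hαβ
          simp [Finsupp.single_eq_of_ne hαβ]
        · simp
      conv_lhs => rw [← h1]
      rw [map_sum, map_sum]
      refine Finset.sum_congr rfl fun α _ => ?_
      rw [map_smul, map_smul, ← Algebra.commutes, ← Algebra.smul_def]
    rw [lapMinus_Tmap D, hsum, add_sub_right_comm, ← Finset.sum_sub_distrib]
    refine IsGen.add ((genSub (lapMinus B h f k u s) nonnegNat).sum_mem fun α _ => ?_) ?_
    · rw [mem_genSub]
      have hwt := Q.wt_lie α ha
      rcases lt_or_ge (w α) N with hα | hα
      · rw [Q.apply_eq_zero hθ hα.ne, map_zero, mul_zero, sub_zero]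
        exact IsGen.mul hmul nonnegNat_add_nonnegNat
          (hA _ _ (Q.wt_section (Q.dualWt α)) (by omega))
          (hA _ _ hwt (by have := Q.one_le α; omega))
      · rw [Tmap_of_mPart D (hwt.mem_mPart_of_two_le (by omega)), LinearMap.neg_apply, fpair_apply,
          map_neg, sub_self]
        exact .zero
    · refine IsGen.smul _ (IsGen.del_lapMinus (hA (4 - N) _ ?_ (by omega)))
      have h1 : DualWt h (((N - 2 : ℤ) : ℚ) / 2) (pairing B h a) := by
        convert dualWt_pairing D.inv ha using 1
        push_cast
        ring
      convert Q.wt_section h1 using 1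
      push_cast
      ring
  have hθ : DualWt h (((N : ℤ) : ℚ) / 2) (-fpair B h f a) := by
    intro j n hn hj
    rw [LinearMap.neg_apply, dualWt_fpair D.sl2 D.inv ha j n hn, neg_zero]
    intro h0
    refine hj (h0.trans ?_)
    push_cast
    ring
  have hsec : ∀ θ, -fpair B h f (s θ) = θ := fun θ => LinearMap.ext fun n => by
    rw [LinearMap.neg_apply, fpair_apply, Q.sec]
  -- a₁ = πa satisfies πa₁ = a₁, which makes L - 1 reduce T(a₁); and π(a - a₁) = 0, which makes L
  -- reduce T(a - a₁).
  set a₁ := s (-fpair B h f a) with ha₁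
  have hw₁ : IsWt h (((2 - N : ℤ) : ℚ) / 2) a₁ := Q.wt_section hθ
  have h1 : IsGen (lapMinus B h f k u s) nonnegNat (Tmap B h f u a₁) := by
    refine .step 1 _ (posNat_subset_nonnegNat one_mem_posNat) ?_
    have := key a₁ hw₁
    rwa [ha₁, hsec, ← ha₁, ← one_smul ℂ (Tmap B h f u a₁), map_smul, one_smul] at this
  have h2 : IsGen (lapMinus B h f k u s) nonnegNat (Tmap B h f u (a - a₁)) := by
    refine .step 0 _ zero_mem_nonnegNat ?_
    have := key (a - a₁) (ha.sub hw₁)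
    have e0 : fpair B h f (a - a₁) = 0 := by
      rw [map_sub, ← neg_inj.1 (hsec (-fpair B h f a)), sub_self]
    rwa [e0, neg_zero, map_zero, map_zero, ← zero_smul ℂ (Tmap B h f u (a - a₁))] at this
  have := h2.add h1
  rwa [← map_add, sub_add_cancel] at this

/-- A simultaneous induction: T(a) by decreasing weight of a, φ^θ by increasing weight of θ. Weights
are counted in halves. For N = 0 both families vanish: T is 0 in weights above 1, and 𝔫* has no
negative weights. -/
theorem IsGradedData.isGen_of_wt (Q : IsGradedData B h f u s w) (D : IsDatum B e h f) (N : ℕ) :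
    (∀ (i : ℤ) a, IsWt h ((i : ℚ) / 2) a → 2 - (N : ℤ) < i →
      IsGen (lapMinus B h f k u s) nonnegNat (Tmap B h f u a)) ∧
    (∀ (i : ℤ) θ, DualWt h ((i : ℚ) / 2) θ → i < N →
      IsGen (lapMinus B h f k u s) posNat (phiDual h θ)) := by
  induction N with
  | zero =>
    refine ⟨fun i a ha hi => ?_, fun i θ hθ hi => ?_⟩
    · rw [Tmap_of_two_lt D ha (by simpa using hi)]; exact .zero
    · have : θ = 0 := u.ext fun α => Q.apply_eq_zero hθ (by
        have := Q.one_le α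
        simp only [Nat.cast_zero] at hi
        omega)
      rw [this, map_zero]; exact .zero
  | succ N ih =>
    obtain ⟨hA, hB⟩ := ih
    refine ⟨fun i a ha hi => ?_, fun i θ hθ hi => ?_⟩
    · rcases lt_or_ge (2 - (N : ℤ)) i with h1 | h1
      · exact hA i a ha h1
      · obtain rfl : i = 2 - (N : ℤ) := by push_cast at hi; omega
        exact Q.isGen_Tmap_step D N hA ha
    · rcases lt_or_ge i (N : ℤ) with h1 | h1
      · exact hB i θ hθ h1
      · obtain rfl : i = (N : ℤ) := by push_cast at hi; omega
        exact Q.isGen_phiDual_step D N hA hB hθ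

theorem IsGradedData.isGen_Tmap (Q : IsGradedData B h f u s w) (D : IsDatum B e h f) (a : 𝔤) :
    IsGen (lapMinus B h f k u s) nonnegNat (Tmap B h f u a) := by
  have h1 : gradePart h (Set.range fun n : ℤ => (n : ℚ) / 2) ≤
      (genSub (lapMinus B h f k u s) nonnegNat).comap (Tmap B h f u) := by
    refine gradePart_le ?_
    rintro _ ⟨i, rfl⟩ x hx
    -- The condition 2 - N < i holds as soon as N ≥ 3 - i.
    refine (Q.isGen_of_wt D (3 - i).toNat).1 i x hx ?_
    have := Int.self_le_toNat (3 - i)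
    omega
  rw [gradePart_half_integers D.sl2] at h1
  exact h1 (Submodule.mem_top (x := a))

theorem IsGradedData.isGen_phiDual (Q : IsGradedData B h f u s w) (D : IsDatum B e h f)
    (θ : Module.Dual ℂ (nPart h)) : IsGen (lapMinus B h f k u s) posNat (phiDual h θ) := by
  rw [← sum_smul_phiDual (u := u) θ]
  refine (genSub (lapMinus B h f k u s) posNat).sum_mem fun α _ => IsGen.smul _ ?_
  refine (Q.isGen_of_wt D (w α + 1).toNat).2 (w α) _ (Q.dualWt α) ?_
  have := Int.self_le_toNat (w α + 1)
  omega

theorem IsGradedData.isGen_of_mem_Sminus (Q : IsGradedData B h f u s w) (D : IsDatum B e h f)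
    {x : C₁ h} (hx : x ∈ Sminus h u) : IsGen (lapMinus B h f k u s) nonnegNat x := by
  refine Sminus_induction (u := u) (P := fun x => IsGen (lapMinus B h f k u s) nonnegNat x)
    (fun r => ?_) (fun a ha => ?_) (fun b => ?_) (fun θ => ?_) (fun x _ hx => hx.del_lapMinus)
    (fun x hx' y hy' hx hy => IsGen.mul lapMinus_mul nonnegNat_add_nonnegNat hx hy)
    (fun x _ y _ hx hy => hx.add hy) hx
  · refine .of_eigen zero_mem_nonnegNat ?_
    rw [lapMinus_apply, homMinus_algebraMap, brst_algebraMap]; simp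
  · rw [← Tmap_of_nonpos D ha]; exact Q.isGen_Tmap D a
  · have := (Q.isGen_Tmap (k := k) D b).smul (-1)
    rwa [Tmap_of_half D, neg_one_smul, neg_neg] at this
  · exact (Q.isGen_phiDual D θ).mono posNat_subset_nonnegNat

/-- T ∘ i fixes J_a and Φ_b and kills φ^θ, which has positive eigenvalues. For products one uses xy
- x'y' = (x - x')y + x'(y - y') and the nonnegativity of all eigenvalues on S(R_-). -/
theorem IsGradedData.isGen_sub_Tlift (Q : IsGradedData B h f u s w) (D : IsDatum B e h f)
    {x : C₁ h} (hx : x ∈ Sminus h u) :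
    IsGen (lapMinus B h f k u s) posNat (x - Tlift B h f u (toScur h x)) := by
  refine Sminus_induction (u := u)
    (P := fun x => IsGen (lapMinus B h f k u s) posNat (x - Tlift B h f u (toScur h x)))
    (fun r => ?_) (fun a ha => ?_) (fun b => ?_) (fun θ => ?_) (fun x _ hx => ?_)
    (fun x hx' y hy' hx hy => ?_) (fun x _ y _ hx hy => ?_) hx
  · rw [AlgHom.commutes, AlgHom.commutes, sub_self]; exact .zero
  · rw [toScur_J, Tlift_scur, Tmap_of_nonpos D ha, sub_self]; exact .zero
  · rw [toScur_Phi, map_neg, Tlift_scur, Tmap_of_half D, neg_neg, sub_self]; exact .zero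
  · rw [toScur_phiDual, map_zero, sub_zero]; exact Q.isGen_phiDual D θ
  · rw [toScur_del, Tlift_del, ← map_sub]; exact hx.del_lapMinus
  · have h1 := IsGen.mul lapMinus_mul posNat_add_nonnegNat hx (Q.isGen_of_mem_Sminus D hy')
    have h2 := IsGen.mul lapMinus_mul nonnegNat_add_posNat
      (Q.isGen_of_mem_Sminus D (Tlift_mem_Sminus (B := B) (f := f) (toScur h x))) hy
    have h3 := h1.add h2
    rw [map_mul, map_mul]
    convert h3 using 1
    noncomm_ring
  · rw [map_add, map_add, add_sub_add_comm]; exact hx.add hy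

/-- Since T kills the ideal, T(i(x)) = 0, and so x itself has positive eigenvalues. The primitive
stays in S(R_-), as both d and the homotopy preserve it. -/
theorem IsGradedData.exists_eq_brst (Q : IsGradedData B h f u s w) (D : IsDatum B e h f) {x : C₁ h}
    (hx : x ∈ Sminus h u) (h0 : (brst B h f k u).d x = 0) (hr : toScur h x ∈ redIdeal B h f) :
    ∃ y ∈ Sminus h u, (brst B h f k u).d y = x := by
  have h1 := Q.isGen_sub_Tlift (k := k) D hx
  rw [Tlift_of_mem_redIdeal D hr, sub_zero] at h1
  exact h1.exists_eq_apply (brst_brst D) lapMinus_apply zero_notMem_posNat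
    (Subalgebra.toSubmodule (Sminus h u)) (fun _ h => homMinus_mem_Sminus h)
    (fun _ h => brst_mem_Sminus D h) hx h0

end HomotopyMinus

/-! ### Independence of the basis -/

section BasisIndependence

variable {𝔤 : Type*} [LieRing 𝔤] [LieAlgebra ℂ 𝔤] {e h f : 𝔤} {B : LinearMap.BilinForm ℂ 𝔤} {k : ℂ}
  {I : Type*} [Fintype I] {I' : Type*} [Fintype I']

/-- The sum is the contraction of F with the canonical element of 𝔫* ⊗ 𝔫, in which no basis is
chosen. -/
theorem sum_phiDual_mul_eq (u : Module.Basis I ℂ (nPart h)) (u' : Module.Basis I' ℂ (nPart h))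
    (F : nPart h →ₗ[ℂ] C₁ h) :
    ∑ α, phiDual h (u.coord α) * F (u α) = ∑ α, phiDual h (u'.coord α) * F (u' α) := by
  have h1 : ∀ α, phiDual h (u.coord α) * F (u α)
      = ∑ β, phiDual h (u'.coord β) * (u.coord α (u' β) • F (u α)) := by
    intro α
    rw [← sum_smul_phiDual (u := u') (u.coord α), Finset.sum_mul]
    refine Finset.sum_congr rfl fun β _ => ?_
    rw [smul_mul_assoc, mul_smul_comm]
  simp only [h1]
  rw [Finset.sum_comm]
  refine Finset.sum_congr rfl fun β _ => ?_
  rw [← Finset.mul_sum, sum_coord_smul]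

theorem J_eq_J (u : Module.Basis I ℂ (nPart h)) (u' : Module.Basis I' ℂ (nPart h)) (a : 𝔤) :
    J h u a = J h u' a := by
  rw [J_eq, J_eq]
  congr 1
  exact sum_phiDual_mul_eq u u' (phi h ∘ₗ adN h a)

theorem Sminus_eq (u : Module.Basis I ℂ (nPart h)) (u' : Module.Basis I' ℂ (nPart h)) :
    Sminus h u = Sminus h u' := by
  simp only [Sminus, J_eq_J u u']

/-- It rewrites the cubic term of d as a contraction with the canonical element, with J_n - n in
place of F(n), so that `sum_phiDual_mul_eq` applies. -/
theorem sum_phiDual_mul_phi (u : Module.Basis I ℂ (nPart h)) (α : I) :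
    ∑ β, phiDual h (u.coord α) * phiDual h (u.coord β) *
        phi h (gradeProj h (Set.Ici (1 / 2)) ⁅(u β : 𝔤), (u α : 𝔤)⁆)
      = phiDual h (u.coord α) * ((Jlin h u - cur h) ∘ₗ (nPart h).subtype) (u α) := by
  simp only [LinearMap.comp_apply, LinearMap.sub_apply, Jlin_apply, Submodule.subtype_apply, J,
    add_sub_cancel_left, Finset.mul_sum, mul_assoc]

theorem brstElement_eq (u : Module.Basis I ℂ (nPart h)) (u' : Module.Basis I' ℂ (nPart h)) :
    brstElement B h f u = brstElement B h f u' := by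
  have h2 : Jlin h u = Jlin h u' := LinearMap.ext fun a => by
    rw [Jlin_apply, Jlin_apply, J_eq_J u u']
  rw [brstElement, brstElement]
  simp only [sum_phiDual_mul_phi]
  rw [h2, sum_phiDual_mul_eq u u' ((Jlin h u' - cur h) ∘ₗ (nPart h).subtype)]
  congr 1
  exact sum_phiDual_mul_eq u u' (cur h ∘ₗ (nPart h).subtype
      + Algebra.linearMap ℂ (C₁ h) ∘ₗ B f ∘ₗ (nPart h).subtype
      + Phi h ∘ₗ gradeProj h {1 / 2} ∘ₗ (nPart h).subtype)

theorem brst_eq_brst (u : Module.Basis I ℂ (nPart h)) (u' : Module.Basis I' ℂ (nPart h)) :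
    (brst B h f k u).d = (brst B h f k u').d := LinearMap.ext fun a => by
  rw [brst_apply, brst_apply, brstElement_eq u u']

/-- A cocycle of `S(R_-)` with zero image in the quotient is a coboundary. -/
theorem exists_eq_brst_of_toScur_mem [FiniteDimensional ℂ 𝔤] [LieAlgebra.IsSimple ℂ 𝔤]
    (D : IsDatum B e h f) (u : Module.Basis I ℂ (nPart h)) {x : C₁ h} (hx : x ∈ Sminus h u)
    (h0 : (brst B h f k u).d x = 0) (hr : toScur h x ∈ redIdeal B h f) :
    ∃ y ∈ Sminus h u, (brst B h f k u).d y = x := by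
  obtain ⟨s, hs, hsw⟩ := exists_dual_section D.sl2 D.symm D.inv D.ef
  -- The given basis need not consist of weight vectors. The complex does not depend on the basis,
  -- so the argument is carried out with a homogeneous one.
  obtain ⟨I', _, u', w, h1, h2, h3⟩ := exists_wt_basis D.sl2
  have Q : IsGradedData B h f u' s w := ⟨h1, h2, h3, hs, hsw⟩
  rw [Sminus_eq u u'] at hx ⊢
  rw [brst_eq_brst u u'] at h0 ⊢
  exact Q.exists_eq_brst D hx h0 hr

end BasisIndependence


/-! ### The λ-bracket modulo `redIdeal` -/

section RedBracket

variable {𝔤 : Type*} [LieRing 𝔤] [LieAlgebra ℂ 𝔤] {e h f : 𝔤} {B : LinearMap.BilinForm ℂ 𝔤} {k : ℂ}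
  {I : Type*} [Fintype I] {u : Module.Basis I ℂ (nPart h)}

/-- All coefficients of `p` are in `redIdeal`. -/
def InRed (B : LinearMap.BilinForm ℂ 𝔤) (h f : 𝔤) (p : (Scur 𝔤)[X]) : Prop :=
  ∀ n, p.coeff n ∈ redIdeal B h f

theorem inRed_zero : InRed B h f 0 := fun n => by rw [coeff_zero]; exact zero_mem _

theorem inRed_C {x : Scur 𝔤} (hx : x ∈ redIdeal B h f) : InRed B h f (C x) := fun n => by
  rw [coeff_C]
  split_ifs
  · exact hx
  · exact zero_mem _

theorem InRed.add {p q : (Scur 𝔤)[X]} (hp : InRed B h f p) (hq : InRed B h f q) :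
    InRed B h f (p + q) := fun n => by rw [coeff_add]; exact add_mem (hp n) (hq n)

theorem InRed.sub {p q : (Scur 𝔤)[X]} (hp : InRed B h f p) (hq : InRed B h f q) :
    InRed B h f (p - q) := fun n => by rw [coeff_sub]; exact sub_mem (hp n) (hq n)

theorem InRed.neg {p : (Scur 𝔤)[X]} (hp : InRed B h f p) : InRed B h f (-p) := fun n => by
  rw [coeff_neg]; exact neg_mem (hp n)

theorem InRed.C_mul {p : (Scur 𝔤)[X]} (hp : InRed B h f p) (a : Scur 𝔤) :
    InRed B h f (C a * p) := fun n => by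
  rw [coeff_C_mul]; exact TwoSidedIdeal.mul_mem_left _ _ _ (hp n)

theorem InRed.mul_C {p : (Scur 𝔤)[X]} (hp : InRed B h f p) (a : Scur 𝔤) :
    InRed B h f (p * C a) := fun n => by
  rw [coeff_mul_C]; exact TwoSidedIdeal.mul_mem_right _ _ _ (hp n)

theorem InRed.lamAdd {p : (Scur 𝔤)[X]} (hp : InRed B h f p) : InRed B h f (lamAdd del p) :=
  coeff_lamAdd_mem_ideal _ (fun _ hx => del_mem_redIdeal hx) p hp

theorem InRed.skewSubst {p : (Scur 𝔤)[X]} (hp : InRed B h f p) :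
    InRed B h f (skewSubst del p) :=
  coeff_skewSubst_mem_ideal _ (fun _ hx => del_mem_redIdeal hx) p hp

/-- The image of the λ-bracket of `S(R)` in `S(ℂ[∂] ⊗ 𝔤)[λ]`. -/
def redBr (B : LinearMap.BilinForm ℂ 𝔤) (h f : 𝔤) (k : ℂ) :
    C₁ h →ₗ[ℂ] C₁ h →ₗ[ℂ] (Scur 𝔤)[X] :=
  (brstData B h f k).br.compr₂ (mapLin (toScur h).toLinearMap)

theorem redBr_apply (x y : C₁ h) :
    redBr B h f k x y = mapLin (toScur h).toLinearMap ((brstData B h f k).br x y) := rfl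

theorem coeff_redBr (x y : C₁ h) (n : ℕ) :
    (redBr B h f k x y).coeff n = toScur h (((brstData B h f k).br x y).coeff n) := by
  rw [redBr_apply, coeff_mapLin]; rfl

theorem redBr_algebraMap (x : C₁ h) (r : ℂ) : redBr B h f k x (algebraMap ℂ _ r) = 0 := by
  rw [redBr_apply, brst_br_algebraMap, map_zero]

/-- An additive property holds for all elements if it holds for the homogeneous ones. -/
theorem of_homogeneous {W₀ W₁ : Type*} [AddCommGroup W₀] [Module ℂ W₀] [AddCommGroup W₁]
    [Module ℂ W₁] {P : S W₀ W₁ → Prop} (hadd : ∀ x y, P x → P y → P (x + y))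
    (H : ∀ o x, HasPar o x → P x) (x : S W₀ W₁) : P x := by
  rw [← part_add_part x]
  exact hadd _ _ (H _ _ (hasPar_part _ _)) (H _ _ (hasPar_part _ _))

/-- The parity sign of the Leibniz rule disappears because `toScur` is insensitive to σ. -/
theorem redBr_mul (y a b : C₁ h) : redBr B h f k y (a * b)
    = C (toScur h a) * redBr B h f k y b + redBr B h f k y a * C (toScur h b) := by
  refine of_homogeneous (P := fun y => redBr B h f k y (a * b)
    = C (toScur h a) * redBr B h f k y b + redBr B h f k y a * C (toScur h b))
    (fun x y hx hy => ?_) (fun o y hy => ?_) y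
  · rw [map_add, LinearMap.add_apply, LinearMap.add_apply, LinearMap.add_apply, hx, hy, mul_add,
      add_mul]
    exact add_add_add_comm _ _ _ _
  · ext n
    rw [coeff_redBr, brst_br_mul hy, coeff_add, coeff_C_mul, coeff_mul_C, map_add,
      map_mul, map_mul, toScur_twist, coeff_add, coeff_C_mul, coeff_mul_C, coeff_redBr, coeff_redBr]

theorem redBr_del (y a : C₁ h) : redBr B h f k y (del a) = lamAdd del (redBr B h f k y a) := by
  rw [redBr_apply, redBr_apply, ← mapLin_lamAdd _ del del fun a => toScur_del a]
  congr 1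
  exact br_del_right y a

theorem redBr_skew (D : IsDatum B e h f) {o : Bool} {a : C₁ h} (ha : HasPar o a) (b : C₁ h) :
    redBr B h f k a b = -skewSubst del (redBr B h f k (twist o b) a) := by
  rw [redBr_apply, redBr_apply, ← mapLin_skewSubst _ del del fun a => toScur_del a, ← map_neg]
  congr 1
  exact br_skew (isEven_brstBracket B h f k) (isSkew_brstBracket D.symm) ha b

theorem redBr_skew_even (D : IsDatum B e h f) {a : C₁ h} (ha : HasPar false a) (b : C₁ h) :
    redBr B h f k b a = -skewSubst del (redBr B h f k a b) := by
  rw [redBr_skew D ha b, map_neg, neg_neg, skewSubst_skewSubst]; rfl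

/-- To compare `{y_λ ·}` with `{v_λ ·}` it suffices to compare on the generators. -/
theorem redBr_congr {y : C₁ h} {v : Scur 𝔤}
    (hcur : ∀ a, InRed B h f (redBr B h f k y (cur h a) - (curData B k).br v (scur a)))
    (hPhi : ∀ b, InRed B h f (redBr B h f k y (Phi h b) + (curData B k).br v (scur (b : 𝔤))))
    (hphi : ∀ n, InRed B h f (redBr B h f k y (phi h n)))
    (hphiDual : ∀ θ, InRed B h f (redBr B h f k y (phiDual h θ))) (x : C₁ h) :
    InRed B h f (redBr B h f k y x - (curData B k).br v (toScur h x)) := by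
  induction x using C₁_induction with
  | hc r => rw [redBr_algebraMap, AlgHom.commutes, cur_br_algebraMap, sub_self]; exact inRed_zero
  | hcur a => rw [toScur_cur]; exact hcur a
  | hPhi b => rw [toScur_Phi, map_neg, sub_neg_eq_add]; exact hPhi b
  | hphi n => rw [toScur_phi, map_zero, sub_zero]; exact hphi n
  | hphiDual θ => rw [toScur_phiDual, map_zero, sub_zero]; exact hphiDual θ
  | hdel a ha => rw [redBr_del, toScur_del, cur_br_del_right, ← map_sub]; exact ha.lamAdd
  | hmul a b ha hb =>
    rw [redBr_mul, map_mul, cur_br_mul, add_sub_add_comm, ← mul_sub, ← sub_mul]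
    exact (hb.C_mul _).add (ha.mul_C _)
  | hadd a b ha hb => rw [map_add, map_add, map_add, add_sub_add_comm]; exact ha.add hb

theorem br_cur_fromScur (D : IsDatum B e h f) (a : 𝔤) (w : Scur 𝔤) :
    (brstData B h f k).br (cur h a) (fromScur h w)
      = mapLin (fromScur h).toLinearMap ((curData B k).br (scur a) w) := by
  induction w using Scur_induction with
  | hc r => rw [AlgHom.commutes, brst_br_algebraMap, cur_br_algebraMap, map_zero]
  | hgen b =>
    rw [fromScur_scur, br_cur_cur D, br_scur_scur D, map_add, mapLin_X_mul, mapLin_C, mapLin_C,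
      AlgHom.toLinearMap_apply, AlgHom.toLinearMap_apply, fromScur_scur, AlgHom.commutes]
  | hdel b hb =>
    rw [fromScur_del, cur_br_del_right, mapLin_lamAdd _ del del fun a => fromScur_del a, ← hb]
    exact br_del_right _ _
  | hmul b c hb hc =>
    rw [map_mul, brst_br_even_mul (hasPar_cur a), hb, hc, cur_br_mul]
    ext n
    simp only [coeff_mapLin, coeff_add, coeff_C_mul, coeff_mul_C, AlgHom.toLinearMap_apply, map_add,
      map_mul]
  | hadd b c hb hc => rw [map_add, map_add, map_add, map_add, hb, hc]

theorem fromScur_redBr_cur (D : IsDatum B e h f) (w : Scur 𝔤) (a : 𝔤) :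
    redBr B h f k (fromScur h w) (cur h a) = (curData B k).br w (scur a) := by
  have h1 : redBr B h f k (cur h a) (fromScur h w) = (curData B k).br (scur a) w := by
    rw [redBr_apply, br_cur_fromScur D]
    ext n
    rw [coeff_mapLin, coeff_mapLin]
    exact toScur_fromScur _
  rw [redBr_skew_even D (hasPar_cur a), h1, cur_br_skew D w]

theorem br_fromScur_eq_zero {y : C₁ h} {o : Bool} (hy : HasPar o y)
    (H : ∀ a, (brstData B h f k).br y (cur h a) = 0) (w : Scur 𝔤) :
    (brstData B h f k).br y (fromScur h w) = 0 := by
  induction w using Scur_induction with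
  | hc r => rw [AlgHom.commutes, brst_br_algebraMap]
  | hgen b => rw [fromScur_scur, H]
  | hdel b hb =>
    rw [fromScur_del]
    refine (br_del_right _ _).trans ?_
    rw [show (freeData _).br y (fromScur h b) = 0 from hb, map_zero]
  | hmul b c hb hc => rw [map_mul, brst_br_mul hy, hb, hc, mul_zero, zero_mul, add_zero]
  | hadd b c hb hc => rw [map_add, map_add, hb, hc, add_zero]

theorem redBr_fromScur_eq_zero (D : IsDatum B e h f) {y : C₁ h} {o : Bool} (hy : HasPar o y)
    (H : ∀ a, (brstData B h f k).br y (cur h a) = 0) (w : Scur 𝔤) :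
    redBr B h f k (fromScur h w) y = 0 := by
  rw [redBr_skew D (hasPar_fromScur w)]
  have : redBr B h f k (twist false y) (fromScur h w) = 0 := by
    change redBr B h f k y _ = 0
    rw [redBr_apply, br_fromScur_eq_zero hy H, map_zero]
  rw [this, map_zero, neg_zero]

/-- Invariance of w enters only through Φ_b. The bracket with Φ_b is 0, while Φ_b goes to -b and
{w_λ b} lies in the ideal for b in 𝔤(1/2) ⊆ 𝔫. -/
theorem redBr_fromScur (D : IsDatum B e h f) {w : Scur 𝔤} (hw : w ∈ W₂lift B h f k) (x : C₁ h) :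
    InRed B h f (redBr B h f k (fromScur h w) x - (curData B k).br w (toScur h x)) := by
  refine redBr_congr (fun a => ?_) (fun b => ?_) (fun n => ?_) (fun θ => ?_) x
  · rw [fromScur_redBr_cur D, sub_self]; exact inRed_zero
  · rw [redBr_fromScur_eq_zero D (hasPar_Phi b) (br_Phi_cur D b), zero_add, cur_br_skew D]
    exact InRed.neg (InRed.skewSubst ((mem_W₂lift D).1 hw b (halfPart_le_nPart b.2)))
  · rw [redBr_fromScur_eq_zero D (hasPar_phi n) (br_phi_cur D n)]; exact inRed_zero
  · rw [redBr_fromScur_eq_zero D (hasPar_phiDual θ) (br_phiDual_cur D θ)]; exact inRed_zero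

/-- Both factors φ^{v^α} and φ_{[u_α, a]} go to 0, so by the Leibniz rule the bracket of anything
with their product goes to 0. -/
theorem toScur_mul_sum_zero (y : C₁ h) (a : 𝔤) : redBr B h f k y (∑ α, phiDual h (u.coord α)
    * phi h (gradeProj h (Set.Ici (1 / 2)) ⁅(u α : 𝔤), a⁆)) = 0 := by
  rw [map_sum]
  refine Finset.sum_eq_zero fun α _ => ?_
  rw [redBr_mul, toScur_phiDual, toScur_phi, C_0, zero_mul, mul_zero, add_zero]

theorem sum_mul_redBr (D : IsDatum B e h f) (a : 𝔤) (x : C₁ h) :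
    redBr B h f k (∑ α, phiDual h (u.coord α)
      * phi h (gradeProj h (Set.Ici (1 / 2)) ⁅(u α : 𝔤), a⁆)) x = 0 := by
  have hp : HasPar false (∑ α, phiDual h (u.coord α)
      * phi h (gradeProj h (Set.Ici (1 / 2)) ⁅(u α : 𝔤), a⁆)) := by
    rw [hasPar_false, map_sum]
    refine Finset.sum_congr rfl fun α _ => ?_
    rw [map_mul, σ_phiDual, σ_phi, neg_mul_neg]
  rw [redBr_skew D hp, toScur_mul_sum_zero, map_zero, neg_zero]

variable [FiniteDimensional ℂ 𝔤]

/-- `{n + Φ_n _λ x}` is `{n_λ x}` modulo the ideal. -/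
theorem redBr_cur_add_Phi (D : IsDatum B e h f) (n : nPart h) (x : C₁ h) :
    InRed B h f (redBr B h f k (cur h n + Phi h (gradeProj h {1 / 2} (n : 𝔤))) x
      - (curData B k).br (scur (n : 𝔤)) (toScur h x)) := by
  refine redBr_congr (fun a => ?_) (fun b => ?_) (fun m => ?_) (fun θ => ?_) x
  · rw [map_add, LinearMap.add_apply, redBr_apply, redBr_apply, br_cur_cur D, br_Phi_cur D,
      br_scur_scur D, map_add, mapLin_X_mul, mapLin_C, mapLin_C, AlgHom.toLinearMap_apply,
      AlgHom.toLinearMap_apply, toScur_cur, AlgHom.commutes, map_zero, add_zero, sub_self]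
    exact inRed_zero
  -- {n + Φ_n λ Φ_b} = (f, [n_{1/2}, b]) = (f, [n, b]) and {n_λ b} = [n, b]; their sum is a
  -- generator of the ideal, since [n, b] is in 𝔪.
  · rw [map_add, LinearMap.add_apply, redBr_apply, redBr_apply, br_cur_Phi D, br_Phi_Phi D,
      br_scur_scur D, mapLin_C, AlgHom.toLinearMap_apply, AlgHom.commutes, map_zero, zero_add,
      bilin_nPart D.inv n.2 (halfPart_le_nPart b.2), mul_zero, map_zero, C_0, mul_zero, add_zero,
      ← C_add]
    refine inRed_C ?_
    have h1 := redGen_mem (B := B) (f := f) (lie_mem_mPart n.2 (halfPart_le_nPart b.2)) 0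
    have hb := bilin_f_lie_half D.sl2 D.inv n.2 (halfPart_le_nPart b.2)
    rw [gradeProj_of_mem D.sl2 b.2] at hb
    rw [hb, add_comm]
    exact h1
  · rw [map_add, LinearMap.add_apply, redBr_apply, redBr_apply, br_cur_phi D, br_Phi_phi D,
      map_zero, add_zero]
    exact inRed_zero
  · rw [map_add, LinearMap.add_apply, redBr_apply, redBr_apply, br_cur_phiDual D, br_Phi_phiDual D,
      map_zero, add_zero]
    exact inRed_zero

/-- Besides n + Φ_n, dφ_n consists of a scalar, which is central, and of products φ^{v^α}φ_{[u_α,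
n]}, whose brackets go to 0. -/
theorem redBr_brst_phi (D : IsDatum B e h f) (n : nPart h) (x : C₁ h) :
    InRed B h f (redBr B h f k ((brst B h f k u).d (phi h n)) x
      - (curData B k).br (scur (n : 𝔤)) (toScur h x)) := by
  have h0 : redBr B h f k (algebraMap ℂ _ (B f n)) x = 0 := by
    rw [redBr_apply]
    exact (congrArg _ (br_algebraMap_left _ x)).trans (map_zero _)
  have h1 := redBr_cur_add_Phi (k := k) D n x
  have h2 : redBr B h f k ((brst B h f k u).d (phi h n)) x
      = redBr B h f k (cur h n + Phi h (gradeProj h {1 / 2} (n : 𝔤))) x := by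
    rw [brst_phi D, J]
    simp only [map_add, LinearMap.add_apply, h0, sum_mul_redBr D, add_zero]
  rwa [h2]

end RedBracket

/-! ### Compatibility of the differential with the λ-bracket -/

section Compat

variable {𝔤 : Type*} [LieRing 𝔤] [LieAlgebra ℂ 𝔤] {e h f : 𝔤} {B : LinearMap.BilinForm ℂ 𝔤} {k : ℂ}
  {I : Type*} [Fintype I] {u : Module.Basis I ℂ (nPart h)}

/-- The Jacobi identity with first argument d, at λ = 0: d_(0) is an odd derivation of the
λ-bracket. -/
theorem brst_coeff_br (D : IsDatum B e h f) (x y : C₁ h) (n : ℕ) :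
    (brst B h f k u).d (((brstData B h f k).br x y).coeff n)
      = ((brstData B h f k).br ((brst B h f k u).d x) y).coeff n
        + ((brstData B h f k).br (σ x) ((brst B h f k u).d y)).coeff n := by
  have hd : (brstData B h f k).HasParity 1 (brstElement B h f u) := by
    rw [LambdaData.HasParity, pow_one, neg_one_smul]; exact σ_brstElement B h f u
  have H : ∀ (q : ℕ) x, (brstData B h f k).HasParity q x →
      (brst B h f k u).d (((brstData B h f k).br x y).coeff n)
      = ((brstData B h f k).br ((brst B h f k u).d x) y).coeff n
        + ((brstData B h f k).br (σ x) ((brst B h f k u).d y)).coeff n := by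
    intro q x hx
    have := (isPVA_brstData (k := k) D.symm D.inv).jacobi 1 q (brstElement B h f u) x y 0 n hd hx
    have hσ : σ x = (-1 : ℂ) ^ q • x := hx
    rw [zero_add, Finset.sum_range_one, Nat.sub_zero, zero_add, Nat.choose_self, one_smul, one_mul,
      add_comm] at this
    rw [brst_apply, this, hσ, map_smul, LinearMap.smul_apply, coeff_smul]
    rfl
  refine of_homogeneous (P := fun x =>
    (brst B h f k u).d (((brstData B h f k).br x y).coeff n)
      = ((brstData B h f k).br ((brst B h f k u).d x) y).coeff n
        + ((brstData B h f k).br (σ x) ((brst B h f k u).d y)).coeff n)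
    (fun x x' hx hx' => ?_) (fun o x hx => ?_) x
  · simp only [map_add, LinearMap.add_apply, coeff_add, hx, hx']
    exact add_add_add_comm _ _ _ _
  · cases o
    · exact H 0 x (by rw [LambdaData.HasParity, pow_zero, one_smul]; exact hasPar_false.1 hx)
    · exact H 1 x (by rw [LambdaData.HasParity, pow_one, neg_one_smul]; exact hasPar_true.1 hx)

variable [FiniteDimensional ℂ 𝔤]

/-- The image of a cocycle is invariant under `𝔫`. -/
theorem toScur_mem_W₂lift (D : IsDatum B e h f) {z : C₁ h} (hz : (brst B h f k u).d z = 0) :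
    toScur h z ∈ W₂lift B h f k := by
  rw [mem_W₂lift D]
  intro n hn
  have h1 := redBr_brst_phi (k := k) (u := u) D ⟨n, hn⟩ z
  -- Since dz = 0, {dφ_n λ z} = d{φ_n λ z}, and coboundaries go into the ideal.
  have h2 : InRed B h f (redBr B h f k ((brst B h f k u).d (phi h ⟨n, hn⟩)) z) := by
    intro i
    have := brst_coeff_br (k := k) (u := u) D (phi h ⟨n, hn⟩) z i
    rw [hz, map_zero, coeff_zero, add_zero] at this
    rw [coeff_redBr, ← this]
    exact toScur_brst_mem D _
  have h3 := h2.sub h1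
  rwa [sub_sub_cancel] at h3

end Compat


/-! ### Lifting invariants to cocycles, and comparison of the λ-brackets -/

section Lifts

variable {𝔤 : Type*} [LieRing 𝔤] [LieAlgebra ℂ 𝔤] {e h f : 𝔤} {B : LinearMap.BilinForm ℂ 𝔤} {k : ℂ}
  {I : Type*} [Fintype I] {u : Module.Basis I ℂ (nPart h)}

/-- The linear map `∑ λᵐ a_m ↦ ∑ ∂ᵐ φ^θ T(a_m)`. -/
def dualSum (B : LinearMap.BilinForm ℂ 𝔤) (h f : 𝔤) (u : Module.Basis I ℂ (nPart h))
    (θ : Module.Dual ℂ (nPart h)) : (Scur 𝔤)[X] →ₗ[ℂ] C₁ h :=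
  Polynomial.lsum fun m =>
    LinearMap.mulLeft ℂ ((del ^ m) (phiDual h θ)) ∘ₗ (Tlift B h f u).toLinearMap

theorem dualSum_monomial (θ : Module.Dual ℂ (nPart h)) (m : ℕ) (a : Scur 𝔤) :
    dualSum B h f u θ (monomial m a) = (del ^ m) (phiDual h θ) * Tlift B h f u a := by
  rw [dualSum, Polynomial.lsum_apply]
  exact Polynomial.sum_monomial_index _ _ (map_zero _)

theorem dualSum_C (θ : Module.Dual ℂ (nPart h)) (a : Scur 𝔤) :
    dualSum B h f u θ (C a) = phiDual h θ * Tlift B h f u a := dualSum_monomial θ 0 a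

theorem dualSum_X_mul_C (θ : Module.Dual ℂ (nPart h)) (a : Scur 𝔤) :
    dualSum B h f u θ (X * C a) = del (phiDual h θ) * Tlift B h f u a := by
  rw [← monomial_zero_left, X_mul_monomial, dualSum_monomial, zero_add, pow_one]

theorem dualSum_C_mul (θ : Module.Dual ℂ (nPart h)) (a : Scur 𝔤) (p : (Scur 𝔤)[X]) :
    dualSum B h f u θ (C a * p) = Tlift B h f u a * dualSum B h f u θ p := by
  induction p using Polynomial.induction_on' with
  | add p q hp hq => rw [mul_add, map_add, hp, hq, map_add, mul_add]
  | monomial m b =>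
    rw [C_mul_monomial, dualSum_monomial, dualSum_monomial, map_mul, ← mul_assoc, ← mul_assoc,
      (hasPar_Tlift a).mul_comm]
    rfl

theorem dualSum_mul_C (θ : Module.Dual ℂ (nPart h)) (a : Scur 𝔤) (p : (Scur 𝔤)[X]) :
    dualSum B h f u θ (p * C a) = dualSum B h f u θ p * Tlift B h f u a := by
  induction p using Polynomial.induction_on' with
  | add p q hp hq => rw [add_mul, map_add, hp, hq, map_add, add_mul]
  | monomial m b =>
    rw [monomial_mul_C, dualSum_monomial, dualSum_monomial, map_mul, mul_assoc]

theorem dualSum_lamAdd (θ : Module.Dual ℂ (nPart h)) (p : (Scur 𝔤)[X]) :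
    dualSum B h f u θ (lamAdd del p) = del (dualSum B h f u θ p) := by
  induction p using Polynomial.induction_on' with
  | add p q hp hq => rw [map_add, map_add, hp, hq, map_add, map_add]
  | monomial m b =>
    rw [lamAdd_apply, coeffwise_eq_mapLin, mapLin_monomial, X_mul_monomial, map_add,
      dualSum_monomial, dualSum_monomial, dualSum_monomial, del_mul, Tlift_del, pow_succ',
      Module.End.mul_apply]

variable [FiniteDimensional ℂ 𝔤]

theorem dualSum_of_inRed (D : IsDatum B e h f) (θ : Module.Dual ℂ (nPart h)) {p : (Scur 𝔤)[X]}
    (hp : InRed B h f p) : dualSum B h f u θ p = 0 := by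
  rw [dualSum, Polynomial.lsum_apply, Polynomial.sum_def]
  refine Finset.sum_eq_zero fun m _ => ?_
  rw [LinearMap.comp_apply, AlgHom.toLinearMap_apply, Tlift_of_mem_redIdeal D (hp m), map_zero]

/-- In w both sides are derivations along T compatible with ∂, and on generators the formula is
`brst_Tmap`: λᵐ in {u_α λ w} is replaced by ∂ᵐφ^{v^α}. -/
theorem brst_Tlift (D : IsDatum B e h f) (w : Scur 𝔤) :
    (brst B h f k u).d (Tlift B h f u w)
      = ∑ α, dualSum B h f u (u.coord α) ((curData B k).br (scur (u α : 𝔤)) w) := by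
  induction w using Scur_induction with
  | hc r => simp only [AlgHom.commutes, brst_algebraMap, cur_br_algebraMap, map_zero,
      Finset.sum_const_zero]
  | hgen a =>
    rw [Tlift_scur, brst_Tmap D, ← sum_smul_phiDual (u := u) (pairing B h a), map_sum,
      Finset.smul_sum, ← Finset.sum_add_distrib]
    refine Finset.sum_congr rfl fun α _ => ?_
    rw [br_scur_scur D, map_add, dualSum_C, dualSum_X_mul_C, Tlift_scur, AlgHom.commutes,
      ← Algebra.commutes, ← Algebra.smul_def, map_smul, smul_smul, pairing_apply, D.symm a]
  | hdel a ha => simp only [Tlift_del, brst_del, ha, map_sum, cur_br_del_right, dualSum_lamAdd]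
  | hmul a b ha hb =>
    rw [map_mul, brst_mul, ha, hb, hasPar_false.1 (hasPar_Tlift a), Finset.mul_sum, Finset.sum_mul,
      ← Finset.sum_add_distrib]
    refine Finset.sum_congr rfl fun α _ => ?_
    rw [cur_br_mul, map_add, dualSum_C_mul, dualSum_mul_C]
  | hadd a b ha hb => simp only [map_add, ha, hb, Finset.sum_add_distrib]

/-- `T` maps invariants to cocycles. -/
theorem brst_Tlift_eq_zero (D : IsDatum B e h f) {w : Scur 𝔤} (hw : w ∈ W₂lift B h f k) :
    (brst B h f k u).d (Tlift B h f u w) = 0 := by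
  rw [brst_Tlift D]
  exact Finset.sum_eq_zero fun α _ => dualSum_of_inRed D _ ((mem_W₂lift D).1 hw _ (u α).2)

theorem redBr_σ (x y : C₁ h) : redBr B h f k (σ x) (σ y) = redBr B h f k x y := by
  ext n
  have := par_br (isEven_brstBracket B h f k) x y
  rw [coeff_redBr, coeff_redBr, ← toScur_σ (((brstData B h f k).br x y).coeff n), ← coeff_σX]
  exact congrArg (fun p => toScur h (coeff p n)) this.symm

/-- φ^θ has nonzero brackets only with φ_n, which occurs in S(R_-) through J alone; its bracket with
J_a is again some φ^η and goes to 0. -/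
theorem redBr_phiDual_of_mem_Sminus (D : IsDatum B e h f) (θ : Module.Dual ℂ (nPart h)) {x : C₁ h}
    (hx : x ∈ Sminus h u) : InRed B h f (redBr B h f k (phiDual h θ) x) := by
  refine Sminus_induction (u := u) (P := fun x => InRed B h f (redBr B h f k (phiDual h θ) x))
    (fun r => ?_) (fun a ha => ?_) (fun b => ?_) (fun η => ?_) (fun x _ hx => ?_)
    (fun x hx' y hy' hx hy => ?_) (fun x _ y _ hx hy => ?_) hx
  · rw [redBr_algebraMap]; exact inRed_zero
  · rw [redBr_apply, br_phiDual_J D, mapLin_C, AlgHom.toLinearMap_apply, map_neg, toScur_phiDual,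
      neg_zero, C_0]
    exact inRed_zero
  · rw [redBr_apply, br_phiDual_Phi D, map_zero]; exact inRed_zero
  · rw [redBr_apply, br_phiDual_phiDual D, map_zero]; exact inRed_zero
  · rw [redBr_del]; exact hx.lamAdd
  · rw [redBr_mul]; exact (hy.C_mul _).add (hx.mul_C _)
  · rw [map_add]; exact hx.add hy

/-- The Leibniz rule reduces z to generators, where the difference is ∑ φ^{v^α}φ_{[u_α, a]} for J_a,
b + Φ_b for Φ_b, and φ^η itself. The first is harmless since both factors go to 0; the second since
{b + Φ_b λ x} goes to {b_λ 0} modulo the ideal; the third is covered by the hypothesis on x. -/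
theorem redBr_sub_fromScur (D : IsDatum B e h f) {x z : C₁ h} (h0 : toScur h x = 0)
    (hx : ∀ θ, InRed B h f (redBr B h f k (phiDual h θ) x)) (hz : z ∈ Sminus h u) :
    InRed B h f (redBr B h f k x (z - fromScur h (toScur h z))) := by
  have hq : ∀ z, toScur h (z - fromScur h (toScur h z)) = 0 := fun z => by
    rw [map_sub, toScur_fromScur, sub_self]
  refine Sminus_induction (u := u)
    (P := fun z => InRed B h f (redBr B h f k x (z - fromScur h (toScur h z))))
    (fun r => ?_) (fun a ha => ?_) (fun b => ?_) (fun η => ?_) (fun z _ hz => ?_)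
    (fun y _ z _ hy hz => ?_) (fun y _ z _ hy hz => ?_) hz
  · rw [AlgHom.commutes, AlgHom.commutes, sub_self, map_zero]; exact inRed_zero
  · rw [toScur_J, fromScur_scur, J, add_sub_cancel_left, toScur_mul_sum_zero]; exact inRed_zero
  · rw [toScur_Phi, map_neg, fromScur_scur, sub_neg_eq_add, add_comm]
    have h1 := redBr_cur_add_Phi (k := k) D ⟨b, halfPart_le_nPart b.2⟩ x
    rw [h0, map_zero, sub_zero] at h1
    simp only [gradeProj_of_mem D.sl2 b.2] at h1
    rw [redBr_skew_even D ((hasPar_cur (b : 𝔤)).add (hasPar_Phi b))]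
    exact h1.skewSubst.neg
  · rw [toScur_phiDual, map_zero, sub_zero]
    have h1 := redBr_skew (k := k) D (hasPar_phiDual η) (σ x)
    have h2 : twist true (σ x) = x := twist_self true x
    have h3 : InRed B h f (redBr B h f k (phiDual h η) (σ x)) := by
      have := redBr_σ (B := B) (f := f) (k := k) (phiDual h η) x
      rw [σ_phiDual, map_neg, LinearMap.neg_apply] at this
      rw [← neg_neg (redBr B h f k (phiDual h η) (σ x)), this]
      exact (hx η).neg
    rw [h2] at h1
    rw [h1] at h3
    have h4 := h3.neg.skewSubst
    rwa [neg_neg, skewSubst_skewSubst] at h4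
  · rw [toScur_del, fromScur_del, ← map_sub, redBr_del]; exact hz.lamAdd
  -- Each summand has one factor that goes to 0 under `toScur`, so only the bracket with that factor
  -- survives.
  · have e1 : y * z - fromScur h (toScur h (y * z)) = (y - fromScur h (toScur h y)) * z
        + fromScur h (toScur h y) * (z - fromScur h (toScur h z)) := by
      rw [map_mul, map_mul]; noncomm_ring
    rw [e1, map_add, redBr_mul, redBr_mul, hq, hq, C_0, zero_mul, mul_zero, add_zero, zero_add]
    exact (hy.mul_C _).add (hz.C_mul _)
  · rw [map_add (toScur h), map_add (fromScur h), add_sub_add_comm, map_add]; exact hy.add hz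

/-- The λ-brackets of cocycles of `S(R_-)` and of their images agree modulo the ideal. -/
theorem redBr_of_mem_Sminus (D : IsDatum B e h f) {y z : C₁ h} (hy : y ∈ Sminus h u)
    (hz : z ∈ Sminus h u) (hy0 : toScur h y ∈ W₂lift B h f k) (hz0 : toScur h z ∈ W₂lift B h f k) :
    InRed B h f (redBr B h f k y z - (curData B k).br (toScur h y) (toScur h z)) := by
  have hq : ∀ z, toScur h (z - fromScur h (toScur h z)) = 0 := fun z => by
    rw [map_sub, toScur_fromScur, sub_self]
  have hE : ∀ θ, InRed B h f (redBr B h f k (phiDual h θ) (y - fromScur h (toScur h y))) := by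
    intro θ
    rw [map_sub]
    refine (redBr_phiDual_of_mem_Sminus D θ hy).sub ?_
    rw [redBr_apply, br_fromScur_eq_zero (hasPar_phiDual θ) (br_phiDual_cur D θ), map_zero]
    exact inRed_zero
  -- With y = y' + E and z = z' + F, where y', z' are the lifts of the images to the subalgebra
  -- generated by 𝔤, the terms {E, F}, {y', F}, {y', z'} - {i(y), i(z)} and {E, z'} are shown to lie
  -- in the ideal, the last one by skewsymmetry.
  have h1 := redBr_sub_fromScur D (hq y) hE hz
  have h2 := redBr_fromScur D hy0 (z - fromScur h (toScur h z))
  have h3 := redBr_fromScur D hy0 (fromScur h (toScur h z))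
  have h4 := redBr_fromScur D hz0 (y - fromScur h (toScur h y))
  rw [hq, map_zero, sub_zero] at h2 h4
  rw [toScur_fromScur] at h3
  have h5 := h4.skewSubst.neg
  rw [← redBr_skew_even D (hasPar_fromScur _)] at h5
  have h6 := ((h1.add h2).add h3).add h5
  convert h6 using 1
  simp only [map_sub, LinearMap.sub_apply]
  abel

end Lifts


/-! ### Poisson vertex algebra structures induced on subalgebras and quotients -/

section Induced

variable {A B C' : Type*} [Ring A] [Algebra ℂ A] [Ring B] [Algebra ℂ B] [Ring C'] [Algebra ℂ C']

/-- `F` is compatible with the parity, `∂` and the λ-bracket. -/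
structure IsLambdaHom (P : LambdaData A) (Q : LambdaData B) (F : A →ₐ[ℂ] B) : Prop where
  par : ∀ a, F (P.par a) = Q.par (F a)
  del : ∀ a, F (P.del a) = Q.del (F a)
  br : ∀ a b, mapLin F.toLinearMap (P.br a b) = Q.br (F a) (F b)

variable {P : LambdaData A} {Q : LambdaData B} {Q' : LambdaData C'} {F : A →ₐ[ℂ] B}

theorem IsLambdaHom.coeff_br (hF : IsLambdaHom P Q F) (a b : A) (n : ℕ) :
    F ((P.br a b).coeff n) = (Q.br (F a) (F b)).coeff n := by
  rw [← hF.br, coeff_mapLin]; rfl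

theorem IsLambdaHom.hasParity (hF : IsLambdaHom P Q F) {p : ℕ} {a : A} (ha : P.HasParity p a) :
    Q.HasParity p (F a) := by
  rw [LambdaData.HasParity, ← hF.par, show P.par a = _ from ha, map_smul]

theorem mapLin_C_mul (F : A →ₐ[ℂ] B) (a : A) (p : A[X]) :
    mapLin F.toLinearMap (C a * p) = C (F a) * mapLin F.toLinearMap p := by
  ext n; simp [coeff_mapLin]

theorem mapLin_mul_C (F : A →ₐ[ℂ] B) (a : A) (p : A[X]) :
    mapLin F.toLinearMap (p * C a) = mapLin F.toLinearMap p * C (F a) := by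
  ext n; simp [coeff_mapLin]

theorem mapLin_injective (hF : Function.Injective F) :
    Function.Injective (mapLin F.toLinearMap) := fun p q hpq => by
  ext n
  refine hF ?_
  have := congrArg (fun r => r.coeff n) hpq
  simpa [coeff_mapLin] using this

/-- A structure that embeds in a Poisson vertex algebra is one. -/
theorem IsLambdaHom.isPVA_of_injective (hF : IsLambdaHom P Q F) (hi : Function.Injective F)
    (hQ : Q.IsPVA) : P.IsPVA where
  par_par a := hi (by rw [hF.par, hF.par, hQ.par_par])
  supercomm p q a b ha hb := hi (by
    rw [map_mul, map_smul, map_mul, hQ.supercomm p q _ _ (hF.hasParity ha) (hF.hasParity hb)])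
  par_del a := hi (by rw [hF.par, hF.del, hF.del, hF.par, hQ.par_del])
  par_br a b n := hi (by rw [hF.par, hF.coeff_br, hF.coeff_br, hF.par, hF.par, hQ.par_br])
  del_mul a b := hi (by
    rw [hF.del, map_mul F, hQ.del_mul, map_add, map_mul F, map_mul F, hF.del, hF.del])
  br_del_left a b := mapLin_injective hi (by
    rw [hF.br, hF.del, hQ.br_del_left, map_neg, mapLin_X_mul, hF.br])
  br_del_right a b := mapLin_injective hi (by
    rw [hF.br, hF.del, hQ.br_del_right, mapLin_lamAdd _ P.del Q.del hF.del, hF.br])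
  skew p q a b ha hb := mapLin_injective hi (by
    rw [hF.br, hQ.skew p q _ _ (hF.hasParity ha) (hF.hasParity hb), map_neg, map_smul,
      mapLin_skewSubst _ P.del Q.del hF.del, hF.br])
  jacobi p q a b c m n ha hb := hi (by
    rw [hF.coeff_br, hF.coeff_br, hQ.jacobi p q _ _ _ m n (hF.hasParity ha) (hF.hasParity hb),
      map_add, map_smul, map_sum, hF.coeff_br, hF.coeff_br]
    simp only [map_nsmul, hF.coeff_br])
  leibniz p q a b c ha hb := mapLin_injective hi (by
    rw [hF.br, map_mul, hQ.leibniz p q _ _ _ (hF.hasParity ha) (hF.hasParity hb), map_add, map_smul,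
      mapLin_C_mul, mapLin_mul_C, hF.br, hF.br])

/-- The component of parity p of any lift is again a lift. It allows the axioms with parity
hypotheses to be checked on homogeneous representatives. -/
theorem IsLambdaHom.exists_hasParity (hF : IsLambdaHom P Q F) (hs : Function.Surjective F)
    (hP : P.IsPVA) {p : ℕ} {b : B} (hb : Q.HasParity p b) : ∃ a, P.HasParity p a ∧ F a = b := by
  obtain ⟨a, rfl⟩ := hs b
  have hp : ((-1 : ℂ) ^ p * (-1) ^ p) = 1 := by rw [← mul_pow]; simp
  refine ⟨(1 / 2 : ℂ) • (a + (-1 : ℂ) ^ p • P.par a), ?_, ?_⟩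
  · rw [LambdaData.HasParity, map_smul, map_add, map_smul, hP.par_par,
      smul_comm ((-1 : ℂ) ^ p) (1 / 2 : ℂ), smul_add ((-1 : ℂ) ^ p), smul_smul ((-1 : ℂ) ^ p), hp,
      one_smul, add_comm]
  · rw [map_smul, map_add, map_smul, hF.par, show Q.par (F a) = _ from hb, smul_smul, hp, one_smul,
      ← two_smul ℂ (F a), smul_smul]
    norm_num

/-- A quotient of a Poisson vertex algebra is one. -/
theorem IsLambdaHom.isPVA_of_surjective (hF : IsLambdaHom P Q F) (hs : Function.Surjective F)
    (hP : P.IsPVA) : Q.IsPVA where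
  par_par a := by
    obtain ⟨a, rfl⟩ := hs a
    rw [← hF.par, ← hF.par, hP.par_par]
  supercomm p q a b ha hb := by
    obtain ⟨a, ha', rfl⟩ := hF.exists_hasParity hs hP ha
    obtain ⟨b, hb', rfl⟩ := hF.exists_hasParity hs hP hb
    rw [← map_mul, hP.supercomm p q _ _ ha' hb', map_smul, map_mul]
  par_del a := by
    obtain ⟨a, rfl⟩ := hs a
    rw [← hF.del, ← hF.par, hP.par_del, hF.del, hF.par]
  par_br a b n := by
    obtain ⟨a, rfl⟩ := hs a
    obtain ⟨b, rfl⟩ := hs b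
    rw [← hF.coeff_br, ← hF.par, hP.par_br, hF.coeff_br, hF.par, hF.par]
  del_mul a b := by
    obtain ⟨a, rfl⟩ := hs a
    obtain ⟨b, rfl⟩ := hs b
    rw [← map_mul, ← hF.del, hP.del_mul, map_add, map_mul, map_mul, hF.del, hF.del]
  br_del_left a b := by
    obtain ⟨a, rfl⟩ := hs a
    obtain ⟨b, rfl⟩ := hs b
    rw [← hF.del, ← hF.br, hP.br_del_left, map_neg, mapLin_X_mul, hF.br]
  br_del_right a b := by
    obtain ⟨a, rfl⟩ := hs a
    obtain ⟨b, rfl⟩ := hs b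
    rw [← hF.del, ← hF.br, hP.br_del_right, mapLin_lamAdd _ P.del Q.del hF.del, hF.br]
  skew p q a b ha hb := by
    obtain ⟨a, ha', rfl⟩ := hF.exists_hasParity hs hP ha
    obtain ⟨b, hb', rfl⟩ := hF.exists_hasParity hs hP hb
    rw [← hF.br, hP.skew p q _ _ ha' hb', map_neg, map_smul, mapLin_skewSubst _ P.del Q.del hF.del,
      hF.br]
  jacobi p q a b c m n ha hb := by
    obtain ⟨a, ha', rfl⟩ := hF.exists_hasParity hs hP ha
    obtain ⟨b, hb', rfl⟩ := hF.exists_hasParity hs hP hb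
    obtain ⟨c, rfl⟩ := hs c
    rw [← hF.coeff_br, ← hF.coeff_br, hP.jacobi p q _ _ _ m n ha' hb', map_add, map_smul, map_sum,
      hF.coeff_br, hF.coeff_br]
    simp only [map_nsmul, hF.coeff_br]
  leibniz p q a b c ha hb := by
    obtain ⟨a, ha', rfl⟩ := hF.exists_hasParity hs hP ha
    obtain ⟨b, hb', rfl⟩ := hF.exists_hasParity hs hP hb
    obtain ⟨c, rfl⟩ := hs c
    rw [← map_mul, ← hF.br, hP.leibniz p q _ _ _ ha' hb', map_add, map_smul, mapLin_C_mul,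
      mapLin_mul_C, hF.br, hF.br]

/-- The restriction of a structure to a subalgebra. -/
theorem exists_restriction (P : LambdaData A) (Z : Subalgebra ℂ A) (hpar : ∀ z ∈ Z, P.par z ∈ Z)
    (hdel : ∀ z ∈ Z, P.del z ∈ Z) (hbr : ∀ z ∈ Z, ∀ w ∈ Z, ∀ n, (P.br z w).coeff n ∈ Z) :
    ∃ PZ : LambdaData Z, IsLambdaHom PZ P Z.val := by
  -- A linear retraction onto Z is a device for writing the restricted operations as linear maps; by
  -- stability only its values on Z matter.
  obtain ⟨r, hr⟩ := Z.val.toLinearMap.exists_leftInverse_of_injective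
    (LinearMap.ker_eq_bot.2 Subtype.val_injective)
  have hr' : ∀ a ∈ Z, (r a : A) = a := fun a ha =>
    congrArg Subtype.val (LinearMap.congr_fun hr ⟨a, ha⟩)
  refine ⟨⟨(P.par.comp Z.val).codRestrict Z fun z => hpar z z.2,
    r ∘ₗ P.del ∘ₗ Z.val.toLinearMap,
    (P.br.compl₁₂ Z.val.toLinearMap Z.val.toLinearMap).compr₂ (mapLin r)⟩,
    fun a => rfl, fun a => hr' _ (hdel a a.2), fun a b => ?_⟩
  ext n
  rw [coeff_mapLin]
  change ((mapLin r (P.br a b)).coeff n : A) = _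
  rw [coeff_mapLin, hr' _ (hbr a a.2 b b.2 n)]
  rfl

/-- The structure induced on a quotient. -/
theorem exists_quotient (P : LambdaData A) {F : A →ₐ[ℂ] B} (hs : Function.Surjective F)
    (hpar : ∀ z, F z = 0 → F (P.par z) = 0) (hdel : ∀ z, F z = 0 → F (P.del z) = 0)
    (hbr : ∀ z w n, F z = 0 → F ((P.br z w).coeff n) = 0)
    (hbr' : ∀ z w n, F w = 0 → F ((P.br z w).coeff n) = 0) :
    ∃ Q : LambdaData B, IsLambdaHom P Q F := by
  -- The operations are transported through a linear section; stability of the kernel makes the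
  -- result independent of this choice.
  obtain ⟨s, hs'⟩ := F.toLinearMap.exists_rightInverse_of_surjective (LinearMap.range_eq_top.2 hs)
  have hs : ∀ b, F (s b) = b := fun b => LinearMap.congr_fun hs' b
  have hz : ∀ a, F (s (F a) - a) = 0 := fun a => by rw [map_sub, hs, sub_self]
  have hp : ∀ a, F (P.par (s (F a))) = F (P.par a) := fun a => by
    rw [← sub_eq_zero, ← map_sub, ← map_sub]; exact hpar _ (hz a)
  refine ⟨⟨AlgHom.ofLinearMap (F.toLinearMap ∘ₗ P.par.toLinearMap ∘ₗ s) ?_ ?_,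
    F.toLinearMap ∘ₗ P.del ∘ₗ s,
    (P.br.compl₁₂ s s).compr₂ (mapLin F.toLinearMap)⟩,
    fun a => (hp a).symm, fun a => ?_, fun a b => ?_⟩
  · have := hp 1
    rwa [map_one F, map_one P.par, map_one F] at this
  · intro x y
    have h1 := hp (s x * s y)
    rw [map_mul F, hs, hs] at h1
    change F (P.par (s (x * y))) = F (P.par (s x)) * F (P.par (s y))
    rw [h1, map_mul, map_mul]
  · change F (P.del a) = F (P.del (s (F a)))
    rw [eq_comm, ← sub_eq_zero, ← map_sub, ← map_sub]
    exact hdel _ (hz a)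
  · ext n
    change (mapLin F.toLinearMap (P.br a b)).coeff n
      = (mapLin F.toLinearMap (P.br (s (F a)) (s (F b)))).coeff n
    rw [coeff_mapLin, coeff_mapLin, AlgHom.toLinearMap_apply, AlgHom.toLinearMap_apply]
    have h1 := hbr (s (F a) - a) (s (F b)) n (hz a)
    have h2 := hbr' a (s (F b) - b) n (hz b)
    rw [map_sub, LinearMap.sub_apply, coeff_sub, map_sub, sub_eq_zero] at h1
    rw [map_sub, coeff_sub, map_sub, sub_eq_zero] at h2
    rw [h1, h2]

/-- Two surjective homomorphisms with the same kernel have isomorphic targets. -/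
theorem exists_algEquiv {F : A →ₐ[ℂ] B} {G : A →ₐ[ℂ] C'} (hF : Function.Surjective F)
    (hG : Function.Surjective G) (hk : ∀ a, F a = 0 ↔ G a = 0) :
    ∃ j : B ≃ₐ[ℂ] C', ∀ a, j (F a) = G a := by
  obtain ⟨s, hs'⟩ := F.toLinearMap.exists_rightInverse_of_surjective (LinearMap.range_eq_top.2 hF)
  have hs : ∀ b, F (s b) = b := fun b => LinearMap.congr_fun hs' b
  have hp : ∀ a, G (s (F a)) = G a := fun a => by
    rw [← sub_eq_zero, ← map_sub, ← hk, map_sub, hs, sub_self]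
  let φ : B →ₐ[ℂ] C' := AlgHom.ofLinearMap (G.toLinearMap ∘ₗ s)
    (by have := hp 1; rwa [map_one F, map_one G] at this)
    (fun x y => by
      have h1 := hp (s x * s y)
      rw [map_mul F, hs, hs, map_mul G] at h1
      exact h1)
  have hφ : ∀ a, φ (F a) = G a := hp
  refine ⟨AlgEquiv.ofBijective φ ⟨?_, fun c => ?_⟩, hφ⟩
  · rw [injective_iff_map_eq_zero]
    intro b hb
    obtain ⟨a, rfl⟩ := hF b
    rw [hφ, ← hk] at hb
    exact hb
  · obtain ⟨a, rfl⟩ := hG c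
    exact ⟨F a, hφ a⟩

theorem IsLambdaHom.isPVAEquiv (hF : IsLambdaHom P Q F) (hs : Function.Surjective F)
    {G : A →ₐ[ℂ] C'} (hG : IsLambdaHom P Q' G) {j : B ≃ₐ[ℂ] C'} (hj : ∀ a, j (F a) = G a) :
    IsPVAEquiv Q Q' j where
  par b := by
    obtain ⟨a, rfl⟩ := hs b
    rw [← hF.par, hj, hj, hG.par]
  del b := by
    obtain ⟨a, rfl⟩ := hs b
    rw [← hF.del, hj, hj, hG.del]
  br b c n := by
    obtain ⟨a, rfl⟩ := hs b
    obtain ⟨a', rfl⟩ := hs c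
    rw [← hF.coeff_br, hj, hj, hj, hG.coeff_br]

theorem IsPVAEquiv.symm_trans {P : LambdaData A} {j : A ≃ₐ[ℂ] B} {j' : A ≃ₐ[ℂ] C'}
    (hj : IsPVAEquiv P Q j) (hj' : IsPVAEquiv P Q' j') : IsPVAEquiv Q Q' (j.symm.trans j') where
  par b := by
    obtain ⟨a, rfl⟩ := j.surjective b
    rw [← hj.par]; simp [hj'.par]
  del b := by
    obtain ⟨a, rfl⟩ := j.surjective b
    rw [← hj.del]; simp [hj'.del]
  br b c n := by
    obtain ⟨a, rfl⟩ := j.surjective b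
    obtain ⟨a', rfl⟩ := j.surjective c
    rw [← hj.br]; simp [hj'.br]

theorem isInduced_of_isLambdaHom {P : LambdaData A} {Z : Subalgebra ℂ A} {PZ : LambdaData Z}
    (hPZ : IsLambdaHom PZ P Z.val) {π : Z →ₐ[ℂ] B} (hπ : IsLambdaHom PZ Q π) :
    IsInduced P Z π Q where
  par z := ⟨PZ.par z, hPZ.par z, (hπ.par z).symm⟩
  del z := ⟨PZ.del z, hPZ.del z, (hπ.del z).symm⟩
  br z w n := ⟨(PZ.br z w).coeff n, hPZ.coeff_br z w n, (hπ.coeff_br z w n).symm⟩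

end Induced


/-! ### Classes in cohomology and composition of homomorphisms -/

section Cohomology

theorem cls_eq_zero {A : Type*} [Ring A] [Algebra ℂ A] (d : OddDeriv A) (Z : Subalgebra ℂ A)
    (hZ : ∀ b ∈ Z, d.par b ∈ Z) (z : d.cocycles Z) :
    d.cls Z hZ z = 0 ↔ ∃ b ∈ Z, d.d b = z := by
  have h1 : d.cls Z hZ z = 0 ↔ z ∈ d.coboundaries Z hZ := by
    rw [TwoSidedIdeal.mem_iff, ← RingCon.eq]; rfl
  rw [h1, OddDeriv.coboundaries, TwoSidedIdeal.mem_mk']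
  rfl

theorem cls_surjective {A : Type*} [Ring A] [Algebra ℂ A] (d : OddDeriv A) (Z : Subalgebra ℂ A)
    (hZ : ∀ b ∈ Z, d.par b ∈ Z) : Function.Surjective (d.cls Z hZ) :=
  RingCon.mkₐ_surjective _

variable {A B C' : Type*} [Ring A] [Algebra ℂ A] [Ring B] [Algebra ℂ B] [Ring C'] [Algebra ℂ C']

theorem IsLambdaHom.comp {P : LambdaData A} {Q : LambdaData B} {Q' : LambdaData C'}
    {F : A →ₐ[ℂ] B} {G : B →ₐ[ℂ] C'} (hG : IsLambdaHom Q Q' G) (hF : IsLambdaHom P Q F) :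
    IsLambdaHom P Q' (G.comp F) where
  par a := by rw [AlgHom.comp_apply, AlgHom.comp_apply, hF.par, hG.par]
  del a := by rw [AlgHom.comp_apply, AlgHom.comp_apply, hF.del, hG.del]
  br a b := by
    ext n
    rw [coeff_mapLin, AlgHom.toLinearMap_apply, AlgHom.comp_apply, AlgHom.comp_apply,
      AlgHom.comp_apply, hF.coeff_br, hG.coeff_br]

end Cohomology

/-! ### The induced structures and the isomorphisms -/

section Main

variable {𝔤 : Type*} [LieRing 𝔤] [LieAlgebra ℂ 𝔤] {e h f : 𝔤} {B : LinearMap.BilinForm ℂ 𝔤} {k : ℂ}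
  {I : Type*} [Fintype I] {u : Module.Basis I ℂ (nPart h)}

/-- The structures induced on the cocycles and on the cohomology of a stable subalgebra. -/
theorem exists_induced_cohomology (D : IsDatum B e h f) (Z : Subalgebra ℂ (C₁ h))
    (hσ : ∀ x ∈ Z, (brst B h f k u).par x ∈ Z) (hdel : ∀ x ∈ Z, del x ∈ Z)
    (hbr : ∀ x ∈ Z, ∀ y ∈ Z, ∀ n, ((brstData B h f k).br x y).coeff n ∈ Z) :
    ∃ (PZ : LambdaData ((brst B h f k u).cocycles Z))
      (Q : LambdaData ((brst B h f k u).Cohomology Z hσ)),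
      IsLambdaHom PZ (brstData B h f k) ((brst B h f k u).cocycles Z).val ∧
      IsLambdaHom PZ Q ((brst B h f k u).cls Z hσ) := by
  obtain ⟨PZ, hPZ⟩ := exists_restriction (brstData B h f k) ((brst B h f k u).cocycles Z)
    (fun z hz => ⟨hσ z hz.1, (brst_σ z).trans (by rw [hz.2, map_zero, neg_zero])⟩)
    (fun z hz => ⟨hdel z hz.1, (brst_del z).trans (by rw [hz.2, map_zero])⟩)
    (fun z hz w hw n => ⟨hbr z hz.1 w hw.1 n, (brst_coeff_br D z w n).trans (by
      rw [hz.2, hw.2, map_zero, map_zero, LinearMap.zero_apply, coeff_zero, add_zero])⟩)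
  have hc := cls_eq_zero (brst B h f k u) Z hσ
  obtain ⟨Q, hQ⟩ := exists_quotient PZ (cls_surjective (brst B h f k u) Z hσ)
    (fun z hz => by
      rw [hc] at hz ⊢
      obtain ⟨b, hb, hbz⟩ := hz
      refine ⟨-σ b, neg_mem (hσ b hb), ?_⟩
      rw [map_neg, brst_σ, neg_neg, hbz]
      exact (hPZ.par z).symm)
    (fun z hz => by
      rw [hc] at hz ⊢
      obtain ⟨b, hb, hbz⟩ := hz
      refine ⟨del b, hdel b hb, ?_⟩
      rw [brst_del, hbz]
      exact (hPZ.del z).symm)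
    (fun z w n hz => by
      rw [hc] at hz ⊢
      obtain ⟨b, hb, hbz⟩ := hz
      -- {db_λ w} = d{b_λ w} for a cocycle w.
      refine ⟨_, hbr b hb w w.2.1 n, ?_⟩
      have hw : (brst B h f k u).d (w : C₁ h) = 0 := w.2.2
      rw [brst_coeff_br D, hw, map_zero, coeff_zero, add_zero, hbz]
      exact (hPZ.coeff_br z w n).symm)
    (fun z w n hw => by
      rw [hc] at hw ⊢
      obtain ⟨b, hb, hbw⟩ := hw
      have hz : (brst B h f k u).d (σ (z : C₁ h)) = 0 := by
        rw [brst_σ, show (brst B h f k u).d (z : C₁ h) = 0 from z.2.2, map_zero, neg_zero]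
      -- d{σ(z)_λ b} = {z_λ db} for a cocycle z, since σ² = 1 and σ(z) is a cocycle as well.
      have key := brst_coeff_br (k := k) (u := u) D (σ (z : C₁ h)) b n
      rw [hz, σ_σ, hbw, map_zero, LinearMap.zero_apply, coeff_zero, zero_add] at key
      exact ⟨((brstData B h f k).br (σ (z : C₁ h)) b).coeff n, hbr _ (hσ z z.2.1) b hb n,
        key.trans (hPZ.coeff_br z w n).symm⟩)
  exact ⟨PZ, Q, hPZ, hQ⟩

/-- The projection onto `W₂` as a homomorphism. -/
def toW₂Hom (B : LinearMap.BilinForm ℂ 𝔤) (h f : 𝔤) (k : ℂ) : W₂lift B h f k →ₐ[ℂ] W₂ B h f k :=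
  ((toRed B h f).comp (W₂lift B h f k).val).codRestrict (W₂ B h f k) fun z => z.2

theorem toW₂Hom_eq_zero (z : W₂lift B h f k) :
    toW₂Hom B h f k z = 0 ↔ (z : Scur 𝔤) ∈ redIdeal B h f := by
  rw [← toRed_eq_zero, ← Subtype.coe_inj]; rfl

theorem toW₂Hom_surjective : Function.Surjective (toW₂Hom B h f k) := by
  rintro ⟨x, a, rfl, ha⟩
  exact ⟨⟨a, a, rfl, ha⟩, rfl⟩

/-- The structures induced on `W₂lift` and on `W₂`. -/
theorem exists_induced_W₂ (D : IsDatum B e h f) :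
    ∃ (PZ : LambdaData (W₂lift B h f k)) (Q : LambdaData (W₂ B h f k)),
      IsLambdaHom PZ (curData B k) (W₂lift B h f k).val ∧
      IsLambdaHom PZ Q (toW₂Hom B h f k) := by
  obtain ⟨PZ, hPZ⟩ := exists_restriction (curData B k) (W₂lift B h f k)
    (fun z hz => (σ_Scur z).symm ▸ hz) (fun z hz => del_mem_W₂lift D hz)
    (fun z hz w hw n => br_mem_W₂lift D hz hw n)
  obtain ⟨Q, hQ⟩ := exists_quotient PZ (F := toW₂Hom B h f k) toW₂Hom_surjective
    (fun z hz => by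
      rw [toW₂Hom_eq_zero] at hz ⊢
      rw [show (PZ.par z : Scur 𝔤) = z from (hPZ.par z).trans (σ_Scur _)]
      exact hz)
    (fun z hz => by
      rw [toW₂Hom_eq_zero] at hz ⊢
      rw [show (PZ.del z : Scur 𝔤) = del z from hPZ.del z]
      exact del_mem_redIdeal hz)
    (fun z w n hz => by
      rw [toW₂Hom_eq_zero] at hz ⊢
      rw [show (((PZ.br z w).coeff n : W₂lift B h f k) : Scur 𝔤) = _ from hPZ.coeff_br z w n]
      exact br_redIdeal_W₂lift_mem D w.2 hz n)
    (fun z w n hw => by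
      rw [toW₂Hom_eq_zero] at hw ⊢
      rw [show (((PZ.br z w).coeff n : W₂lift B h f k) : Scur 𝔤) = _ from hPZ.coeff_br z w n]
      exact br_W₂lift_mem_redIdeal D z.2 hw n)
  exact ⟨PZ, Q, hPZ, hQ⟩

theorem toScur_del_pow (n : ℕ) (x : C₁ h) : toScur h ((del ^ n) x) = (del ^ n) (toScur h x) := by
  induction n with
  | zero => rfl
  | succ n ih => rw [pow_succ', Module.End.mul_apply, toScur_del, ih, pow_succ', Module.End.mul_apply]

variable [FiniteDimensional ℂ 𝔤]

/-- The homomorphism from the cocycles of `S(R_-)` to `W₂lift`. -/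
def cocycleLift (D : IsDatum B e h f) (k : ℂ) (u : Module.Basis I ℂ (nPart h)) :
    (brst B h f k u).cocycles (Sminus h u) →ₐ[ℂ] W₂lift B h f k :=
  ((toScur h).comp ((brst B h f k u).cocycles (Sminus h u)).val).codRestrict (W₂lift B h f k)
    fun z => toScur_mem_W₂lift D z.2.2

/-- The homomorphism from the cocycles of `S(R_-)` to `W₂`. -/
def cocycleHom (D : IsDatum B e h f) (k : ℂ) (u : Module.Basis I ℂ (nPart h)) :
    (brst B h f k u).cocycles (Sminus h u) →ₐ[ℂ] W₂ B h f k :=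
  (toW₂Hom B h f k).comp (cocycleLift D k u)

theorem coe_cocycleHom (D : IsDatum B e h f) (z : (brst B h f k u).cocycles (Sminus h u)) :
    (cocycleHom D k u z : Red B h f) = toRed B h f (toScur h z) := rfl

/-- T of an invariant is a cocycle of S(R_-), and T is a section of i modulo the ideal. -/
theorem cocycleHom_surjective (D : IsDatum B e h f) : Function.Surjective (cocycleHom D k u) := by
  rintro ⟨x, hx⟩
  obtain ⟨a, rfl, -⟩ := id hx
  refine ⟨⟨Tlift B h f u a, Tlift_mem_Sminus a, brst_Tlift_eq_zero D hx⟩, Subtype.ext ?_⟩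
  rw [coe_cocycleHom]
  exact toRed_toScur_Tlift D a

/-- Coboundaries go into the ideal by `toScur_brst_mem`; the converse is the homotopy argument on
S(R_-). -/
theorem cocycleHom_eq_zero [LieAlgebra.IsSimple ℂ 𝔤] (D : IsDatum B e h f)
    (z : (brst B h f k u).cocycles (Sminus h u)) :
    (brst B h f k u).cls (Sminus h u) (σ_mem_Sminus h u) z = 0 ↔ cocycleHom D k u z = 0 := by
  refine (cls_eq_zero _ _ _ z).trans ?_
  rw [← Subtype.coe_inj, coe_cocycleHom, ZeroMemClass.coe_zero, toRed_eq_zero]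
  constructor
  · rintro ⟨b, -, hb⟩
    rw [← hb]
    exact toScur_brst_mem D b
  · exact exists_eq_brst_of_toScur_mem D u z.2.1 z.2.2

theorem isLambdaHom_cocycleHom (D : IsDatum B e h f)
    {PZ : LambdaData ((brst B h f k u).cocycles (Sminus h u))} {PW : LambdaData (W₂lift B h f k)}
    {Q : LambdaData (W₂ B h f k)}
    (hPZ : IsLambdaHom PZ (brstData B h f k) ((brst B h f k u).cocycles (Sminus h u)).val)
    (hPW : IsLambdaHom PW (curData B k) (W₂lift B h f k).val)
    (hQ : IsLambdaHom PW Q (toW₂Hom B h f k)) : IsLambdaHom PZ Q (cocycleHom D k u) where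
  par z := by
    refine Eq.trans ?_ (hQ.par _)
    refine congrArg (toW₂Hom B h f k) (Subtype.ext ?_)
    refine Eq.trans ?_ (hPW.par _).symm
    exact (congrArg (toScur h) (hPZ.par z)).trans ((toScur_σ _).trans (σ_Scur _).symm)
  del z := by
    refine Eq.trans ?_ (hQ.del _)
    refine congrArg (toW₂Hom B h f k) (Subtype.ext ?_)
    refine Eq.trans ?_ (hPW.del _).symm
    exact (congrArg (toScur h) (hPZ.del z)).trans (toScur_del _)
  br z w := by
    ext n
    rw [coeff_mapLin]
    have h1 := redBr_of_mem_Sminus (k := k) D z.2.1 w.2.1 (toScur_mem_W₂lift D z.2.2)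
      (toScur_mem_W₂lift D w.2.2) n
    rw [coeff_sub, ← toRed_eq_zero, map_sub, sub_eq_zero, coeff_redBr] at h1
    have h2 := congrArg (fun x => toRed B h f (toScur h x)) (hPZ.coeff_br z w n)
    have h3 := congrArg (toRed B h f) (hPW.coeff_br (cocycleLift D k u z) (cocycleLift D k u w) n)
    have h4 := congrArg Subtype.val (hQ.coeff_br (cocycleLift D k u z) (cocycleLift D k u w) n)
    exact ((h2.trans h1).trans h3.symm).trans h4

/-- The homomorphism from the cocycles of `S(R_-)` to the cohomology of `S(R)`. -/
def inclusionHom (B : LinearMap.BilinForm ℂ 𝔤) (h f : 𝔤) (k : ℂ) (u : Module.Basis I ℂ (nPart h)) :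
    (brst B h f k u).cocycles (Sminus h u) →ₐ[ℂ] (brst B h f k u).cocycles ⊤ :=
  Subalgebra.inclusion fun _ hx => ⟨Algebra.mem_top, hx.2⟩

theorem cls_inclusionHom_surjective (D : IsDatum B e h f) : Function.Surjective
    (((brst B h f k u).cls ⊤ fun _ _ => Algebra.mem_top).comp (inclusionHom B h f k u)) := by
  intro x
  obtain ⟨z, rfl⟩ := cls_surjective _ _ _ x
  obtain ⟨y, hy, hy0, b, hb⟩ := exists_cocycle_Sminus D (u := u) (k := k) z.2.2
  refine ⟨⟨y, hy, hy0⟩, ?_⟩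
  rw [eq_comm, ← sub_eq_zero, AlgHom.comp_apply, ← map_sub, cls_eq_zero]
  exact ⟨b, Algebra.mem_top, hb⟩

theorem cls_inclusionHom_eq_zero (D : IsDatum B e h f)
    (z : (brst B h f k u).cocycles (Sminus h u)) :
    (brst B h f k u).cls (Sminus h u) (σ_mem_Sminus h u) z = 0 ↔
      (((brst B h f k u).cls ⊤ fun _ _ => Algebra.mem_top).comp (inclusionHom B h f k u)) z = 0 := by
  refine (cls_eq_zero _ _ _ z).trans ?_
  rw [AlgHom.comp_apply, cls_eq_zero]
  constructor
  · rintro ⟨b, -, hb⟩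
    exact ⟨b, Algebra.mem_top, hb⟩
  · rintro ⟨b, -, hb⟩
    have hb' : (brst B h f k u).d b = z := hb
    obtain ⟨y, hy, hyb⟩ := exists_eq_brst_of_mem_Sminus D (hb'.symm ▸ z.2.1)
    exact ⟨y, hy, hyb.trans hb'⟩

theorem isLambdaHom_inclusionHom
    {PZ : LambdaData ((brst B h f k u).cocycles (Sminus h u))}
    {P₁ : LambdaData ((brst B h f k u).cocycles ⊤)}
    (hPZ : IsLambdaHom PZ (brstData B h f k) ((brst B h f k u).cocycles (Sminus h u)).val)
    (hP₁ : IsLambdaHom P₁ (brstData B h f k) ((brst B h f k u).cocycles ⊤).val) :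
    IsLambdaHom PZ P₁ (inclusionHom B h f k u) where
  par z := Subtype.ext ((hPZ.par z).trans (hP₁.par (inclusionHom B h f k u z)).symm)
  del z := Subtype.ext ((hPZ.del z).trans (hP₁.del (inclusionHom B h f k u z)).symm)
  br z w := by
    ext n
    rw [coeff_mapLin]
    exact (hPZ.coeff_br z w n).trans
      (hP₁.coeff_br (inclusionHom B h f k u z) (inclusionHom B h f k u w) n).symm

/-- The homomorphism from `S(R_-)` to the reduced quotient with `J_a ↦ a`, `Φ_b ↦ -b`, `φ^θ ↦ 0`. -/
def redHom (B : LinearMap.BilinForm ℂ 𝔤) (h f : 𝔤) (u : Module.Basis I ℂ (nPart h)) :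
    Sminus h u →ₐ[ℂ] Red B h f :=
  ((toRed B h f).comp (toScur h)).comp (Sminus h u).val

theorem redHom_J (n : ℕ) (a : 𝔤) (ha : a ∈ nonposPart h) :
    redHom B h f u ⟨_, J_mem h u n a ha⟩ = toRed B h f ((del ^ n) (scur a)) :=
  congrArg (toRed B h f) ((toScur_del_pow n _).trans (by rw [toScur_J]))

theorem redHom_Phi (n : ℕ) (b : halfPart h) :
    redHom B h f u ⟨_, Phi_mem h u n b⟩ = -toRed B h f ((del ^ n) (scur (b : 𝔤))) :=
  (congrArg (toRed B h f) ((toScur_del_pow n _).trans (by rw [toScur_Phi, map_neg]))).trans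
    (map_neg (toRed B h f) _)

theorem redHom_phiDual (n : ℕ) (θ : Module.Dual ℂ (nPart h)) :
    redHom B h f u ⟨_, phiDual_mem h u n θ⟩ = 0 :=
  (congrArg (toRed B h f) ((toScur_del_pow n _).trans (by rw [toScur_phiDual, map_zero]))).trans
    (map_zero (toRed B h f))

end Main

end
end ClassicalW

set_option maxHeartbeats 1000000 in
theorem mainTheorem1 {𝔤 : Type*} [LieRing 𝔤] [LieAlgebra ℂ 𝔤] [FiniteDimensional ℂ 𝔤]
    [LieAlgebra.IsSimple ℂ 𝔤] (e h f : 𝔤) (hsl : IsSl2Triple h e f)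
    (B : LinearMap.BilinForm ℂ 𝔤) (hsymm : ∀ x y, B x y = B y x)
    (hinv : ∀ x y z, B ⁅x, y⁆ z = B x ⁅y, z⁆) (hef : B e f = 1) (hhh : B h h = 2) (k : ℂ)
    {I : Type*} [Fintype I] (u : Module.Basis I ℂ (ClassicalW.nPart h)) :
    -- `S(R_k(𝔤, f))` and `S(ℂ[∂] ⊗ 𝔤)` are PVAs with the given λ-brackets of generators
    (ClassicalW.brstData B h f k).IsPVA ∧
    (∀ v w, (ClassicalW.brstData B h f k).br (ClassicalW.gen 0 v) (ClassicalW.gen 0 w) =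
      ClassicalW.brstBracket B h f k v w) ∧
    (ClassicalW.curData B k).IsPVA ∧
    (∀ v w, (ClassicalW.curData B k).br (ClassicalW.gen 0 v) (ClassicalW.gen 0 w) =
      ClassicalW.curBracket B k v w) ∧
    -- `d_(0)` is a differential, it preserves `S(R_-)`, and `ad_λ 𝔫` acts on the quotient
    (∀ a, (ClassicalW.brst B h f k u).d ((ClassicalW.brst B h f k u).d a) = 0) ∧
    (∀ a ∈ ClassicalW.Sminus h u, (ClassicalW.brst B h f k u).d a ∈ ClassicalW.Sminus h u) ∧
    (∀ n ∈ ClassicalW.nPart h, ∀ a ∈ ClassicalW.redIdeal B h f, ∀ i,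
      ((ClassicalW.curData B k).br (ClassicalW.scur n) a).coeff i ∈ ClassicalW.redIdeal B h f) ∧
    -- the induced PVA structures
    ∃ (P₁ : ClassicalW.LambdaData (ClassicalW.W₁ B h f k u))
      (Pm : ClassicalW.LambdaData (ClassicalW.Hminus B h f k u))
      (P₂ : ClassicalW.LambdaData (ClassicalW.W₂ B h f k)),
      P₁.IsPVA ∧ Pm.IsPVA ∧ P₂.IsPVA ∧
      ClassicalW.IsInduced (ClassicalW.brstData B h f k)
        ((ClassicalW.brst B h f k u).cocycles ⊤) ((ClassicalW.brst B h f k u).cls ⊤ _) P₁ ∧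
      ClassicalW.IsInduced (ClassicalW.brstData B h f k)
        ((ClassicalW.brst B h f k u).cocycles (ClassicalW.Sminus h u))
        ((ClassicalW.brst B h f k u).cls (ClassicalW.Sminus h u) _) Pm ∧
      ClassicalW.IsInduced (ClassicalW.curData B k) (ClassicalW.W₂lift B h f k)
        (ClassicalW.toW₂ B h f k) P₂ ∧
      -- the homomorphism `i` and the isomorphism `j` that it induces
      (∃ i : ClassicalW.Sminus h u →ₐ[ℂ] ClassicalW.Red B h f,
        (∀ (n : ℕ) (a : 𝔤) (ha : a ∈ ClassicalW.nonposPart h),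
          i ⟨_, ClassicalW.J_mem h u n a ha⟩ =
            ClassicalW.toRed B h f ((ClassicalW.del ^ n) (ClassicalW.scur a))) ∧
        (∀ (n : ℕ) (b : ClassicalW.halfPart h),
          i ⟨_, ClassicalW.Phi_mem h u n b⟩ =
            -ClassicalW.toRed B h f ((ClassicalW.del ^ n) (ClassicalW.scur (b : 𝔤)))) ∧
        (∀ (n : ℕ) (θ : Module.Dual ℂ (ClassicalW.nPart h)),
          i ⟨_, ClassicalW.phiDual_mem h u n θ⟩ = 0) ∧
        ∃ j : ClassicalW.Hminus B h f k u ≃ₐ[ℂ] ClassicalW.W₂ B h f k,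
          (∀ z : (ClassicalW.brst B h f k u).cocycles (ClassicalW.Sminus h u),
            (j ((ClassicalW.brst B h f k u).cls (ClassicalW.Sminus h u) _ z) :
              ClassicalW.Red B h f) = i ⟨z, z.2.1⟩) ∧
          ClassicalW.IsPVAEquiv Pm P₂ j) ∧
      -- the two definitions of the classical affine `W`-algebra agree
      ∃ Ψ : ClassicalW.W₁ B h f k u ≃ₐ[ℂ] ClassicalW.W₂ B h f k,
        ClassicalW.IsPVAEquiv P₁ P₂ Ψ := by
  have D : ClassicalW.IsDatum B e h f := ⟨hsl, hsymm, hinv, hef⟩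
  obtain ⟨Z₁, P₁, hZ₁, hP₁⟩ := ClassicalW.exists_induced_cohomology (k := k) (u := u) D ⊤
    (fun _ _ => Algebra.mem_top) (fun _ _ => Algebra.mem_top) (fun _ _ _ _ _ => Algebra.mem_top)
  obtain ⟨Zm, Pm, hZm, hPm⟩ := ClassicalW.exists_induced_cohomology (k := k) (u := u) D
    (ClassicalW.Sminus h u) (ClassicalW.σ_mem_Sminus h u)
    (fun _ hx => ClassicalW.del_mem_Sminus hx)
    (fun _ hx _ hy n => ClassicalW.br_mem_Sminus D hx hy n)
  obtain ⟨Z₂, P₂, hZ₂, hP₂⟩ := ClassicalW.exists_induced_W₂ (k := k) D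
  have hb := ClassicalW.isPVA_brstData (h := h) (f := f) (k := k) hsymm hinv
  have hc := ClassicalW.isPVA_curData (k := k) hsymm hinv
  have hsurj := ClassicalW.cls_surjective (ClassicalW.brst B h f k u) (ClassicalW.Sminus h u)
    (ClassicalW.σ_mem_Sminus h u)
  -- The projection to cohomology and the map to W₂ are surjections from the cocycles of S(R_-) with
  -- the same kernel.
  obtain ⟨j, hj⟩ := ClassicalW.exists_algEquiv hsurj
    (ClassicalW.cocycleHom_surjective (k := k) (u := u) D) (ClassicalW.cocycleHom_eq_zero D)
  -- In the same way j' identifies H(S(R_-)) with H(S(R)); composing its inverse with j gives the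
  -- isomorphism of W₁ with W₂.
  obtain ⟨j', hj'⟩ := ClassicalW.exists_algEquiv hsurj
    (ClassicalW.cls_inclusionHom_surjective (k := k) (u := u) D)
    (ClassicalW.cls_inclusionHom_eq_zero D)
  have hjP := hPm.isPVAEquiv hsurj (ClassicalW.isLambdaHom_cocycleHom D hZm hZ₂ hP₂) hj
  have hjP' := hPm.isPVAEquiv hsurj
    (hP₁.comp (ClassicalW.isLambdaHom_inclusionHom hZm hZ₁)) hj'
  refine ⟨hb, ClassicalW.br_gen_gen (ClassicalW.isSkew_brstBracket hsymm), hc,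
    ClassicalW.br_gen_gen (ClassicalW.isSkew_curBracket hsymm), ClassicalW.brst_brst D,
    fun a ha => ClassicalW.brst_mem_Sminus D ha,
    fun n hn a ha i => ClassicalW.br_nPart_mem_redIdeal D hn ha i, P₁, Pm, P₂,
    hP₁.isPVA_of_surjective (ClassicalW.cls_surjective _ _ _)
      (hZ₁.isPVA_of_injective Subtype.val_injective hb),
    hPm.isPVA_of_surjective hsurj (hZm.isPVA_of_injective Subtype.val_injective hb),
    hP₂.isPVA_of_surjective ClassicalW.toW₂Hom_surjective
      (hZ₂.isPVA_of_injective Subtype.val_injective hc),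
    ClassicalW.isInduced_of_isLambdaHom hZ₁ hP₁, ClassicalW.isInduced_of_isLambdaHom hZm hPm,
    ClassicalW.isInduced_of_isLambdaHom hZ₂ hP₂,
    ⟨ClassicalW.redHom B h f u, ClassicalW.redHom_J, ClassicalW.redHom_Phi,
      ClassicalW.redHom_phiDual, j, fun z => ?_, hjP⟩, j'.symm.trans j, hjP'.symm_trans hjP⟩
  rw [hj]
  rfl
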